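/- **Theorem 2.1.** Let $0<\alpha\le 1$ and $F(y)=(1-\alpha y)^{\alpha}(1+(1-\alpha)y)^{1-\alpha}$ for $0\le y\le\frac1\alpha$. For $v,v_*\in\mathbb R^2$ and a unit vector $n\in S^1$ put $v'=v-n[(v-v_*)\cdot n]$, $v'_*=v_*+n[(v-v_*)\cdot n]$ and $\cos\theta=n\cdot\frac{v-v_*}{|v-v_*|}$. Let $d\omega$ be the Lebesgue probability measure on $S^1$ and $$Q(f)(x,v)=\int_{\mathbb R^2\times S^1}B(|v-v_*|,\theta)\,\big[f'f'_*F(f)F(f_*)-ff_*F(f')F(f'_*)\big]\,dv_*\,d\omega(n),$$ where $f=f(x,v)$, $f_*=f(x,v_*)$, $f'=f(x,v')$, $f'_*=f(x,v'_*)$. Assume that $B$ is measurable, depends on $\theta$ only through $|\cos\theta|$, that $0\le B\le B_0$, and that for some $\gamma,\gamma',c_B>0$: $B(|v-v_*|,\theta)=0$ if $|\cos\theta|<\gamma'$, if $1-|\cos\theta|<\gamma'$, or if $|v-v_*|<\gamma$; and $\int_{-\pi/2}^{\pi/2} B(|v-v_*|,\theta)\,d\theta\ge c_B$ if $|v-v_*|\ge\gamma$.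 Call a measurable function $f_0(x,v)$ on $\mathbb R\times\mathbb R^2$, periodic in $x$ with period $1$ and with values in $]0,\frac1\alpha]$, *admissible* if $$(1+|v|^2)f_0\in L^1([0,1]\times\mathbb R^2),\qquad \int\sup_{x\in[0,1]}f_0(x,v)\,dv<\infty,\qquad \inf_{x\in[0,1]}f_0(x,v)>0\ \text{ for a.a. } v .$$ Consider, for functions that are $1$-periodic in $x$, the initial value problem $$\partial_tf+v_1\partial_xf=Q(f),\qquad f(0,x,v)=f_0(x,v).\tag{$*$}$$ A *strong solution* of $(*)$ on a time interval $I$ with left end point $0$ is an $f\in\mathcal C(I;L^1([0,1]\times\mathbb R^2))$ with $0\le f\le\frac1\alpha$ and $f(0)=f_0$, such that for every $t\in I$ the gain and loss integrands $B f'f'_*F(f)F(f_*)$ and $B ff_*F(f')F(f'_*)$ are integrable in $(x,v,v_*,n)$, and such that $f^\sharp(t,x,v)=f(t,x+tv_1,v)$ is continuously differentiable from $I$ into $L^1([0,1]\times\mathbb R^2)$ with $\frac{d}{dt}f^\sharp=Q(f)^\sharp$. Let $f_0$ be admissible. Then there is a strong solution $f\in\mathcal C([0,\infty[;L^1([0,1]\times\mathbb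 R^2))$ of $(*)$ on $[0,\infty[$ such that (inequalities holding for a.e. $(x,v)$): 1. $0<f(t,\cdot)<\frac1\alpha$ for every $t>0$. 2. There is $t_m>0$ such that for any $T>t_m$ there is $\eta_T>0$ with $f(t,\cdot)\le\frac1\alpha-\eta_T$ for $t_m\le t\le T$. 3. (Uniqueness.) For every $T>0$, any strong solution of $(*)$ on $[0,T]$ with initial value $f_0$ coincides with $f$ on $[0,T]$. 4. (Stability.) For every $T>0$ there is a constant $C$, depending only on $T,f_0,\alpha$ and $B$, such that for every admissible $g_0$ and every strong solution $g$ on $[0,T]$ with initial value $g_0$, $$\|f(t)-g(t)\|_{L^1}\le C\,\|f_0-g_0\|_{L^1},\qquad 0\le t\le T .$$ 5. (Conservation.) For every $t\ge0$, $(1+|v|^2)f(t)\in L^1([0,1]\times\mathbb R^2)$ and $$\int f(t)\,dx\,dv=\int f_0\,dx\,dv,\qquad \int v f(t)\,dx\,dv=\int v f_0\,dx\,dv,\qquad \int|v|^2f(t)\,dx\,dv=\int|v|^2f_0\,dx\,dv .$$ -/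

import Mathlib

open MeasureTheory Set
open scoped Real

/-- Velocities `v = (v₁, v₂) ∈ ℝ²`, with the Euclidean norm; `v 0` is the component `v₁` along the
slab direction. -/
abbrev Velocity : Type := EuclideanSpace ℝ (Fin 2)

/-- Phase space `[0,1] × ℝ²` with periodicity in `x`: the position lives on the circle `ℝ/ℤ`,
which carries Lebesgue measure of total mass one. -/
abbrev Phase : Type := UnitAddCircle × Velocity

/-- The space `L¹([0,1] × ℝ²)` (of functions periodic in `x`). -/
abbrev PhaseL1 : Type := Lp ℝ 1 (volume : Measure Phase)

/-- The filling factor `F(y) = (1 - αy)^α (1 + (1-α)y)^(1-α)`, meant for `0 ≤ y ≤ 1/α`. -/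
noncomputable def fillingFactor (α y : ℝ) : ℝ :=
  (1 - α * y) ^ α * (1 + (1 - α) * y) ^ (1 - α)

/-- The unit vector `n = (cos φ, sin φ)`. -/
noncomputable def unitVec (φ : ℝ) : Velocity := !₂[Real.cos φ, Real.sin φ]

/-- The Lebesgue probability measure `dω` on the unit circle, in the parameter `φ ∈ (0, 2π]`. -/
noncomputable def angleMeasure : Measure ℝ :=
  (ENNReal.ofReal (2 * π))⁻¹ • (volume : Measure ℝ).restrict (Ioc 0 (2 * π))

/-- `v' = v - n[(v - v_*) · n]`. -/
noncomputable def postVel (v w : Velocity) (φ : ℝ) : Velocity :=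
  v - (inner ℝ (v - w) (unitVec φ)) • unitVec φ

/-- `v'_* = v_* + n[(v - v_*) · n]`. -/
noncomputable def postVelStar (v w : Velocity) (φ : ℝ) : Velocity :=
  w + (inner ℝ (v - w) (unitVec φ)) • unitVec φ

/-- The value `B(|v - v_*|, θ)` of the kernel, `θ ∈ [0, π]` being the angle between `n` and
`v - v_*`, so that `cos θ = n · (v - v_*)/|v - v_*|`. -/
noncomputable def kernelAt (B : ℝ → ℝ → ℝ) (v w : Velocity) (φ : ℝ) : ℝ :=
  B ‖v - w‖ (InnerProductGeometry.angle (unitVec φ) (v - w))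

/-- `B f' f'_* F(f) F(f_*)` at position `x`, velocities `v`, `v_* = w` and direction `n(φ)`. -/
noncomputable def gainIntegrand (α : ℝ) (B : ℝ → ℝ → ℝ) (u : Phase → ℝ)
    (x : UnitAddCircle) (v w : Velocity) (φ : ℝ) : ℝ :=
  kernelAt B v w φ * (u (x, postVel v w φ) * u (x, postVelStar v w φ) *
    fillingFactor α (u (x, v)) * fillingFactor α (u (x, w)))

/-- `B f f_* F(f') F(f'_*)` at position `x`, velocities `v`, `v_* = w` and direction `n(φ)`. -/
noncomputable def lossIntegrand (α : ℝ) (B : ℝ → ℝ → ℝ) (u : Phase → ℝ)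
    (x : UnitAddCircle) (v w : Velocity) (φ : ℝ) : ℝ :=
  kernelAt B v w φ * (u (x, v) * u (x, w) *
    fillingFactor α (u (x, postVel v w φ)) * fillingFactor α (u (x, postVelStar v w φ)))

/-- The collision operator
`Q(f)(x,v) = ∫ B(|v - v_*|, θ) [f' f'_* F(f) F(f_*) - f f_* F(f') F(f'_*)] dv_* dω`. -/
noncomputable def collisionOp (α : ℝ) (B : ℝ → ℝ → ℝ) (u : Phase → ℝ) (p : Phase) : ℝ :=
  ∫ q : Velocity × ℝ, (gainIntegrand α B u p.1 p.2 q.1 q.2 - lossIntegrand α B u p.1 p.2 q.1 q.2)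
    ∂((volume : Measure Velocity).prod angleMeasure)

/-- Both parts of the collision integrand are integrable in all the variables `(x, v, v_*, ω)`,
that is, gain and loss terms separately belong to `L¹([0,1] × ℝ²)`. -/
def CollisionIntegrable (α : ℝ) (B : ℝ → ℝ → ℝ) (u : Phase → ℝ) : Prop :=
  Integrable (fun z : Phase × (Velocity × ℝ) => gainIntegrand α B u z.1.1 z.1.2 z.2.1 z.2.2)
    ((volume : Measure Phase).prod ((volume : Measure Velocity).prod angleMeasure)) ∧
  Integrable (fun z : Phase × (Velocity × ℝ) => lossIntegrand α B u z.1.1 z.1.2 z.2.1 z.2.2)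
    ((volume : Measure Phase).prod ((volume : Measure Velocity).prod angleMeasure))

/-- Free streaming `(x, v) ↦ (x + t v₁, v)`. -/
noncomputable def freeFlow (t : ℝ) (p : Phase) : Phase :=
  (p.1 + ((t * p.2 0 : ℝ) : UnitAddCircle), p.2)

theorem measurePreserving_freeFlow (t : ℝ) :
    MeasurePreserving (freeFlow t) (volume : Measure Phase) (volume : Measure Phase) := by
  have hc : Measurable fun v : Velocity => ((t * v 0 : ℝ) : UnitAddCircle) := by
    have : Continuous fun v : Velocity => ((t * v 0 : ℝ) : UnitAddCircle) :=
      (AddCircle.continuous_mk' (1 : ℝ)).comp (by fun_prop)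
    exact this.measurable
  have h1 : MeasurePreserving
      (fun q : Velocity × UnitAddCircle => (q.1, q.2 + ((t * q.1 0 : ℝ) : UnitAddCircle)))
      ((volume : Measure Velocity).prod (volume : Measure UnitAddCircle))
      ((volume : Measure Velocity).prod (volume : Measure UnitAddCircle)) := by
    refine MeasurePreserving.skew_product (f := id)
      (g := fun (v : Velocity) (x : UnitAddCircle) => x + ((t * v 0 : ℝ) : UnitAddCircle))
      (MeasurePreserving.id _) ?_ ?_
    · exact measurable_snd.add (hc.comp measurable_fst)
    · exact Filter.Eventually.of_forall fun v => (measurePreserving_add_right _ _).map_eq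
  have h2 := (Measure.measurePreserving_swap (μ := (volume : Measure Velocity))
    (ν := (volume : Measure UnitAddCircle))).comp
    (h1.comp (Measure.measurePreserving_swap (μ := (volume : Measure UnitAddCircle))
      (ν := (volume : Measure Velocity))))
  exact h2

/-- `f ↦ f^♯(t)`, where `f^♯(t, x, v) = f(x + t v₁, v)`, on `L¹`. -/
noncomputable def sharp (t : ℝ) (u : PhaseL1) : PhaseL1 :=
  Lp.compMeasurePreserving (freeFlow t) (measurePreserving_freeFlow t) u

/-- Hypotheses on the collision kernel `B(r, θ)`, `r = |v - v_*| ≥ 0`: measurable, depending on `θ`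
through `|cos θ|` only, bounded, with angular and small relative velocity cut-offs, and
nondegenerate outside the latter. -/
structure IsCutoffKernel (B : ℝ → ℝ → ℝ) (B₀ γ γ' cB : ℝ) : Prop where
  measurable : Measurable (Function.uncurry B)
  even : ∀ r, 0 ≤ r → ∀ θ θ', |Real.cos θ| = |Real.cos θ'| → B r θ = B r θ'
  nonneg : ∀ r, 0 ≤ r → ∀ θ, 0 ≤ B r θ
  le_bound : ∀ r, 0 ≤ r → ∀ θ, B r θ ≤ B₀
  grazing : ∀ r, 0 ≤ r → ∀ θ, |Real.cos θ| < γ' → B r θ = 0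
  frontal : ∀ r, 0 ≤ r → ∀ θ, 1 - |Real.cos θ| < γ' → B r θ = 0
  small_velocity : ∀ r, 0 ≤ r → r < γ → ∀ θ, B r θ = 0
  lower : ∀ r, γ ≤ r → cB ≤ ∫ θ in (-(π / 2))..(π / 2), B r θ

/-- Hypotheses on the initial value `f₀`. -/
structure IsInitialDatum (α : ℝ) (f₀ : Phase → ℝ) : Prop where
  measurable : Measurable f₀
  pos : ∀ p, 0 < f₀ p
  le : ∀ p, f₀ p ≤ 1 / α
  mass_energy : Integrable (fun p : Phase => (1 + ‖p.2‖ ^ 2) * f₀ p) volume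
  sup_integrable : Integrable (fun v : Velocity => ⨆ x : UnitAddCircle, f₀ (x, v)) volume
  inf_pos : ∀ᵐ v : Velocity, 0 < ⨅ x : UnitAddCircle, f₀ (x, v)

/-- `f` is a strong solution, on the time interval `I` (containing `0`), of
`∂ₜf + v₁∂ₓf = Q(f)`, `f(0) = f₀`: it is continuous in time with values in `L¹`, takes its values in
`[0, 1/α]` (where the filling factor is defined), the gain and loss terms are in `L¹` at every time,
and `f^♯` is continuously differentiable in time with values in `L¹`, with `d/dt f^♯ = Q(f)^♯`
(one-sided derivatives at end points of `I`). -/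
structure IsStrongSolution (α : ℝ) (B : ℝ → ℝ → ℝ) (I : Set ℝ) (f₀ : Phase → ℝ)
    (f : ℝ → PhaseL1) : Prop where
  continuousOn : ContinuousOn f I
  initial : f 0 =ᵐ[volume] f₀
  range : ∀ t ∈ I, ∀ᵐ p : Phase, 0 ≤ f t p ∧ f t p ≤ 1 / α
  collision : ∀ t ∈ I, CollisionIntegrable α B (f t)
  equation : ∃ q : ℝ → PhaseL1,
    (∀ t ∈ I, q t =ᵐ[volume] collisionOp α B (f t)) ∧
    ContinuousOn (fun t => sharp t (q t)) I ∧
    ∀ t ∈ I, HasDerivWithinAt (fun s => sharp s (f s)) (sharp t (q t)) I t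

/-! Write M = 1/α. Two things stand in the way of a fixed point argument in L¹. The collision term
is controlled only through the spatial density ∫ f dv, which must be bounded uniformly in x; and the
filling factor behaves like (M - y)^α near full occupation, so that for α < 1 the collision operator
is not Lipschitz. The first is overcome by dispersion along the slab, the second by the equation
itself, which pushes solutions away from full occupation at a linear rate.

Density. The angular cut-offs make both postcollisional velocities admissible integration variables
for fixed v (`CollisionKernel.lintegral_post_le`, `CollisionKernel.lintegral_postStar_le`). Since
one of the two carries at least half of the energy of v, the gain at v is bounded by the density of
velocities w with |v|² ≤ 2|w|² (`gainAt_le`). Tested against a set of positions transported freely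
for a time τ, this gives a growth rate of order R²N + E/(Rτ) plus a multiple of E, where N bounds
the density, E the energy and R is free (`lintegral_mul_gainAt_le`). The choice R = rτ^(-1/3) makes
the rate an integrable τ^(-2/3), and a small r turns a bound N into a bound D + N/2. Iteration
yields a density bound depending only on the data and on T, with T arbitrary
(`exists_density_bound`).

Full occupation. Along characteristics a solution stays above an exponentially decaying multiple of
its initial value, hence above a positive constant on a set Z of velocities whose measure can be
prescribed. The velocities at which f > M/2 form a set of bounded measure, so for large Z most
collisions with partners in Z lead to states that are at most half full; this bounds the collision
frequency from below (`le_lintegral_freqFn`). Near M the gain is small because it contains Φ(f),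
while the loss is not, and so f ≤ M - c₀t (`KineticSolution.le_barrier`).

Comparison. A concave filling function has Lipschitz constant 1 + Mη^(α-1) between two values of
which only one need be at distance η from M (`FillingFunction.lipschitz_away`). With η = c₀t the
singularity t^(α-1) is integrable, and Gronwall's inequality applies to the integral of the positive
part of f - g. On {g ≤ f} the difference of the collision terms is controlled by bounds for f alone
(`exists_collQ_sub_le`), so g may be any strong solution; conservation of mass recovers the L¹ norm
from the positive part (`exists_comparison`).

Construction. Truncating collisions at energy k² and replacing F by min(F, k(M - y)) gives a
Lipschitz problem, solved by Picard iteration (`exists_truncated_solution`). The bounds above are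
uniform in k (`exists_uniform_bounds`). Comparing two truncations makes the approximations Cauchy,
uniformly on bounded time intervals, and the limit inherits all bounds
(`controlledSolution_of_tendsto`). Comparing this limit with another strong solution gives stability
and uniqueness. The conservation laws follow from the weak form of the collision term, tested with
truncated collision invariants. -/

namespace HaldaneBoltzmann

open Filter Topology
open scoped ENNReal

/-! ### Collision geometry -/

/-- The unit vector orthogonal to `unitVec φ`. -/
noncomputable def perpVec (φ : ℝ) : Velocity := !₂[-Real.sin φ, Real.cos φ]

theorem unitVec_zero (φ : ℝ) : unitVec φ 0 = Real.cos φ := by simp [unitVec]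
theorem unitVec_one (φ : ℝ) : unitVec φ 1 = Real.sin φ := by simp [unitVec]
theorem perpVec_zero (φ : ℝ) : perpVec φ 0 = -Real.sin φ := by simp [perpVec]
theorem perpVec_one (φ : ℝ) : perpVec φ 1 = Real.cos φ := by simp [perpVec]

theorem inner_eq (u v : Velocity) : inner ℝ u v = u 0 * v 0 + u 1 * v 1 := by
  simp [PiLp.inner_apply, Fin.sum_univ_two, mul_comm]

theorem norm_sq_eq (u : Velocity) : ‖u‖ ^ 2 = u 0 ^ 2 + u 1 ^ 2 := by
  rw [EuclideanSpace.norm_sq_eq]; simp [Fin.sum_univ_two]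

theorem velocity_ext {u v : Velocity} (h0 : u 0 = v 0) (h1 : u 1 = v 1) : u = v := by
  ext i; fin_cases i
  · exact h0
  · exact h1

theorem continuous_unitVec : Continuous unitVec := by
  unfold unitVec
  refine (PiLp.continuous_toLp 2 _).comp ?_
  refine continuous_pi fun i => ?_
  fin_cases i <;> simp <;> fun_prop

theorem norm_unitVec (φ : ℝ) : ‖unitVec φ‖ = 1 := by
  have : ‖unitVec φ‖ ^ 2 = 1 := by
    rw [norm_sq_eq, unitVec_zero, unitVec_one]; exact Real.cos_sq_add_sin_sq φ
  nlinarith [norm_nonneg (unitVec φ)]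

theorem inner_unitVec_sq_add (u : Velocity) (φ : ℝ) :
    inner ℝ u (unitVec φ) ^ 2 + inner ℝ u (perpVec φ) ^ 2 = ‖u‖ ^ 2 := by
  rw [inner_eq, inner_eq, norm_sq_eq, unitVec_zero, unitVec_one, perpVec_zero, perpVec_one]
  linear_combination (u 0 ^ 2 + u 1 ^ 2) * Real.cos_sq_add_sin_sq φ

theorem postVel_zero (v w : Velocity) (φ : ℝ) :
    postVel v w φ 0 = v 0 - inner ℝ (v - w) (unitVec φ) * Real.cos φ := by
  simp [postVel, unitVec_zero]
theorem postVel_one (v w : Velocity) (φ : ℝ) :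
    postVel v w φ 1 = v 1 - inner ℝ (v - w) (unitVec φ) * Real.sin φ := by
  simp [postVel, unitVec_one]
theorem postVelStar_zero (v w : Velocity) (φ : ℝ) :
    postVelStar v w φ 0 = w 0 + inner ℝ (v - w) (unitVec φ) * Real.cos φ := by
  simp [postVelStar, unitVec_zero]
theorem postVelStar_one (v w : Velocity) (φ : ℝ) :
    postVelStar v w φ 1 = w 1 + inner ℝ (v - w) (unitVec φ) * Real.sin φ := by
  simp [postVelStar, unitVec_one]

theorem inner_sub_unitVec (v w : Velocity) (φ : ℝ) :
    inner ℝ (v - w) (unitVec φ) = (v 0 - w 0) * Real.cos φ + (v 1 - w 1) * Real.sin φ := by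
  rw [inner_eq, unitVec_zero, unitVec_one]; simp

theorem inner_sub_perpVec (v w : Velocity) (φ : ℝ) :
    inner ℝ (v - w) (perpVec φ) = -(v 0 - w 0) * Real.sin φ + (v 1 - w 1) * Real.cos φ := by
  rw [inner_eq, perpVec_zero, perpVec_one]; simp; ring

theorem inner_post_unitVec (v w : Velocity) (φ : ℝ) :
    inner ℝ (postVel v w φ - postVelStar v w φ) (unitVec φ) = -inner ℝ (v - w) (unitVec φ) := by
  rw [inner_sub_unitVec, postVel_zero, postVel_one, postVelStar_zero, postVelStar_one,
    inner_sub_unitVec]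
  linear_combination (-2 * ((v 0 - w 0) * Real.cos φ + (v 1 - w 1) * Real.sin φ)) *
    Real.cos_sq_add_sin_sq φ

theorem inner_post_perpVec (v w : Velocity) (φ : ℝ) :
    inner ℝ (postVel v w φ - postVelStar v w φ) (perpVec φ) = inner ℝ (v - w) (perpVec φ) := by
  rw [inner_sub_perpVec, postVel_zero, postVel_one, postVelStar_zero, postVelStar_one,
    inner_sub_perpVec]
  ring

theorem norm_post_sub (v w : Velocity) (φ : ℝ) :
    ‖postVel v w φ - postVelStar v w φ‖ = ‖v - w‖ := by
  have h : ‖postVel v w φ - postVelStar v w φ‖ ^ 2 = ‖v - w‖ ^ 2 := by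
    rw [← inner_unitVec_sq_add _ φ, ← inner_unitVec_sq_add (v - w) φ, inner_post_unitVec,
      inner_post_perpVec]; ring
  exact (pow_left_inj₀ (norm_nonneg _) (norm_nonneg _) two_ne_zero).1 h

theorem postVel_postVel (v w : Velocity) (φ : ℝ) :
    postVel (postVel v w φ) (postVelStar v w φ) φ = v := by
  rw [postVel, inner_post_unitVec, postVel]; simp

theorem postVelStar_postVel (v w : Velocity) (φ : ℝ) :
    postVelStar (postVel v w φ) (postVelStar v w φ) φ = w := by
  rw [postVelStar, inner_post_unitVec, postVelStar]; simp

theorem postVel_swap (v w : Velocity) (φ : ℝ) : postVel w v φ = postVelStar v w φ := by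
  have : inner ℝ (w - v) (unitVec φ) = -inner ℝ (v - w) (unitVec φ) := by
    rw [← inner_neg_left, neg_sub]
  rw [postVel, postVelStar, this]; simp

theorem postVelStar_swap (v w : Velocity) (φ : ℝ) : postVelStar w v φ = postVel v w φ := by
  rw [← postVel_swap]

theorem post_add (v w : Velocity) (φ : ℝ) :
    postVel v w φ + postVelStar v w φ = v + w := by
  rw [postVel, postVelStar]; abel

theorem post_energy (v w : Velocity) (φ : ℝ) :
    ‖postVel v w φ‖ ^ 2 + ‖postVelStar v w φ‖ ^ 2 = ‖v‖ ^ 2 + ‖w‖ ^ 2 := by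
  have h1 := parallelogram_law_with_norm ℝ (postVel v w φ) (postVelStar v w φ)
  have h2 := parallelogram_law_with_norm ℝ v w
  rw [post_add, norm_post_sub] at h1
  nlinarith

/-- Coordinates of a velocity in the frame `(unitVec φ, perpVec φ)`. -/
noncomputable def frameMap (φ : ℝ) : Velocity →ₗᵢ[ℝ] Velocity where
  toFun ξ := ξ 0 • unitVec φ + ξ 1 • perpVec φ
  map_add' ξ η := by simp only [PiLp.add_apply, add_smul]; abel
  map_smul' r ξ := by simp only [PiLp.smul_apply, smul_eq_mul, RingHom.id_apply, mul_smul, smul_add]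
  norm_map' ξ := by
    have h : ‖ξ 0 • unitVec φ + ξ 1 • perpVec φ‖ ^ 2 = ‖ξ‖ ^ 2 := by
      rw [norm_sq_eq, norm_sq_eq]
      simp only [PiLp.add_apply, PiLp.smul_apply, smul_eq_mul, unitVec_zero, unitVec_one,
        perpVec_zero, perpVec_one]
      linear_combination (ξ 0 ^ 2 + ξ 1 ^ 2) * Real.cos_sq_add_sin_sq φ
    exact (pow_left_inj₀ (norm_nonneg _) (norm_nonneg _) two_ne_zero).1 h

theorem frameMap_apply (φ : ℝ) (ξ : Velocity) :
    frameMap φ ξ = ξ 0 • unitVec φ + ξ 1 • perpVec φ := rfl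

theorem measurePreserving_frameMap (φ : ℝ) :
    MeasurePreserving (frameMap φ) (volume : Measure Velocity) volume := by
  have := ((frameMap φ).toLinearIsometryEquiv rfl).measurePreserving
  exact this

theorem inner_frameMap_unitVec (φ : ℝ) (ξ : Velocity) :
    inner ℝ (frameMap φ ξ) (unitVec φ) = ξ 0 := by
  rw [inner_eq, frameMap_apply]
  simp only [PiLp.add_apply, PiLp.smul_apply, smul_eq_mul, unitVec_zero, unitVec_one,
        perpVec_zero, perpVec_one]
  linear_combination (ξ 0) * Real.cos_sq_add_sin_sq φ

theorem inner_frameMap_perpVec (φ : ℝ) (ξ : Velocity) :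
    inner ℝ (frameMap φ ξ) (perpVec φ) = ξ 1 := by
  rw [inner_eq, frameMap_apply]
  simp only [PiLp.add_apply, PiLp.smul_apply, smul_eq_mul, unitVec_zero, unitVec_one,
        perpVec_zero, perpVec_one]
  linear_combination (ξ 1) * Real.cos_sq_add_sin_sq φ

/-- Cartesian coordinates on the velocity plane. -/
noncomputable def coordEquiv : ℝ × ℝ ≃ᵐ Velocity :=
  MeasurableEquiv.finTwoArrow.symm.trans (MeasurableEquiv.toLp 2 (Fin 2 → ℝ))

theorem coordEquiv_zero (q : ℝ × ℝ) : coordEquiv q 0 = q.1 := rfl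
theorem coordEquiv_one (q : ℝ × ℝ) : coordEquiv q 1 = q.2 := rfl

theorem measurePreserving_coordEquiv :
    MeasurePreserving coordEquiv (volume : Measure (ℝ × ℝ)) (volume : Measure Velocity) := by
  have h1 := (volume_preserving_finTwoArrow ℝ).symm
  have h2 := EuclideanSpace.volume_preserving_symm_measurableEquiv_toLp (Fin 2)
  exact h2.symm.comp h1

theorem lintegral_velocity (G : Velocity → ℝ≥0∞) (hG : Measurable G) :
    ∫⁻ v, G v = ∫⁻ a : ℝ, ∫⁻ b : ℝ, G (coordEquiv (a, b)) := by
  rw [← measurePreserving_coordEquiv.lintegral_comp hG, Measure.volume_eq_prod,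
    lintegral_prod _ (by exact (hG.comp coordEquiv.measurable).aemeasurable)]

theorem lintegral_velocity' (G : Velocity → ℝ≥0∞) (hG : Measurable G) :
    ∫⁻ v, G v = ∫⁻ b : ℝ, ∫⁻ a : ℝ, G (coordEquiv (a, b)) := by
  rw [← measurePreserving_coordEquiv.lintegral_comp hG, Measure.volume_eq_prod,
    lintegral_prod_symm _ (by exact (hG.comp coordEquiv.measurable).aemeasurable)]

/-! ### The angle measure, collision space and its measure-preserving symmetries -/

instance : IsProbabilityMeasure angleMeasure := by
  constructor
  have h : (0 : ℝ) < 2 * π := by positivity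
  simp only [angleMeasure, Measure.smul_apply, Measure.restrict_apply_univ, Real.volume_Ioc, sub_zero,
    smul_eq_mul]
  exact ENNReal.inv_mul_cancel (by simpa using Real.pi_pos) ENNReal.ofReal_ne_top

theorem lintegral_angleMeasure (G : ℝ → ℝ≥0∞) :
    ∫⁻ φ, G φ ∂angleMeasure = (ENNReal.ofReal (2 * π))⁻¹ * ∫⁻ φ in Ioc 0 (2 * π), G φ := by
  rw [angleMeasure, lintegral_smul_measure, smul_eq_mul]

/-- The collision space `{((x, v), (v_*, φ))}`. -/
abbrev CollSpace : Type := Phase × (Velocity × ℝ)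

/-- The measure `dx dv dv_* dω`. -/
noncomputable abbrev collMeasure : Measure CollSpace :=
  (volume : Measure Phase).prod ((volume : Measure Velocity).prod angleMeasure)

theorem continuous_inner_unitVec :
    Continuous fun q : Velocity × Velocity × ℝ => inner ℝ (q.1 - q.2.1) (unitVec q.2.2) :=
  (continuous_fst.sub (continuous_fst.comp continuous_snd)).inner
    (continuous_unitVec.comp (continuous_snd.comp continuous_snd))

theorem continuous_postVel :
    Continuous fun q : Velocity × Velocity × ℝ => postVel q.1 q.2.1 q.2.2 :=
  continuous_fst.sub (continuous_inner_unitVec.smul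
    (continuous_unitVec.comp (continuous_snd.comp continuous_snd)))

theorem continuous_postVelStar :
    Continuous fun q : Velocity × Velocity × ℝ => postVelStar q.1 q.2.1 q.2.2 :=
  (continuous_fst.comp continuous_snd).add (continuous_inner_unitVec.smul
    (continuous_unitVec.comp (continuous_snd.comp continuous_snd)))

/-- `(x, v, v_*, φ) ↦ (v, v_*, φ)`. -/
def velTriple (z : CollSpace) : Velocity × Velocity × ℝ := (z.1.2, z.2.1, z.2.2)

theorem measurable_velTriple : Measurable velTriple := by unfold velTriple; fun_prop

/-- `(x, v_*)`. -/
def ptStar (z : CollSpace) : Phase := (z.1.1, z.2.1)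
/-- `(x, v')`. -/
noncomputable def ptPost (z : CollSpace) : Phase := (z.1.1, postVel z.1.2 z.2.1 z.2.2)
/-- `(x, v'_*)`. -/
noncomputable def ptPostStar (z : CollSpace) : Phase := (z.1.1, postVelStar z.1.2 z.2.1 z.2.2)
/-- The exchange of pre- and postcollisional velocities. -/
noncomputable def collideMap (z : CollSpace) : CollSpace :=
  ((z.1.1, postVel z.1.2 z.2.1 z.2.2), (postVelStar z.1.2 z.2.1 z.2.2, z.2.2))
/-- The exchange of the two colliding particles. -/
def swapMap (z : CollSpace) : CollSpace := ((z.1.1, z.2.1), (z.1.2, z.2.2))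

theorem measurable_ptStar : Measurable ptStar := by unfold ptStar; fun_prop
theorem measurable_ptPost : Measurable ptPost :=
  (measurable_fst.comp measurable_fst).prodMk
    (continuous_postVel.measurable.comp measurable_velTriple)
theorem measurable_ptPostStar : Measurable ptPostStar :=
  (measurable_fst.comp measurable_fst).prodMk
    (continuous_postVelStar.measurable.comp measurable_velTriple)
theorem measurable_collideMap : Measurable collideMap :=
  measurable_ptPost.prodMk ((continuous_postVelStar.measurable.comp measurable_velTriple).prodMk
    (measurable_snd.comp measurable_snd))
theorem measurable_swapMap : Measurable swapMap := by unfold swapMap; fun_prop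

theorem lintegral_collMeasure {F : CollSpace → ℝ≥0∞} (hF : Measurable F) :
    ∫⁻ z, F z ∂collMeasure =
      ∫⁻ x : UnitAddCircle, ∫⁻ φ, (∫⁻ v : Velocity, ∫⁻ w : Velocity, F ((x, v), (w, φ)))
        ∂angleMeasure := by
  have h1 : Measurable fun p : Phase => ∫⁻ q : Velocity × ℝ, F (p, q)
      ∂((volume : Measure Velocity).prod angleMeasure) := hF.lintegral_prod_right'
  rw [lintegral_prod _ hF.aemeasurable, Measure.volume_eq_prod, lintegral_prod _ h1.aemeasurable]
  refine lintegral_congr fun x => ?_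
  have h2 : Measurable fun r : Velocity × (Velocity × ℝ) => F ((x, r.1), r.2) :=
    hF.comp (by fun_prop)
  have h3 : Measurable fun q : Velocity × ℝ => ∫⁻ v : Velocity, F ((x, v), q) :=
    h2.lintegral_prod_left'
  rw [lintegral_lintegral_swap (by exact h2.aemeasurable), lintegral_prod_symm _ h3.aemeasurable]
  refine lintegral_congr fun φ => ?_
  rw [lintegral_lintegral_swap]
  exact (hF.comp (by fun_prop : Measurable fun r : Velocity × Velocity =>
    (((x, r.2), (r.1, φ)) : CollSpace))).aemeasurable

theorem measurePreserving_swapMap : MeasurePreserving swapMap collMeasure collMeasure := by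
  refine ⟨measurable_swapMap, ?_⟩
  refine Measure.ext_of_lintegral _ fun F hF => ?_
  rw [lintegral_map hF measurable_swapMap, lintegral_collMeasure hF,
    lintegral_collMeasure (by exact hF.comp measurable_swapMap)]
  refine lintegral_congr fun x => lintegral_congr fun φ => ?_
  rw [lintegral_lintegral_swap]
  · rfl
  · exact ((hF.comp measurable_swapMap).comp (by fun_prop)).aemeasurable

/-- The collision map at fixed direction, as a linear map. -/
noncomputable def collideLin (φ : ℝ) : Velocity × Velocity →ₗ[ℝ] Velocity × Velocity where
  toFun q := (postVel q.1 q.2 φ, postVelStar q.1 q.2 φ)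
  map_add' a b := by
    refine Prod.ext (velocity_ext ?_ ?_) (velocity_ext ?_ ?_) <;>
    simp only [postVel_zero, postVel_one, postVelStar_zero, postVelStar_one, inner_sub_unitVec,
      Prod.fst_add, Prod.snd_add, PiLp.add_apply] <;> ring
  map_smul' r a := by
    refine Prod.ext (velocity_ext ?_ ?_) (velocity_ext ?_ ?_) <;>
    simp only [postVel_zero, postVel_one, postVelStar_zero, postVelStar_one, inner_sub_unitVec,
      Prod.smul_fst, Prod.smul_snd, PiLp.smul_apply, smul_eq_mul, RingHom.id_apply] <;> ring

/-- At a fixed direction n the collision is a linear involution of the pair of velocities, so its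
determinant squares to one. No explicit matrix is needed. -/
theorem measurePreserving_collideLin (φ : ℝ) :
    MeasurePreserving (collideLin φ) (volume : Measure (Velocity × Velocity)) volume := by
  have hinv : collideLin φ ∘ₗ collideLin φ = LinearMap.id := by
    refine LinearMap.ext fun q => Prod.ext ?_ ?_
    · exact postVel_postVel q.1 q.2 φ
    · exact postVelStar_postVel q.1 q.2 φ
  have hdet : LinearMap.det (collideLin φ) * LinearMap.det (collideLin φ) = 1 := by
    rw [← LinearMap.det_comp, hinv, LinearMap.det_id]
  have hne : LinearMap.det (collideLin φ) ≠ 0 := fun h => by simp [h] at hdet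
  have habs : |LinearMap.det (collideLin φ)| = 1 := by
    have : |LinearMap.det (collideLin φ)| * |LinearMap.det (collideLin φ)| = 1 := by
      rw [← abs_mul, hdet, abs_one]
    nlinarith [abs_nonneg (LinearMap.det (collideLin φ))]
  have : (volume : Measure (Velocity × Velocity)).IsAddHaarMeasure := by
    rw [Measure.volume_eq_prod]; infer_instance
  refine ⟨(collideLin φ).continuous_of_finiteDimensional.measurable, ?_⟩
  rw [Measure.map_linearMap_addHaar_eq_smul_addHaar _ hne, abs_inv, habs]
  simp

theorem measurePreserving_collideMap :
    MeasurePreserving collideMap collMeasure collMeasure := by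
  refine ⟨measurable_collideMap, ?_⟩
  refine Measure.ext_of_lintegral _ fun F hF => ?_
  rw [lintegral_map hF measurable_collideMap, lintegral_collMeasure hF,
    lintegral_collMeasure (by exact hF.comp measurable_collideMap)]
  refine lintegral_congr fun x => lintegral_congr fun φ => ?_
  have h1 : Measurable fun q : Velocity × Velocity => F ((x, q.1), (q.2, φ)) :=
    hF.comp (by fun_prop)
  have h3 := lintegral_prod (μ := (volume : Measure Velocity)) (ν := (volume : Measure Velocity)) _
    h1.aemeasurable
  have h4 := lintegral_prod (μ := (volume : Measure Velocity)) (ν := (volume : Measure Velocity)) _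
    (h1.comp (measurePreserving_collideLin φ).measurable).aemeasurable
  have h5 := (measurePreserving_collideLin φ).lintegral_comp h1
  rw [Measure.volume_eq_prod] at h5
  rw [← h3, ← h5]
  exact h4.symm

theorem fst_collideMap (z : CollSpace) : (collideMap z).1 = ptPost z := rfl
theorem ptStar_collideMap (z : CollSpace) : ptStar (collideMap z) = ptPostStar z := rfl
theorem ptPost_collideMap (z : CollSpace) : ptPost (collideMap z) = z.1 := by
  simp only [ptPost, collideMap, postVel_postVel]
theorem ptPostStar_collideMap (z : CollSpace) : ptPostStar (collideMap z) = ptStar z := by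
  simp only [ptPostStar, collideMap, postVelStar_postVel, ptStar]
theorem fst_swapMap (z : CollSpace) : (swapMap z).1 = ptStar z := rfl
theorem ptStar_swapMap (z : CollSpace) : ptStar (swapMap z) = z.1 := rfl
theorem ptPost_swapMap (z : CollSpace) : ptPost (swapMap z) = ptPostStar z := by
  simp only [ptPost, swapMap, postVel_swap, ptPostStar]
theorem ptPostStar_swapMap (z : CollSpace) : ptPostStar (swapMap z) = ptPost z := by
  simp only [ptPost, swapMap, postVelStar_swap, ptPostStar]

/-- This and the next three lemmas carry almost-everywhere statements on phase space to each of the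
four particles of a collision. They are what makes the collision term well defined on L¹ classes. -/
theorem quasiMeasurePreserving_fst :
    Measure.QuasiMeasurePreserving (Prod.fst : CollSpace → Phase) collMeasure volume :=
  Measure.quasiMeasurePreserving_fst
theorem quasiMeasurePreserving_ptStar :
    Measure.QuasiMeasurePreserving ptStar collMeasure volume :=
  quasiMeasurePreserving_fst.comp measurePreserving_swapMap.quasiMeasurePreserving
theorem quasiMeasurePreserving_ptPost :
    Measure.QuasiMeasurePreserving ptPost collMeasure volume :=
  quasiMeasurePreserving_fst.comp measurePreserving_collideMap.quasiMeasurePreserving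
theorem quasiMeasurePreserving_ptPostStar :
    Measure.QuasiMeasurePreserving ptPostStar collMeasure volume :=
  quasiMeasurePreserving_ptStar.comp measurePreserving_collideMap.quasiMeasurePreserving

/-! ### Collision kernels -/

/-- Bounded collision kernels `K(v, v_*, φ)` with the symmetries of binary collisions, vanishing
for grazing and for frontal collisions. -/
structure CollisionKernel (K : Velocity → Velocity → ℝ → ℝ) (b c : ℝ) : Prop where
  measurable : Measurable fun q : Velocity × Velocity × ℝ => K q.1 q.2.1 q.2.2
  nonneg : ∀ v w φ, 0 ≤ K v w φ
  le : ∀ v w φ, K v w φ ≤ b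
  swap : ∀ v w φ, K w v φ = K v w φ
  coll : ∀ v w φ, K (postVel v w φ) (postVelStar v w φ) φ = K v w φ
  tangential_le : ∀ v w φ, K v w φ ≠ 0 →
    |inner ℝ (v - w) (perpVec φ)| ≤ c * |inner ℝ (v - w) (unitVec φ)|
  normal_le : ∀ v w φ, K v w φ ≠ 0 →
    |inner ℝ (v - w) (unitVec φ)| ≤ c * |inner ℝ (v - w) (perpVec φ)|

theorem cos_angle_unitVec (u : Velocity) (φ : ℝ) :
    Real.cos (InnerProductGeometry.angle (unitVec φ) u) * ‖u‖ = inner ℝ u (unitVec φ) := by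
  have h := InnerProductGeometry.cos_angle_mul_norm_mul_norm (unitVec φ) u
  rw [norm_unitVec, one_mul] at h
  rw [h, real_inner_comm]

theorem measurable_kernelAt {B : ℝ → ℝ → ℝ} (hB : Measurable (Function.uncurry B)) :
    Measurable fun q : Velocity × Velocity × ℝ => kernelAt B q.1 q.2.1 q.2.2 := by
  have h1 : Measurable fun q : Velocity × Velocity × ℝ => ‖q.1 - q.2.1‖ := by fun_prop
  have h2 : Measurable fun q : Velocity × Velocity × ℝ =>
      InnerProductGeometry.angle (unitVec q.2.2) (q.1 - q.2.1) := by
    unfold InnerProductGeometry.angle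
    refine Real.continuous_arccos.measurable.comp (Measurable.div ?_ ?_)
    · have := continuous_inner_unitVec.measurable
      simpa only [real_inner_comm] using this
    · exact (continuous_unitVec.measurable.comp (measurable_snd.comp measurable_snd)).norm.mul h1
  exact hB.comp (h1.prodMk h2)

/-- The two angular cut-offs keep the normal and the tangential part of v - v_* each at least γ'|v -
v_*|, so that they are comparable with constant c = 1/γ'. The symmetries hold because a collision
preserves |v - v_*| and the modulus of its normal component, which is all that the kernel sees. -/
theorem IsCutoffKernel.collisionKernel {B : ℝ → ℝ → ℝ} {B₀ γ γ' cB : ℝ} (hγ : 0 < γ) (hγ' : 0 < γ')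
    (hB : IsCutoffKernel B B₀ γ γ' cB) : ∃ c : ℝ, 0 < c ∧ CollisionKernel (kernelAt B) B₀ c := by
  have hcos : ∀ u u' : Velocity, ∀ φ : ℝ, ‖u‖ = ‖u'‖ →
      |inner ℝ u (unitVec φ)| = |inner ℝ u' (unitVec φ)| →
      B ‖u‖ (InnerProductGeometry.angle (unitVec φ) u) =
        B ‖u'‖ (InnerProductGeometry.angle (unitVec φ) u') := by
    intro u u' φ hn hi
    rw [← hn]
    -- The cosine is recovered from the normal component by cancelling the norm. At zero relative
    -- velocity this is impossible, but there both sides vanish by the cut-off of small velocities.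
    by_cases h0 : ‖u‖ = 0
    · rw [hB.small_velocity _ (norm_nonneg _) (by rw [h0]; exact hγ),
        hB.small_velocity _ (norm_nonneg _) (by rw [h0]; exact hγ)]
    refine hB.even _ (norm_nonneg _) _ _ ?_
    have hpos : 0 < ‖u‖ := lt_of_le_of_ne (norm_nonneg _) (Ne.symm h0)
    have h1 : |Real.cos (InnerProductGeometry.angle (unitVec φ) u)| * ‖u‖ =
        |Real.cos (InnerProductGeometry.angle (unitVec φ) u')| * ‖u‖ := by
      calc _ = |inner ℝ u (unitVec φ)| := by rw [← cos_angle_unitVec, abs_mul, abs_norm]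
        _ = |inner ℝ u' (unitVec φ)| := hi
        _ = _ := by rw [← cos_angle_unitVec, abs_mul, abs_norm, ← hn]
    exact mul_right_cancel₀ h0 h1
  have hkey : ∀ v w φ, kernelAt B v w φ ≠ 0 → 0 < ‖v - w‖ ∧
      γ' * ‖v - w‖ ≤ |inner ℝ (v - w) (unitVec φ)| ∧
      |inner ℝ (v - w) (unitVec φ)| ≤ (1 - γ') * ‖v - w‖ := by
    intro v w φ h
    have h1 : γ ≤ ‖v - w‖ := by
      by_contra hlt
      exact h (hB.small_velocity _ (norm_nonneg _) (not_le.1 hlt) _)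
    have hpos : 0 < ‖v - w‖ := lt_of_lt_of_le hγ h1
    have h2 : γ' ≤ |Real.cos (InnerProductGeometry.angle (unitVec φ) (v - w))| := by
      by_contra hlt
      exact h (hB.grazing _ (norm_nonneg _) _ (not_le.1 hlt))
    have h3 : γ' ≤ 1 - |Real.cos (InnerProductGeometry.angle (unitVec φ) (v - w))| := by
      by_contra hlt
      exact h (hB.frontal _ (norm_nonneg _) _ (not_le.1 hlt))
    have h4 : |inner ℝ (v - w) (unitVec φ)| =
        |Real.cos (InnerProductGeometry.angle (unitVec φ) (v - w))| * ‖v - w‖ := by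
      rw [← cos_angle_unitVec, abs_mul, abs_norm]
    refine ⟨hpos, ?_, ?_⟩ <;> rw [h4] <;> gcongr
    linarith
  have hsq : ∀ v w φ, |inner ℝ (v - w) (unitVec φ)| ^ 2 + |inner ℝ (v - w) (perpVec φ)| ^ 2 =
      ‖v - w‖ ^ 2 := fun v w φ => by rw [sq_abs, sq_abs, inner_unitVec_sq_add]
  refine ⟨1 / γ', by positivity, measurable_kernelAt hB.measurable,
    fun v w φ => hB.nonneg _ (norm_nonneg _) _, fun v w φ => hB.le_bound _ (norm_nonneg _) _,
    fun v w φ => ?_, fun v w φ => ?_, fun v w φ h => ?_, fun v w φ h => ?_⟩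
  · refine hcos _ _ _ (norm_sub_rev _ _) ?_
    rw [← abs_neg, ← inner_neg_left, neg_sub]
  · refine hcos _ _ _ (norm_post_sub v w φ) ?_
    rw [inner_post_unitVec, abs_neg]
  · obtain ⟨h0, h1, h2⟩ := hkey v w φ h
    have h3 := hsq v w φ
    set a := |inner ℝ (v - w) (unitVec φ)|
    set b := |inner ℝ (v - w) (perpVec φ)|
    have hb : 0 ≤ b := abs_nonneg _
    have ha : 0 ≤ a := abs_nonneg _
    have h4 : b ≤ ‖v - w‖ := by nlinarith
    rw [div_mul_eq_mul_div, one_mul, le_div_iff₀ hγ']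
    nlinarith
  · obtain ⟨h0, h1, h2⟩ := hkey v w φ h
    have h3 := hsq v w φ
    set a := |inner ℝ (v - w) (unitVec φ)|
    set b := |inner ℝ (v - w) (perpVec φ)|
    have hb : 0 ≤ b := abs_nonneg _
    have ha : 0 ≤ a := abs_nonneg _
    set r := ‖v - w‖
    -- A collision that passes both cut-offs exists only if γ' ≤ 1/2; this is used to get 1 - (1 -
    -- γ')² ≥ γ'².
    have hg : γ' ≤ 1 - γ' := by nlinarith
    have h5 : a ^ 2 ≤ ((1 - γ') * r) ^ 2 := pow_le_pow_left₀ ha h2 2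
    have h6 : γ' * r ≤ b := by
      refine le_of_sq_le_sq ?_ hb
      nlinarith [mul_nonneg hγ'.le (sub_nonneg.2 hg), sq_nonneg r, mul_nonneg (mul_nonneg hγ'.le (sub_nonneg.2 hg)) (sq_nonneg r)]
    have h7 : a ≤ r := by nlinarith
    rw [div_mul_eq_mul_div, one_mul, le_div_iff₀ hγ']
    nlinarith

/-- The kernel restricted to collisions of energy at most `R ^ 2`. -/
noncomputable def truncKernel (K : Velocity → Velocity → ℝ → ℝ) (R : ℝ) (v w : Velocity) (φ : ℝ) :
    ℝ :=
  if ‖v‖ ^ 2 + ‖w‖ ^ 2 ≤ R ^ 2 then K v w φ else 0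

theorem truncKernel_of_le {K : Velocity → Velocity → ℝ → ℝ} {R : ℝ} {v w : Velocity}
    (h : ‖v‖ ^ 2 + ‖w‖ ^ 2 ≤ R ^ 2) (φ : ℝ) : truncKernel K R v w φ = K v w φ := if_pos h

theorem truncKernel_of_lt {K : Velocity → Velocity → ℝ → ℝ} {R : ℝ} {v w : Velocity}
    (h : R ^ 2 < ‖v‖ ^ 2 + ‖w‖ ^ 2) (φ : ℝ) : truncKernel K R v w φ = 0 := if_neg (not_le.2 h)

theorem CollisionKernel.trunc {K : Velocity → Velocity → ℝ → ℝ} {b c : ℝ}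
    (hK : CollisionKernel K b c) (hb : 0 ≤ b) (R : ℝ) :
    CollisionKernel (truncKernel K R) b c := by
  have hne : ∀ v w φ, truncKernel K R v w φ ≠ 0 → K v w φ ≠ 0 := by
    intro v w φ h
    rcases le_or_gt (‖v‖ ^ 2 + ‖w‖ ^ 2) (R ^ 2) with h' | h'
    · rwa [truncKernel_of_le h'] at h
    · exact absurd (truncKernel_of_lt h' φ) h
  refine ⟨?_, fun v w φ => ?_, fun v w φ => ?_, fun v w φ => ?_, fun v w φ => ?_,
    fun v w φ h => hK.tangential_le v w φ (hne v w φ h),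
    fun v w φ h => hK.normal_le v w φ (hne v w φ h)⟩
  · have hs : MeasurableSet {q : Velocity × Velocity × ℝ | ‖q.1‖ ^ 2 + ‖q.2.1‖ ^ 2 ≤ R ^ 2} :=
      measurableSet_le (by fun_prop) (by fun_prop)
    exact Measurable.ite hs hK.measurable measurable_const
  · unfold truncKernel
    split_ifs
    exacts [hK.nonneg _ _ _, le_rfl]
  · unfold truncKernel
    split_ifs
    exacts [hK.le _ _ _, hb]
  · rcases le_or_gt (‖v‖ ^ 2 + ‖w‖ ^ 2) (R ^ 2) with h' | h'
    · rw [truncKernel_of_le h', truncKernel_of_le (by linarith), hK.swap]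
    · rw [truncKernel_of_lt h', truncKernel_of_lt (by linarith)]
  · rcases le_or_gt (‖v‖ ^ 2 + ‖w‖ ^ 2) (R ^ 2) with h' | h'
    · rw [truncKernel_of_le h', truncKernel_of_le (by rwa [post_energy]), hK.coll]
    · rw [truncKernel_of_lt h', truncKernel_of_lt (by rwa [post_energy])]

/-! ### Carleman-type change of variables -/

theorem measurePreserving_neg_velocity :
    MeasurePreserving (fun v : Velocity => -v) volume volume :=
  (LinearIsometryEquiv.neg ℝ (E := Velocity)).measurePreserving

theorem polar_pos (G : Velocity → ℝ≥0∞) (hG : Measurable G) :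
    ∫⁻ φ in Ioc (0 : ℝ) (2 * π), ∫⁻ a in Ioi (0 : ℝ), ENNReal.ofReal a * G (a • unitVec φ) =
      ∫⁻ v, G v := by
  -- Polar coordinates use angles in (-π, π). Reflection of the velocity is a shift of the angle by
  -- π, which leads to the interval (0, 2π] of the angle measure.
  have hneg : ∫⁻ v, G (-v) = ∫⁻ v, G v := measurePreserving_neg_velocity.lintegral_comp hG
  have hGn : Measurable fun v => G (-v) := hG.comp measurable_neg
  rw [← hneg, ← measurePreserving_coordEquiv.lintegral_comp hGn,
    ← lintegral_comp_polarCoord_symm, polarCoord_target, Measure.volume_eq_prod,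
    ← Measure.prod_restrict]
  have hm : Measurable fun p : ℝ × ℝ => G (-coordEquiv (polarCoord.symm p)) :=
    hGn.comp (coordEquiv.measurable.comp continuous_polarCoord_symm.measurable)
  rw [lintegral_prod_symm _
    (by exact ((ENNReal.measurable_ofReal.comp measurable_fst).smul hm).aemeasurable)]
  have hshift : MeasurePreserving (fun ψ : ℝ => ψ + π) volume volume :=
    measurePreserving_add_right volume π
  have hpre : (fun ψ : ℝ => ψ + π) ⁻¹' Ioc 0 (2 * π) = Ioc (-π) π := by
    ext ψ; simp only [mem_preimage, mem_Ioc]; constructor <;> rintro ⟨h1, h2⟩ <;> constructor <;>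
      linarith
  rw [← hshift.setLIntegral_comp_preimage_emb (measurableEmbedding_addRight π), hpre,
    restrict_Ioo_eq_restrict_Ioc]
  refine lintegral_congr fun ψ => setLIntegral_congr_fun measurableSet_Ioi fun a _ => ?_
  have : a • unitVec (ψ + π) = -coordEquiv (polarCoord.symm (a, ψ)) := by
    refine velocity_ext ?_ ?_
    · simp [unitVec_zero, coordEquiv_zero, polarCoord_symm_apply]
    · simp [unitVec_one, coordEquiv_one, polarCoord_symm_apply]
  simp only [smul_eq_mul, this]

/-- With a running over the whole line and φ over a full turn, the plane is covered twice, hence the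
factor 2. -/
theorem polar_univ_le (G : Velocity → ℝ≥0∞) (hG : Measurable G) :
    ∫⁻ φ in Ioc (0 : ℝ) (2 * π), ∫⁻ a : ℝ, ENNReal.ofReal |a| * G (a • unitVec φ) ≤
      2 * ∫⁻ v, G v := by
  have hneg : ∫⁻ v, G (-v) = ∫⁻ v, G v := measurePreserving_neg_velocity.lintegral_comp hG
  have hGn : Measurable fun v => G (-v) := hG.comp measurable_neg
  have hsplit : ∀ φ : ℝ, ∫⁻ a : ℝ, ENNReal.ofReal |a| * G (a • unitVec φ) =
      (∫⁻ a in Ioi (0 : ℝ), ENNReal.ofReal a * G (a • unitVec φ)) +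
      ∫⁻ a in Ioi (0 : ℝ), ENNReal.ofReal a * G (-(a • unitVec φ)) := by
    intro φ
    rw [← lintegral_add_compl _ (measurableSet_Ioi (a := (0 : ℝ))), compl_Ioi]
    congr 1
    · refine setLIntegral_congr_fun measurableSet_Ioi fun a ha => ?_
      simp only [abs_of_pos (mem_Ioi.1 ha)]
    · rw [← restrict_Iio_eq_restrict_Iic]
      have hm : MeasurePreserving (fun a : ℝ => -a) volume volume :=
        Measure.measurePreserving_neg volume
      have hpre : (fun a : ℝ => -a) ⁻¹' Iio 0 = Ioi 0 := by ext; simp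
      rw [← hm.setLIntegral_comp_preimage_emb measurableEmbedding_neg, hpre]
      refine setLIntegral_congr_fun measurableSet_Ioi fun a ha => ?_
      simp only [abs_neg, abs_of_pos (mem_Ioi.1 ha), neg_smul]
  simp_rw [hsplit]
  have hmeas : Measurable fun φ : ℝ =>
      ∫⁻ a in Ioi (0 : ℝ), ENNReal.ofReal a * G (a • unitVec φ) := by
    have : Measurable fun q : ℝ × ℝ => ENNReal.ofReal q.2 * G (q.2 • unitVec q.1) :=
      (ENNReal.measurable_ofReal.comp measurable_snd).mul
        (hG.comp (continuous_snd.smul (continuous_unitVec.comp continuous_fst)).measurable)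
    exact this.lintegral_prod_right'
  rw [lintegral_add_left hmeas, polar_pos G hG, polar_pos _ hGn, hneg, two_mul]

theorem lintegral_frame (φ : ℝ) (v : Velocity) {H : Velocity → ℝ≥0∞} (hH : Measurable H) :
    ∫⁻ w, H w = ∫⁻ ξ, H (v - frameMap φ ξ) := by
  have h := (Measure.measurePreserving_sub_left (volume : Measure Velocity) v).comp
    (measurePreserving_frameMap φ)
  exact (h.lintegral_comp hH).symm

theorem perpVec_eq_frameMap (φ : ℝ) : perpVec φ = frameMap (π / 2) (unitVec φ) := by
  refine velocity_ext ?_ ?_ <;>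
  simp [frameMap_apply, unitVec_zero, unitVec_one, perpVec_zero, perpVec_one]

/-- Once v - v_* is written in the frame of n, v' depends on the normal coordinate only and v'_* on
the tangential coordinate only. This decoupling is the basis of the change of variables. -/
theorem postVel_frame (φ : ℝ) (v ξ : Velocity) :
    postVel v (v - frameMap φ ξ) φ = v - ξ 0 • unitVec φ := by
  rw [postVel, sub_sub_cancel, inner_frameMap_unitVec]

theorem postVelStar_frame (φ : ℝ) (v ξ : Velocity) :
    postVelStar v (v - frameMap φ ξ) φ = v - ξ 1 • perpVec φ := by
  rw [postVelStar, sub_sub_cancel, inner_frameMap_unitVec, frameMap_apply]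
  abel

theorem lintegral_indicator_abs_le (c a : ℝ) (m : ℝ≥0∞) :
    ∫⁻ b : ℝ, indicator {b : ℝ | |b| ≤ c * |a|} (fun _ => m) b = m * ENNReal.ofReal (2 * c * |a|) := by
  have hs : {b : ℝ | |b| ≤ c * |a|} = Icc (-(c * |a|)) (c * |a|) := by
    ext b; simp [abs_le]
  rw [hs, lintegral_indicator_const measurableSet_Icc, Real.volume_Icc]
  congr 2; ring

theorem two_mul_inv_two_pi_le : (ENNReal.ofReal (2 * π))⁻¹ * 2 ≤ 1 := by
  have h : (2 : ℝ≥0∞) ≤ ENNReal.ofReal (2 * π) := by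
    rw [← ENNReal.ofReal_ofNat]
    exact ENNReal.ofReal_le_ofReal (by linarith [Real.pi_gt_three])
  calc (ENNReal.ofReal (2 * π))⁻¹ * 2 ≤ (ENNReal.ofReal (2 * π))⁻¹ * ENNReal.ofReal (2 * π) := by
        gcongr
    _ = 1 := ENNReal.inv_mul_cancel (by simpa using Real.pi_pos) ENNReal.ofReal_ne_top

/-- Common end of the two estimates that follow: the length 2c|a| of the interval of admissible
second coordinates plays the role of the Jacobian of polar coordinates. -/
theorem polar_angle_le {b c : ℝ} (hc : 0 ≤ c) {G : Velocity → ℝ≥0∞}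
    (hG : Measurable G) {J : ℝ → ℝ≥0∞}
    (hJ : ∀ φ, J φ ≤ ∫⁻ a : ℝ, G (a • unitVec φ) * (ENNReal.ofReal b * ENNReal.ofReal (2 * c * |a|))) :
    ∫⁻ φ, J φ ∂angleMeasure ≤ ENNReal.ofReal (2 * c * b) * ∫⁻ u, G u := by
  have h1 : ∀ φ, J φ ≤ ENNReal.ofReal (2 * c * b) *
      ∫⁻ a : ℝ, ENNReal.ofReal |a| * G (a • unitVec φ) := by
    intro φ
    refine (hJ φ).trans (le_of_eq ?_)
    rw [← lintegral_const_mul' _ _ ENNReal.ofReal_ne_top]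
    refine lintegral_congr fun a => ?_
    rw [ENNReal.ofReal_mul (by positivity : (0 : ℝ) ≤ 2 * c),
      ENNReal.ofReal_mul (by positivity : (0 : ℝ) ≤ 2 * c)]
    ring
  calc ∫⁻ φ, J φ ∂angleMeasure ≤ ∫⁻ φ, ENNReal.ofReal (2 * c * b) *
      (∫⁻ a : ℝ, ENNReal.ofReal |a| * G (a • unitVec φ)) ∂angleMeasure := lintegral_mono h1
    _ = ENNReal.ofReal (2 * c * b) * ((ENNReal.ofReal (2 * π))⁻¹ *
        ∫⁻ φ in Ioc (0 : ℝ) (2 * π), ∫⁻ a : ℝ, ENNReal.ofReal |a| * G (a • unitVec φ)) := by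
        rw [lintegral_const_mul' _ _ ENNReal.ofReal_ne_top, lintegral_angleMeasure]
    _ ≤ ENNReal.ofReal (2 * c * b) * ((ENNReal.ofReal (2 * π))⁻¹ * (2 * ∫⁻ u, G u)) := by
        gcongr; exact polar_univ_le G hG
    _ ≤ ENNReal.ofReal (2 * c * b) * (1 * ∫⁻ u, G u) := by
        rw [← mul_assoc ((ENNReal.ofReal (2 * π))⁻¹)]
        gcongr
        exact two_mul_inv_two_pi_le
    _ = _ := by rw [one_mul]

theorem CollisionKernel.measurable_section {K : Velocity → Velocity → ℝ → ℝ} {b c : ℝ}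
    (hK : CollisionKernel K b c) (v : Velocity) : Measurable fun q : Velocity × ℝ => K v q.1 q.2 :=
  hK.measurable.comp measurable_prodMk_left

/-- For fixed v and n the integrand sees v_* through v' = v - an, apart from the bounded kernel. The
tangential coordinate is confined to |β| ≤ c|a|; integrating it out leaves the weight |a|, and (a,
n) become polar coordinates of v' about v. -/
theorem CollisionKernel.lintegral_post_le {K : Velocity → Velocity → ℝ → ℝ} {b c : ℝ}
    (hK : CollisionKernel K b c) (hb : 0 ≤ b) (hc : 0 ≤ c) (v : Velocity) {g : Velocity → ℝ≥0∞}
    (hg : Measurable g) :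
    ∫⁻ q : Velocity × ℝ, ENNReal.ofReal (K v q.1 q.2) * g (postVel v q.1 q.2)
      ∂((volume : Measure Velocity).prod angleMeasure) ≤ ENNReal.ofReal (2 * c * b) * ∫⁻ u, g u := by
  have hm : Measurable fun q : Velocity × ℝ =>
      ENNReal.ofReal (K v q.1 q.2) * g (postVel v q.1 q.2) :=
    (hK.measurable_section v).ennreal_ofReal.mul
      (hg.comp (continuous_postVel.measurable.comp measurable_prodMk_left))
  rw [lintegral_prod_symm _ hm.aemeasurable,
    ← lintegral_sub_left_eq_self (μ := (volume : Measure Velocity)) g v]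
  refine polar_angle_le hc (G := fun u => g (v - u)) (hg.comp (by fun_prop)) fun φ => ?_
  have hmφ : Measurable fun w : Velocity => ENNReal.ofReal (K v w φ) * g (postVel v w φ) :=
    hm.comp measurable_prodMk_right
  simp only []
  rw [lintegral_frame φ v hmφ]
  simp only [postVel_frame]
  rw [lintegral_velocity _ (by
    refine Measurable.mul (Measurable.ennreal_ofReal ?_) ?_
    · exact (hK.measurable_section v).comp
        ((measurable_const.sub (frameMap φ).continuous.measurable).prodMk measurable_const)
    · exact hg.comp (by fun_prop))]
  refine lintegral_mono fun a => ?_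
  rw [← lintegral_indicator_abs_le,
    ← lintegral_const_mul _ (measurable_const.indicator (measurableSet_le (by fun_prop) (by fun_prop)))]
  refine lintegral_mono fun β => ?_
  simp only [coordEquiv_zero]
  rw [mul_comm]
  gcongr
  by_cases h0 : K v (v - frameMap φ (coordEquiv (a, β))) φ = 0
  · rw [h0]; simp
  · have h1 := hK.tangential_le _ _ _ h0
    rw [sub_sub_cancel, inner_frameMap_perpVec, inner_frameMap_unitVec] at h1
    rw [indicator_of_mem (by exact h1)]
    exact ENNReal.ofReal_le_ofReal (hK.le _ _ _)

/-- The roles of the two coordinates are exchanged: now the tangential one is kept and the normal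
one is integrated out, so the cut-off of frontal collisions is needed in place of the grazing one.
-/
theorem CollisionKernel.lintegral_postStar_le {K : Velocity → Velocity → ℝ → ℝ} {b c : ℝ}
    (hK : CollisionKernel K b c) (hb : 0 ≤ b) (hc : 0 ≤ c) (v : Velocity) {g : Velocity → ℝ≥0∞}
    (hg : Measurable g) :
    ∫⁻ q : Velocity × ℝ, ENNReal.ofReal (K v q.1 q.2) * g (postVelStar v q.1 q.2)
      ∂((volume : Measure Velocity).prod angleMeasure) ≤ ENNReal.ofReal (2 * c * b) * ∫⁻ u, g u := by
  have hm : Measurable fun q : Velocity × ℝ =>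
      ENNReal.ofReal (K v q.1 q.2) * g (postVelStar v q.1 q.2) :=
    (hK.measurable_section v).ennreal_ofReal.mul
      (hg.comp (continuous_postVelStar.measurable.comp measurable_prodMk_left))
  -- The rotation by π/2 carries n to the orthogonal direction along which v'_* moves, so that the
  -- same polar estimate applies.
  rw [lintegral_prod_symm _ hm.aemeasurable, lintegral_frame (π / 2) v hg]
  refine polar_angle_le hc (G := fun u => g (v - frameMap (π / 2) u))
    (hg.comp (measurable_const.sub (frameMap (π / 2)).continuous.measurable)) fun φ => ?_
  have hmφ : Measurable fun w : Velocity => ENNReal.ofReal (K v w φ) * g (postVelStar v w φ) :=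
    hm.comp measurable_prodMk_right
  simp only []
  rw [lintegral_frame φ v hmφ]
  simp only [postVelStar_frame]
  rw [lintegral_velocity' _ (by
    refine Measurable.mul (Measurable.ennreal_ofReal ?_) ?_
    · exact (hK.measurable_section v).comp
        ((measurable_const.sub (frameMap φ).continuous.measurable).prodMk measurable_const)
    · exact hg.comp (by fun_prop))]
  refine lintegral_mono fun a => ?_
  rw [← lintegral_indicator_abs_le,
    ← lintegral_const_mul _ (measurable_const.indicator (measurableSet_le (by fun_prop) (by fun_prop)))]
  refine lintegral_mono fun β => ?_
  simp only [coordEquiv_one]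
  rw [mul_comm, map_smul, ← perpVec_eq_frameMap]
  gcongr
  by_cases h0 : K v (v - frameMap φ (coordEquiv (β, a))) φ = 0
  · rw [h0]; simp
  · have h1 := hK.normal_le _ _ _ h0
    rw [sub_sub_cancel, inner_frameMap_perpVec, inner_frameMap_unitVec] at h1
    rw [indicator_of_mem (by exact h1)]
    exact ENNReal.ofReal_le_ofReal (hK.le _ _ _)

/-! ### Nondegeneracy of the kernel -/

/-- A full turn of n contains the half turn of the nondegeneracy hypothesis; the factor 1/(2π) is
the normalisation of the angle measure. -/
theorem IsCutoffKernel.lintegral_angle_ge {B : ℝ → ℝ → ℝ} {B₀ γ γ' cB : ℝ} (hγ : 0 < γ)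
    (hB : IsCutoffKernel B B₀ γ γ' cB) {v w : Velocity} (hvw : γ ≤ ‖v - w‖) :
    ENNReal.ofReal (cB / (2 * π)) ≤ ∫⁻ φ, ENNReal.ofReal (kernelAt B v w φ) ∂angleMeasure := by
  have hr : 0 < ‖v - w‖ := lt_of_lt_of_le hγ hvw
  obtain ⟨β, h0, h1⟩ : ∃ β : ℝ, (v - w) 0 = ‖v - w‖ * Real.cos β ∧
      (v - w) 1 = ‖v - w‖ * Real.sin β := by
    set z : ℂ := ⟨(v - w) 0, (v - w) 1⟩ with hz
    have hn : ‖z‖ = ‖v - w‖ := by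
      have : ‖z‖ ^ 2 = ‖v - w‖ ^ 2 := by
        rw [Complex.sq_norm, Complex.normSq_apply, norm_sq_eq]; ring
      exact (pow_left_inj₀ (norm_nonneg _) (norm_nonneg _) two_ne_zero).1 this
    refine ⟨z.arg, ?_, ?_⟩
    · rw [← hn, Complex.norm_mul_cos_arg]
    · rw [← hn, Complex.norm_mul_sin_arg]
  set r := ‖v - w‖
  -- With β the polar angle of v - v_*, the unoriented angle in [0, π] and φ - β have the same
  -- cosine, and the kernel depends on nothing else.
  have hk : ∀ φ, kernelAt B v w φ = B r (φ - β) := by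
    intro φ
    refine hB.even _ hr.le _ _ ?_
    have h2 := cos_angle_unitVec (v - w) φ
    rw [inner_eq, h0, h1, unitVec_zero, unitVec_one] at h2
    congr 1
    have h3 : Real.cos (φ - β) * r = Real.cos (InnerProductGeometry.angle (unitVec φ) (v - w)) * r := by
      rw [h2, Real.cos_sub]; ring
    exact (mul_right_cancel₀ hr.ne' h3).symm
  have hmeas : Measurable (B r) := hB.measurable.comp measurable_prodMk_left
  have hint : ∀ a b, IntervalIntegrable (B r) volume a b := by
    intro a b
    refine (intervalIntegrable_const (c := B₀)).mono_fun hmeas.aestronglyMeasurable ?_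
    refine Eventually.of_forall fun θ => ?_
    simp only [Real.norm_of_nonneg (hB.nonneg r hr.le θ)]
    exact (hB.le_bound r hr.le θ).trans (le_abs_self _)
  have hper : Function.Periodic (B r) (2 * π) := fun θ =>
    hB.even r hr.le _ _ (by rw [Real.cos_add_two_pi])
  have hge : cB ≤ ∫ φ in (0 : ℝ)..(2 * π), B r (φ - β) := by
    rw [intervalIntegral.integral_comp_sub_right (fun θ => B r θ) β]
    have e1 : ∫ θ in (0 - β)..(2 * π - β), B r θ = ∫ θ in (-π)..π, B r θ := by
      have := hper.intervalIntegral_add_eq (0 - β) (-π)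
      rw [show 0 - β + 2 * π = 2 * π - β by ring, show -π + 2 * π = π by ring] at this
      exact this
    rw [e1]
    refine (hB.lower r hvw).trans ?_
    refine intervalIntegral.integral_mono_interval ?_ ?_ ?_ ?_ (hint _ _)
    · linarith [Real.pi_pos]
    · linarith [Real.pi_pos]
    · linarith [Real.pi_pos]
    · exact Eventually.of_forall fun θ => hB.nonneg r hr.le θ
  have hpi : (0 : ℝ) ≤ 2 * π := by positivity
  simp_rw [hk]
  rw [lintegral_angleMeasure, ← ofReal_integral_eq_lintegral_ofReal,
    ← intervalIntegral.integral_of_le hpi, div_eq_mul_inv, mul_comm, ENNReal.ofReal_mul (by positivity),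
    ENNReal.ofReal_inv_of_pos (by positivity)]
  · gcongr
  · have := ((hint (0 - β) (2 * π - β)).comp_sub_right β)
    simp only [sub_add_cancel] at this
    exact (intervalIntegrable_iff_integrableOn_Ioc_of_le hpi).1 this
  · exact Eventually.of_forall fun θ => hB.nonneg r hr.le _

/-! ### Filling factors -/

/-- Concave filling functions below the filling factor, vanishing at full occupation `M = 1/α`. -/
structure FillingFunction (α M : ℝ) (Φ : ℝ → ℝ) : Prop where
  measurable : Measurable Φ
  nonneg : ∀ y ∈ Icc 0 M, 0 ≤ Φ y
  le_bound : ∀ y ∈ Icc 0 M, Φ y ≤ M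
  le_one_add : ∀ y ∈ Icc 0 M, Φ y ≤ 1 + y
  le_rpow : ∀ y ∈ Icc 0 M, Φ y ≤ M * (M - y) ^ α
  concave : ConcaveOn ℝ (Icc 0 M) Φ
  zero : Φ 0 = 1
  full : Φ M = 0

/-- Dividing by the value at the mean point, the weighted inequality of arithmetic and geometric
means bounds each term by an affine expression, and these average to exactly one. -/
theorem geom_mean_concave {α a₁ a₂ b₁ b₂ s t : ℝ} (hα : 0 < α) (hα1 : α ≤ 1)
    (ha₁ : 0 ≤ a₁) (ha₂ : 0 ≤ a₂) (hb₁ : 1 ≤ b₁) (hb₂ : 1 ≤ b₂) (hs : 0 ≤ s) (ht : 0 ≤ t)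
    (hst : s + t = 1) :
    s * (a₁ ^ α * b₁ ^ (1 - α)) + t * (a₂ ^ α * b₂ ^ (1 - α)) ≤
      (s * a₁ + t * a₂) ^ α * (s * b₁ + t * b₂) ^ (1 - α) := by
  have hα' : 0 ≤ 1 - α := by linarith
  set A := s * a₁ + t * a₂ with hA
  set D := s * b₁ + t * b₂ with hD
  have hD1 : 1 ≤ D := by nlinarith
  have hA0 : 0 ≤ A := by positivity
  -- Division by A fails only if both weighted values of a vanish, and then the left-hand side is
  -- zero.
  rcases hA0.eq_or_lt with h0 | hpos
  · have h1 : s * a₁ = 0 := by nlinarith [mul_nonneg hs ha₁, mul_nonneg ht ha₂]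
    have h2 : t * a₂ = 0 := by nlinarith [mul_nonneg hs ha₁, mul_nonneg ht ha₂]
    have h3 : ∀ r a b : ℝ, r * a = 0 → r * (a ^ α * b) = 0 := by
      intro r a b h
      rcases mul_eq_zero.1 h with h | h
      · rw [h, zero_mul]
      · rw [h, Real.zero_rpow hα.ne', zero_mul, mul_zero]
    rw [h3 _ _ _ h1, h3 _ _ _ h2, add_zero]
    exact mul_nonneg (Real.rpow_nonneg hA0 _) (Real.rpow_nonneg (by linarith) _)
  · have key : ∀ a b : ℝ, 0 ≤ a → 1 ≤ b →
        a ^ α * b ^ (1 - α) ≤ (α * (a / A) + (1 - α) * (b / D)) * (A ^ α * D ^ (1 - α)) := by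
      intro a b ha hb
      have h1 := Real.geom_mean_le_arith_mean2_weighted hα.le hα' (div_nonneg ha hA0)
        (by positivity : 0 ≤ b / D) (by ring)
      rw [Real.div_rpow ha hA0, Real.div_rpow (by linarith) (by linarith)] at h1
      have hP : 0 < A ^ α := Real.rpow_pos_of_pos hpos _
      have hR : 0 < D ^ (1 - α) := Real.rpow_pos_of_pos (by linarith) _
      rw [div_mul_div_comm, div_le_iff₀ (by positivity)] at h1
      exact h1
    have e1 := mul_le_mul_of_nonneg_left (key a₁ b₁ ha₁ hb₁) hs
    have e2 := mul_le_mul_of_nonneg_left (key a₂ b₂ ha₂ hb₂) ht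
    have e3 : s * (α * (a₁ / A) + (1 - α) * (b₁ / D)) + t * (α * (a₂ / A) + (1 - α) * (b₂ / D)) = 1 := by
      have hD0 : D ≠ 0 := by linarith
      have : s * (α * (a₁ / A) + (1 - α) * (b₁ / D)) + t * (α * (a₂ / A) + (1 - α) * (b₂ / D)) =
        α * (A / A) + (1 - α) * (D / D) := by rw [hA, hD]; ring
      rw [this, div_self hpos.ne', div_self hD0]; ring
    calc _ ≤ _ := add_le_add e1 e2
      _ = (s * (α * (a₁ / A) + (1 - α) * (b₁ / D)) + t * (α * (a₂ / A) + (1 - α) * (b₂ / D))) *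
          (A ^ α * D ^ (1 - α)) := by ring
      _ = _ := by rw [e3, one_mul]

theorem one_le_one_div {α : ℝ} (hα : 0 < α) (hα1 : α ≤ 1) : 1 ≤ 1 / α := by
  rw [le_div_iff₀ hα]; linarith

theorem fillingFunction_fillingFactor {α : ℝ} (hα : 0 < α) (hα1 : α ≤ 1) :
    FillingFunction α (1 / α) (fillingFactor α) := by
  have hM := one_le_one_div hα hα1
  have hα' : 0 ≤ 1 - α := by linarith
  have ha : ∀ y ∈ Icc 0 (1 / α), 0 ≤ 1 - α * y := by
    intro y hy
    have := (le_div_iff₀ hα).1 hy.2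
    linarith
  have hb : ∀ y ∈ Icc 0 (1 / α), 1 ≤ 1 + (1 - α) * y := fun y hy => by
    nlinarith [mul_nonneg hα' hy.1]
  have hb' : ∀ y ∈ Icc 0 (1 / α), (1 + (1 - α) * y) ^ (1 - α) ≤ 1 / α := by
    intro y hy
    have h1 : 1 + (1 - α) * y ≤ 1 / α := by
      have h2 : (1 - α) * y ≤ (1 - α) * (1 / α) := mul_le_mul_of_nonneg_left hy.2 hα'
      have h3 : (1 - α) * (1 / α) = 1 / α - 1 := by field_simp
      linarith
    calc (1 + (1 - α) * y) ^ (1 - α) ≤ (1 + (1 - α) * y) ^ (1 : ℝ) :=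
          Real.rpow_le_rpow_of_exponent_le (hb y hy) (by linarith)
      _ = 1 + (1 - α) * y := Real.rpow_one _
      _ ≤ 1 / α := h1
  refine ⟨?_, fun y hy => ?_, fun y hy => ?_, fun y hy => ?_, fun y hy => ?_, ?_, ?_, ?_⟩
  · unfold fillingFactor; fun_prop
  · exact mul_nonneg (Real.rpow_nonneg (ha y hy) _) (Real.rpow_nonneg (by linarith [hb y hy]) _)
  · have h1 : (1 - α * y) ^ α ≤ 1 := Real.rpow_le_one (ha y hy) (by nlinarith [hy.1]) hα.le
    calc fillingFactor α y ≤ 1 * (1 / α) := mul_le_mul h1 (hb' y hy)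
          (Real.rpow_nonneg (by linarith [hb y hy]) _) zero_le_one
      _ = 1 / α := one_mul _
  -- The arithmetic mean of the two bases with weights α and 1 - α is 1 + (1 - 2α)y.
  · have h1 := Real.geom_mean_le_arith_mean2_weighted hα.le hα' (ha y hy)
      (by linarith [hb y hy] : 0 ≤ 1 + (1 - α) * y) (by ring)
    refine h1.trans ?_
    nlinarith [mul_nonneg hα.le hy.1, hy.1]
  · have h1 : 1 - α * y = α * (1 / α - y) := by field_simp
    have h2 : 0 ≤ 1 / α - y := by linarith [hy.2]
    have h3 : (1 - α * y) ^ α ≤ (1 / α - y) ^ α := by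
      rw [h1]
      exact Real.rpow_le_rpow (by positivity) (by nlinarith) hα.le
    calc fillingFactor α y ≤ (1 / α - y) ^ α * (1 / α) := mul_le_mul h3 (hb' y hy)
          (Real.rpow_nonneg (by linarith [hb y hy]) _) (Real.rpow_nonneg h2 _)
      _ = _ := mul_comm _ _
  · refine ⟨convex_Icc _ _, fun y hy z hz s t hs ht hst => ?_⟩
    have h := geom_mean_concave hα hα1 (ha y hy) (ha z hz) (hb y hy) (hb z hz) hs ht hst
    have e1 : s * (1 - α * y) + t * (1 - α * z) = 1 - α * (s * y + t * z) := by
      linear_combination hst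
    have e2 : s * (1 + (1 - α) * y) + t * (1 + (1 - α) * z) = 1 + (1 - α) * (s * y + t * z) := by
      linear_combination hst
    rw [e1, e2] at h
    exact h
  · simp [fillingFactor]
  · have : 1 - α * (1 / α) = 0 := by field_simp; ring
    rw [fillingFactor, this, Real.zero_rpow hα.ne', zero_mul]

/-- By concavity the slope of the chord over [y, z] lies between those over [y, M] and [0, y]. The
latter is at most 1 since Φ(0) = 1 and Φ(y) ≤ 1 + y; the former is -Φ(y)/(M - y) ≥ -L. The condition
with L is thus needed at the left end only. -/
theorem FillingFunction.lipschitz_aux {α M : ℝ} {Φ : ℝ → ℝ} (hΦ : FillingFunction α M Φ)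
    {y z L : ℝ} (hy : 0 ≤ y) (hyz : y < z) (hz : z ≤ M) (hL : Φ y ≤ L * (M - y)) (hL1 : 1 ≤ L) :
    |Φ y - Φ z| ≤ L * (z - y) := by
  have hyM : y < M := lt_of_lt_of_le hyz hz
  have hyI : y ∈ Icc 0 M := ⟨hy, hyM.le⟩
  have hzI : z ∈ Icc 0 M := ⟨hy.trans hyz.le, hz⟩
  rw [abs_le]
  constructor
  · have h1 : Φ z - Φ y ≤ z - y := by
      rcases hy.eq_or_lt with h0 | hpos
      · rw [← h0, hΦ.zero]; linarith [hΦ.le_one_add z hzI]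
      · have h2 := hΦ.concave.2 (⟨le_rfl, hpos.le.trans hyM.le⟩ : (0 : ℝ) ∈ Icc 0 M) hzI
          (show 0 ≤ (z - y) / z from div_nonneg (by linarith) (by linarith))
          (show 0 ≤ y / z from div_nonneg (by linarith) (by linarith)) (by have := (hpos.trans hyz).ne'; field_simp; ring)
        have hz0 := (hpos.trans hyz)
        have e : ((z - y) / z) • (0 : ℝ) + (y / z) • z = y := by
          simp only [smul_eq_mul]; field_simp; ring
        rw [e, hΦ.zero] at h2
        simp only [smul_eq_mul, mul_one] at h2
        rw [div_mul_eq_mul_div, ← add_div, div_le_iff₀ hz0] at h2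
        have h3 := hΦ.le_one_add y hyI
        have h4 := hΦ.le_one_add z hzI
        nlinarith
    nlinarith
  · have h2 := hΦ.concave.2 hyI (⟨hy.trans hyM.le, le_rfl⟩ : M ∈ Icc 0 M)
      (show 0 ≤ (M - z) / (M - y) from div_nonneg (by linarith) (by linarith))
      (show 0 ≤ (z - y) / (M - y) from div_nonneg (by linarith) (by linarith))
      (by rw [← add_div]; rw [div_eq_one_iff_eq (by linarith)]; ring)
    have hMy : M - y ≠ 0 := by linarith
    have e : ((M - z) / (M - y)) • y + ((z - y) / (M - y)) • M = z := by
      simp only [smul_eq_mul]; field_simp; ring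
    rw [e, hΦ.full] at h2
    simp only [smul_eq_mul, mul_zero, add_zero] at h2
    rw [div_mul_eq_mul_div, div_le_iff₀ (by linarith)] at h2
    have h5 : (Φ y - Φ z) * (M - y) ≤ L * (z - y) * (M - y) := by nlinarith
    exact le_of_mul_le_mul_right h5 (by linarith)

theorem FillingFunction.lipschitz_of_le {α M : ℝ} {Φ : ℝ → ℝ} (hΦ : FillingFunction α M Φ)
    {L : ℝ} (hL1 : 1 ≤ L) (hL : ∀ y ∈ Icc 0 M, Φ y ≤ L * (M - y)) {y z : ℝ} (hy : y ∈ Icc 0 M)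
    (hz : z ∈ Icc 0 M) : |Φ y - Φ z| ≤ L * |y - z| := by
  rcases lt_trichotomy y z with h | h | h
  · rw [abs_sub_comm y z, abs_of_pos (by linarith : 0 < z - y)]
    exact hΦ.lipschitz_aux hy.1 h hz.2 (hL y hy) hL1
  · simp [h]
  · rw [abs_sub_comm (Φ y), abs_of_pos (by linarith : 0 < y - z)]
    exact hΦ.lipschitz_aux hz.1 h hy.2 (hL z hz) hL1

/-- The smaller of the two values is at distance at least η from M, and there M(M - m)^α ≤
Mη^(α-1)(M - m). The other value may be equal to M; this asymmetry allows comparison with solutions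
about which nothing is known. -/
theorem FillingFunction.lipschitz_away {α M : ℝ} (hα1 : α ≤ 1) (hM : 1 ≤ M) {Φ : ℝ → ℝ}
    (hΦ : FillingFunction α M Φ) {η : ℝ} (hη : 0 < η) {y z : ℝ} (hy : y ∈ Icc 0 M)
    (hz : z ∈ Icc 0 M) (hyη : y ≤ M - η) :
    |Φ y - Φ z| ≤ (1 + M * η ^ (α - 1)) * |y - z| := by
  have hpow : 0 ≤ η ^ (α - 1) := Real.rpow_nonneg hη.le _
  have hL1 : 1 ≤ 1 + M * η ^ (α - 1) := by nlinarith
  have key : ∀ m ∈ Icc 0 M, m ≤ M - η → Φ m ≤ (1 + M * η ^ (α - 1)) * (M - m) := by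
    intro m hm hmη
    have hs : 0 < M - m := by linarith
    have h1 : (M - m) ^ α = (M - m) ^ (α - 1) * (M - m) := by
      rw [← Real.rpow_add_one hs.ne']; ring_nf
    have h2 : (M - m) ^ (α - 1) ≤ η ^ (α - 1) :=
      Real.rpow_le_rpow_of_nonpos hη (by linarith) (by linarith)
    calc Φ m ≤ M * (M - m) ^ α := hΦ.le_rpow m hm
      _ = M * (M - m) ^ (α - 1) * (M - m) := by rw [h1]; ring
      _ ≤ (1 + M * η ^ (α - 1)) * (M - m) := by
        gcongr
        nlinarith
  rcases lt_trichotomy y z with h | h | h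
  · rw [abs_sub_comm y z, abs_of_pos (by linarith : 0 < z - y)]
    exact hΦ.lipschitz_aux hy.1 h hz.2 (key y hy hyη) hL1
  · simp [h]
  · rw [abs_sub_comm (Φ y), abs_of_pos (by linarith : 0 < y - z)]
    exact hΦ.lipschitz_aux hz.1 h hy.2 (key z hz (by linarith)) hL1

/-- The filling factor cut off to be Lipschitz at full occupation. -/
noncomputable def cutFilling (α k y : ℝ) : ℝ := min (fillingFactor α y) (k * (1 / α - y))

theorem cutFilling_le {α k : ℝ} (y : ℝ) : cutFilling α k y ≤ k * (1 / α - y) := min_le_right _ _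

theorem fillingFunction_cutFilling {α k : ℝ} (hα : 0 < α) (hα1 : α ≤ 1) (hk : 1 ≤ k) :
    FillingFunction α (1 / α) (cutFilling α k) := by
  have hF := fillingFunction_fillingFactor hα hα1
  have hM := one_le_one_div hα hα1
  refine ⟨hF.measurable.min (by fun_prop), fun y hy => ?_,
    fun y hy => (min_le_left _ _).trans (hF.le_bound y hy),
    fun y hy => (min_le_left _ _).trans (hF.le_one_add y hy),
    fun y hy => (min_le_left _ _).trans (hF.le_rpow y hy), ?_, ?_, ?_⟩
  · exact le_min (hF.nonneg y hy) (mul_nonneg (by linarith) (by linarith [hy.2]))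
  · refine hF.concave.inf ⟨convex_Icc _ _, fun y hy z hz s t hs ht hst => le_of_eq ?_⟩
    simp only [smul_eq_mul]
    linear_combination (k * (1 / α)) * hst
  · rw [cutFilling, hF.zero, sub_zero, min_eq_left]; nlinarith
  · rw [cutFilling, hF.full, sub_self, mul_zero, min_self]

/-- Within distance δ of full occupation both functions lie between 0 and Mδ^α ≤ ε. Farther away the
line k(M - y) is above M once k ≥ M/δ, so that the cut is inactive. -/
theorem exists_cutFilling_close {α : ℝ} (hα : 0 < α) (hα1 : α ≤ 1) {ε : ℝ} (hε : 0 < ε) :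
    ∃ k₀ : ℝ, ∀ k, k₀ ≤ k → ∀ y ∈ Icc 0 (1 / α), |cutFilling α k y - fillingFactor α y| ≤ ε := by
  have hF := fillingFunction_fillingFactor hα hα1
  have hM := one_le_one_div hα hα1
  obtain ⟨δ, hδ, hδε⟩ : ∃ δ : ℝ, 0 < δ ∧ 1 / α * δ ^ α ≤ ε := by
    refine ⟨(ε * α) ^ (1 / α), by positivity, le_of_eq ?_⟩
    rw [← Real.rpow_mul (by positivity), one_div_mul_cancel hα.ne', Real.rpow_one]
    field_simp
  refine ⟨(1 / α) / δ, fun k hk y hy => ?_⟩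
  have h0 : 0 ≤ 1 / α - y := by linarith [hy.2]
  have hk0 : 0 ≤ k := le_trans (by positivity) hk
  have h1 : cutFilling α k y ≤ fillingFactor α y := min_le_left _ _
  rw [abs_sub_comm, abs_of_nonneg (by linarith)]
  rcases lt_or_ge (1 / α - y) δ with h | h
  · have h2 : 0 ≤ cutFilling α k y := le_min (hF.nonneg y hy) (mul_nonneg hk0 h0)
    have h3 : (1 / α - y) ^ α ≤ δ ^ α := Real.rpow_le_rpow h0 h.le hα.le
    have h4 := hF.le_rpow y hy
    nlinarith
  · have h2 : 1 / α ≤ k * (1 / α - y) := by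
      calc 1 / α = (1 / α) / δ * δ := by field_simp
        _ ≤ k * (1 / α - y) := mul_le_mul hk h hδ.le hk0
    rw [cutFilling, min_eq_left ((hF.le_bound y hy).trans h2)]
    linarith

/-- A uniform modulus of continuity in the form that integrates well: the linear part is measured by
the L¹ distance, and ε is absorbed by the energy weight. It replaces the missing Lipschitz bound in
the passage to the limit. -/
theorem exists_fillingFactor_modulus {α : ℝ} (hα : 0 < α) (hα1 : α ≤ 1) {ε : ℝ} (hε : 0 < ε) :
    ∃ L : ℝ, 0 ≤ L ∧ ∀ y ∈ Icc 0 (1 / α), ∀ z ∈ Icc 0 (1 / α),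
      |fillingFactor α y - fillingFactor α z| ≤ L * |y - z| + ε := by
  obtain ⟨k₀, hk₀⟩ := exists_cutFilling_close hα hα1 (half_pos hε)
  set k := max k₀ 1
  have hk1 : 1 ≤ k := le_max_right _ _
  have hc := fillingFunction_cutFilling hα hα1 hk1
  refine ⟨k, by linarith, fun y hy z hz => ?_⟩
  have h1 := hk₀ k (le_max_left _ _) y hy
  have h2 := hk₀ k (le_max_left _ _) z hz
  have h3 := hc.lipschitz_of_le hk1 (fun y _ => cutFilling_le y) hy hz
  rw [abs_le] at *
  constructor <;> linarith [h1.1, h1.2, h2.1, h2.2, h3.1, h3.2]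

/-- For densities at most half of the maximal one, the filling function is at least `1/2`. -/
theorem FillingFunction.half_le {α M : ℝ} (hM : 1 ≤ M) {Φ : ℝ → ℝ} (hΦ : FillingFunction α M Φ)
    {y : ℝ} (hy0 : 0 ≤ y) (hy : y ≤ M / 2) : 1 / 2 ≤ Φ y := by
  have h2 := hΦ.concave.2 (⟨le_rfl, by linarith⟩ : (0 : ℝ) ∈ Icc 0 M)
    (⟨by linarith, le_rfl⟩ : M ∈ Icc 0 M)
    (show 0 ≤ (M - y) / M from div_nonneg (by linarith) (by linarith))
    (show 0 ≤ y / M from div_nonneg hy0 (by linarith)) (by field_simp; ring)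
  have e : ((M - y) / M) • (0 : ℝ) + (y / M) • M = y := by
    simp only [smul_eq_mul]; field_simp; ring
  rw [e, hΦ.zero, hΦ.full] at h2
  simp only [smul_eq_mul, mul_one, mul_zero, add_zero] at h2
  refine le_trans ?_ h2
  rw [le_div_iff₀ (by linarith)]
  linarith

section

/-! ### Gain, loss and collision operator for general kernels -/

/-- Measurable occupation densities with values in `[0, M]`. -/
structure Occupation (M : ℝ) (u : Phase → ℝ) : Prop where
  measurable : Measurable u
  mem : ∀ p, u p ∈ Icc 0 M

/-- The spatial density `∫ u(x, v) dv` is at most `N` for almost every `x`. -/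
def DensityLE (u : Phase → ℝ) (N : ℝ) : Prop :=
  ∀ᵐ x : UnitAddCircle, ∫⁻ v : Velocity, ENNReal.ofReal (u (x, v)) ≤ ENNReal.ofReal N

/-- The weight `1 + |v|²`. -/
noncomputable def energyWeight (p : Phase) : ℝ := 1 + ‖p.2‖ ^ 2

theorem measurable_energyWeight : Measurable energyWeight := by unfold energyWeight; fun_prop
theorem one_le_energyWeight (p : Phase) : 1 ≤ energyWeight p := by
  unfold energyWeight; nlinarith [sq_nonneg ‖p.2‖]
theorem energyWeight_nonneg (p : Phase) : 0 ≤ energyWeight p :=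
  zero_le_one.trans (one_le_energyWeight p)

theorem energyWeight_post (z : CollSpace) :
    energyWeight (ptPost z) + energyWeight (ptPostStar z) =
      energyWeight z.1 + energyWeight (ptStar z) := by
  have := post_energy z.1.2 z.2.1 z.2.2
  simp only [energyWeight, ptPost, ptPostStar, ptStar]
  linarith

/-- `K` on collision space. -/
def kernelOn (K : Velocity → Velocity → ℝ → ℝ) (z : CollSpace) : ℝ := K z.1.2 z.2.1 z.2.2

/-- The gain integrand for the kernel `K` and the filling function `Φ`. -/
noncomputable def gainFn (K : Velocity → Velocity → ℝ → ℝ) (Φ : ℝ → ℝ) (u : Phase → ℝ)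
    (z : CollSpace) : ℝ :=
  kernelOn K z * (u (ptPost z) * u (ptPostStar z) * Φ (u z.1) * Φ (u (ptStar z)))

/-- The loss integrand for the kernel `K` and the filling function `Φ`. -/
noncomputable def lossFn (K : Velocity → Velocity → ℝ → ℝ) (Φ : ℝ → ℝ) (u : Phase → ℝ)
    (z : CollSpace) : ℝ :=
  kernelOn K z * (u z.1 * u (ptStar z) * Φ (u (ptPost z)) * Φ (u (ptPostStar z)))

/-- The collision operator for the kernel `K` and the filling function `Φ`. -/
noncomputable def collQ (K : Velocity → Velocity → ℝ → ℝ) (Φ : ℝ → ℝ) (u : Phase → ℝ)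
    (p : Phase) : ℝ :=
  ∫ q : Velocity × ℝ, (gainFn K Φ u (p, q) - lossFn K Φ u (p, q))
    ∂((volume : Measure Velocity).prod angleMeasure)

/-- Integrability of gain and loss. -/
def CollInt (K : Velocity → Velocity → ℝ → ℝ) (Φ : ℝ → ℝ) (u : Phase → ℝ) : Prop :=
  Integrable (gainFn K Φ u) collMeasure ∧ Integrable (lossFn K Φ u) collMeasure

variable {K : Velocity → Velocity → ℝ → ℝ} {b c α M : ℝ} {Φ : ℝ → ℝ}

theorem CollisionKernel.measurable_kernelOn (hK : CollisionKernel K b c) :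
    Measurable (kernelOn K) := hK.measurable.comp measurable_velTriple

theorem CollisionKernel.kernelOn_collideMap (hK : CollisionKernel K b c) (z : CollSpace) :
    kernelOn K (collideMap z) = kernelOn K z := hK.coll _ _ _

theorem CollisionKernel.kernelOn_swapMap (hK : CollisionKernel K b c) (z : CollSpace) :
    kernelOn K (swapMap z) = kernelOn K z := hK.swap _ _ _

theorem CollisionKernel.kernelOn_nonneg (hK : CollisionKernel K b c) (z : CollSpace) :
    0 ≤ kernelOn K z := hK.nonneg _ _ _

theorem CollisionKernel.kernelOn_le (hK : CollisionKernel K b c) (z : CollSpace) :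
    kernelOn K z ≤ b := hK.le _ _ _

/-- Microreversibility: the gain is the loss read backwards through the collision. -/
theorem lossFn_collideMap (hK : CollisionKernel K b c) (u : Phase → ℝ) (z : CollSpace) :
    lossFn K Φ u (collideMap z) = gainFn K Φ u z := by
  simp only [lossFn, gainFn, hK.kernelOn_collideMap, fst_collideMap, ptStar_collideMap,
    ptPost_collideMap, ptPostStar_collideMap]

theorem lossFn_swapMap (hK : CollisionKernel K b c) (u : Phase → ℝ) (z : CollSpace) :
    lossFn K Φ u (swapMap z) = lossFn K Φ u z := by
  simp only [lossFn, hK.kernelOn_swapMap, fst_swapMap, ptStar_swapMap,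
    ptPost_swapMap, ptPostStar_swapMap]
  ring

theorem measurable_gainFn (hK : CollisionKernel K b c) (hΦ : Measurable Φ) {u : Phase → ℝ}
    (hu : Measurable u) : Measurable (gainFn K Φ u) :=
  hK.measurable_kernelOn.mul ((((hu.comp measurable_ptPost).mul (hu.comp measurable_ptPostStar)).mul
    (hΦ.comp (hu.comp measurable_fst))).mul (hΦ.comp (hu.comp measurable_ptStar)))

theorem measurable_lossFn (hK : CollisionKernel K b c) (hΦ : Measurable Φ) {u : Phase → ℝ}
    (hu : Measurable u) : Measurable (lossFn K Φ u) :=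
  hK.measurable_kernelOn.mul ((((hu.comp measurable_fst).mul (hu.comp measurable_ptStar)).mul
    (hΦ.comp (hu.comp measurable_ptPost))).mul (hΦ.comp (hu.comp measurable_ptPostStar)))

theorem gainFn_nonneg (hK : CollisionKernel K b c) (hΦ : FillingFunction α M Φ) {u : Phase → ℝ}
    (hu : Occupation M u) (z : CollSpace) : 0 ≤ gainFn K Φ u z :=
  mul_nonneg (hK.kernelOn_nonneg z) (mul_nonneg (mul_nonneg (mul_nonneg (hu.mem _).1 (hu.mem _).1)
    (hΦ.nonneg _ (hu.mem _))) (hΦ.nonneg _ (hu.mem _)))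

theorem lossFn_nonneg (hK : CollisionKernel K b c) (hΦ : FillingFunction α M Φ) {u : Phase → ℝ}
    (hu : Occupation M u) (z : CollSpace) : 0 ≤ lossFn K Φ u z :=
  mul_nonneg (hK.kernelOn_nonneg z) (mul_nonneg (mul_nonneg (mul_nonneg (hu.mem _).1 (hu.mem _).1)
    (hΦ.nonneg _ (hu.mem _))) (hΦ.nonneg _ (hu.mem _)))

theorem CollInt.sub (h : CollInt K Φ u) :
    Integrable (fun z => gainFn K Φ u z - lossFn K Φ u z) collMeasure := Integrable.sub h.1 h.2

theorem CollInt.integrable_collQ {u : Phase → ℝ} (h : CollInt K Φ u) :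
    Integrable (collQ K Φ u) (volume : Measure Phase) :=
  Integrable.integral_prod_left (f := fun z => gainFn K Φ u z - lossFn K Φ u z) h.sub

/-! ### Integral bounds on collision space -/

/-- `F` is integrable with integral at most `r`. -/
def IntLE (F : CollSpace → ℝ) (r : ℝ) : Prop :=
  Integrable F collMeasure ∧ ∫ z, F z ∂collMeasure ≤ r

theorem IntLE.of_lintegral {F : CollSpace → ℝ} {r : ℝ} (hm : Measurable F) (h0 : ∀ z, 0 ≤ F z)
    (hr : 0 ≤ r) (h : ∫⁻ z, ENNReal.ofReal (F z) ∂collMeasure ≤ ENNReal.ofReal r) : IntLE F r := by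
  have hi : Integrable F collMeasure :=
    (lintegral_ofReal_ne_top_iff_integrable hm.aestronglyMeasurable
      (Eventually.of_forall h0)).1 (h.trans_lt ENNReal.ofReal_lt_top).ne
  refine ⟨hi, ?_⟩
  rw [← ofReal_integral_eq_lintegral_ofReal hi (Eventually.of_forall h0)] at h
  exact (ENNReal.ofReal_le_ofReal_iff hr).1 h

theorem IntLE.add {F G : CollSpace → ℝ} {r s : ℝ} (hF : IntLE F r) (hG : IntLE G s) :
    IntLE (fun z => F z + G z) (r + s) :=
  ⟨hF.1.add hG.1, by rw [integral_add hF.1 hG.1]; exact add_le_add hF.2 hG.2⟩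

theorem IntLE.const_mul {F : CollSpace → ℝ} {r : ℝ} (hF : IntLE F r) {a : ℝ} (ha : 0 ≤ a) :
    IntLE (fun z => a * F z) (a * r) :=
  ⟨hF.1.const_mul a, by rw [integral_const_mul]; exact mul_le_mul_of_nonneg_left hF.2 ha⟩

theorem IntLE.comp {F : CollSpace → ℝ} {r : ℝ} (hF : IntLE F r) {T : CollSpace → CollSpace}
    (hT : MeasurePreserving T collMeasure collMeasure) : IntLE (fun z => F (T z)) r := by
  refine ⟨hT.integrable_comp_of_integrable hF.1, ?_⟩
  have h1 := integral_map hT.measurable.aemeasurable (f := F)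
    (by rw [hT.map_eq]; exact hF.1.aestronglyMeasurable)
  rw [hT.map_eq] at h1
  rw [← h1]; exact hF.2

theorem IntLE.mono {F G : CollSpace → ℝ} {r : ℝ} (hG : IntLE G r) (hm : Measurable F)
    (h0 : ∀ z, 0 ≤ F z) (h : ∀ᵐ z ∂collMeasure, F z ≤ G z) : IntLE F r := by
  have hi : Integrable F collMeasure := by
    refine hG.1.mono hm.aestronglyMeasurable ?_
    filter_upwards [h] with z hz
    rw [Real.norm_of_nonneg (h0 z)]
    exact hz.trans (le_abs_self _)
  exact ⟨hi, (integral_mono_ae hi hG.1 h).trans hG.2⟩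

theorem IntLE.mono_right {F : CollSpace → ℝ} {r s : ℝ} (hF : IntLE F r) (h : r ≤ s) : IntLE F s :=
  ⟨hF.1, hF.2.trans h⟩

theorem lintegral_tensor_le {f g : Phase → ℝ≥0∞} (hf : Measurable f) (hg : Measurable g) {N : ℝ≥0∞}
    (hN : ∀ᵐ x : UnitAddCircle, ∫⁻ v : Velocity, g (x, v) ≤ N) :
    ∫⁻ z, f z.1 * g (ptStar z) ∂collMeasure ≤ N * ∫⁻ p, f p := by
  have hm : Measurable fun z : CollSpace => f z.1 * g (ptStar z) :=
    (hf.comp measurable_fst).mul (hg.comp measurable_ptStar)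
  rw [lintegral_prod _ hm.aemeasurable, ← lintegral_const_mul _ hf]
  have hN' : ∀ᵐ p : Phase, ∫⁻ v : Velocity, g (p.1, v) ≤ N :=
    Measure.quasiMeasurePreserving_fst.ae hN
  refine lintegral_mono_ae ?_
  filter_upwards [hN'] with p hp
  have hgp : Measurable fun q : Velocity × ℝ => g (p.1, q.1) := hg.comp (by fun_prop)
  simp only [ptStar]
  rw [lintegral_const_mul _ hgp, mul_comm]
  gcongr
  rw [lintegral_prod _ hgp.aemeasurable]
  simpa using hp

theorem lintegral_kernel_post_le (hK : CollisionKernel K b c) (hb : 0 ≤ b) (hc : 0 ≤ c)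
    {f g : Phase → ℝ≥0∞} (hf : Measurable f) (hg : Measurable g) {N : ℝ≥0∞}
    (hN : ∀ᵐ x : UnitAddCircle, ∫⁻ v : Velocity, g (x, v) ≤ N) :
    ∫⁻ z, ENNReal.ofReal (kernelOn K z) * (f z.1 * g (ptPost z)) ∂collMeasure ≤
      ENNReal.ofReal (2 * c * b) * N * ∫⁻ p, f p := by
  have hm : Measurable fun z : CollSpace => ENNReal.ofReal (kernelOn K z) * (f z.1 * g (ptPost z)) :=
    hK.measurable_kernelOn.ennreal_ofReal.mul
      ((hf.comp measurable_fst).mul (hg.comp measurable_ptPost))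
  rw [lintegral_prod _ hm.aemeasurable, ← lintegral_const_mul _ hf]
  have hN' : ∀ᵐ p : Phase, ∫⁻ v : Velocity, g (p.1, v) ≤ N :=
    Measure.quasiMeasurePreserving_fst.ae hN
  refine lintegral_mono_ae ?_
  filter_upwards [hN'] with p hp
  have hgp : Measurable fun u : Velocity => g (p.1, u) := hg.comp (by fun_prop)
  have h1 := hK.lintegral_post_le hb hc p.2 hgp
  calc ∫⁻ q : Velocity × ℝ, ENNReal.ofReal (kernelOn K (p, q)) * (f p * g (ptPost (p, q)))
        ∂((volume : Measure Velocity).prod angleMeasure)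
      = f p * ∫⁻ q : Velocity × ℝ, ENNReal.ofReal (K p.2 q.1 q.2) * g (p.1, postVel p.2 q.1 q.2)
        ∂((volume : Measure Velocity).prod angleMeasure) := by
        rw [← lintegral_const_mul]
        · refine lintegral_congr fun q => ?_
          simp only [kernelOn, ptPost]; ring
        · exact (hK.measurable_section p.2).ennreal_ofReal.mul
            (hgp.comp (continuous_postVel.measurable.comp measurable_prodMk_left))
    _ ≤ f p * (ENNReal.ofReal (2 * c * b) * N) := by
        gcongr
        exact h1.trans (by gcongr)
    _ = _ := mul_comm _ _

theorem DensityLE.mono {u : Phase → ℝ} {N N' : ℝ} (h : DensityLE u N) (hN : N ≤ N') :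
    DensityLE u N' := by
  filter_upwards [h] with x hx
  exact hx.trans (ENNReal.ofReal_le_ofReal hN)

theorem IntLE.tensor {f g : Phase → ℝ} (hf : Measurable f) (hg : Measurable g) (hf0 : ∀ p, 0 ≤ f p)
    (hg0 : ∀ p, 0 ≤ g p) (hfi : Integrable f volume) {N : ℝ} (hN0 : 0 ≤ N) (hN : DensityLE g N) :
    IntLE (fun z => f z.1 * g (ptStar z)) (N * ∫ p, f p) := by
  refine IntLE.of_lintegral ((hf.comp measurable_fst).mul (hg.comp measurable_ptStar))
    (fun z => mul_nonneg (hf0 _) (hg0 _)) (mul_nonneg hN0 (integral_nonneg hf0)) ?_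
  simp_rw [ENNReal.ofReal_mul (hf0 _)]
  rw [ENNReal.ofReal_mul hN0, ofReal_integral_eq_lintegral_ofReal hfi (Eventually.of_forall hf0)]
  exact lintegral_tensor_le hf.ennreal_ofReal hg.ennreal_ofReal hN

theorem IntLE.kernel_tensor (hK : CollisionKernel K b c) (hb : 0 ≤ b) {f g : Phase → ℝ}
    (hf : Measurable f) (hg : Measurable g) (hf0 : ∀ p, 0 ≤ f p)
    (hg0 : ∀ p, 0 ≤ g p) (hfi : Integrable f volume) {N : ℝ} (hN0 : 0 ≤ N) (hN : DensityLE g N) :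
    IntLE (fun z => kernelOn K z * (f z.1 * g (ptStar z))) (b * (N * ∫ p, f p)) := by
  refine ((IntLE.tensor hf hg hf0 hg0 hfi hN0 hN).const_mul hb).mono
    (hK.measurable_kernelOn.mul ((hf.comp measurable_fst).mul (hg.comp measurable_ptStar)))
    (fun z => mul_nonneg (hK.kernelOn_nonneg z) (mul_nonneg (hf0 _) (hg0 _)))
    (Eventually.of_forall fun z => ?_)
  exact mul_le_mul_of_nonneg_right (hK.kernelOn_le z) (mul_nonneg (hf0 _) (hg0 _))

theorem IntLE.kernel_post (hK : CollisionKernel K b c) (hb : 0 ≤ b) (hc : 0 ≤ c) {f g : Phase → ℝ}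
    (hf : Measurable f) (hg : Measurable g) (hf0 : ∀ p, 0 ≤ f p)
    (hg0 : ∀ p, 0 ≤ g p) (hfi : Integrable f volume) {N : ℝ} (hN0 : 0 ≤ N) (hN : DensityLE g N) :
    IntLE (fun z => kernelOn K z * (f z.1 * g (ptPost z))) (2 * c * b * (N * ∫ p, f p)) := by
  refine IntLE.of_lintegral
    (hK.measurable_kernelOn.mul ((hf.comp measurable_fst).mul (hg.comp measurable_ptPost)))
    (fun z => mul_nonneg (hK.kernelOn_nonneg z) (mul_nonneg (hf0 _) (hg0 _)))
    (mul_nonneg (by positivity) (mul_nonneg hN0 (integral_nonneg hf0))) ?_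
  simp_rw [ENNReal.ofReal_mul (hK.kernelOn_nonneg _), ENNReal.ofReal_mul (hf0 _)]
  rw [ENNReal.ofReal_mul (by positivity), ENNReal.ofReal_mul hN0,
    ofReal_integral_eq_lintegral_ofReal hfi (Eventually.of_forall hf0), ← mul_assoc]
  exact lintegral_kernel_post_le hK hb hc hf.ennreal_ofReal hg.ennreal_ofReal hN

end

section

variable {K : Velocity → Velocity → ℝ → ℝ} {b c α M : ℝ} {Φ : ℝ → ℝ}

/-! ### Quadratic and cubic bounds for densities with bounded spatial density -/

theorem IntLE.congr {F G : CollSpace → ℝ} {r : ℝ} (hF : IntLE F r) (h : ∀ z, G z = F z) :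
    IntLE G r := by rwa [show G = F from funext h]

/-- Occupation densities with finite mass and energy and bounded spatial density. -/
structure BoundedDensity (M N : ℝ) (u : Phase → ℝ) : Prop extends Occupation M u where
  energy : Integrable (fun p => energyWeight p * u p) volume
  nonneg_bound : 0 ≤ N
  density : DensityLE u N

theorem Occupation.integrable {u : Phase → ℝ} (hu : Occupation M u)
    (h : Integrable (fun p => energyWeight p * u p) volume) : Integrable u volume := by
  refine h.mono hu.measurable.aestronglyMeasurable (Eventually.of_forall fun p => ?_)
  rw [Real.norm_of_nonneg (hu.mem p).1,
    Real.norm_of_nonneg (mul_nonneg (energyWeight_nonneg p) (hu.mem p).1)]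
  exact le_mul_of_one_le_left (hu.mem p).1 (one_le_energyWeight p)

theorem BoundedDensity.integrable {N : ℝ} {u : Phase → ℝ} (hu : BoundedDensity M N u) :
    Integrable u volume := hu.toOccupation.integrable hu.energy

section Quadratic

variable {d f : Phase → ℝ} {N : ℝ}

/-- Only the first bound is computed; the others are its images under the exchange of the particles
and under the collision, which preserve both the measure and the kernel. -/
theorem IntLE.quad (hK : CollisionKernel K b c) (hb : 0 ≤ b) (hd : Measurable d)
    (hd0 : ∀ p, 0 ≤ d p) (hdi : Integrable d volume) (hf : Measurable f) (hf0 : ∀ p, 0 ≤ f p)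
    (hN0 : 0 ≤ N) (hN : DensityLE f N) :
    IntLE (fun z => kernelOn K z * (d z.1 * f (ptStar z))) (b * (N * ∫ p, d p)) ∧
    IntLE (fun z => kernelOn K z * (f z.1 * d (ptStar z))) (b * (N * ∫ p, d p)) ∧
    IntLE (fun z => kernelOn K z * (d (ptPost z) * f (ptPostStar z))) (b * (N * ∫ p, d p)) ∧
    IntLE (fun z => kernelOn K z * (f (ptPost z) * d (ptPostStar z))) (b * (N * ∫ p, d p)) := by
  have h1 := IntLE.kernel_tensor hK hb hd hf hd0 hf0 hdi hN0 hN
  have h2 := (h1.comp measurePreserving_swapMap).congr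
    (G := fun z => kernelOn K z * (f z.1 * d (ptStar z))) fun z => by
      rw [hK.kernelOn_swapMap, fst_swapMap, ptStar_swapMap, mul_comm (d _)]
  refine ⟨h1, h2, (h1.comp measurePreserving_collideMap).congr fun z => ?_,
    (h2.comp measurePreserving_collideMap).congr fun z => ?_⟩ <;>
  rw [hK.kernelOn_collideMap, fst_collideMap, ptStar_collideMap]

/-- Differences of filling factors give products such as f' f'_* d, in which d sits at v while the
densities sit at v' and v'_*. One density is bounded by M, the other is integrated in v' for fixed v
by the change of variables. The symmetries yield the remaining positions of d. -/
theorem IntLE.cubic (hK : CollisionKernel K b c) (hb : 0 ≤ b) (hc : 0 ≤ c) (hM : 0 ≤ M)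
    (hd : Measurable d) (hd0 : ∀ p, 0 ≤ d p) (hdi : Integrable d volume)
    (hf : BoundedDensity M N f) {Λ κ : ℝ} (hΛ : 0 ≤ Λ) (hκ : 0 ≤ κ) :
    IntLE (fun z => kernelOn K z *
        (f (ptPost z) * f (ptPostStar z) * (Λ * d z.1 + κ * energyWeight z.1 +
          (Λ * d (ptStar z) + κ * energyWeight (ptStar z))) +
        f z.1 * f (ptStar z) * (Λ * d (ptPost z) + κ * energyWeight (ptPost z) +
          (Λ * d (ptPostStar z) + κ * energyWeight (ptPostStar z)))))
      (Λ * (8 * c * M * b * (N * ∫ p, d p)) + κ * (4 * b * (N * ∫ p, energyWeight p * f p))) := by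
  have hf0 : ∀ p, 0 ≤ f p := fun p => (hf.mem p).1
  have hfm := hf.measurable
  have h1 := IntLE.kernel_post hK hb hc hd hfm hd0 hf0 hdi hf.nonneg_bound hf.density
  have h2 : IntLE (fun z => kernelOn K z * (f (ptPost z) * f (ptPostStar z) * d z.1))
      (M * (2 * c * b * (N * ∫ p, d p))) := by
    refine (h1.const_mul hM).mono (hK.measurable_kernelOn.mul
      (((hfm.comp measurable_ptPost).mul (hfm.comp measurable_ptPostStar)).mul
        (hd.comp measurable_fst)))
      (fun z => mul_nonneg (hK.kernelOn_nonneg z) (mul_nonneg (mul_nonneg (hf0 _) (hf0 _)) (hd0 _)))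
      (Eventually.of_forall fun z => ?_)
    have e1 : kernelOn K z * (f (ptPost z) * f (ptPostStar z) * d z.1) =
      f (ptPostStar z) * (kernelOn K z * (d z.1 * f (ptPost z))) := by ring
    rw [e1]
    exact mul_le_mul_of_nonneg_right (hf.mem _).2
      (mul_nonneg (hK.kernelOn_nonneg z) (mul_nonneg (hd0 _) (hf0 _)))
  have h3 := (h2.comp measurePreserving_swapMap).congr
    (G := fun z => kernelOn K z * (f (ptPost z) * f (ptPostStar z) * d (ptStar z))) fun z => by
      rw [hK.kernelOn_swapMap, fst_swapMap, ptPost_swapMap, ptPostStar_swapMap]; ring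
  have h4 := (h2.comp measurePreserving_collideMap).congr
    (G := fun z => kernelOn K z * (f z.1 * f (ptStar z) * d (ptPost z))) fun z => by
      rw [hK.kernelOn_collideMap, fst_collideMap, ptPost_collideMap, ptPostStar_collideMap]
  have h5 := (h3.comp measurePreserving_collideMap).congr
    (G := fun z => kernelOn K z * (f z.1 * f (ptStar z) * d (ptPostStar z))) fun z => by
      rw [hK.kernelOn_collideMap, ptStar_collideMap, ptPost_collideMap, ptPostStar_collideMap]
  obtain ⟨q1, q2, q3, q4⟩ := IntLE.quad hK hb
    (measurable_energyWeight.mul hfm) (fun p => mul_nonneg (energyWeight_nonneg p) (hf0 p))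
    hf.energy hfm hf0 hf.nonneg_bound hf.density
  refine ((((((h2.add h3).add (h4.add h5))).const_mul hΛ).add
    (((q1.add q2).add (q3.add q4)).const_mul hκ)).congr fun z => ?_).mono_right (le_of_eq (by simp only [Pi.mul_apply]; ring))
  have he := energyWeight_post z
  simp only [Pi.mul_apply]
  -- Conservation of energy moves the weights from one pair of velocities to the other, where they
  -- sit on the same particles as the densities and the quadratic bounds apply.
  linear_combination kernelOn K z * κ *
    (f z.1 * f (ptStar z) - f (ptPost z) * f (ptPostStar z)) * he

end Quadratic

/-! ### Continuity estimates for the collision operator -/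

/-- Inserting min(f₂, g₂) min(f₃, g₃) between the two products makes every error term carry factors
of f or |f - g| only. No density bound for g is then needed, at the price of a one-sided estimate.
-/
theorem gain_sub_le {f₂ f₃ g₂ g₃ F F₁ G G₁ : ℝ} (hM : 0 ≤ M)
    (hf₂ : 0 ≤ f₂) (hf₃ : 0 ≤ f₃) (hg₂ : 0 ≤ g₂) (hg₃ : 0 ≤ g₃)
    (hF : F ∈ Icc 0 M) (hF₁ : F₁ ∈ Icc 0 M) (hG : G ∈ Icc 0 M) (hG₁ : G₁ ∈ Icc 0 M) :
    f₂ * f₃ * F * F₁ - g₂ * g₃ * G * G₁ ≤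
      M ^ 2 * (|f₂ - g₂| * f₃ + f₂ * |f₃ - g₃|) + M * (f₂ * f₃ * (|F - G| + |F₁ - G₁|)) := by
  have hm : f₂ * f₃ - min f₂ g₂ * min f₃ g₃ ≤ |f₂ - g₂| * f₃ + f₂ * |f₃ - g₃| := by
    have h1 : f₂ - min f₂ g₂ ≤ |f₂ - g₂| := by
      rcases le_total f₂ g₂ with h | h
      · rw [min_eq_left h]; simp
      · rw [min_eq_right h]; exact le_abs_self _
    have h2 : f₃ - min f₃ g₃ ≤ |f₃ - g₃| := by
      rcases le_total f₃ g₃ with h | h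
      · rw [min_eq_left h]; simp
      · rw [min_eq_right h]; exact le_abs_self _
    have h3 : min f₂ g₂ ≤ f₂ := min_le_left _ _
    calc f₂ * f₃ - min f₂ g₂ * min f₃ g₃ =
        (f₂ - min f₂ g₂) * f₃ + min f₂ g₂ * (f₃ - min f₃ g₃) := by ring
      _ ≤ |f₂ - g₂| * f₃ + f₂ * |f₃ - g₃| := by
        refine add_le_add (mul_le_mul_of_nonneg_right h1 hf₃) (mul_le_mul h3 h2 ?_ hf₂)
        linarith [min_le_left f₃ g₃]
  have hm0 : 0 ≤ min f₂ g₂ * min f₃ g₃ := mul_nonneg (le_min hf₂ hg₂) (le_min hf₃ hg₃)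
  have hmf : min f₂ g₂ * min f₃ g₃ ≤ f₂ * f₃ :=
    mul_le_mul (min_le_left _ _) (min_le_left _ _) (le_min hf₃ hg₃) hf₂
  have hmg : min f₂ g₂ * min f₃ g₃ ≤ g₂ * g₃ :=
    mul_le_mul (min_le_right _ _) (min_le_right _ _) (le_min hf₃ hg₃) hg₂
  have hFF : F * F₁ ≤ M ^ 2 := by
    rw [sq]; exact mul_le_mul hF.2 hF₁.2 hF₁.1 hM
  have hdiff : F * F₁ - G * G₁ ≤ M * (|F - G| + |F₁ - G₁|) := by
    calc F * F₁ - G * G₁ = (F - G) * F₁ + G * (F₁ - G₁) := by ring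
      _ ≤ |F - G| * M + M * |F₁ - G₁| := by
        refine add_le_add (mul_le_mul (le_abs_self _) hF₁.2 hF₁.1 (abs_nonneg _)) ?_
        calc G * (F₁ - G₁) ≤ G * |F₁ - G₁| := mul_le_mul_of_nonneg_left (le_abs_self _) hG.1
          _ ≤ _ := mul_le_mul_of_nonneg_right hG.2 (abs_nonneg _)
      _ = _ := by ring
  have hd0 : 0 ≤ M * (|F - G| + |F₁ - G₁|) := by positivity
  calc f₂ * f₃ * F * F₁ - g₂ * g₃ * G * G₁
      ≤ f₂ * f₃ * F * F₁ - min f₂ g₂ * min f₃ g₃ * (G * G₁) := by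
        have := mul_le_mul_of_nonneg_right hmg (mul_nonneg hG.1 hG₁.1)
        nlinarith
    _ = (f₂ * f₃ - min f₂ g₂ * min f₃ g₃) * (F * F₁) +
        min f₂ g₂ * min f₃ g₃ * (F * F₁ - G * G₁) := by ring
    _ ≤ (|f₂ - g₂| * f₃ + f₂ * |f₃ - g₃|) * M ^ 2 +
        f₂ * f₃ * (M * (|F - G| + |F₁ - G₁|)) := by
        refine add_le_add (mul_le_mul hm hFF (mul_nonneg hF.1 hF₁.1) (by positivity)) ?_
        exact (mul_le_mul_of_nonneg_left hdiff hm0).trans (mul_le_mul_of_nonneg_right hmf hd0)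
    _ = _ := by ring

/-- The hypothesis g ≤ f allows the factor g to be replaced by f in the loss of g, so again only f
appears as a coefficient. This is why the comparison works with the positive part of f - g. -/
theorem loss_sub_le {f f₁ g g₁ F₂ F₃ G₂ G₃ : ℝ} (hM : 0 ≤ M)
    (hf₁ : 0 ≤ f₁) (hg : 0 ≤ g) (hg₁ : 0 ≤ g₁) (hgf : g ≤ f)
    (hF₂ : F₂ ∈ Icc 0 M) (hG₂ : G₂ ∈ Icc 0 M) (hG₃ : G₃ ∈ Icc 0 M) :
    g * g₁ * G₂ * G₃ - f * f₁ * F₂ * F₃ ≤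
      M ^ 2 * (f * |f₁ - g₁|) + M * (f * f₁ * (|F₂ - G₂| + |F₃ - G₃|)) := by
  have hf : 0 ≤ f := hg.trans hgf
  have hGG : G₂ * G₃ ≤ M ^ 2 := by
    rw [sq]; exact mul_le_mul hG₂.2 hG₃.2 hG₃.1 hM
  have hGG0 : 0 ≤ G₂ * G₃ := mul_nonneg hG₂.1 hG₃.1
  have hgg : g * g₁ ≤ f * f₁ + f * |f₁ - g₁| := by
    have h1 : g₁ ≤ f₁ + |f₁ - g₁| := by linarith [neg_abs_le (f₁ - g₁)]
    calc g * g₁ ≤ f * (f₁ + |f₁ - g₁|) := mul_le_mul hgf h1 hg₁ hf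
      _ = _ := by ring
  have hdiff : G₂ * G₃ - F₂ * F₃ ≤ M * (|F₂ - G₂| + |F₃ - G₃|) := by
    calc G₂ * G₃ - F₂ * F₃ = (G₂ - F₂) * G₃ + F₂ * (G₃ - F₃) := by ring
      _ ≤ |F₂ - G₂| * M + M * |F₃ - G₃| := by
        refine add_le_add (mul_le_mul ?_ hG₃.2 hG₃.1 (abs_nonneg _)) ?_
        · rw [abs_sub_comm]; exact le_abs_self _
        · calc F₂ * (G₃ - F₃) ≤ F₂ * |F₃ - G₃| :=
              mul_le_mul_of_nonneg_left (by rw [abs_sub_comm]; exact le_abs_self _) hF₂.1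
            _ ≤ _ := mul_le_mul_of_nonneg_right hF₂.2 (abs_nonneg _)
      _ = _ := by ring
  calc g * g₁ * G₂ * G₃ - f * f₁ * F₂ * F₃ = g * g₁ * (G₂ * G₃) - f * f₁ * (F₂ * F₃) := by ring
    _ ≤ (f * f₁ + f * |f₁ - g₁|) * (G₂ * G₃) - f * f₁ * (F₂ * F₃) := by
        linarith [mul_le_mul_of_nonneg_right hgg hGG0]
    _ = f * |f₁ - g₁| * (G₂ * G₃) + f * f₁ * (G₂ * G₃ - F₂ * F₃) := by ring
    _ ≤ f * |f₁ - g₁| * M ^ 2 + f * f₁ * (M * (|F₂ - G₂| + |F₃ - G₃|)) :=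
        add_le_add (mul_le_mul_of_nonneg_left hGG (mul_nonneg hf (abs_nonneg _)))
          (mul_le_mul_of_nonneg_left hdiff (mul_nonneg hf hf₁))
    _ = _ := by ring

/-- The two-sided version of `gain_sub_le`. -/
theorem abs_gain_sub_le {f₂ f₃ g₂ g₃ F F₁ G G₁ : ℝ} (hM : 0 ≤ M)
    (hf₃ : 0 ≤ f₃) (hg₂ : 0 ≤ g₂) (hg₃ : 0 ≤ g₃)
    (hF : F ∈ Icc 0 M) (hF₁ : F₁ ∈ Icc 0 M) (hG : G ∈ Icc 0 M) :
    |f₂ * f₃ * F * F₁ - g₂ * g₃ * G * G₁| ≤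
      M ^ 2 * (|f₂ - g₂| * f₃ + g₂ * |f₃ - g₃|) + M * (g₂ * g₃ * (|F - G| + |F₁ - G₁|)) := by
  have hFF : F * F₁ ≤ M ^ 2 := by
    rw [sq]; exact mul_le_mul hF.2 hF₁.2 hF₁.1 hM
  have hFF0 : 0 ≤ F * F₁ := mul_nonneg hF.1 hF₁.1
  have e : f₂ * f₃ * F * F₁ - g₂ * g₃ * G * G₁ =
      (f₂ - g₂) * f₃ * (F * F₁) + g₂ * (f₃ - g₃) * (F * F₁) +
        (g₂ * g₃ * ((F - G) * F₁) + g₂ * g₃ * (G * (F₁ - G₁))) := by ring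
  have h1 : |(f₂ - g₂) * f₃ * (F * F₁)| ≤ |f₂ - g₂| * f₃ * M ^ 2 := by
    rw [abs_mul, abs_mul, abs_of_nonneg hf₃, abs_of_nonneg hFF0]
    gcongr
  have h2 : |g₂ * (f₃ - g₃) * (F * F₁)| ≤ g₂ * |f₃ - g₃| * M ^ 2 := by
    rw [abs_mul, abs_mul, abs_of_nonneg hg₂, abs_of_nonneg hFF0]
    gcongr
  have h3 : |g₂ * g₃ * ((F - G) * F₁)| ≤ g₂ * g₃ * (|F - G| * M) := by
    rw [abs_mul, abs_mul (F - G), abs_of_nonneg (mul_nonneg hg₂ hg₃), abs_of_nonneg hF₁.1]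
    gcongr; exact hF₁.2
  have h4 : |g₂ * g₃ * (G * (F₁ - G₁))| ≤ g₂ * g₃ * (M * |F₁ - G₁|) := by
    rw [abs_mul, abs_mul G, abs_of_nonneg (mul_nonneg hg₂ hg₃), abs_of_nonneg hG.1]
    gcongr; exact hG.2
  rw [e]
  refine (abs_add_le _ _).trans ((add_le_add (abs_add_le _ _) (abs_add_le _ _)).trans ?_)
  linarith

/-- The constant in the continuity estimates. -/
noncomputable def collConst (M b c : ℝ) : ℝ := 4 * M ^ 2 * b * (1 + 2 * c)

theorem FillingFunction.mem_Icc (hΦ : FillingFunction α M Φ) {y : ℝ} (hy : y ∈ Icc 0 M) :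
    Φ y ∈ Icc 0 M := ⟨hΦ.nonneg y hy, hΦ.le_bound y hy⟩

theorem collConst_bound {Λ κ N D E : ℝ} (hM : 1 ≤ M) (hb : 0 ≤ b) (hc : 0 ≤ c) (hN : 0 ≤ N)
    (hD : 0 ≤ D) (hE : 0 ≤ E) (hΛ : 0 ≤ Λ) (hκ : 0 ≤ κ) :
    M ^ 2 * (4 * (b * (N * D))) + M * (Λ * (8 * c * M * b * (N * D)) + κ * (4 * b * (N * E))) ≤
      collConst M b c * N * ((1 + Λ) * D + κ * E) := by
  have hMM : M ≤ M ^ 2 := by nlinarith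
  have hM0 : 0 ≤ M := by linarith
  have h1 : 0 ≤ M ^ 2 * b * c * (N * D) := by positivity
  have h2 : 0 ≤ Λ * (M ^ 2 * b * (N * D)) := by positivity
  have h3 : 0 ≤ (M ^ 2 - M) * (κ * b * (N * E)) := mul_nonneg (by linarith) (by positivity)
  have h4 : 0 ≤ M ^ 2 * c * (κ * b * (N * E)) := by positivity
  unfold collConst
  nlinarith

theorem Occupation.abs_sub {f g : Phase → ℝ} (hf : Occupation M f) (hg : Occupation M g) :
    Measurable fun p => |f p - g p| := (hf.measurable.sub hg.measurable).abs

/-- One-sided estimate: on `{g ≤ f}` the difference of the collision terms is controlled by the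
bounds of `f` alone. -/
theorem exists_collQ_sub_le (hK : CollisionKernel K b c) (hb : 0 ≤ b) (hc : 0 ≤ c) (hM : 1 ≤ M)
    (hΦ : FillingFunction α M Φ) {f g : Phase → ℝ} {N : ℝ} (hf : BoundedDensity M N f)
    (hg : Occupation M g) (hgi : Integrable g volume) (hfc : CollInt K Φ f) (hgc : CollInt K Φ g)
    {Λ κ : ℝ} (hΛ : 0 ≤ Λ) (hκ : 0 ≤ κ)
    (hφ : ∀ᵐ p : Phase, |Φ (f p) - Φ (g p)| ≤ Λ * |f p - g p| + κ * energyWeight p) :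
    ∃ β : Phase → ℝ, Integrable β volume ∧ (∀ p, 0 ≤ β p) ∧
      (∀ᵐ p : Phase, g p ≤ f p → collQ K Φ f p - collQ K Φ g p ≤ β p) ∧
      ∫ p, β p ≤ collConst M b c * N *
        ((1 + Λ) * (∫ p, |f p - g p|) + κ * ∫ p, energyWeight p * f p) := by
  have hM0 : 0 ≤ M := by linarith
  have hf0 : ∀ p, 0 ≤ f p := fun p => (hf.mem p).1
  have hdm := hf.toOccupation.abs_sub hg
  have hd0 : ∀ p, 0 ≤ |f p - g p| := fun p => abs_nonneg _
  have hdi : Integrable (fun p => |f p - g p|) volume := (hf.integrable.sub hgi).abs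
  obtain ⟨q1, q2, q3, q4⟩ := IntLE.quad hK hb hdm hd0 hdi hf.measurable hf0 hf.nonneg_bound
    hf.density
  have hcub := IntLE.cubic hK hb hc hM0 hdm hd0 hdi hf hΛ hκ
  -- The product of |f - g| at v with f at v_* does not occur: on {g ≤ f} this part of the
  -- difference of the loss terms has a favourable sign.
  have hB := ((((q3.add q4).add q2)).const_mul (sq_nonneg M)).add (hcub.const_mul hM0)
  set Bd : CollSpace → ℝ := _ with hBd
  change IntLE Bd _ at hB
  have hpt : ∀ᵐ z ∂collMeasure, g z.1 ≤ f z.1 →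
      gainFn K Φ f z - lossFn K Φ f z - (gainFn K Φ g z - lossFn K Φ g z) ≤ Bd z := by
    filter_upwards [quasiMeasurePreserving_fst.ae hφ, quasiMeasurePreserving_ptStar.ae hφ,
      quasiMeasurePreserving_ptPost.ae hφ, quasiMeasurePreserving_ptPostStar.ae hφ]
      with z h0 h1 h2 h3 hgf
    have a1 := gain_sub_le hM0 (hf0 (ptPost z)) (hf0 (ptPostStar z)) (hg.mem (ptPost z)).1
      (hg.mem (ptPostStar z)).1 (hΦ.mem_Icc (hf.mem z.1)) (hΦ.mem_Icc (hf.mem (ptStar z)))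
      (hΦ.mem_Icc (hg.mem z.1)) (hΦ.mem_Icc (hg.mem (ptStar z)))
    have a2 := loss_sub_le (F₃ := Φ (f (ptPostStar z))) hM0 (hf0 (ptStar z)) (hg.mem z.1).1
      (hg.mem (ptStar z)).1 hgf (hΦ.mem_Icc (hf.mem (ptPost z))) (hΦ.mem_Icc (hg.mem (ptPost z)))
      (hΦ.mem_Icc (hg.mem (ptPostStar z)))
    have a3 : M * (f (ptPost z) * f (ptPostStar z) *
        (|Φ (f z.1) - Φ (g z.1)| + |Φ (f (ptStar z)) - Φ (g (ptStar z))|)) ≤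
        M * (f (ptPost z) * f (ptPostStar z) * (Λ * |f z.1 - g z.1| + κ * energyWeight z.1 +
          (Λ * |f (ptStar z) - g (ptStar z)| + κ * energyWeight (ptStar z)))) := by
      gcongr
      exact mul_nonneg (hf0 _) (hf0 _)
    have a4 : M * (f z.1 * f (ptStar z) *
        (|Φ (f (ptPost z)) - Φ (g (ptPost z))| + |Φ (f (ptPostStar z)) - Φ (g (ptPostStar z))|)) ≤
        M * (f z.1 * f (ptStar z) * (Λ * |f (ptPost z) - g (ptPost z)| +
          κ * energyWeight (ptPost z) + (Λ * |f (ptPostStar z) - g (ptPostStar z)| +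
          κ * energyWeight (ptPostStar z)))) := by
      gcongr
      exact mul_nonneg (hf0 _) (hf0 _)
    have hk := hK.kernelOn_nonneg z
    have a5 := mul_le_mul_of_nonneg_left
      (add_le_add (a1.trans (add_le_add_right a3 _)) (a2.trans (add_le_add_right a4 _))) hk
    simp only [hBd, gainFn, lossFn]
    refine le_trans (le_of_eq ?_) (a5.trans (le_of_eq ?_)) <;> ring
  have hBd0 : ∀ z, 0 ≤ Bd z := by
    intro z
    have hk := hK.kernelOn_nonneg z
    have := hf0 (ptPost z); have := hf0 (ptPostStar z); have := hf0 (ptStar z); have := hf0 z.1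
    have := energyWeight_nonneg z.1; have := energyWeight_nonneg (ptStar z)
    have := energyWeight_nonneg (ptPost z); have := energyWeight_nonneg (ptPostStar z)
    simp only [hBd]
    positivity
  refine ⟨fun p => ∫ q, Bd (p, q) ∂((volume : Measure Velocity).prod angleMeasure),
    hB.1.integral_prod_left, fun p => integral_nonneg fun q => hBd0 _, ?_, ?_⟩
  · filter_upwards [Measure.ae_ae_of_ae_prod hpt, hB.1.prod_right_ae, hfc.sub.prod_right_ae,
      hgc.sub.prod_right_ae] with p hp h1 h2 h3 hgf
    rw [collQ, collQ, ← integral_sub h2 h3]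
    refine integral_mono_ae (h2.sub h3) h1 ?_
    filter_upwards [hp] with q hq
    exact hq hgf
  · rw [← integral_prod _ hB.1]
    refine hB.2.trans ?_
    have h0 : 0 ≤ b * (N * ∫ p, |f p - g p|) :=
      mul_nonneg hb (mul_nonneg hf.nonneg_bound (integral_nonneg hd0))
    have h1 := collConst_bound (Λ := Λ) (κ := κ) hM hb hc hf.nonneg_bound
      (integral_nonneg (μ := (volume : Measure Phase)) hd0)
      (integral_nonneg (μ := (volume : Measure Phase)) fun p => mul_nonneg (energyWeight_nonneg p) (hf0 p)) hΛ hκ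
    refine le_trans ?_ h1
    nlinarith [mul_nonneg (sq_nonneg M) h0]

theorem CollInt.of_bounded (hK : CollisionKernel K b c) (hb : 0 ≤ b) (hM : 0 ≤ M)
    (hΦ : FillingFunction α M Φ) {f : Phase → ℝ} (hf : Occupation M f) (hfi : Integrable f volume)
    {N : ℝ} (hN0 : 0 ≤ N) (hN : DensityLE f N) : CollInt K Φ f := by
  have hf0 : ∀ p, 0 ≤ f p := fun p => (hf.mem p).1
  obtain ⟨q1, q2, q3, q4⟩ := IntLE.quad hK hb hf.measurable hf0 hfi hf.measurable hf0 hN0 hN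
  have key : ∀ z x p q : ℝ, 0 ≤ x → p ∈ Icc 0 M → q ∈ Icc 0 M → 0 ≤ z →
      z * (x * p * q) ≤ M ^ 2 * (z * x) := by
    intro z x p q hx hp hq hz
    have : p * q ≤ M ^ 2 := by rw [sq]; exact mul_le_mul hp.2 hq.2 hq.1 hM
    calc z * (x * p * q) = z * x * (p * q) := by ring
      _ ≤ z * x * M ^ 2 := by gcongr
      _ = _ := by ring
  constructor
  · refine ((q3.const_mul (sq_nonneg M)).mono (measurable_gainFn hK hΦ.measurable hf.measurable)
      (gainFn_nonneg hK hΦ hf) (Eventually.of_forall fun z => ?_)).1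
    exact key _ _ _ _ (mul_nonneg (hf0 _) (hf0 _)) (hΦ.mem_Icc (hf.mem _)) (hΦ.mem_Icc (hf.mem _))
      (hK.kernelOn_nonneg z)
  · refine ((q1.const_mul (sq_nonneg M)).mono (measurable_lossFn hK hΦ.measurable hf.measurable)
      (lossFn_nonneg hK hΦ hf) (Eventually.of_forall fun z => ?_)).1
    exact key _ _ _ _ (mul_nonneg (hf0 _) (hf0 _)) (hΦ.mem_Icc (hf.mem _)) (hΦ.mem_Icc (hf.mem _))
      (hK.kernelOn_nonneg z)

theorem BoundedDensity.collInt (hK : CollisionKernel K b c) (hb : 0 ≤ b) (hM : 0 ≤ M)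
    (hΦ : FillingFunction α M Φ) {f : Phase → ℝ} {N : ℝ} (hf : BoundedDensity M N f) :
    CollInt K Φ f :=
  CollInt.of_bounded hK hb hM hΦ hf.toOccupation hf.integrable hf.nonneg_bound hf.density

end

section

variable {K K' : Velocity → Velocity → ℝ → ℝ} {b c α M : ℝ} {Φ Φ' : ℝ → ℝ}

/-- An integral bound for the difference of collision terms from one on collision space. -/
theorem integral_abs_collQ_sub_le {f g : Phase → ℝ} (hfc : CollInt K Φ f) (hgc : CollInt K' Φ' g)
    {Bd : CollSpace → ℝ} {r : ℝ} (hB : IntLE Bd r)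
    (h : ∀ᵐ z ∂collMeasure,
      |gainFn K Φ f z - gainFn K' Φ' g z| + |lossFn K Φ f z - lossFn K' Φ' g z| ≤ Bd z) :
    ∫ p, |collQ K Φ f p - collQ K' Φ' g p| ≤ r := by
  refine le_trans ?_ hB.2
  rw [integral_prod _ hB.1]
  refine integral_mono_ae (hfc.integrable_collQ.sub hgc.integrable_collQ).abs
    hB.1.integral_prod_left ?_
  filter_upwards [Measure.ae_ae_of_ae_prod h, hB.1.prod_right_ae, hfc.sub.prod_right_ae,
      hgc.sub.prod_right_ae] with p hp h1 h2 h3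
  rw [collQ, collQ, ← integral_sub h2 h3]
  refine (abs_integral_le_integral_abs).trans (integral_mono_ae (h2.sub h3).abs h1 ?_)
  filter_upwards [hp] with q hq
  refine le_trans ?_ hq
  have e : gainFn K Φ f (p, q) - lossFn K Φ f (p, q) - (gainFn K' Φ' g (p, q) - lossFn K' Φ' g (p, q))
    = (gainFn K Φ f (p, q) - gainFn K' Φ' g (p, q)) -
      (lossFn K Φ f (p, q) - lossFn K' Φ' g (p, q)) := by ring
  rw [e]
  exact abs_sub _ _

/-- Two-sided continuity estimate for the collision operator. -/
theorem integral_abs_collQ_le (hK : CollisionKernel K b c) (hb : 0 ≤ b) (hc : 0 ≤ c) (hM : 1 ≤ M)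
    (hΦ : FillingFunction α M Φ) {f g : Phase → ℝ} {N : ℝ} (hf : Occupation M f)
    (hfi : Integrable f volume) (hfN : DensityLE f N) (hg : BoundedDensity M N g)
    {Λ κ : ℝ} (hΛ : 0 ≤ Λ) (hκ : 0 ≤ κ)
    (hφ : ∀ᵐ p : Phase, |Φ (f p) - Φ (g p)| ≤ Λ * |f p - g p| + κ * energyWeight p) :
    ∫ p, |collQ K Φ f p - collQ K Φ g p| ≤ collConst M b c * N *
        ((1 + Λ) * (∫ p, |f p - g p|) + κ * ∫ p, energyWeight p * g p) := by
  have hM0 : 0 ≤ M := by linarith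
  have hN0 := hg.nonneg_bound
  have hf0 : ∀ p, 0 ≤ f p := fun p => (hf.mem p).1
  have hg0 : ∀ p, 0 ≤ g p := fun p => (hg.mem p).1
  have hdm := hf.abs_sub hg.toOccupation
  have hd0 : ∀ p, 0 ≤ |f p - g p| := fun p => abs_nonneg _
  have hdi : Integrable (fun p => |f p - g p|) volume := (hfi.sub hg.integrable).abs
  -- In the two-sided telescoping of a product one error term has f as its coefficient and the other
  -- has g, so here both densities must be bounded.
  obtain ⟨q1, -, q3, -⟩ := IntLE.quad hK hb hdm hd0 hdi hf.measurable hf0 hN0 hfN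
  obtain ⟨-, q2, -, q4⟩ := IntLE.quad hK hb hdm hd0 hdi hg.measurable hg0 hN0 hg.density
  have hcub := IntLE.cubic hK hb hc hM0 hdm hd0 hdi hg hΛ hκ
  have hB := (((q3.add q4).add (q1.add q2)).const_mul (sq_nonneg M)).add (hcub.const_mul hM0)
  have h1 := collConst_bound (Λ := Λ) (κ := κ) hM hb hc hN0
      (integral_nonneg (μ := (volume : Measure Phase)) hd0)
      (integral_nonneg (μ := (volume : Measure Phase))
        fun p => mul_nonneg (energyWeight_nonneg p) (hg0 p)) hΛ hκ
  refine integral_abs_collQ_sub_le (CollInt.of_bounded hK hb hM0 hΦ hf hfi hN0 hfN)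
    (hg.collInt hK hb hM0 hΦ) (hB.mono_right (le_trans (le_of_eq (by ring)) h1)) ?_
  filter_upwards [quasiMeasurePreserving_fst.ae hφ, quasiMeasurePreserving_ptStar.ae hφ,
      quasiMeasurePreserving_ptPost.ae hφ, quasiMeasurePreserving_ptPostStar.ae hφ]
      with z h0 h1 h2 h3
  have hk := hK.kernelOn_nonneg z
  have a1 := abs_gain_sub_le (f₂ := f (ptPost z)) hM0 (hf0 (ptPostStar z)) (hg0 (ptPost z))
    (hg0 (ptPostStar z)) (hΦ.mem_Icc (hf.mem z.1)) (hΦ.mem_Icc (hf.mem (ptStar z)))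
    (hΦ.mem_Icc (hg.mem z.1)) (G₁ := Φ (g (ptStar z)))
  have a2 := abs_gain_sub_le (f₂ := f z.1) hM0 (hf0 (ptStar z)) (hg0 z.1)
    (hg0 (ptStar z)) (hΦ.mem_Icc (hf.mem (ptPost z))) (hΦ.mem_Icc (hf.mem (ptPostStar z)))
    (hΦ.mem_Icc (hg.mem (ptPost z))) (G₁ := Φ (g (ptPostStar z)))
  have a3 : M * (g (ptPost z) * g (ptPostStar z) *
      (|Φ (f z.1) - Φ (g z.1)| + |Φ (f (ptStar z)) - Φ (g (ptStar z))|)) ≤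
      M * (g (ptPost z) * g (ptPostStar z) * (Λ * |f z.1 - g z.1| + κ * energyWeight z.1 +
        (Λ * |f (ptStar z) - g (ptStar z)| + κ * energyWeight (ptStar z)))) := by
    gcongr
    exact mul_nonneg (hg0 _) (hg0 _)
  have a4 : M * (g z.1 * g (ptStar z) *
      (|Φ (f (ptPost z)) - Φ (g (ptPost z))| + |Φ (f (ptPostStar z)) - Φ (g (ptPostStar z))|)) ≤
      M * (g z.1 * g (ptStar z) * (Λ * |f (ptPost z) - g (ptPost z)| +
        κ * energyWeight (ptPost z) + (Λ * |f (ptPostStar z) - g (ptPostStar z)| +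
        κ * energyWeight (ptPostStar z)))) := by
    gcongr
    exact mul_nonneg (hg0 _) (hg0 _)
  have a5 := mul_le_mul_of_nonneg_left
    (add_le_add (a1.trans (add_le_add_right a3 _)) (a2.trans (add_le_add_right a4 _))) hk
  simp only [gainFn, lossFn]
  rw [← mul_sub, ← mul_sub, abs_mul, abs_mul, abs_of_nonneg hk, ← mul_add]
  refine a5.trans (le_of_eq ?_)
  ring

/-- Dependence of the collision operator on the kernel and on the filling function. -/
theorem integral_abs_collQ_perturb_le (hK : CollisionKernel K b c) (hK' : CollisionKernel K' b c)
    (hb : 0 ≤ b) (hM : 1 ≤ M) (hΦ : FillingFunction α M Φ)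
    (hΦ' : FillingFunction α M Φ') {f : Phase → ℝ} {N : ℝ} (hf : BoundedDensity M N f) {κ : ℝ}
    (hκ : 0 ≤ κ) (hφ : ∀ y ∈ Icc 0 M, |Φ y - Φ' y| ≤ κ)
    (hKK : ∀ v w φ, |K v w φ - K' v w φ| ≤ b * (κ * (‖v‖ ^ 2 + ‖w‖ ^ 2))) :
    ∫ p, |collQ K Φ f p - collQ K' Φ' f p| ≤
      8 * M ^ 2 * b * N * (κ * ∫ p, energyWeight p * f p) := by
  have hM0 : 0 ≤ M := by linarith
  have hf0 : ∀ p, 0 ≤ f p := fun p => (hf.mem p).1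
  have hfm := hf.measurable
  have hef0 : ∀ p, 0 ≤ energyWeight p * f p := fun p => mul_nonneg (energyWeight_nonneg p) (hf0 p)
  have t1 := IntLE.tensor (measurable_energyWeight.mul hfm) hfm hef0 hf0 hf.energy
    hf.nonneg_bound hf.density
  have t2 := (t1.comp measurePreserving_swapMap).congr
    (G := fun z => f z.1 * (energyWeight (ptStar z) * f (ptStar z))) fun z => by
      rw [fst_swapMap, ptStar_swapMap, mul_comm (f _)]; rfl
  have t3 := (t1.add t2).congr (G := fun z => f z.1 * f (ptStar z) * (energyWeight z.1 +
    energyWeight (ptStar z))) fun z => by simp only [Pi.mul_apply]; ring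
  have t4 := (t3.comp measurePreserving_collideMap).congr (G := fun z => f (ptPost z) *
      f (ptPostStar z) * (energyWeight z.1 + energyWeight (ptStar z))) fun z => by
    rw [fst_collideMap, ptStar_collideMap, energyWeight_post]
  -- The change of kernel costs M²bκ(|v|² + |v_*|²) and the two changes of filling factor cost 2Mbκ
  -- per unit of density product. Both fit under the sum of the two weights, which is 2 + |v|² +
  -- |v_*|².
  have hB := ((t3.add t4)).const_mul (by positivity : 0 ≤ 2 * M ^ 2 * b * κ)
  refine integral_abs_collQ_sub_le (hf.collInt hK hb hM0 hΦ) (hf.collInt hK' hb hM0 hΦ')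
    (hB.mono_right (le_of_eq (by simp only [Pi.mul_apply]; ring))) (Eventually.of_forall fun z => ?_)
  have key : ∀ x F F₁ G G₁ : ℝ, 0 ≤ x → F ∈ Icc 0 M → F₁ ∈ Icc 0 M → G ∈ Icc 0 M →
      |F - G| ≤ κ → |F₁ - G₁| ≤ κ →
      |kernelOn K z * (x * F * F₁) - kernelOn K' z * (x * G * G₁)| ≤
        2 * M ^ 2 * b * κ * (x * (energyWeight z.1 + energyWeight (ptStar z))) := by
    intro x F F₁ G G₁ hx hF hF₁ hG h1 h2
    have e : kernelOn K z * (x * F * F₁) - kernelOn K' z * (x * G * G₁) =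
        (kernelOn K z - kernelOn K' z) * (x * (F * F₁)) +
        (kernelOn K' z * x * ((F - G) * F₁) + kernelOn K' z * x * (G * (F₁ - G₁))) := by ring
    have hk' := hK'.kernelOn_nonneg z
    have hFF : F * F₁ ≤ M ^ 2 := by rw [sq]; exact mul_le_mul hF.2 hF₁.2 hF₁.1 hM0
    have hFF0 : 0 ≤ F * F₁ := mul_nonneg hF.1 hF₁.1
    have b1 : |(kernelOn K z - kernelOn K' z) * (x * (F * F₁))| ≤
        b * (κ * (‖z.1.2‖ ^ 2 + ‖z.2.1‖ ^ 2)) * (x * M ^ 2) := by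
      rw [abs_mul, abs_of_nonneg (mul_nonneg hx hFF0)]
      refine mul_le_mul (hKK _ _ _) (by gcongr) (mul_nonneg hx hFF0) (by positivity)
    have b2 : |kernelOn K' z * x * ((F - G) * F₁)| ≤ b * x * (κ * M) := by
      rw [abs_mul, abs_mul (F - G), abs_of_nonneg (mul_nonneg hk' hx), abs_of_nonneg hF₁.1]
      exact mul_le_mul (mul_le_mul_of_nonneg_right (hK'.kernelOn_le z) hx)
        (mul_le_mul h1 hF₁.2 hF₁.1 hκ) (mul_nonneg (abs_nonneg _) hF₁.1) (mul_nonneg hb hx)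
    have b3 : |kernelOn K' z * x * (G * (F₁ - G₁))| ≤ b * x * (M * κ) := by
      rw [abs_mul, abs_mul G, abs_of_nonneg (mul_nonneg hk' hx), abs_of_nonneg hG.1]
      exact mul_le_mul (mul_le_mul_of_nonneg_right (hK'.kernelOn_le z) hx)
        (mul_le_mul hG.2 h2 (abs_nonneg _) hM0) (mul_nonneg hG.1 (abs_nonneg _)) (mul_nonneg hb hx)
    rw [e]
    refine (abs_add_le _ _).trans ((add_le_add b1 ((abs_add_le _ _).trans (add_le_add b2 b3))).trans ?_)
    have hMM : M ≤ M ^ 2 := by nlinarith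
    have h5 : 0 ≤ b * x * κ := mul_nonneg (mul_nonneg hb hx) hκ
    have h6 : b * x * κ * M ≤ b * x * κ * M ^ 2 := mul_le_mul_of_nonneg_left hMM h5
    have h7 : 0 ≤ b * x * κ * M ^ 2 * (‖z.1.2‖ ^ 2 + ‖z.2.1‖ ^ 2) := by positivity
    simp only [energyWeight, ptStar]
    nlinarith
  have k1 := key (f (ptPost z) * f (ptPostStar z)) _ _ _ _ (mul_nonneg (hf0 _) (hf0 _))
    (hΦ.mem_Icc (hf.mem z.1)) (hΦ.mem_Icc (hf.mem (ptStar z))) (hΦ'.mem_Icc (hf.mem z.1))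
    (hφ _ (hf.mem _)) (hφ _ (hf.mem (ptStar z)))
  have k2 := key (f z.1 * f (ptStar z)) _ _ _ _ (mul_nonneg (hf0 _) (hf0 _))
    (hΦ.mem_Icc (hf.mem (ptPost z))) (hΦ.mem_Icc (hf.mem (ptPostStar z)))
    (hΦ'.mem_Icc (hf.mem (ptPost z))) (hφ _ (hf.mem _)) (hφ _ (hf.mem (ptPostStar z)))
  simp only [gainFn, lossFn]
  linarith

/-! ### Pointwise bounds for gain and loss -/

/-- The gain term, as a function on phase space. -/
noncomputable def gainAt (K : Velocity → Velocity → ℝ → ℝ) (Φ : ℝ → ℝ) (u : Phase → ℝ)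
    (p : Phase) : ℝ≥0∞ :=
  ∫⁻ q : Velocity × ℝ, ENNReal.ofReal (gainFn K Φ u (p, q))
    ∂((volume : Measure Velocity).prod angleMeasure)

/-- Since |v|² ≤ |v'|² + |v'_*|², one of the outgoing velocities satisfies |v|² ≤ 2|w|². Its density
is kept and integrated by the change of variables, and the three other factors are bounded by M. The
restriction on w is what later permits integration in v as well. -/
theorem gainAt_le (hK : CollisionKernel K b c) (hb : 0 ≤ b) (hc : 0 ≤ c) (hM : 0 ≤ M)
    (hΦ : FillingFunction α M Φ) {u : Phase → ℝ} (hu : Occupation M u) (p : Phase) :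
    gainAt K Φ u p ≤ ENNReal.ofReal (4 * M ^ 3 * c * b) *
      ∫⁻ w : Velocity, indicator {w : Velocity | ‖p.2‖ ^ 2 ≤ 2 * ‖w‖ ^ 2}
        (fun w => ENNReal.ofReal (u (p.1, w))) w := by
  set g : Velocity → ℝ≥0∞ := indicator {w : Velocity | ‖p.2‖ ^ 2 ≤ 2 * ‖w‖ ^ 2}
        (fun w => ENNReal.ofReal (u (p.1, w))) with hg
  have hgm : Measurable g := (hu.measurable.comp measurable_prodMk_left).ennreal_ofReal.indicator
    (measurableSet_le (by fun_prop) (by fun_prop))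
  have hpt : ∀ q : Velocity × ℝ, ENNReal.ofReal (gainFn K Φ u (p, q)) ≤
      ENNReal.ofReal (M ^ 3) * (ENNReal.ofReal (K p.2 q.1 q.2) * g (postVel p.2 q.1 q.2) +
        ENNReal.ofReal (K p.2 q.1 q.2) * g (postVelStar p.2 q.1 q.2)) := by
    intro q
    have hF := hΦ.mem_Icc (hu.mem p)
    have hF₁ := hΦ.mem_Icc (hu.mem (ptStar (p, q)))
    have hk := hK.nonneg p.2 q.1 q.2
    have h2 := hu.mem (p.1, postVel p.2 q.1 q.2)
    have h3 := hu.mem (p.1, postVelStar p.2 q.1 q.2)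
    have hbase : ∀ x y : ℝ, x ∈ Icc 0 M → y ∈ Icc 0 M → x * y * Φ (u p) * Φ (u (ptStar (p, q))) ≤
        M ^ 3 * x := by
      intro x y hx hy
      have h4 : Φ (u p) * Φ (u (ptStar (p, q))) ≤ M ^ 2 := by
        rw [sq]; exact mul_le_mul hF.2 hF₁.2 hF₁.1 hM
      calc x * y * Φ (u p) * Φ (u (ptStar (p, q))) = x * (y * (Φ (u p) * Φ (u (ptStar (p, q))))) := by
            ring
        _ ≤ x * (M * M ^ 2) := by
            refine mul_le_mul_of_nonneg_left ?_ hx.1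
            exact mul_le_mul hy.2 h4 (mul_nonneg hF.1 hF₁.1) hM
        _ = _ := by ring
    have hcase : ∀ x : ℝ, x ∈ Icc 0 M →
        u (p.1, postVel p.2 q.1 q.2) * u (p.1, postVelStar p.2 q.1 q.2) * Φ (u p) *
          Φ (u (ptStar (p, q))) ≤ M ^ 3 * x →
        ENNReal.ofReal (gainFn K Φ u (p, q)) ≤
          ENNReal.ofReal (M ^ 3) * (ENNReal.ofReal (K p.2 q.1 q.2) * ENNReal.ofReal x) := by
      intro x hx h
      rw [← ENNReal.ofReal_mul hk, ← ENNReal.ofReal_mul (by positivity)]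
      refine ENNReal.ofReal_le_ofReal ?_
      simp only [gainFn, kernelOn]
      calc _ ≤ K p.2 q.1 q.2 * (M ^ 3 * x) := mul_le_mul_of_nonneg_left h hk
        _ = _ := by ring
    have hen := post_energy p.2 q.1 q.2
    by_cases hlarge : ‖p.2‖ ^ 2 ≤ 2 * ‖postVel p.2 q.1 q.2‖ ^ 2
    · have e : g (postVel p.2 q.1 q.2) = ENNReal.ofReal (u (p.1, postVel p.2 q.1 q.2)) :=
        indicator_of_mem (s := {w : Velocity | ‖p.2‖ ^ 2 ≤ 2 * ‖w‖ ^ 2}) hlarge _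
      refine (hcase _ h2 (hbase _ _ h2 h3)).trans ?_
      rw [e]
      gcongr
      exact le_self_add
    · have hlarge' : ‖p.2‖ ^ 2 ≤ 2 * ‖postVelStar p.2 q.1 q.2‖ ^ 2 := by
        nlinarith [sq_nonneg ‖q.1‖]
      have e : g (postVelStar p.2 q.1 q.2) = ENNReal.ofReal (u (p.1, postVelStar p.2 q.1 q.2)) :=
        indicator_of_mem (s := {w : Velocity | ‖p.2‖ ^ 2 ≤ 2 * ‖w‖ ^ 2}) hlarge' _
      refine (hcase _ h3 ?_).trans ?_
      · rw [mul_comm (u (p.1, postVel p.2 q.1 q.2))]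
        exact hbase _ _ h3 h2
      · rw [e]
        gcongr
        exact le_add_self
  have m1 : Measurable fun q : Velocity × ℝ =>
      ENNReal.ofReal (K p.2 q.1 q.2) * g (postVel p.2 q.1 q.2) :=
    (hK.measurable_section p.2).ennreal_ofReal.mul
      (hgm.comp (continuous_postVel.measurable.comp measurable_prodMk_left))
  calc gainAt K Φ u p ≤ ∫⁻ q : Velocity × ℝ, ENNReal.ofReal (M ^ 3) *
        (ENNReal.ofReal (K p.2 q.1 q.2) * g (postVel p.2 q.1 q.2) +
        ENNReal.ofReal (K p.2 q.1 q.2) * g (postVelStar p.2 q.1 q.2))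
        ∂((volume : Measure Velocity).prod angleMeasure) := lintegral_mono hpt
    _ ≤ ENNReal.ofReal (M ^ 3) * (ENNReal.ofReal (2 * c * b) * (∫⁻ w, g w) +
        ENNReal.ofReal (2 * c * b) * (∫⁻ w, g w)) := by
        rw [lintegral_const_mul' _ _ ENNReal.ofReal_ne_top, lintegral_add_left m1]
        gcongr
        · exact hK.lintegral_post_le hb hc p.2 hgm
        · exact hK.lintegral_postStar_le hb hc p.2 hgm
    _ = _ := by
        rw [← add_mul, ← ENNReal.ofReal_add (by positivity) (by positivity), ← mul_assoc,
          ← ENNReal.ofReal_mul (by positivity)]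
        congr 2; ring

theorem lintegral_lossFn_le (hK : CollisionKernel K b c) (hb : 0 ≤ b) (hM : 0 ≤ M)
    (hΦ : FillingFunction α M Φ) {u : Phase → ℝ} (hu : Occupation M u) (p : Phase) :
    ∫⁻ q : Velocity × ℝ, ENNReal.ofReal (lossFn K Φ u (p, q))
      ∂((volume : Measure Velocity).prod angleMeasure) ≤
      ENNReal.ofReal (M ^ 2 * b * u p) * ∫⁻ w : Velocity, ENNReal.ofReal (u (p.1, w)) := by
  have hm : Measurable fun q : Velocity × ℝ => ENNReal.ofReal (u (p.1, q.1)) :=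
    (hu.measurable.comp (by fun_prop)).ennreal_ofReal
  calc _ ≤ ∫⁻ q : Velocity × ℝ, ENNReal.ofReal (M ^ 2 * b * u p) * ENNReal.ofReal (u (p.1, q.1))
      ∂((volume : Measure Velocity).prod angleMeasure) := by
        refine lintegral_mono fun q => ?_
        have h0 := (hu.mem p).1
        rw [← ENNReal.ofReal_mul (by positivity)]
        refine ENNReal.ofReal_le_ofReal ?_
        have hF := hΦ.mem_Icc (hu.mem (ptPost (p, q)))
        have hF₁ := hΦ.mem_Icc (hu.mem (ptPostStar (p, q)))
        have h4 : Φ (u (ptPost (p, q))) * Φ (u (ptPostStar (p, q))) ≤ M ^ 2 := by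
          rw [sq]; exact mul_le_mul hF.2 hF₁.2 hF₁.1 hM
        have h5 : 0 ≤ u p * u (p.1, q.1) := mul_nonneg h0 (hu.mem _).1
        simp only [lossFn, ptStar]
        calc _ = kernelOn K (p, q) * (u p * u (p.1, q.1)) *
              (Φ (u (ptPost (p, q))) * Φ (u (ptPostStar (p, q)))) := by ring
          _ ≤ b * (u p * u (p.1, q.1)) * M ^ 2 := by
              refine mul_le_mul (mul_le_mul_of_nonneg_right (hK.kernelOn_le _) h5) h4
                (mul_nonneg hF.1 hF₁.1) (mul_nonneg hb h5)
          _ = _ := by ring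
    _ = _ := by
        rw [lintegral_const_mul' _ _ ENNReal.ofReal_ne_top, lintegral_prod _ hm.aemeasurable]
        simp

/-! ### Collision invariants -/

/-- The collision map turns the φ-moment of the gain into the moment of the loss weighted by φ(v').
Symmetrising in the two particles replaces φ(v) and φ(v') by half sums, which agree for a collision
invariant. -/
theorem integral_mul_collQ_eq_zero (hK : CollisionKernel K b c) {u : Phase → ℝ}
    {φ : Velocity → ℝ}
    (hinv : ∀ v w θ, φ (postVel v w θ) + φ (postVelStar v w θ) = φ v + φ w)
    (h1 : Integrable (fun z => φ z.1.2 * lossFn K Φ u z) collMeasure)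
    (h2 : Integrable (fun z => φ (ptPost z).2 * lossFn K Φ u z) collMeasure) :
    Integrable (fun p : Phase => φ p.2 * collQ K Φ u p) volume ∧
      ∫ p : Phase, φ p.2 * collQ K Φ u p = 0 := by
  have hcomp : ∀ {T : CollSpace → CollSpace} {F : CollSpace → ℝ},
      MeasurePreserving T collMeasure collMeasure → Integrable F collMeasure →
      Integrable (fun z => F (T z)) collMeasure ∧
        ∫ z, F (T z) ∂collMeasure = ∫ z, F z ∂collMeasure := by
    intro T F hT hF
    refine ⟨hT.integrable_comp_of_integrable hF, ?_⟩
    have h := integral_map hT.measurable.aemeasurable (f := F)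
      (by rw [hT.map_eq]; exact hF.aestronglyMeasurable)
    rw [hT.map_eq] at h
    exact h.symm
  have g1 := hcomp measurePreserving_collideMap h2
  have s1 := hcomp measurePreserving_swapMap h1
  have s2 := hcomp measurePreserving_swapMap h2
  simp only [ptPost_collideMap, lossFn_collideMap hK] at g1
  simp only [lossFn_swapMap hK, fst_swapMap, ptPost_swapMap] at s1 s2
  have hsum : ∫ z, φ (ptPost z).2 * lossFn K Φ u z ∂collMeasure +
      ∫ z, φ (ptPost z).2 * lossFn K Φ u z ∂collMeasure =
      ∫ z, φ z.1.2 * lossFn K Φ u z ∂collMeasure +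
      ∫ z, φ z.1.2 * lossFn K Φ u z ∂collMeasure := by
    calc _ = ∫ z, φ (ptPost z).2 * lossFn K Φ u z ∂collMeasure +
        ∫ z, φ (ptPostStar z).2 * lossFn K Φ u z ∂collMeasure := by rw [s2.2]
      _ = ∫ z, φ z.1.2 * lossFn K Φ u z ∂collMeasure +
        ∫ z, φ (ptStar z).2 * lossFn K Φ u z ∂collMeasure := by
        rw [← integral_add h2 s2.1, ← integral_add h1 s1.1]
        refine integral_congr_ae (Eventually.of_forall fun z => ?_)
        simp only [← add_mul]
        exact congrArg (· * lossFn K Φ u z) (hinv _ _ _)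
      _ = _ := by rw [s1.2]
  have hint : Integrable (fun z : CollSpace => φ z.1.2 * (gainFn K Φ u z - lossFn K Φ u z))
      collMeasure := by
    refine (g1.1.sub h1).congr (Eventually.of_forall fun z => ?_)
    simp only [Pi.sub_apply]; ring
  have e : ∀ p : Phase, φ p.2 * collQ K Φ u p = ∫ q : Velocity × ℝ,
      φ p.2 * (gainFn K Φ u (p, q) - lossFn K Φ u (p, q))
        ∂((volume : Measure Velocity).prod angleMeasure) := fun p => by
    rw [collQ, integral_const_mul]
  simp_rw [e]
  refine ⟨hint.integral_prod_left, ?_⟩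
  rw [← integral_prod _ hint]
  have e2 : ∫ z : CollSpace, φ z.1.2 * (gainFn K Φ u z - lossFn K Φ u z) ∂collMeasure =
      ∫ z, φ z.1.2 * gainFn K Φ u z ∂collMeasure - ∫ z, φ z.1.2 * lossFn K Φ u z ∂collMeasure := by
    rw [← integral_sub g1.1 h1]
    refine integral_congr_ae (Eventually.of_forall fun z => ?_)
    simp only; ring
  rw [e2, g1.2]
  linarith

theorem integral_collQ_eq_zero (hK : CollisionKernel K b c) {u : Phase → ℝ}
    (h : CollInt K Φ u) : ∫ p : Phase, collQ K Φ u p = 0 := by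
  have := (integral_mul_collQ_eq_zero hK (Φ := Φ) (u := u) (φ := fun _ => 1) (fun _ _ _ => rfl)
    (by simpa using h.2) (by simpa using h.2)).2
  simpa using this

/-- Vanishing of the moments of the collision term for collision invariants of at most quadratic
growth. -/
theorem BoundedDensity.integral_mul_collQ (hK : CollisionKernel K b c) (hb : 0 ≤ b) (hM : 0 ≤ M)
    (hΦ : FillingFunction α M Φ) {u : Phase → ℝ} {N : ℝ} (hu : BoundedDensity M N u)
    {φ : Velocity → ℝ} (hφ : Measurable φ)
    (hinv : ∀ v w θ, φ (postVel v w θ) + φ (postVelStar v w θ) = φ v + φ w) {C : ℝ} (hC : 0 ≤ C)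
    (hle : ∀ v, |φ v| ≤ C * (1 + ‖v‖ ^ 2)) :
    Integrable (fun p : Phase => φ p.2 * collQ K Φ u p) volume ∧
      ∫ p : Phase, φ p.2 * collQ K Φ u p = 0 := by
  have hu0 : ∀ p, 0 ≤ u p := fun p => (hu.mem p).1
  obtain ⟨q1, q2, -, -⟩ := IntLE.quad hK hb (measurable_energyWeight.mul hu.measurable)
    (fun p => mul_nonneg (energyWeight_nonneg p) (hu0 p)) hu.energy hu.measurable hu0
    hu.nonneg_bound hu.density
  have hlm := measurable_lossFn hK hΦ.measurable hu.measurable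
  have hl : ∀ z, lossFn K Φ u z ≤ M ^ 2 * (kernelOn K z * (u z.1 * u (ptStar z))) := by
    intro z
    have hF := hΦ.mem_Icc (hu.mem (ptPost z))
    have hF₁ := hΦ.mem_Icc (hu.mem (ptPostStar z))
    have h4 : Φ (u (ptPost z)) * Φ (u (ptPostStar z)) ≤ M ^ 2 := by
      rw [sq]; exact mul_le_mul hF.2 hF₁.2 hF₁.1 hM
    have h5 : 0 ≤ kernelOn K z * (u z.1 * u (ptStar z)) :=
      mul_nonneg (hK.kernelOn_nonneg z) (mul_nonneg (hu0 _) (hu0 _))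
    calc lossFn K Φ u z = kernelOn K z * (u z.1 * u (ptStar z)) *
          (Φ (u (ptPost z)) * Φ (u (ptPostStar z))) := by rw [lossFn]; ring
      _ ≤ kernelOn K z * (u z.1 * u (ptStar z)) * M ^ 2 := mul_le_mul_of_nonneg_left h4 h5
      _ = _ := mul_comm _ _
  have hB := (((q1.add q2).1.const_mul (M ^ 2)).const_mul C)
  have key : ∀ ψ : CollSpace → ℝ, Measurable ψ →
      (∀ z, |ψ z| ≤ C * (energyWeight z.1 + energyWeight (ptStar z))) →
      Integrable (fun z => ψ z * lossFn K Φ u z) collMeasure := by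
    intro ψ hψ hψC
    refine hB.mono (hψ.mul hlm).aestronglyMeasurable (Eventually.of_forall fun z => ?_)
    refine le_trans ?_ (le_abs_self _)
    rw [Real.norm_eq_abs, abs_mul, abs_of_nonneg (lossFn_nonneg hK hΦ hu.toOccupation z)]
    calc |ψ z| * lossFn K Φ u z ≤ (C * (energyWeight z.1 + energyWeight (ptStar z))) *
          (M ^ 2 * (kernelOn K z * (u z.1 * u (ptStar z)))) :=
          mul_le_mul (hψC z) (hl z) (lossFn_nonneg hK hΦ hu.toOccupation z)
            (mul_nonneg hC (add_nonneg (energyWeight_nonneg _) (energyWeight_nonneg _)))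
      _ = _ := by simp only [Pi.mul_apply]; ring
  refine integral_mul_collQ_eq_zero hK hinv
    (key _ (hφ.comp (measurable_snd.comp measurable_fst)) fun z => ?_)
    (key _ (hφ.comp (measurable_snd.comp measurable_ptPost)) fun z => ?_)
  · refine (hle _).trans (mul_le_mul_of_nonneg_left ?_ hC)
    exact le_add_of_nonneg_right (energyWeight_nonneg _)
  · refine (hle _).trans (mul_le_mul_of_nonneg_left ?_ hC)
    rw [← energyWeight_post]
    exact le_add_of_nonneg_right (energyWeight_nonneg _)

end

section

/-! ### Free streaming on `L¹` -/

/-- `sharp t` as a linear isometry. -/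
noncomputable def sharpL (t : ℝ) : PhaseL1 →ₗᵢ[ℝ] PhaseL1 :=
  Lp.compMeasurePreservingₗᵢ ℝ (freeFlow t) (measurePreserving_freeFlow t)

theorem coeFn_sharp (t : ℝ) (u : PhaseL1) : sharp t u =ᵐ[volume] fun p => u (freeFlow t p) :=
  Lp.coeFn_compMeasurePreserving u (measurePreserving_freeFlow t)

theorem norm_sharp (t : ℝ) (u : PhaseL1) : ‖sharp t u‖ = ‖u‖ := (sharpL t).norm_map u

theorem sharp_sub (t : ℝ) (u w : PhaseL1) : sharp t (u - w) = sharp t u - sharp t w :=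
  (sharpL t).map_sub u w

theorem freeFlow_freeFlow (s t : ℝ) (p : Phase) : freeFlow s (freeFlow t p) = freeFlow (s + t) p := by
  simp only [freeFlow, add_assoc, ← AddCircle.coe_add]
  congr 3
  ring

theorem freeFlow_zero (p : Phase) : freeFlow 0 p = p := by simp [freeFlow]

theorem sharp_sharp (s t : ℝ) (u : PhaseL1) : sharp s (sharp t u) = sharp (s + t) u := by
  refine Lp.ext ?_
  have h1 := (measurePreserving_freeFlow s).quasiMeasurePreserving.ae (coeFn_sharp t u)
  filter_upwards [coeFn_sharp s (sharp t u), h1, coeFn_sharp (s + t) u] with p a1 a2 a3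
  rw [a1, a2, a3, freeFlow_freeFlow, add_comm]

theorem sharp_zero (u : PhaseL1) : sharp 0 u = u := by
  refine Lp.ext ?_
  filter_upwards [coeFn_sharp 0 u] with p hp
  rw [hp, freeFlow_zero]

theorem sharp_neg_sharp (t : ℝ) (u : PhaseL1) : sharp (-t) (sharp t u) = u := by
  rw [sharp_sharp, neg_add_cancel, sharp_zero]

theorem sharp_sharp_neg (t : ℝ) (u : PhaseL1) : sharp t (sharp (-t) u) = u := by
  rw [sharp_sharp, add_neg_cancel, sharp_zero]

theorem continuous_freeFlow : Continuous fun q : ℝ × Phase => freeFlow q.1 q.2 := by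
  have h : Continuous fun q : ℝ × Phase => ((q.1 * q.2.2 0 : ℝ) : UnitAddCircle) :=
    (AddCircle.continuous_mk' (1 : ℝ)).comp (by fun_prop)
  exact ((continuous_fst.comp continuous_snd).add h).prodMk (continuous_snd.comp continuous_snd)

theorem measurable_freeFlow (t : ℝ) : Measurable (freeFlow t) :=
  (measurePreserving_freeFlow t).measurable

/-- Free streaming is strongly continuous but not continuous in operator norm; continuity along
curves in L¹ is the form that is available and sufficient. -/
theorem continuousOn_sharp {I : Set ℝ} {τ : ℝ → ℝ} {f : ℝ → PhaseL1} (hτ : ContinuousOn τ I)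
    (hf : ContinuousOn f I) : ContinuousOn (fun t => sharp (τ t) (f t)) I := by
  let F : C(ℝ × Phase, Phase) := ⟨fun q => freeFlow q.1 q.2, continuous_freeFlow⟩
  have hF : ContinuousOn (fun t => F.curry (τ t)) I := F.curry.continuous.comp_continuousOn hτ
  exact hf.compMeasurePreservingLp hF (fun t => measurePreserving_freeFlow (τ t)) ENNReal.one_ne_top

theorem ae_freeFlow {P : Phase → Prop} (t : ℝ) (h : ∀ᵐ p : Phase, P p) :
    ∀ᵐ p : Phase, P (freeFlow t p) :=
  (measurePreserving_freeFlow t).quasiMeasurePreserving.ae h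

theorem ae_of_ae_freeFlow {P : Phase → Prop} (t : ℝ) (h : ∀ᵐ p : Phase, P (freeFlow t p)) :
    ∀ᵐ p : Phase, P p := by
  filter_upwards [ae_freeFlow (-t) h] with p hp
  rwa [freeFlow_freeFlow, add_neg_cancel, freeFlow_zero] at hp

theorem integrable_comp_freeFlow {F : Phase → ℝ} (t : ℝ) (hF : Integrable F volume) :
    Integrable (fun p => F (freeFlow t p)) volume :=
  (measurePreserving_freeFlow t).integrable_comp_of_integrable hF

theorem integral_comp_freeFlow {F : Phase → ℝ} (t : ℝ) (hF : AEStronglyMeasurable F volume) :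
    ∫ p, F (freeFlow t p) = ∫ p, F p := by
  have h := integral_map (measurable_freeFlow t).aemeasurable (f := F)
    (by rw [(measurePreserving_freeFlow t).map_eq]; exact hF)
  rw [(measurePreserving_freeFlow t).map_eq] at h
  exact h.symm

theorem integral_sharp (t : ℝ) (u : PhaseL1) : ∫ p, sharp t u p = ∫ p, u p := by
  rw [integral_congr_ae (coeFn_sharp t u)]
  exact integral_comp_freeFlow t (Lp.aestronglyMeasurable u)

/-! ### Differential inequalities in `L¹` -/

section PosPart

variable {X : Type*} [MeasurableSpace X] {μ : Measure X}

/-- From a negative value h₀ a linear step must first climb by |h₀| before the positive part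
changes. Hence h₁ need only be controlled where h₀ ≥ 0, up to a remainder that disappears for short
steps. -/
theorem posPart_step {h₀ h₁ β δ : ℝ} (hδ : 0 < δ) (hβ0 : 0 ≤ β) (hβ : 0 ≤ h₀ → h₁ ≤ β) :
    max (h₀ + δ * h₁) 0 - max h₀ 0 ≤ δ * (β + max (h₁ - |h₀| / δ) 0 * (if h₀ < 0 then 1 else 0)) := by
  rcases lt_or_ge h₀ 0 with h | h
  · rw [if_pos h, max_eq_right h.le, sub_zero, mul_one, abs_of_neg h]
    have e : δ * (h₁ - -h₀ / δ) = h₀ + δ * h₁ := by field_simp; ring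
    have h1 : δ * (h₁ - -h₀ / δ) ≤ δ * (β + max (h₁ - -h₀ / δ) 0) := by
      gcongr
      exact (le_max_left _ _).trans (le_add_of_nonneg_left hβ0)
    refine max_le (by rw [← e]; exact h1) (by positivity)
  · rw [if_neg (not_lt.2 h), mul_zero, add_zero, max_eq_left h]
    have h1 := hβ h
    have h2 : δ * h₁ ≤ δ * β := by gcongr
    have h3 : 0 ≤ δ * β := by positivity
    have h4 : max (h₀ + δ * h₁) 0 ≤ h₀ + δ * β := max_le (by linarith) (by linarith)
    linarith

/-- The positive part is not differentiable, but an upper bound for the right slope is enough. At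
each point with h < 0 the remainder of `posPart_step` vanishes for short steps, and it is dominated
by |h'|, so its integral tends to zero; the error of the linearisation is small in L¹. -/
theorem posPart_slope_lt {h : ℝ → Lp ℝ 1 μ} {h' : Lp ℝ 1 μ} {t : ℝ}
    (hd : HasDerivWithinAt h h' (Ioi t) t) {β : X → ℝ} (hβi : Integrable β μ) (hβ0 : ∀ x, 0 ≤ β x)
    (hβ : ∀ᵐ x ∂μ, 0 ≤ h t x → h' x ≤ β x) {r : ℝ} (hr : ∫ x, β x ∂μ < r) :
    ∀ᶠ s in 𝓝[>] t, slope (fun s => ∫ x, max (h s x) 0 ∂μ) t s < r := by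
  set ψ : ℝ → X → ℝ := fun δ x => max (h' x - |h t x| / δ) 0 * (if h t x < 0 then 1 else 0) with hψ
  have hi : ∀ u : Lp ℝ 1 μ, Integrable u μ := fun u => L1.integrable_coeFn u
  have hmt := (Lp.stronglyMeasurable (h t)).measurable
  have hm' := (Lp.stronglyMeasurable h').measurable
  have hψm : ∀ δ, Measurable (ψ δ) := fun δ =>
    ((hm'.sub (hmt.abs.div_const δ)).max measurable_const).mul
      (Measurable.ite (measurableSet_lt hmt measurable_const) measurable_const measurable_const)
  have hψ0 : ∀ δ x, 0 ≤ ψ δ x := fun δ x =>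
    mul_nonneg (le_max_right _ _) (by split_ifs <;> norm_num)
  have hψb : ∀ δ, 0 < δ → ∀ x, ‖ψ δ x‖ ≤ ‖h' x‖ := by
    intro δ hδ x
    rw [Real.norm_of_nonneg (hψ0 δ x)]
    have h1 : max (h' x - |h t x| / δ) 0 ≤ ‖h' x‖ := by
      refine max_le ?_ (norm_nonneg _)
      have : 0 ≤ |h t x| / δ := by positivity
      have := le_abs_self (h' x)
      rw [Real.norm_eq_abs]; linarith
    calc ψ δ x ≤ ‖h' x‖ * 1 := mul_le_mul h1 (by split_ifs <;> norm_num)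
          (by split_ifs <;> norm_num) (norm_nonneg _)
      _ = _ := mul_one _
  have hψi : ∀ δ, 0 < δ → Integrable (ψ δ) μ := fun δ hδ =>
    (hi h').mono (hψm δ).aestronglyMeasurable (Eventually.of_forall (hψb δ hδ))
  have hlim : Tendsto (fun s => ∫ x, ψ (s - t) x ∂μ) (𝓝[>] t) (𝓝 0) := by
    have : (0 : ℝ) = ∫ x : X, (0 : ℝ) ∂μ := by simp
    rw [this]
    refine tendsto_integral_filter_of_dominated_convergence (fun x => ‖h' x‖) ?_ ?_ (hi h').norm ?_
    · exact Eventually.of_forall fun s => (hψm _).aestronglyMeasurable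
    · filter_upwards [self_mem_nhdsWithin] with s hs
      exact Eventually.of_forall (hψb _ (sub_pos.2 hs))
    · refine Eventually.of_forall fun x => ?_
      rcases lt_or_ge (h t x) 0 with hx | hx
      · have hev : ∀ᶠ s in 𝓝[>] t, ψ (s - t) x = 0 := by
          have habs : 0 < |h t x| := abs_pos.2 hx.ne
          have hsmall : ∀ᶠ s in 𝓝[>] t, s < t + |h t x| / (|h' x| + 1) :=
            nhdsWithin_le_nhds (eventually_lt_nhds (by
              have : 0 < |h t x| / (|h' x| + 1) := by positivity
              linarith))
          filter_upwards [hsmall, self_mem_nhdsWithin] with s hs hst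
          have hst' : 0 < s - t := sub_pos.2 hst
          have h1 : h' x ≤ |h t x| / (s - t) := by
            rw [le_div_iff₀ hst']
            have h2 : (s - t) * (|h' x| + 1) < |h t x| := by
              rw [← lt_div_iff₀ (by positivity)]; linarith
            nlinarith [le_abs_self (h' x)]
          simp only [hψ, max_eq_right (sub_nonpos.2 h1), zero_mul]
        exact tendsto_const_nhds.congr' (hev.mono fun s hs => hs.symm)
      · have : ∀ s, ψ (s - t) x = 0 := fun s => by simp [hψ, not_lt.2 hx]
        simp only [this, tendsto_const_nhds]
  have hrem : Tendsto (fun s => ‖slope h t s - h'‖) (𝓝[>] t) (𝓝 0) := by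
    have h1 := hasDerivWithinAt_iff_tendsto_slope.1 hd
    have h2 : Ioi t \ {t} = Ioi t := by ext; simp
    rw [h2] at h1
    simpa using (h1.sub_const h').norm
  have hev : ∀ᶠ s in 𝓝[>] t, ∫ x, ψ (s - t) x ∂μ + ‖slope h t s - h'‖ < r - ∫ x, β x ∂μ := by
    have := hlim.add hrem
    rw [add_zero] at this
    exact this.eventually (eventually_lt_nhds (by linarith))
  filter_upwards [hev, self_mem_nhdsWithin] with s hs hst
  have hδ : 0 < s - t := sub_pos.2 hst
  set δ := s - t with hδdef
  have hsl : h s = h t + δ • h' + δ • (slope h t s - h') := by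
    rw [slope_def_module, smul_sub, smul_smul, mul_inv_cancel₀ hδ.ne', one_smul]; abel
  set w := slope h t s - h' with hw
  have hcoe : ∀ᵐ x ∂μ, h s x = h t x + δ * h' x + δ * w x := by
    rw [hsl]
    filter_upwards [Lp.coeFn_add (h t + δ • h') (δ • w), Lp.coeFn_add (h t) (δ • h'),
      Lp.coeFn_smul δ h', Lp.coeFn_smul δ w] with x a1 a2 a3 a4
    rw [a1, Pi.add_apply, a2, Pi.add_apply, a3, a4]
    rfl
  have hpt : ∀ᵐ x ∂μ, max (h s x) 0 - max (h t x) 0 ≤ δ * (β x + ψ δ x) + δ * ‖w x‖ := by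
    filter_upwards [hcoe, hβ] with x h1 h2
    have h3 := posPart_step hδ (hβ0 x) h2
    have h4 : max (h s x) 0 ≤ max (h t x + δ * h' x) 0 + δ * ‖w x‖ := by
      rw [h1]
      have h5 : δ * w x ≤ δ * ‖w x‖ := by gcongr; exact le_abs_self _
      have h6 : 0 ≤ δ * ‖w x‖ := by positivity
      refine max_le ?_ (by positivity)
      linarith [le_max_left (h t x + δ * h' x) 0]
    simp only [hψ]
    linarith
  have hpos : ∀ s, Integrable (fun x => max (h s x) 0) μ := fun s => (hi (h s)).pos_part
  have hI := integral_mono_ae ((hpos s).sub (hpos t))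
    (((hβi.add (hψi δ hδ)).const_mul δ).add ((hi w).norm.const_mul δ)) hpt
  simp only [Pi.sub_apply, Pi.add_apply] at hI
  rw [integral_sub (hpos s) (hpos t), integral_add (by exact ((hβi.add (hψi δ hδ)).const_mul δ))
    ((hi w).norm.const_mul δ), integral_const_mul, integral_const_mul,
    integral_add hβi (hψi δ hδ), ← L1.norm_eq_integral_norm] at hI
  rw [slope_def_field, div_lt_iff₀ hδ]
  nlinarith

end PosPart

/-- The rate a may be singular at time zero, where only its antiderivative A is continuous. The
comparison therefore starts at a time s > 0, with a slack ε that makes the differential inequality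
strict; then ε and s tend to zero. -/
theorem gronwall_slope {φ A a : ℝ → ℝ} {T κ : ℝ} (hφ : ContinuousOn φ (Icc 0 T)) (hκ : 0 ≤ κ)
    (hφ0 : ∀ t, 0 ≤ φ t) (hA : ContinuousOn A (Icc 0 T)) (hA' : ∀ t, 0 < t → HasDerivAt A (a t) t)
    (hs : ∀ t ∈ Ioo 0 T, ∀ r, a t * (φ t + κ) < r → ∀ᶠ s in 𝓝[>] t, slope φ t s < r) :
    ∀ t ∈ Icc 0 T, φ t + κ ≤ (φ 0 + κ) * Real.exp (A t - A 0) := by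
  have step : ∀ s, 0 < s → ∀ t ∈ Icc s T, ∀ ε, 0 < ε →
      φ t ≤ (φ s + κ + ε) * Real.exp (A t - A s + ε * (t - s)) - κ := by
    intro s hs0 t ht ε hε
    have hsub : Icc s T ⊆ Icc 0 T := Icc_subset_Icc_left hs0.le
    have hB' : ∀ x, 0 < x → HasDerivAt
        (fun x => (φ s + κ + ε) * Real.exp (A x - A s + ε * (x - s)) - κ)
        ((φ s + κ + ε) * (Real.exp (A x - A s + ε * (x - s)) * (a x + ε))) x := by
      intro x hx
      have h1 : HasDerivAt (fun x => A x - A s + ε * (x - s)) (a x + ε) x := by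
        have := ((hA' x hx).sub_const (A s)).add (((hasDerivAt_id x).sub_const s).const_mul ε)
        rw [mul_one] at this
        exact this
      exact (h1.exp.const_mul _).sub_const κ
    refine image_le_of_liminf_slope_right_lt_deriv_boundary' (f := φ)
      (f' := fun x => a x * (φ x + κ)) (a := s) (b := T) (hφ.mono hsub) ?_
      (B := fun x => (φ s + κ + ε) * Real.exp (A x - A s + ε * (x - s)) - κ)
      (B' := fun x => (φ s + κ + ε) * (Real.exp (A x - A s + ε * (x - s)) * (a x + ε))) ?_ ?_ ?_ ?_ ht
    · intro x hx r hr
      exact (hs x ⟨hs0.trans_le hx.1, hx.2⟩ r hr).frequently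
    · simp; linarith
    · exact fun x hx => (hB' x (hs0.trans_le hx.1)).continuousAt.continuousWithinAt
    · exact fun x hx => (hB' x (hs0.trans_le hx.1)).hasDerivWithinAt
    · intro x hx h
      have hpos : 0 < (φ s + κ + ε) * Real.exp (A x - A s + ε * (x - s)) := by
        have := hφ0 s
        positivity
      rw [h]
      nlinarith
  intro t ht
  rcases ht.1.eq_or_lt with h0 | hpos
  · rw [← h0]; simp
  have step2 : ∀ s ∈ Ioo 0 t, φ t + κ ≤ (φ s + κ) * Real.exp (A t - A s) := by
    intro s hs
    have hlim : Tendsto (fun ε => (φ s + κ + ε) * Real.exp (A t - A s + ε * (t - s)) - κ)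
        (𝓝[>] 0) (𝓝 ((φ s + κ + 0) * Real.exp (A t - A s + 0 * (t - s)) - κ)) := by
      have : Continuous fun ε : ℝ => (φ s + κ + ε) * Real.exp (A t - A s + ε * (t - s)) - κ := by
        fun_prop
      exact (this.tendsto 0).mono_left nhdsWithin_le_nhds
    have := ge_of_tendsto hlim (by
      filter_upwards [self_mem_nhdsWithin] with ε hε
      exact step s hs.1 t ⟨hs.2.le, ht.2⟩ ε hε)
    simp only [add_zero, zero_mul] at this
    linarith
  have hsub : Ioo 0 t ⊆ Icc 0 T := fun s hs => ⟨hs.1.le, hs.2.le.trans ht.2⟩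
  have h0mem : (0 : ℝ) ∈ Icc 0 T := ⟨le_rfl, ht.1.trans ht.2⟩
  have hlim : Tendsto (fun s => (φ s + κ) * Real.exp (A t - A s)) (𝓝[Ioo 0 t] 0)
      (𝓝 ((φ 0 + κ) * Real.exp (A t - A 0))) := by
    have c1 := (hφ 0 h0mem).mono hsub
    have c2 := (hA 0 h0mem).mono hsub
    exact ((c1.add_const κ).mul (Real.continuous_exp.continuousAt.comp_continuousWithinAt
      (continuousWithinAt_const.sub c2)))
  have : (𝓝[Ioo 0 t] (0 : ℝ)).NeBot := by
    rw [nhdsWithin_Ioo_eq_nhdsGT hpos]; infer_instance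
  exact ge_of_tendsto hlim (by
    filter_upwards [self_mem_nhdsWithin] with s hs
    exact step2 s hs)

end

section

variable {K : Velocity → Velocity → ℝ → ℝ} {b c α M k L : ℝ} {Φ : ℝ → ℝ}

/-! ### Truncation of densities -/

/-- Truncation of the values to `[0, M]`. -/
noncomputable def clip (M : ℝ) (u : Phase → ℝ) (p : Phase) : ℝ := max 0 (min (u p) M)

/-- Truncation of the values to `[0, M]` and of the velocities to `|v| ≤ k`. -/
noncomputable def cut (k M : ℝ) (u : Phase → ℝ) (p : Phase) : ℝ :=
  if ‖p.2‖ ≤ k then clip M u p else 0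

theorem occupation_clip (hM : 0 ≤ M) {u : Phase → ℝ} (hu : Measurable u) :
    Occupation M (clip M u) :=
  ⟨measurable_const.max (hu.min measurable_const),
    fun _ => ⟨le_max_left _ _, max_le hM (min_le_right _ _)⟩⟩

theorem clip_of_mem {u : Phase → ℝ} {p : Phase} (h : u p ∈ Icc 0 M) : clip M u p = u p := by
  rw [clip, min_eq_left h.2, max_eq_right h.1]

theorem clip_ae_eq {u : Phase → ℝ} (h : ∀ᵐ p : Phase, 0 ≤ u p ∧ u p ≤ M) :
    clip M u =ᵐ[volume] u := h.mono fun _ hp => clip_of_mem hp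

theorem abs_clip_sub_le (u w : Phase → ℝ) (p : Phase) : |clip M u p - clip M w p| ≤ |u p - w p| := by
  unfold clip
  refine (abs_max_sub_max_le_max _ _ _ _).trans ?_
  rw [sub_self, abs_zero, max_eq_right (abs_nonneg _)]
  refine (abs_min_sub_min_le_max _ _ _ _).trans ?_
  rw [sub_self, abs_zero, max_eq_left (abs_nonneg _)]

theorem measurableSet_norm_le (k : ℝ) : MeasurableSet {p : Phase | ‖p.2‖ ≤ k} :=
  measurableSet_le (by fun_prop) measurable_const

theorem occupation_cut (hM : 0 ≤ M) {u : Phase → ℝ} (hu : Measurable u) :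
    Occupation M (cut k M u) := by
  refine ⟨Measurable.ite (measurableSet_norm_le k) (occupation_clip hM hu).measurable
    measurable_const, fun p => ?_⟩
  unfold cut
  split_ifs
  exacts [(occupation_clip hM hu).mem p, ⟨le_rfl, hM⟩]

theorem abs_cut_sub_le (u w : Phase → ℝ) (p : Phase) : |cut k M u p - cut k M w p| ≤ |u p - w p| := by
  unfold cut
  split_ifs
  · exact abs_clip_sub_le u w p
  · simp

theorem cut_of_le {u : Phase → ℝ} {p : Phase} (h : ‖p.2‖ ≤ k) : cut k M u p = clip M u p := if_pos h

/-- The bound for the spatial density of densities supported in `|v| ≤ k`. -/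
noncomputable def ballBound (k M : ℝ) : ℝ := M * (volume (Metric.closedBall (0 : Velocity) k)).toReal

theorem ballBound_nonneg (hM : 0 ≤ M) : 0 ≤ ballBound k M := mul_nonneg hM ENNReal.toReal_nonneg

theorem density_cut (hM : 0 ≤ M) {u : Phase → ℝ} (hu : Measurable u) (x : UnitAddCircle) :
    ∫⁻ v : Velocity, ENNReal.ofReal (cut k M u (x, v)) ≤ ENNReal.ofReal (ballBound k M) := by
  have h1 : ∀ v : Velocity, ENNReal.ofReal (cut k M u (x, v)) ≤
      (Metric.closedBall (0 : Velocity) k).indicator (fun _ => ENNReal.ofReal M) v := by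
    intro v
    by_cases hv : v ∈ Metric.closedBall (0 : Velocity) k
    · rw [indicator_of_mem hv]
      exact ENNReal.ofReal_le_ofReal ((occupation_cut hM hu).mem _).2
    · rw [indicator_of_notMem hv]
      rw [mem_closedBall_zero_iff] at hv
      simp [cut, hv]
  refine (lintegral_mono h1).trans (le_of_eq ?_)
  rw [lintegral_indicator_const Metric.isClosed_closedBall.measurableSet, ballBound,
    ENNReal.ofReal_mul hM, ENNReal.ofReal_toReal]
  exact (measure_closedBall_lt_top).ne

theorem integrable_of_support {u : Phase → ℝ} (hu : Measurable u) {C : ℝ} (hC : ∀ p, |u p| ≤ C)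
    (hk : ∀ p, k < ‖p.2‖ → u p = 0) : Integrable u volume := by
  have hfin : volume {p : Phase | ‖p.2‖ ≤ k} ≠ ∞ := by
    have : {p : Phase | ‖p.2‖ ≤ k} = univ ×ˢ Metric.closedBall (0 : Velocity) k := by
      ext p; simp
    rw [this, Measure.volume_eq_prod, Measure.prod_prod]
    exact ENNReal.mul_ne_top (by simp) measure_closedBall_lt_top.ne
  have h1 : Integrable ({p : Phase | ‖p.2‖ ≤ k}.indicator fun _ => C) (volume : Measure Phase) :=
    (integrable_indicator_iff (measurableSet_norm_le k)).2 (integrableOn_const hfin)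
  refine h1.mono' hu.aestronglyMeasurable (Eventually.of_forall fun p => ?_)
  by_cases hp : ‖p.2‖ ≤ k
  · rw [indicator_of_mem (by exact hp)]; exact hC p
  · rw [hk p (not_le.1 hp), norm_zero, indicator_of_notMem (by exact hp)]

theorem cut_of_lt {u : Phase → ℝ} {p : Phase} (h : k < ‖p.2‖) : cut k M u p = 0 :=
  if_neg (not_le.2 h)

theorem boundedDensity_cut (hM : 0 ≤ M) {u : Phase → ℝ} (hu : Measurable u) :
    BoundedDensity M (ballBound k M) (cut k M u) := by
  have ho := occupation_cut (k := k) hM hu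
  refine ⟨ho, ?_, ballBound_nonneg hM, Eventually.of_forall (density_cut hM hu)⟩
  refine integrable_of_support (k := k) (C := (1 + k ^ 2) * M)
    (measurable_energyWeight.mul ho.measurable) (fun p => ?_)
    fun p hp => by rw [cut_of_lt hp, mul_zero]
  rw [abs_mul, abs_of_nonneg (energyWeight_nonneg p), abs_of_nonneg (ho.mem p).1]
  by_cases hp : ‖p.2‖ ≤ k
  · have : energyWeight p ≤ 1 + k ^ 2 := by unfold energyWeight; gcongr
    exact mul_le_mul this (ho.mem p).2 (ho.mem p).1 (by positivity)
  · rw [cut_of_lt (not_le.1 hp), mul_zero]; positivity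

theorem integral_cut_le (hM : 0 ≤ M) {u : Phase → ℝ} (hu : Measurable u) :
    ∫ p, cut k M u p ≤ ballBound k M := by
  have ho := occupation_cut (k := k) hM hu
  rw [integral_eq_lintegral_of_nonneg_ae (Eventually.of_forall fun p => (ho.mem p).1)
    ho.measurable.aestronglyMeasurable]
  refine ENNReal.toReal_le_of_le_ofReal (ballBound_nonneg hM) ?_
  rw [Measure.volume_eq_prod, lintegral_prod _ ho.measurable.ennreal_ofReal.aemeasurable]
  refine (lintegral_mono fun x => density_cut hM hu x).trans ?_
  simp

/-! ### Kernels with bounded support -/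

/-- The kernel lives on `|v|² + |v_*|² ≤ k²`. -/
def KernelSupport (K : Velocity → Velocity → ℝ → ℝ) (k : ℝ) : Prop :=
  ∀ v w φ, k ^ 2 < ‖v‖ ^ 2 + ‖w‖ ^ 2 → K v w φ = 0

theorem kernelSupport_truncKernel (K : Velocity → Velocity → ℝ → ℝ) (k : ℝ) :
    KernelSupport (truncKernel K k) k := fun _ _ φ h => truncKernel_of_lt h φ

theorem KernelSupport.norm_le (hS : KernelSupport K k) (hk : 0 ≤ k) {z : CollSpace}
    (hz : kernelOn K z ≠ 0) : ‖z.1.2‖ ≤ k ∧ ‖(ptStar z).2‖ ≤ k ∧ ‖(ptPost z).2‖ ≤ k ∧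
      ‖(ptPostStar z).2‖ ≤ k := by
  have h1 : ‖z.1.2‖ ^ 2 + ‖(ptStar z).2‖ ^ 2 ≤ k ^ 2 := by
    by_contra h
    exact hz (hS _ _ _ (not_le.1 h))
  have h2 : ‖(ptPost z).2‖ ^ 2 + ‖(ptPostStar z).2‖ ^ 2 ≤ k ^ 2 := by
    have := post_energy z.1.2 z.2.1 z.2.2
    simp only [ptPost, ptPostStar, ptStar] at *
    linarith
  refine ⟨?_, ?_, ?_, ?_⟩ <;> refine abs_le_of_sq_le_sq' ?_ hk |>.2 <;>
    nlinarith [sq_nonneg ‖z.1.2‖, sq_nonneg ‖(ptStar z).2‖, sq_nonneg ‖(ptPost z).2‖,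
      sq_nonneg ‖(ptPostStar z).2‖]

theorem KernelSupport.gain_loss_congr (hS : KernelSupport K k) (hk : 0 ≤ k) {u w : Phase → ℝ}
    (h : ∀ p, ‖p.2‖ ≤ k → u p = w p) :
    gainFn K Φ u = gainFn K Φ w ∧ lossFn K Φ u = lossFn K Φ w := by
  constructor <;> funext z <;> simp only [gainFn, lossFn] <;> by_cases hz : kernelOn K z = 0
  · simp [hz]
  · obtain ⟨h1, h2, h3, h4⟩ := hS.norm_le hk hz
    rw [h _ h1, h _ h2, h _ h3, h _ h4]
  · simp [hz]
  · obtain ⟨h1, h2, h3, h4⟩ := hS.norm_le hk hz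
    rw [h _ h1, h _ h2, h _ h3, h _ h4]

theorem KernelSupport.collQ_congr (hS : KernelSupport K k) (hk : 0 ≤ k) {u w : Phase → ℝ}
    (h : ∀ p, ‖p.2‖ ≤ k → u p = w p) : collQ K Φ u = collQ K Φ w := by
  obtain ⟨h1, h2⟩ := hS.gain_loss_congr (Φ := Φ) hk h
  unfold collQ
  rw [h1, h2]

theorem KernelSupport.collInt_congr (hS : KernelSupport K k) (hk : 0 ≤ k) {u w : Phase → ℝ}
    (h : ∀ p, ‖p.2‖ ≤ k → u p = w p) (hc : CollInt K Φ u) : CollInt K Φ w := by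
  obtain ⟨h1, h2⟩ := hS.gain_loss_congr (Φ := Φ) hk h
  unfold CollInt at *
  rwa [← h1, ← h2]

theorem KernelSupport.collQ_eq_zero (hS : KernelSupport K k) (hk : 0 ≤ k) {u : Phase → ℝ} {p : Phase}
    (hp : k < ‖p.2‖) : collQ K Φ u p = 0 := by
  have h0 : ∀ q : Velocity × ℝ, kernelOn K (p, q) = 0 := fun q => by
    by_contra h
    exact absurd (hS.norm_le hk h).1 (not_le.2 hp)
  simp [collQ, gainFn, lossFn, h0]

/-! ### The collision operator on `L¹` -/

open Classical in
/-- The collision term as an element of `L¹`. -/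
noncomputable def collL (K : Velocity → Velocity → ℝ → ℝ) (Φ : ℝ → ℝ) (u : Phase → ℝ) : PhaseL1 :=
  if h : Integrable (collQ K Φ u) volume then h.toL1 _ else 0

theorem coeFn_collL {u : Phase → ℝ} (h : CollInt K Φ u) :
    collL K Φ u =ᵐ[volume] collQ K Φ u := by
  rw [collL, dif_pos h.integrable_collQ]
  exact h.integrable_collQ.coeFn_toL1

theorem norm_sub_eq_integral {u w : PhaseL1} {f g : Phase → ℝ} (hu : u =ᵐ[volume] f)
    (hw : w =ᵐ[volume] g) : ‖u - w‖ = ∫ p, |f p - g p| := by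
  rw [L1.norm_eq_integral_norm]
  refine integral_congr_ae ?_
  filter_upwards [Lp.coeFn_sub u w, hu, hw] with p h1 h2 h3
  rw [h1, Pi.sub_apply, h2, h3, Real.norm_eq_abs]

theorem measurable_L1 (u : PhaseL1) : Measurable u := (Lp.stronglyMeasurable u).measurable

/-- Lipschitz constant of the truncated collision operator. -/
noncomputable def truncLip (M b c k L : ℝ) : ℝ := collConst M b c * ballBound k M * (1 + L)

theorem collConst_nonneg (hb : 0 ≤ b) (hc : 0 ≤ c) : 0 ≤ collConst M b c := by
  unfold collConst; positivity

theorem truncLip_nonneg (hb : 0 ≤ b) (hc : 0 ≤ c) (hM : 0 ≤ M) (hL : 0 ≤ L) :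
    0 ≤ truncLip M b c k L :=
  mul_nonneg (mul_nonneg (collConst_nonneg hb hc) (ballBound_nonneg hM)) (by linarith)

theorem integral_abs_collQ_cut_le (hK : CollisionKernel K b c) (hb : 0 ≤ b) (hc : 0 ≤ c)
    (hM : 1 ≤ M) (hΦ : FillingFunction α M Φ) (hL0 : 0 ≤ L)
    (hL : ∀ y ∈ Icc 0 M, ∀ z ∈ Icc 0 M, |Φ y - Φ z| ≤ L * |y - z|) {u w : Phase → ℝ}
    (hu : Measurable u) (hw : Measurable w) :
    ∫ p, |collQ K Φ (cut k M u) p - collQ K Φ (cut k M w) p| ≤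
      truncLip M b c k L * ∫ p, |cut k M u p - cut k M w p| := by
  have hM0 : 0 ≤ M := by linarith
  have h1 := boundedDensity_cut (k := k) hM0 hu
  have h2 := boundedDensity_cut (k := k) hM0 hw
  have := integral_abs_collQ_le hK hb hc hM hΦ h1.toOccupation h1.integrable h1.density h2 hL0
    le_rfl (Eventually.of_forall fun p => by
      rw [zero_mul, add_zero]; exact hL _ (h1.mem p) _ (h2.mem p))
  rw [zero_mul, add_zero] at this
  rw [truncLip, mul_assoc _ (1 + L)]
  exact this

theorem norm_collL_cut_sub_le (hK : CollisionKernel K b c) (hb : 0 ≤ b) (hc : 0 ≤ c)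
    (hM : 1 ≤ M) (hΦ : FillingFunction α M Φ) (hL0 : 0 ≤ L)
    (hL : ∀ y ∈ Icc 0 M, ∀ z ∈ Icc 0 M, |Φ y - Φ z| ≤ L * |y - z|) (u w : PhaseL1) :
    ‖collL K Φ (cut k M u) - collL K Φ (cut k M w)‖ ≤ truncLip M b c k L * ‖u - w‖ := by
  have hM0 : 0 ≤ M := by linarith
  have h1 := boundedDensity_cut (k := k) hM0 (measurable_L1 u)
  have h2 := boundedDensity_cut (k := k) hM0 (measurable_L1 w)
  rw [norm_sub_eq_integral (coeFn_collL (h1.collInt hK hb hM0 hΦ))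
    (coeFn_collL (h2.collInt hK hb hM0 hΦ)),
    norm_sub_eq_integral (EventuallyEq.refl _ u) (EventuallyEq.refl _ w)]
  refine (integral_abs_collQ_cut_le hK hb hc hM hΦ hL0 hL (measurable_L1 u)
    (measurable_L1 w)).trans ?_
  refine mul_le_mul_of_nonneg_left ?_ (truncLip_nonneg hb hc hM0 hL0)
  exact integral_mono (h1.integrable.sub h2.integrable).abs
    ((L1.integrable_coeFn u).sub (L1.integrable_coeFn w)).abs fun p => abs_cut_sub_le _ _ p

theorem norm_collL_cut_le (hK : CollisionKernel K b c) (hb : 0 ≤ b) (hc : 0 ≤ c)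
    (hM : 1 ≤ M) (hΦ : FillingFunction α M Φ) (hL0 : 0 ≤ L)
    (hL : ∀ y ∈ Icc 0 M, ∀ z ∈ Icc 0 M, |Φ y - Φ z| ≤ L * |y - z|) (u : PhaseL1) :
    ‖collL K Φ (cut k M u)‖ ≤ truncLip M b c k L * ballBound k M := by
  have hM0 : 0 ≤ M := by linarith
  have h1 := boundedDensity_cut (k := k) hM0 (measurable_L1 u)
  have e0 : cut k M (fun _ => (0 : ℝ)) = fun _ => 0 := by
    funext p; simp [cut, clip, hM0]
  have e1 : collQ K Φ (fun _ => 0) = fun _ => 0 := by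
    funext p; simp [collQ, gainFn, lossFn]
  have h3 := integral_abs_collQ_cut_le (k := k) hK hb hc hM hΦ hL0 hL (measurable_L1 u)
    (measurable_const (a := (0 : ℝ)))
  rw [e0, e1] at h3
  rw [← sub_zero (collL K Φ _), norm_sub_eq_integral (coeFn_collL (h1.collInt hK hb hM0 hΦ))
    (Lp.coeFn_zero ℝ 1 volume)]
  refine h3.trans (mul_le_mul_of_nonneg_left ?_ (truncLip_nonneg hb hc hM0 hL0))
  simp only [sub_zero, abs_of_nonneg (h1.mem _).1]
  exact integral_cut_le hM0 (measurable_L1 u)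

/-- Solutions of the truncated equation along characteristics. -/
theorem exists_truncated_flow (hK : CollisionKernel K b c) (hb : 0 ≤ b) (hc : 0 ≤ c)
    (hM : 1 ≤ M) (hΦ : FillingFunction α M Φ) (hL0 : 0 ≤ L)
    (hL : ∀ y ∈ Icc 0 M, ∀ z ∈ Icc 0 M, |Φ y - Φ z| ≤ L * |y - z|) (u₀ : PhaseL1) (k : ℝ) {T : ℝ}
    (hT : 0 ≤ T) :
    ∃ h : ℝ → PhaseL1, h 0 = u₀ ∧ ∀ t ∈ Icc 0 T,
      HasDerivWithinAt h (sharp t (collL K Φ (cut k M (sharp (-t) (h t))))) (Icc 0 T) t := by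
  have hM0 : 0 ≤ M := by linarith
  set V : ℝ → PhaseL1 → PhaseL1 := fun t u => sharp t (collL K Φ (cut k M (sharp (-t) u))) with hV
  set ℓ := truncLip M b c k L with hℓ
  have hℓ0 : 0 ≤ ℓ := truncLip_nonneg hb hc hM0 hL0
  have hlip : LipschitzWith (Real.toNNReal ℓ) fun u : PhaseL1 => collL K Φ (cut k M u) :=
    LipschitzWith.of_dist_le_mul fun u w => by
      rw [dist_eq_norm, dist_eq_norm, Real.coe_toNNReal _ hℓ0]
      exact norm_collL_cut_sub_le hK hb hc hM hΦ hL0 hL u w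
  have hbd : 0 ≤ ℓ * ballBound k M := mul_nonneg hℓ0 (ballBound_nonneg hM0)
  -- The truncated field is bounded and Lipschitz on all of L¹, so a ball with radius the bound
  -- times T contains the trajectory and T is not restricted.
  have hPL : IsPicardLindelof V (⟨0, le_rfl, hT⟩ : Icc (0 : ℝ) T) u₀
      (Real.toNNReal (ℓ * ballBound k M * T)) 0 (Real.toNNReal (ℓ * ballBound k M))
      (Real.toNNReal ℓ) := by
    refine ⟨fun t _ => LipschitzWith.lipschitzOnWith (LipschitzWith.of_dist_le_mul fun u w => ?_),
      fun u _ => ?_, fun t _ u _ => ?_, ?_⟩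
    · simp only [hV]
      rw [dist_eq_norm, dist_eq_norm, ← sharp_sub, norm_sharp, Real.coe_toNNReal _ hℓ0]
      refine (norm_collL_cut_sub_le hK hb hc hM hΦ hL0 hL _ _).trans ?_
      rw [← sharp_sub, norm_sharp]
    · exact continuousOn_sharp continuousOn_id (hlip.continuous.comp_continuousOn
        (continuousOn_sharp continuousOn_neg continuousOn_const))
    · simp only [hV]
      rw [norm_sharp, Real.coe_toNNReal _ hbd]
      exact norm_collL_cut_le hK hb hc hM hΦ hL0 hL _
    · rw [Real.coe_toNNReal _ hbd, Real.coe_toNNReal _ (mul_nonneg hbd hT)]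
      simp [hT]
  obtain ⟨h, h0, hd⟩ := hPL.exists_eq_forall_mem_Icc_hasDerivWithinAt₀
  exact ⟨h, h0, hd⟩

end

section

/-! ### Gronwall estimates for positive parts -/

section PosPart

variable {X : Type*} [MeasurableSpace X] {μ : Measure X}

theorem hasDerivWithinAt_Ioi_of_Icc {E : Type*} [NormedAddCommGroup E] [NormedSpace ℝ E] {h : ℝ → E}
    {h' : E} {T t : ℝ} (hd : HasDerivWithinAt h h' (Icc 0 T) t) (ht : t ∈ Ico 0 T) :
    HasDerivWithinAt h h' (Ioi t) t :=
  hd.mono_of_mem_nhdsWithin (Icc_mem_nhdsGT_of_mem ht)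

theorem hasDerivWithinAt_Ici_of_Icc {E : Type*} [NormedAddCommGroup E] [NormedSpace ℝ E] {h : ℝ → E}
    {h' : E} {T t : ℝ} (hd : HasDerivWithinAt h h' (Icc 0 T) t) (ht : t ∈ Ico 0 T) :
    HasDerivWithinAt h h' (Ici t) t :=
  (hasDerivWithinAt_Ioi_of_Icc hd ht).Ici_of_Ioi

theorem continuous_integral_posPart :
    Continuous fun u : Lp ℝ 1 μ => ∫ x, max (u x) 0 ∂μ := by
  have h1 : Continuous fun u : Lp ℝ 1 μ => ∫ x, (Lp.posPart u) x ∂μ :=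
    continuous_integral.comp Lp.continuous_posPart
  refine h1.congr fun u => integral_congr_ae ?_
  exact Lp.coeFn_posPart u

theorem integral_posPart_le_exp {h h' : ℝ → Lp ℝ 1 μ} {T κ : ℝ} {A a : ℝ → ℝ} (hκ : 0 ≤ κ)
    (hd : ∀ t ∈ Icc 0 T, HasDerivWithinAt h (h' t) (Icc 0 T) t) (hA : ContinuousOn A (Icc 0 T))
    (hA' : ∀ t, 0 < t → HasDerivAt A (a t) t)
    (hβ : ∀ t ∈ Ioo 0 T, ∃ β : X → ℝ, Integrable β μ ∧ (∀ x, 0 ≤ β x) ∧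
      (∀ᵐ x ∂μ, 0 ≤ h t x → h' t x ≤ β x) ∧ ∫ x, β x ∂μ ≤ a t * ((∫ x, max (h t x) 0 ∂μ) + κ)) :
    ∀ t ∈ Icc 0 T, (∫ x, max (h t x) 0 ∂μ) + κ ≤
      ((∫ x, max (h 0 x) 0 ∂μ) + κ) * Real.exp (A t - A 0) := by
  refine gronwall_slope (φ := fun t => ∫ x, max (h t x) 0 ∂μ) (a := a)
    (continuous_integral_posPart.comp_continuousOn fun t ht => (hd t ht).continuousWithinAt) hκ
    (fun t => integral_nonneg fun x => le_max_right _ _) hA hA' fun t ht r hr => ?_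
  obtain ⟨β, hβi, hβ0, hβh, hβr⟩ := hβ t ht
  exact posPart_slope_lt (hasDerivWithinAt_Ioi_of_Icc (hd t ⟨ht.1.le, ht.2.le⟩) ⟨ht.1.le, ht.2⟩)
    hβi hβ0 hβh (hβr.trans_lt hr)

/-- Nonpositivity is preserved if the derivative is nonpositive where the function is
nonnegative. -/
theorem ae_nonpos_of_deriv {h h' : ℝ → Lp ℝ 1 μ} {T : ℝ}
    (hd : ∀ t ∈ Icc 0 T, HasDerivWithinAt h (h' t) (Icc 0 T) t) (h0 : ∀ᵐ x ∂μ, h 0 x ≤ 0)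
    (hneg : ∀ t ∈ Ioo 0 T, ∀ᵐ x ∂μ, 0 ≤ h t x → h' t x ≤ 0) :
    ∀ t ∈ Icc 0 T, ∀ᵐ x ∂μ, h t x ≤ 0 := by
  intro t ht
  have h1 := integral_posPart_le_exp (A := fun _ => 0) (a := fun _ => 0) le_rfl hd
    continuousOn_const (fun t _ => hasDerivAt_const _ _) (fun s hs => ⟨fun _ => 0,
      integrable_zero _ _ _, fun _ => le_rfl, hneg s hs, by simp⟩) t ht
  have h2 : ∫ x, max (h 0 x) 0 ∂μ = 0 := by
    refine integral_eq_zero_of_ae ?_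
    filter_upwards [h0] with x hx
    exact max_eq_right hx
  simp only [h2, add_zero, zero_mul] at h1
  have h3 : ∀ᵐ x ∂μ, max (h t x) 0 = 0 :=
    (integral_eq_zero_iff_of_nonneg (fun x => le_max_right _ _)
      (L1.integrable_coeFn (h t)).pos_part).1
      (le_antisymm h1 (integral_nonneg fun x => le_max_right _ _))
  filter_upwards [h3] with x hx
  exact hx ▸ le_max_left _ _

end PosPart

/-! ### Solutions with values in `[0, M]` -/

variable {K : Velocity → Velocity → ℝ → ℝ} {b c α M k L T : ℝ} {Φ : ℝ → ℝ}

/-- Strong solutions on `[0, T]` of the kinetic equation with kernel `K` and filling function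
`Φ`. -/
structure KineticSolution (K : Velocity → Velocity → ℝ → ℝ) (Φ : ℝ → ℝ) (M T : ℝ)
    (f : ℝ → PhaseL1) : Prop where
  range : ∀ t ∈ Icc 0 T, ∀ᵐ p : Phase, 0 ≤ f t p ∧ f t p ≤ M
  coll : ∀ t ∈ Icc 0 T, CollInt K Φ (clip M (f t))
  cont : ContinuousOn (fun t => sharp t (collL K Φ (clip M (f t)))) (Icc 0 T)
  deriv : ∀ t ∈ Icc 0 T, HasDerivWithinAt (fun s => sharp s (f s))
    (sharp t (collL K Φ (clip M (f t)))) (Icc 0 T) t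

namespace KineticSolution

variable {f : ℝ → PhaseL1}

theorem mono (hf : KineticSolution K Φ M T f) {T' : ℝ} (hT : T' ≤ T) :
    KineticSolution K Φ M T' f := by
  have hs : Icc 0 T' ⊆ Icc 0 T := Icc_subset_Icc_right hT
  exact ⟨fun t ht => hf.range t (hs ht), fun t ht => hf.coll t (hs ht), hf.cont.mono hs,
    fun t ht => (hf.deriv t (hs ht)).mono hs⟩

theorem clip_ae (hf : KineticSolution K Φ M T f) {t : ℝ} (ht : t ∈ Icc 0 T) :
    clip M (f t) =ᵐ[volume] f t := clip_ae_eq (hf.range t ht)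

theorem coeFn_sharp_collL (hf : KineticSolution K Φ M T f) {t : ℝ} (ht : t ∈ Icc 0 T) :
    sharp t (collL K Φ (clip M (f t))) =ᵐ[volume]
      fun p => collQ K Φ (clip M (f t)) (freeFlow t p) := by
  filter_upwards [coeFn_sharp t (collL K Φ (clip M (f t))),
    ae_freeFlow t (coeFn_collL (hf.coll t ht))] with p h1 h2
  rw [h1, h2]

theorem continuousOn (hf : KineticSolution K Φ M T f) : ContinuousOn f (Icc 0 T) := by
  have h1 : ContinuousOn (fun s => sharp s (f s)) (Icc 0 T) := fun t ht =>
    (hf.deriv t ht).continuousWithinAt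
  refine (continuousOn_sharp (τ := fun t => -t) continuousOn_neg h1).congr fun t _ => ?_
  exact (sharp_neg_sharp t (f t)).symm

end KineticSolution

theorem collQ_nonneg_of_eq_zero (hK : CollisionKernel K b c) (hΦ : FillingFunction α M Φ)
    {u : Phase → ℝ} (hu : Occupation M u) {p : Phase} (hp : u p = 0) : 0 ≤ collQ K Φ u p := by
  refine integral_nonneg fun q => ?_
  have h1 : lossFn K Φ u (p, q) = 0 := by simp [lossFn, hp]
  simp only [h1, sub_zero]
  exact gainFn_nonneg hK hΦ hu _

theorem collQ_nonpos_of_eq_full (hK : CollisionKernel K b c) (hΦ : FillingFunction α M Φ)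
    {u : Phase → ℝ} (hu : Occupation M u) {p : Phase} (hp : u p = M) : collQ K Φ u p ≤ 0 := by
  refine integral_nonpos fun q => ?_
  have h1 : gainFn K Φ u (p, q) = 0 := by simp [gainFn, hp, hΦ.full]
  simp only [h1, zero_sub]
  exact neg_nonpos.2 (lossFn_nonneg hK hΦ hu _)

theorem ae_freeFlow_neg_sharp (t : ℝ) (u : PhaseL1) :
    ∀ᵐ p : Phase, sharp (-t) u (freeFlow t p) = u p := by
  filter_upwards [ae_freeFlow t (coeFn_sharp (-t) u)] with p hp
  rw [hp, freeFlow_freeFlow, neg_add_cancel, freeFlow_zero]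

/-- The flow is solved with densities clipped to [0, M]. An empty state has no loss and a full one
no gain because Φ(M) = 0, so the solution never leaves [0, M] and the clipping may be removed. -/
theorem exists_truncated_solution (hK : CollisionKernel K b c) (hb : 0 ≤ b) (hc : 0 ≤ c)
    (hM : 1 ≤ M) (hΦ : FillingFunction α M Φ) (hk : 0 ≤ k) (hS : KernelSupport K k) (hL0 : 0 ≤ L)
    (hL : ∀ y ∈ Icc 0 M, ∀ z ∈ Icc 0 M, |Φ y - Φ z| ≤ L * |y - z|) {u₀ : PhaseL1}
    (hu₀ : ∀ᵐ p : Phase, 0 ≤ u₀ p ∧ u₀ p ≤ M) (hT : 0 ≤ T) :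
    ∃ f : ℝ → PhaseL1, f 0 = u₀ ∧ KineticSolution K Φ M T f := by
  have hM0 : 0 ≤ M := by linarith
  obtain ⟨h, h0, hd⟩ := exists_truncated_flow hK hb hc hM hΦ hL0 hL u₀ k hT
  set f : ℝ → PhaseL1 := fun t => sharp (-t) (h t) with hf
  have hbd := fun t => boundedDensity_cut (k := k) hM0 (measurable_L1 (f t))
  have hV : ∀ t, sharp t (collL K Φ (cut k M (f t))) =ᵐ[volume]
      fun p => collQ K Φ (cut k M (f t)) (freeFlow t p) := by
    intro t
    filter_upwards [coeFn_sharp t (collL K Φ (cut k M (f t))),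
      ae_freeFlow t (coeFn_collL ((hbd t).collInt hK hb hM0 hΦ))] with p h1 h2
    rw [h1, h2]
  have hlow : ∀ t ∈ Icc 0 T, ∀ᵐ p : Phase, (-h t) p ≤ 0 := by
    refine ae_nonpos_of_deriv (h := fun t => -h t) (fun t ht => (hd t ht).neg) ?_ ?_
    · filter_upwards [Lp.coeFn_neg (h 0), hu₀] with p h1 h2
      rw [h1, Pi.neg_apply, h0]; linarith [h2.1]
    · intro t _
      filter_upwards [Lp.coeFn_neg (h t), Lp.coeFn_neg (sharp t (collL K Φ (cut k M (f t)))), hV t,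
        ae_freeFlow_neg_sharp t (h t)] with p h1 h2 h3 h4 h5
      rw [h2, Pi.neg_apply, h3]
      rw [h1, Pi.neg_apply, ← h4] at h5
      refine neg_nonpos.2 (collQ_nonneg_of_eq_zero hK hΦ (hbd t).toOccupation ?_)
      unfold cut clip
      split_ifs
      · exact max_eq_left ((min_le_left _ _).trans (by linarith))
      · rfl
  -- The constant M is not integrable over phase space. Beyond |v| = k particles stream freely, so
  -- there the initial value serves as an upper barrier.
  set W : Phase → ℝ := fun p => if ‖p.2‖ ≤ k then M else u₀ p with hW
  have hWi : Integrable W volume := by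
    have h1 : Integrable (fun p : Phase => if ‖p.2‖ ≤ k then M else 0) volume := by
      refine integrable_of_support (k := k) (C := M)
        (Measurable.ite (measurableSet_norm_le k) measurable_const measurable_const)
        (fun p => ?_) fun p hp => if_neg (not_le.2 hp)
      split_ifs
      · rw [abs_of_nonneg hM0]
      · simpa using hM0
    have h2 : Integrable (fun p : Phase => if ‖p.2‖ ≤ k then 0 else u₀ p) volume := by
      refine (L1.integrable_coeFn u₀).mono
        (Measurable.ite (measurableSet_norm_le k) measurable_const
          (measurable_L1 u₀)).aestronglyMeasurable (Eventually.of_forall fun p => ?_)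
      split_ifs
      · simp
      · exact le_rfl
    refine (h1.add h2).congr (Eventually.of_forall fun p => ?_)
    simp only [hW, Pi.add_apply]
    split_ifs <;> simp
  have hup : ∀ t ∈ Icc 0 T, ∀ᵐ p : Phase, (h t - hWi.toL1 W) p ≤ 0 := by
    refine ae_nonpos_of_deriv (h := fun t => h t - hWi.toL1 W)
      (fun t ht => (hd t ht).sub_const _) ?_ ?_
    · filter_upwards [Lp.coeFn_sub (h 0) (hWi.toL1 W), hWi.coeFn_toL1, hu₀] with p h1 h2 h3
      rw [h1, Pi.sub_apply, h2, h0]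
      simp only [hW]
      split_ifs
      · linarith
      · simp
    · intro t _
      filter_upwards [Lp.coeFn_sub (h t) (hWi.toL1 W), hWi.coeFn_toL1, hV t,
        ae_freeFlow_neg_sharp t (h t)] with p h1 h2 h3 h4 h5
      rw [h3]
      rw [h1, Pi.sub_apply, h2, ← h4] at h5
      rcases le_or_gt ‖p.2‖ k with hp | hp
      · refine collQ_nonpos_of_eq_full hK hΦ (hbd t).toOccupation ?_
        have hp' : ‖(freeFlow t p).2‖ ≤ k := hp
        simp only [hW, if_pos hp] at h5
        rw [cut_of_le hp', clip, min_eq_right (by linarith), max_eq_right hM0]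
      · exact (hS.collQ_eq_zero hk (p := freeFlow t p) hp).le
  have hrange : ∀ t ∈ Icc 0 T, ∀ᵐ p : Phase, 0 ≤ f t p ∧ f t p ≤ M := by
    intro t ht
    refine ae_of_ae_freeFlow t ?_
    filter_upwards [hlow t ht, hup t ht, Lp.coeFn_neg (h t), Lp.coeFn_sub (h t) (hWi.toL1 W),
      hWi.coeFn_toL1, ae_freeFlow_neg_sharp t (h t), hu₀] with p a1 a2 a3 a4 a5 a6 a7
    rw [a3, Pi.neg_apply] at a1
    rw [a4, Pi.sub_apply, a5] at a2
    simp only [hf, a6]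
    refine ⟨by linarith, ?_⟩
    have : W p ≤ M := by
      simp only [hW]
      split_ifs
      exacts [le_rfl, a7.2]
    linarith
  have heq : ∀ t, collL K Φ (cut k M (f t)) = collL K Φ (clip M (f t)) := by
    intro t
    unfold collL
    rw [hS.collQ_congr hk (w := clip M (f t)) fun p hp => cut_of_le hp]
  have hlip : LipschitzWith (Real.toNNReal (truncLip M b c k L))
      fun u : PhaseL1 => collL K Φ (cut k M u) :=
    LipschitzWith.of_dist_le_mul fun u w => by
      rw [dist_eq_norm, dist_eq_norm, Real.coe_toNNReal _ (truncLip_nonneg hb hc hM0 hL0)]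
      exact norm_collL_cut_sub_le hK hb hc hM hΦ hL0 hL u w
  have hfc : ContinuousOn f (Icc 0 T) :=
    continuousOn_sharp (τ := fun t => -t) continuousOn_neg
      fun t ht => (hd t ht).continuousWithinAt
  refine ⟨f, ?_, hrange, fun t _ => ?_, ?_, fun t ht => ?_⟩
  · simp only [hf, neg_zero, sharp_zero, h0]
  · exact hS.collInt_congr hk (fun p hp => cut_of_le hp) ((hbd t).collInt hK hb hM0 hΦ)
  · simp only [← heq]
    exact continuousOn_sharp continuousOn_id (hlip.continuous.comp_continuousOn hfc)
  · rw [← heq]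
    refine (hd t ht).congr (fun s _ => ?_) ?_ <;> exact sharp_sharp_neg _ _

end

section

variable {K : Velocity → Velocity → ℝ → ℝ} {b c α M k L T : ℝ} {Φ : ℝ → ℝ}

/-! ### Moments of solutions -/

theorem integrable_weight_mul {X : Type*} [MeasurableSpace X] {μ : Measure X} {ω : X → ℝ}
    (hω : Measurable ω) {C : ℝ} (hC : ∀ x, |ω x| ≤ C) {u : X → ℝ} (hu : Integrable u μ) :
    Integrable (fun x => ω x * u x) μ :=
  hu.bdd_mul hω.aestronglyMeasurable (Eventually.of_forall hC)

/-- Integration against a bounded weight as a continuous functional on `L¹`. -/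
theorem exists_weight_functional {ω : Phase → ℝ} (hω : Measurable ω) {C : ℝ} (hC : ∀ p, |ω p| ≤ C) :
    ∃ ℓ : PhaseL1 →L[ℝ] ℝ, ∀ u, ℓ u = ∫ p, ω p * u p := by
  have hi : ∀ u : PhaseL1, Integrable (fun p => ω p * u p) volume := fun u =>
    integrable_weight_mul hω hC (L1.integrable_coeFn u)
  refine ⟨LinearMap.mkContinuous
    { toFun := fun u => ∫ p, ω p * u p
      map_add' := fun u w => ?_
      map_smul' := fun r u => ?_ } C fun u => ?_, fun u => rfl⟩
  · rw [← integral_add (hi u) (hi w)]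
    refine integral_congr_ae ?_
    filter_upwards [Lp.coeFn_add u w] with p hp
    rw [hp, Pi.add_apply, mul_add]
  · rw [RingHom.id_apply, smul_eq_mul, ← integral_const_mul]
    refine integral_congr_ae ?_
    filter_upwards [Lp.coeFn_smul r u] with p hp
    rw [hp, Pi.smul_apply, smul_eq_mul]; ring
  · change ‖∫ p, ω p * u p‖ ≤ _
    rw [L1.norm_eq_integral_norm, ← integral_const_mul]
    refine (norm_integral_le_integral_norm _).trans (integral_mono (hi u).norm
      ((L1.integrable_coeFn u).norm.const_mul C) fun p => ?_)
    simp only [norm_mul]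
    exact mul_le_mul_of_nonneg_right (hC p) (norm_nonneg _)

theorem integral_weight_sharp {ω : Velocity → ℝ} (hω : Measurable ω) (t : ℝ) (u : PhaseL1) :
    ∫ p : Phase, ω p.2 * sharp t u p = ∫ p : Phase, ω p.2 * u p := by
  have h1 : (fun p : Phase => ω p.2 * sharp t u p) =ᵐ[volume]
      fun p => (fun p : Phase => ω p.2 * u p) (freeFlow t p) := by
    filter_upwards [coeFn_sharp t u] with p hp
    rw [hp]; rfl
  rw [integral_congr_ae h1]
  exact integral_comp_freeFlow t
    ((hω.comp measurable_snd).mul (measurable_L1 u)).aestronglyMeasurable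

namespace KineticSolution

variable {f : ℝ → PhaseL1}

/-- A weight in the velocity alone does not see the streaming, so the moment of f itself is
differentiable even though only f^♯ is. -/
theorem hasDerivWithinAt_weight (hf : KineticSolution K Φ M T f) {ω : Velocity → ℝ}
    (hω : Measurable ω) {C : ℝ} (hC : ∀ v, |ω v| ≤ C) {t : ℝ} (ht : t ∈ Icc 0 T) :
    HasDerivWithinAt (fun s => ∫ p : Phase, ω p.2 * f s p)
      (∫ p : Phase, ω p.2 * collQ K Φ (clip M (f t)) p) (Icc 0 T) t := by
  obtain ⟨ℓ, hℓ⟩ := exists_weight_functional (ω := fun p : Phase => ω p.2)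
    (hω.comp measurable_snd) (fun p => hC p.2)
  have h1 := ℓ.hasFDerivAt.comp_hasDerivWithinAt t (hf.deriv t ht)
  have h2 : ℓ (sharp t (collL K Φ (clip M (f t)))) =
      ∫ p : Phase, ω p.2 * collQ K Φ (clip M (f t)) p := by
    rw [hℓ, integral_weight_sharp hω]
    refine integral_congr_ae ?_
    filter_upwards [coeFn_collL (hf.coll t ht)] with p hp
    rw [hp]
  rw [h2] at h1
  refine h1.congr (fun s _ => ?_) ?_ <;>
  · simp only [Function.comp_apply, hℓ]
    exact (integral_weight_sharp hω _ _).symm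

theorem integral_weight_const (hf : KineticSolution K Φ M T f) {ω : Velocity → ℝ}
    (hω : Measurable ω) {C : ℝ} (hC : ∀ v, |ω v| ≤ C)
    (h0 : ∀ t ∈ Icc 0 T, ∫ p : Phase, ω p.2 * collQ K Φ (clip M (f t)) p = 0) :
    ∀ t ∈ Icc 0 T, ∫ p : Phase, ω p.2 * f t p = ∫ p : Phase, ω p.2 * f 0 p := by
  refine constant_of_has_deriv_right_zero
    (fun t ht => (hf.hasDerivWithinAt_weight hω hC ht).continuousWithinAt) fun t ht => ?_
  have := hasDerivWithinAt_Ici_of_Icc (hf.hasDerivWithinAt_weight hω hC ⟨ht.1, ht.2.le⟩) ht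
  rwa [h0 t ⟨ht.1, ht.2.le⟩] at this

theorem integral_eq (hf : KineticSolution K Φ M T f) (hK : CollisionKernel K b c) :
    ∀ t ∈ Icc 0 T, ∫ p : Phase, f t p = ∫ p : Phase, f 0 p := by
  intro t ht
  have := hf.integral_weight_const (ω := fun _ => 1) measurable_const (C := 1) (by simp)
    (fun s hs => by simpa using integral_collQ_eq_zero hK (hf.coll s hs)) t ht
  simpa using this

/-- Fast particles stream freely if the kernel has bounded support. -/
theorem sharp_ae_eq_of_lt (hf : KineticSolution K Φ M T f) (hk : 0 ≤ k) (hS : KernelSupport K k) :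
    ∀ t ∈ Icc 0 T, ∀ᵐ p : Phase, k < ‖p.2‖ → sharp t (f t) p = f 0 p := by
  set S : Set Phase := {p | k < ‖p.2‖} with hSdef
  have hSm : MeasurableSet S := measurableSet_lt measurable_const (by fun_prop)
  let R := LpToLpRestrictCLM Phase ℝ ℝ (volume : Measure Phase) 1 S
  have hR : ∀ u : PhaseL1, R u =ᵐ[volume.restrict S] u := fun u => LpToLpRestrictCLM_coeFn ℝ S u
  have hd : ∀ t ∈ Icc 0 T, HasDerivWithinAt (fun s => R (sharp s (f s))) 0 (Icc 0 T) t := by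
    intro t ht
    have h1 := R.hasFDerivAt.comp_hasDerivWithinAt t (hf.deriv t ht)
    have h2 : R (sharp t (collL K Φ (clip M (f t)))) = 0 := by
      refine Lp.ext ?_
      filter_upwards [hR (sharp t (collL K Φ (clip M (f t)))), Lp.coeFn_zero ℝ 1 (volume.restrict S),
        ae_restrict_of_ae (hf.coeFn_sharp_collL ht), ae_restrict_mem hSm] with p a1 a2 a3 a4
      rw [a1, a2, a3]
      exact hS.collQ_eq_zero hk (p := freeFlow t p) a4
    rwa [h2] at h1
  intro t ht
  have h3 := constant_of_has_deriv_right_zero (fun s hs => (hd s hs).continuousWithinAt)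
    (fun s hs => hasDerivWithinAt_Ici_of_Icc (hd s ⟨hs.1, hs.2.le⟩) hs) t ht
  rw [sharp_zero] at h3
  refine (ae_restrict_iff' hSm).1 ?_
  filter_upwards [hR (sharp t (f t)), hR (f 0)] with p a1 a2
  rw [← a1, ← a2, h3]

/-- The energy weight is unbounded and hence no functional on L¹. It is cut at |v| = k: the slow
part is a bounded weight whose collision moment vanishes, since the truncated collision term lives
on |v| ≤ k, and the fast part is constant along characteristics. -/
theorem energy_eq (hf : KineticSolution K Φ M T f) (hK : CollisionKernel K b c) (hb : 0 ≤ b)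
    (hM : 0 ≤ M) (hΦ : FillingFunction α M Φ) (hk : 0 ≤ k) (hS : KernelSupport K k)
    (h0 : Integrable (fun p => energyWeight p * f 0 p) volume) {t : ℝ} (ht : t ∈ Icc 0 T) :
    Integrable (fun p => energyWeight p * f t p) volume ∧
      ∫ p, energyWeight p * f t p = ∫ p, energyWeight p * f 0 p := by
  set e : Velocity → ℝ := fun v => 1 + ‖v‖ ^ 2 with he
  have hem : Measurable e := by fun_prop
  have hBm : MeasurableSet {v : Velocity | ‖v‖ ≤ k} := measurableSet_le (by fun_prop) measurable_const
  set ω : Velocity → ℝ := fun v => if ‖v‖ ≤ k then e v else 0 with hω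
  have hωm : Measurable ω := Measurable.ite hBm hem measurable_const
  have hωC : ∀ v, |ω v| ≤ 1 + k ^ 2 := by
    intro v
    simp only [hω, he]
    split_ifs with hv
    · rw [abs_of_nonneg (by positivity)]; gcongr
    · rw [abs_zero]; positivity
  have hzero : ∀ s ∈ Icc 0 T, ∫ p : Phase, ω p.2 * collQ K Φ (clip M (f s)) p = 0 := by
    intro s _
    have hbd := boundedDensity_cut (k := k) hM (measurable_L1 (f s))
    have e1 : collQ K Φ (clip M (f s)) = collQ K Φ (cut k M (f s)) :=
      hS.collQ_congr hk fun p hp => (cut_of_le hp).symm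
    have := (hbd.integral_mul_collQ hK hb hM hΦ hem (φ := e) (fun v w θ => by
      simp only [he]; linarith [post_energy v w θ]) (C := 1) zero_le_one (fun v => by
      rw [one_mul, abs_of_nonneg (by positivity)])).2
    rw [e1, ← this]
    refine integral_congr_ae (Eventually.of_forall fun p => ?_)
    simp only [hω]
    split_ifs with hp
    · rfl
    · rw [hS.collQ_eq_zero hk (not_le.1 hp), mul_zero, mul_zero]
  have hI := hf.integral_weight_const hωm hωC hzero t ht
  have hfast : (fun p : Phase => if ‖p.2‖ ≤ k then 0 else e p.2 * f 0 p) =ᵐ[volume]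
      fun p => if ‖p.2‖ ≤ k then 0 else e p.2 * sharp t (f t) p := by
    filter_upwards [hf.sharp_ae_eq_of_lt hk hS t ht] with p hp
    split_ifs with h
    · rfl
    · rw [hp (not_le.1 h)]
  have hfi : Integrable (fun p : Phase => if ‖p.2‖ ≤ k then 0 else e p.2 * f 0 p) volume := by
    refine h0.mono (Measurable.ite (measurableSet_norm_le k) measurable_const
      ((hem.comp measurable_snd).mul (measurable_L1 _))).aestronglyMeasurable
      (Eventually.of_forall fun p => ?_)
    split_ifs
    · rw [norm_zero]; exact norm_nonneg _
    · exact le_rfl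
  have hsplit : ∀ u : PhaseL1, (fun p : Phase => energyWeight p * u p) =
      fun p : Phase => ω p.2 * u p + if ‖p.2‖ ≤ k then 0 else e p.2 * u p := by
    intro u; funext p
    simp only [hω, energyWeight, he]
    split_ifs <;> simp
  have hslow : ∀ u : PhaseL1, Integrable (fun p : Phase => ω p.2 * u p) volume := fun u =>
    integrable_weight_mul (hωm.comp measurable_snd) (fun p => hωC p.2) (L1.integrable_coeFn u)
  have hsharp : Integrable (fun p => energyWeight p * sharp t (f t) p) volume := by
    rw [hsplit]
    exact (hslow _).add (hfi.congr hfast)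
  have hback : (fun p => energyWeight p * f t p) =ᵐ[volume]
      fun p => (fun p => energyWeight p * sharp t (f t) p) (freeFlow (-t) p) := by
    have := ae_freeFlow (-t) (coeFn_sharp t (f t))
    filter_upwards [this] with p hp
    simp only [hp, freeFlow_freeFlow, add_neg_cancel, freeFlow_zero]
    rfl
  refine ⟨(integrable_comp_freeFlow (-t) hsharp).congr hback.symm, ?_⟩
  rw [integral_congr_ae hback, integral_comp_freeFlow (F := fun p => energyWeight p * sharp t (f t) p)
    _ hsharp.aestronglyMeasurable, hsplit, hsplit, integral_add (hslow _) (hfi.congr hfast),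
    integral_add (hslow _) hfi, integral_weight_sharp hωm, hI, integral_congr_ae hfast.symm]

end KineticSolution

end

section

variable {K : Velocity → Velocity → ℝ → ℝ} {b c α M k L T : ℝ} {Φ : ℝ → ℝ}

/-! ### Dispersion by free transport -/

theorem measurable_translate (x : UnitAddCircle) : Measurable fun z : ℝ => x + (z : UnitAddCircle) :=
  measurable_const.add (AddCircle.continuous_mk' (1 : ℝ)).measurable

theorem lintegral_Ioc_translate {χ : UnitAddCircle → ℝ≥0∞} (x : UnitAddCircle)
    (a : ℝ) (n : ℕ) :
    ∫⁻ z in Ioc a (a + n), χ (x + (z : UnitAddCircle)) = n * ∫⁻ y, χ y := by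
  induction n with
  | zero => simp
  | succ n ih =>
    have h1 : Ioc a (a + (n + 1 : ℕ)) = Ioc a (a + n) ∪ Ioc (a + n) (a + n + 1) := by
      rw [Ioc_union_Ioc_eq_Ioc (by simp) (by simp)]; push_cast; rw [add_assoc]
    have h2 : Disjoint (Ioc a (a + n)) (Ioc (a + n) (a + n + 1)) := Ioc_disjoint_Ioc_of_le le_rfl
    rw [h1, lintegral_union measurableSet_Ioc h2, ih,
      UnitAddCircle.lintegral_preimage (a + n) (fun y => χ (x + y)),
      lintegral_add_left_eq_self]
    push_cast; ring

theorem lintegral_Icc_translate_le {χ : UnitAddCircle → ℝ≥0∞}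
    (x : UnitAddCircle) {ℓ : ℝ} (hℓ : 0 ≤ ℓ) :
    ∫⁻ z in Icc (-ℓ) ℓ, χ (x + (z : UnitAddCircle)) ≤ ENNReal.ofReal (2 * ℓ + 1) * ∫⁻ y, χ y := by
  have h1 : Ioc (-ℓ) ℓ ⊆ Ioc (-ℓ) (-ℓ + ⌈2 * ℓ⌉₊) := Ioc_subset_Ioc_right (by
    linarith [Nat.le_ceil (2 * ℓ)])
  rw [← restrict_Ioc_eq_restrict_Icc]
  refine (lintegral_mono_set h1).trans ?_
  rw [lintegral_Ioc_translate]
  gcongr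
  rw [← ENNReal.ofReal_natCast]
  exact ENNReal.ofReal_le_ofReal (Nat.ceil_lt_add_one (by positivity)).le

/-- Dispersion: during the time τ an interval of velocities of length 2ℓ spreads over a length 2τℓ
of the circle, hence winds at most 2τℓ + 1 times around it. Dividing by τ gives the constant. -/
theorem lintegral_Icc_scaled_le {χ : UnitAddCircle → ℝ≥0∞} (hχ : Measurable χ)
    (x : UnitAddCircle) {ℓ τ : ℝ} (hℓ : 0 ≤ ℓ) (hτ : 0 < τ) :
    ∫⁻ a in Icc (-ℓ) ℓ, χ (x + ((τ * a : ℝ) : UnitAddCircle)) ≤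
      ENNReal.ofReal (2 * ℓ + 1 / τ) * ∫⁻ y, χ y := by
  have hm : Measurable ((Icc (-(τ * ℓ)) (τ * ℓ)).indicator
      fun z : ℝ => χ (x + (z : UnitAddCircle))) :=
    (hχ.comp (measurable_translate x)).indicator measurableSet_Icc
  have h1 : ∫⁻ a in Icc (-ℓ) ℓ, χ (x + ((τ * a : ℝ) : UnitAddCircle)) =
      ∫⁻ a, (Icc (-(τ * ℓ)) (τ * ℓ)).indicator (fun z : ℝ => χ (x + (z : UnitAddCircle))) (τ * a) := by
    rw [← lintegral_indicator measurableSet_Icc]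
    refine lintegral_congr fun a => ?_
    have : a ∈ Icc (-ℓ) ℓ ↔ τ * a ∈ Icc (-(τ * ℓ)) (τ * ℓ) := by
      simp only [mem_Icc, ← mul_neg, mul_le_mul_iff_right₀ hτ]
    by_cases h : a ∈ Icc (-ℓ) ℓ
    · rw [indicator_of_mem h, indicator_of_mem (this.1 h)]
    · rw [indicator_of_notMem h, indicator_of_notMem (fun h' => h (this.2 h'))]
  have h2 := lintegral_map (μ := (volume : Measure ℝ)) hm (measurable_const_mul τ)
  rw [Real.map_volume_mul_left hτ.ne', lintegral_smul_measure, lintegral_indicator measurableSet_Icc]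
    at h2
  rw [h1, ← h2, abs_of_pos (inv_pos.2 hτ), smul_eq_mul]
  calc _ ≤ ENNReal.ofReal τ⁻¹ * (ENNReal.ofReal (2 * (τ * ℓ) + 1) * ∫⁻ y, χ y) := by
        gcongr
        exact lintegral_Icc_translate_le x (by positivity)
    _ = _ := by
        rw [← mul_assoc, ← ENNReal.ofReal_mul (by positivity)]
        congr 2
        field_simp

/-- The integral of `χ(x + τ v₁)` over the velocities `|v₁| ≤ 2r`, `|v₂| ≤ 2r`. -/
noncomputable def slabIntegral (χ : UnitAddCircle → ℝ≥0∞) (τ : ℝ) (r : ℝ) (x : UnitAddCircle) :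
    ℝ≥0∞ :=
  ENNReal.ofReal (4 * r) * ∫⁻ a in Icc (-(2 * r)) (2 * r), χ (x + ((τ * a : ℝ) : UnitAddCircle))

theorem slabIntegral_le {χ : UnitAddCircle → ℝ≥0∞} (hχ : Measurable χ) {τ r : ℝ} (hτ : 0 < τ)
    (hr : 0 ≤ r) (x : UnitAddCircle) :
    slabIntegral χ τ r x ≤ ENNReal.ofReal (16 * r ^ 2 + 4 * r / τ) * ∫⁻ y, χ y := by
  rw [slabIntegral]
  calc _ ≤ ENNReal.ofReal (4 * r) * (ENNReal.ofReal (2 * (2 * r) + 1 / τ) * ∫⁻ y, χ y) := by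
        gcongr
        exact lintegral_Icc_scaled_le hχ x (by positivity) hτ
    _ = _ := by
        rw [← mul_assoc, ← ENNReal.ofReal_mul (by positivity)]
        congr 2; ring

theorem slabIntegral_mono {χ : UnitAddCircle → ℝ≥0∞} {τ r s : ℝ} (h : r ≤ s) (x : UnitAddCircle) :
    slabIntegral χ τ r x ≤ slabIntegral χ τ s x := by
  unfold slabIntegral
  gcongr

theorem measurable_streamed (τ : ℝ) :
    Measurable fun q : UnitAddCircle × ℝ => q.1 + ((τ * q.2 : ℝ) : UnitAddCircle) :=
  measurable_fst.add ((AddCircle.continuous_mk' (1 : ℝ)).measurable.comp (by fun_prop))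

/-- After integration in x the translations are invisible and the term 1/τ of the pointwise bound is
absent. This version serves for slow particles, whose density is bounded by N; the pointwise one
serves for fast particles, where the energy pays for 1/τ. -/
theorem lintegral_slabIntegral {χ : UnitAddCircle → ℝ≥0∞} (hχ : Measurable χ) {τ r : ℝ}
    (hr : 0 ≤ r) :
    ∫⁻ x, slabIntegral χ τ r x = ENNReal.ofReal (16 * r ^ 2) * ∫⁻ y, χ y := by
  unfold slabIntegral
  have hm : Measurable fun q : UnitAddCircle × ℝ => χ (q.1 + ((τ * q.2 : ℝ) : UnitAddCircle)) :=
    hχ.comp (measurable_streamed τ)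
  rw [lintegral_const_mul' _ _ ENNReal.ofReal_ne_top, lintegral_lintegral_swap
    (by exact hm.aemeasurable)]
  simp_rw [lintegral_add_right_eq_self]
  rw [setLIntegral_const, Real.volume_Icc, mul_comm (∫⁻ y, χ y), ← mul_assoc,
    ← ENNReal.ofReal_mul (by positivity)]
  congr 2; ring

theorem measurable_slabIntegral {χ : UnitAddCircle → ℝ≥0∞} (hχ : Measurable χ) (τ r : ℝ) :
    Measurable (slabIntegral χ τ r) := by
  have hm : Measurable fun q : UnitAddCircle × ℝ => χ (q.1 + ((τ * q.2 : ℝ) : UnitAddCircle)) :=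
    hχ.comp (measurable_streamed τ)
  exact hm.lintegral_prod_right'.const_mul _

/-- The disc lies in the square |v₁|, |v₂| ≤ 2r, whose second side contributes the length 4r. -/
theorem lintegral_ball_le_slabIntegral {χ : UnitAddCircle → ℝ≥0∞} (hχ : Measurable χ) (τ : ℝ)
    {r : ℝ} (hr : 0 ≤ r) (x : UnitAddCircle) :
    ∫⁻ v : Velocity, {v : Velocity | ‖v‖ ^ 2 ≤ 2 * r ^ 2}.indicator
      (fun v => χ (x + ((τ * v 0 : ℝ) : UnitAddCircle))) v ≤ slabIntegral χ τ r x := by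
  set I := Icc (-(2 * r)) (2 * r) with hI
  have hχx : Measurable fun a : ℝ => χ (x + ((τ * a : ℝ) : UnitAddCircle)) :=
    hχ.comp ((measurable_translate x).comp (measurable_const_mul τ))
  have h0 : Measurable fun v : Velocity => v 0 := by fun_prop
  have h1 : Measurable fun v : Velocity => v 1 := by fun_prop
  have hg : Measurable (I.indicator fun a : ℝ => χ (x + ((τ * a : ℝ) : UnitAddCircle))) :=
    hχx.indicator measurableSet_Icc
  have hg' : Measurable (I.indicator fun _ : ℝ => (1 : ℝ≥0∞)) :=
    measurable_const.indicator measurableSet_Icc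
  have hle : ∀ v : Velocity, {v : Velocity | ‖v‖ ^ 2 ≤ 2 * r ^ 2}.indicator
      (fun v => χ (x + ((τ * v 0 : ℝ) : UnitAddCircle))) v ≤
      (I.indicator fun a : ℝ => χ (x + ((τ * a : ℝ) : UnitAddCircle))) (v 0) *
        (I.indicator fun _ : ℝ => (1 : ℝ≥0∞)) (v 1) := by
    intro v
    by_cases hv : v ∈ {v : Velocity | ‖v‖ ^ 2 ≤ 2 * r ^ 2}
    · have hv' : v 0 ^ 2 + v 1 ^ 2 ≤ 2 * r ^ 2 := by rw [← norm_sq_eq]; exact hv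
      have a0 : v 0 ∈ I := abs_le.1 (abs_le_of_sq_le_sq (by nlinarith [sq_nonneg (v 1)]) (by linarith))
      have a1 : v 1 ∈ I := abs_le.1 (abs_le_of_sq_le_sq (by nlinarith [sq_nonneg (v 0)]) (by linarith))
      rw [indicator_of_mem hv, indicator_of_mem a0, indicator_of_mem a1, mul_one]
    · rw [indicator_of_notMem hv]; exact zero_le
  refine (lintegral_mono hle).trans (le_of_eq ?_)
  rw [lintegral_velocity _ (by exact (hg.comp h0).mul (hg'.comp h1))]
  simp only [coordEquiv_zero, coordEquiv_one]
  have h2 : ∀ a : ℝ, ∫⁻ b : ℝ, (I.indicator fun a : ℝ => χ (x + ((τ * a : ℝ) : UnitAddCircle))) a *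
      (I.indicator fun _ : ℝ => (1 : ℝ≥0∞)) b =
      ENNReal.ofReal (4 * r) * (I.indicator fun a : ℝ => χ (x + ((τ * a : ℝ) : UnitAddCircle))) a := by
    intro a
    rw [lintegral_const_mul _ hg', lintegral_indicator_const measurableSet_Icc, hI, Real.volume_Icc,
      one_mul, mul_comm]
    congr 2; ring
  simp_rw [h2]
  rw [lintegral_const_mul _ hg, lintegral_indicator measurableSet_Icc, slabIntegral]

/-- The gain term, integrated along freely moving strips. -/
theorem lintegral_mul_gainAt_le (hK : CollisionKernel K b c) (hb : 0 ≤ b) (hc : 0 ≤ c) (hM : 0 ≤ M)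
    (hΦ : FillingFunction α M Φ) {u : Phase → ℝ} {N E : ℝ} (hu : BoundedDensity M N u)
    (hE : ∫ p, energyWeight p * u p ≤ E) {χ : UnitAddCircle → ℝ≥0∞} (hχ : Measurable χ) {τ R : ℝ}
    (hτ : 0 < τ) (hR : 0 < R) :
    ∫⁻ p : Phase, χ (freeFlow τ p).1 * gainAt K Φ u p ≤
      ENNReal.ofReal (4 * M ^ 3 * c * b * (16 * R ^ 2 * N + (16 + 4 / (R * τ)) * E)) *
        ∫⁻ y, χ y := by
  set U : Phase → ℝ≥0∞ := fun p => ENNReal.ofReal (u p) with hU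
  have hUm : Measurable U := hu.measurable.ennreal_ofReal
  set C := ENNReal.ofReal (4 * M ^ 3 * c * b) with hC
  set m := ∫⁻ y, χ y with hm
  set S : Set (Velocity × Velocity) := {q | ‖q.1‖ ^ 2 ≤ 2 * ‖q.2‖ ^ 2} with hS
  have hSm : MeasurableSet S := measurableSet_le (by fun_prop) (by fun_prop)
  set e := ENNReal.ofReal (16 + 4 / (R * τ)) with he
  have hχf : Measurable fun p : Phase => χ (freeFlow τ p).1 :=
    hχ.comp (measurable_fst.comp (measurable_freeFlow τ))
  have hinner : ∀ x : UnitAddCircle, ∀ w : Velocity,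
      ∫⁻ v : Velocity, S.indicator (fun q => χ (x + ((τ * q.1 0 : ℝ) : UnitAddCircle)) * U (x, q.2)) (v, w)
      ≤ U (x, w) * slabIntegral χ τ R x + e * m * ENNReal.ofReal (energyWeight (x, w) * u (x, w)) := by
    intro x w
    have h1 : ∀ v : Velocity,
        S.indicator (fun q => χ (x + ((τ * q.1 0 : ℝ) : UnitAddCircle)) * U (x, q.2)) (v, w) =
        U (x, w) * {v : Velocity | ‖v‖ ^ 2 ≤ 2 * ‖w‖ ^ 2}.indicator
          (fun v => χ (x + ((τ * v 0 : ℝ) : UnitAddCircle))) v := by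
      intro v
      by_cases hv : ‖v‖ ^ 2 ≤ 2 * ‖w‖ ^ 2
      · rw [indicator_of_mem (by exact hv), indicator_of_mem (by exact hv), mul_comm]
      · rw [indicator_of_notMem (by exact hv), indicator_of_notMem (by exact hv), mul_zero]
    simp_rw [h1]
    rw [lintegral_const_mul' _ _ ENNReal.ofReal_ne_top]
    have h2 := lintegral_ball_le_slabIntegral hχ τ (norm_nonneg w) x
    -- Splitting at |w| = R: below, monotonicity in the radius; above, the pointwise bound together
    -- with 4|w|/τ ≤ 4|w|²/(Rτ), which is absorbed by the energy weight.
    have h3 : slabIntegral χ τ ‖w‖ x ≤ slabIntegral χ τ R x +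
        e * m * ENNReal.ofReal (energyWeight (x, w)) := by
      rcases le_or_gt ‖w‖ R with hw | hw
      · exact (slabIntegral_mono hw x).trans le_self_add
      · refine (slabIntegral_le hχ hτ (norm_nonneg w) x).trans (le_add_left ?_)
        rw [mul_assoc, mul_comm m, ← mul_assoc, ← ENNReal.ofReal_mul (by positivity)]
        refine mul_le_mul_left (ENNReal.ofReal_le_ofReal ?_) _
        have h4 : 4 * ‖w‖ / τ ≤ 4 / (R * τ) * ‖w‖ ^ 2 := by
          rw [div_mul_eq_mul_div, div_le_div_iff₀ hτ (by positivity)]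
          have h6 : ‖w‖ * R ≤ ‖w‖ ^ 2 := by nlinarith [norm_nonneg w]
          nlinarith
        have h5 : 0 ≤ 4 / (R * τ) := by positivity
        unfold energyWeight
        simp only
        nlinarith
    calc _ ≤ U (x, w) * (slabIntegral χ τ R x + e * m * ENNReal.ofReal (energyWeight (x, w))) := by
          gcongr; exact h2.trans h3
      _ = _ := by
          rw [mul_add, ENNReal.ofReal_mul (energyWeight_nonneg _)]; ring
  have hx : ∀ᵐ x : UnitAddCircle, ∫⁻ v : Velocity, χ (freeFlow τ (x, v)).1 * gainAt K Φ u (x, v) ≤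
      C * (ENNReal.ofReal N * slabIntegral χ τ R x +
        e * m * ∫⁻ w : Velocity, ENNReal.ofReal (energyWeight (x, w) * u (x, w))) := by
    filter_upwards [hu.density] with x hx
    have hSx : Measurable (S.indicator
        fun q : Velocity × Velocity => χ (x + ((τ * q.1 0 : ℝ) : UnitAddCircle)) * U (x, q.2)) := by
      refine Measurable.indicator (Measurable.mul ?_ (hUm.comp (by fun_prop))) hSm
      exact hχ.comp ((measurable_translate x).comp (by fun_prop))
    have hEm : Measurable fun w : Velocity => ENNReal.ofReal (energyWeight (x, w) * u (x, w)) :=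
      ((measurable_energyWeight.mul hu.measurable).comp measurable_prodMk_left).ennreal_ofReal
    calc _ ≤ ∫⁻ v : Velocity, C * ∫⁻ w : Velocity, S.indicator
          (fun q => χ (x + ((τ * q.1 0 : ℝ) : UnitAddCircle)) * U (x, q.2)) (v, w) := by
          refine lintegral_mono fun v => ?_
          refine (mul_le_mul_right (gainAt_le hK hb hc hM hΦ hu.toOccupation (x, v)) _).trans ?_
          have hmi : Measurable ({w : Velocity | ‖v‖ ^ 2 ≤ 2 * ‖w‖ ^ 2}.indicator
              fun w => U (x, w)) := (hUm.comp measurable_prodMk_left).indicator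
                (measurableSet_le (by fun_prop) (by fun_prop))
          rw [mul_left_comm]
          refine mul_le_mul_right ?_ _
          change _ * ∫⁻ w : Velocity, {w : Velocity | ‖v‖ ^ 2 ≤ 2 * ‖w‖ ^ 2}.indicator
              (fun w => U (x, w)) w ≤ _
          rw [← lintegral_const_mul _ hmi]
          refine lintegral_mono fun w => ?_
          by_cases hv : ‖v‖ ^ 2 ≤ 2 * ‖w‖ ^ 2
          · rw [indicator_of_mem (by exact hv), indicator_of_mem (by exact hv)]; exact le_rfl
          · rw [indicator_of_notMem (by exact hv), indicator_of_notMem (by exact hv), mul_zero]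
      _ = C * ∫⁻ w : Velocity, ∫⁻ v : Velocity, S.indicator
          (fun q => χ (x + ((τ * q.1 0 : ℝ) : UnitAddCircle)) * U (x, q.2)) (v, w) := by
          rw [lintegral_const_mul' _ _ ENNReal.ofReal_ne_top,
            lintegral_lintegral_swap (by exact hSx.aemeasurable)]
      _ ≤ C * ∫⁻ w : Velocity, (U (x, w) * slabIntegral χ τ R x +
          e * m * ENNReal.ofReal (energyWeight (x, w) * u (x, w))) := by
          gcongr with w
          exact hinner x w
      _ = C * ((∫⁻ w : Velocity, U (x, w)) * slabIntegral χ τ R x +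
          e * m * ∫⁻ w : Velocity, ENNReal.ofReal (energyWeight (x, w) * u (x, w))) := by
          rw [lintegral_add_left (by exact (hUm.comp measurable_prodMk_left).mul_const _),
            lintegral_mul_const _ (by exact hUm.comp measurable_prodMk_left),
            lintegral_const_mul _ hEm]
      _ ≤ _ := by gcongr
  have hgm : Measurable fun p : Phase => ENNReal.ofReal (energyWeight p * u p) :=
    (measurable_energyWeight.mul hu.measurable).ennreal_ofReal
  have hgain : Measurable (gainAt K Φ u) :=
    ((measurable_gainFn hK hΦ.measurable hu.measurable).ennreal_ofReal).lintegral_prod_right'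
  have hE0 : 0 ≤ E := (integral_nonneg fun p =>
    mul_nonneg (energyWeight_nonneg p) (hu.mem p).1).trans hE
  have hEE : ∫⁻ x : UnitAddCircle, ∫⁻ w : Velocity, ENNReal.ofReal (energyWeight (x, w) * u (x, w)) ≤
      ENNReal.ofReal E := by
    rw [← lintegral_prod (μ := (volume : Measure UnitAddCircle)) (ν := (volume : Measure Velocity))
      (fun p : Phase => ENNReal.ofReal (energyWeight p * u p)) hgm.aemeasurable]
    change ∫⁻ p : Phase, _ ≤ _
    rw [← ofReal_integral_eq_lintegral_ofReal hu.energy (Eventually.of_forall fun p =>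
      mul_nonneg (energyWeight_nonneg p) (hu.mem p).1)]
    exact ENNReal.ofReal_le_ofReal hE
  rw [Measure.volume_eq_prod, lintegral_prod _ (by exact (hχf.mul hgain).aemeasurable)]
  refine (lintegral_mono_ae hx).trans ?_
  rw [lintegral_const_mul' _ _ ENNReal.ofReal_ne_top,
    lintegral_add_left ((measurable_slabIntegral hχ τ R).const_mul _),
    lintegral_const_mul _ (measurable_slabIntegral hχ τ R), lintegral_slabIntegral hχ hR.le,
    lintegral_const_mul _ (by exact hgm.lintegral_prod_right')]
  calc _ ≤ C * (ENNReal.ofReal N * (ENNReal.ofReal (16 * R ^ 2) * m) + e * m * ENNReal.ofReal E) := by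
        gcongr
    _ = C * (ENNReal.ofReal N * ENNReal.ofReal (16 * R ^ 2) + e * ENNReal.ofReal E) * m := by ring
    _ = _ := by
        rw [hC, he, ← ENNReal.ofReal_mul hu.nonneg_bound, ← ENNReal.ofReal_mul (by positivity),
          ← ENNReal.ofReal_add (mul_nonneg hu.nonneg_bound (by positivity)) (by positivity),
          ← ENNReal.ofReal_mul (by positivity)]
        congr 2; ring

end

section

variable {K : Velocity → Velocity → ℝ → ℝ} {b c α M k L T : ℝ} {Φ : ℝ → ℝ}

/-! ### Bounds for the spatial density -/

theorem ofReal_integral_mul_collQ_le (hK : CollisionKernel K b c) (hΦ : FillingFunction α M Φ)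
    {u : Phase → ℝ} (hu : Occupation M u) (hc : CollInt K Φ u) {ω : Phase → ℝ} (hω : Measurable ω)
    (hω0 : ∀ p, 0 ≤ ω p) {C : ℝ} (hC : ∀ p, |ω p| ≤ C) :
    ENNReal.ofReal (∫ p, ω p * collQ K Φ u p) ≤
      ∫⁻ p, ENNReal.ofReal (ω p) * gainAt K Φ u p := by
  set G : Phase → ℝ := fun p => ∫ q : Velocity × ℝ, gainFn K Φ u (p, q)
    ∂((volume : Measure Velocity).prod angleMeasure) with hG
  have hGi : Integrable G volume := hc.1.integral_prod_left
  have hG0 : ∀ p, 0 ≤ G p := fun p => integral_nonneg fun q => gainFn_nonneg hK hΦ hu _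
  have hle : ∫ p, ω p * collQ K Φ u p ≤ ∫ p, ω p * G p := by
    refine integral_mono_ae (integrable_weight_mul hω hC hc.integrable_collQ)
      (integrable_weight_mul hω hC hGi) ?_
    filter_upwards [hc.1.prod_right_ae, hc.2.prod_right_ae] with p h1 h2
    refine mul_le_mul_of_nonneg_left ?_ (hω0 p)
    rw [collQ]
    refine integral_mono (h1.sub h2) h1 fun q => ?_
    simp only [sub_le_self_iff]
    exact lossFn_nonneg hK hΦ hu _
  refine (ENNReal.ofReal_le_ofReal hle).trans ?_
  rw [ofReal_integral_eq_lintegral_ofReal (integrable_weight_mul hω hC hGi)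
    (Eventually.of_forall fun p => mul_nonneg (hω0 p) (hG0 p))]
  refine le_of_eq (lintegral_congr_ae ?_)
  filter_upwards [hc.1.prod_right_ae] with p h1
  rw [ENNReal.ofReal_mul (hω0 p), hG, gainAt,
    ofReal_integral_eq_lintegral_ofReal h1 (Eventually.of_forall fun q => gainFn_nonneg hK hΦ hu _)]

/-- Essential bounds in x are tested on measurable sets of positions, because only bounded weights
act on curves in L¹. -/
theorem densityLE_of_forall {u : Phase → ℝ} (hu : Occupation M u) (hui : Integrable u volume)
    {N : ℝ} (hN : 0 ≤ N) (h : ∀ A : Set UnitAddCircle, MeasurableSet A →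
      ∫ p : Phase, A.indicator 1 p.1 * u p ≤ N * (volume A).toReal) : DensityLE u N := by
  have hm : Measurable fun p : Phase => ENNReal.ofReal (u p) := hu.measurable.ennreal_ofReal
  refine ae_le_of_forall_setLIntegral_le_of_sigmaFinite (by exact hm.lintegral_prod_right')
    fun A hA _ => ?_
  have hA1 : Measurable fun p : Phase => A.indicator (1 : UnitAddCircle → ℝ) p.1 :=
    (measurable_one.indicator hA).comp measurable_fst
  have hA0 : ∀ x, 0 ≤ A.indicator (1 : UnitAddCircle → ℝ) x := fun x =>
    indicator_nonneg (fun _ _ => zero_le_one) x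
  have hA2 : ∀ x, |A.indicator (1 : UnitAddCircle → ℝ) x| ≤ 1 := fun x => by
    by_cases hx : x ∈ A <;> simp [hx]
  have h1 : ∫⁻ x in A, ∫⁻ v : Velocity, ENNReal.ofReal (u (x, v)) =
      ENNReal.ofReal (∫ p : Phase, A.indicator 1 p.1 * u p) := by
    rw [ofReal_integral_eq_lintegral_ofReal
      (integrable_weight_mul (ω := fun p : Phase => A.indicator 1 p.1) hA1 (fun p => hA2 _) hui)
      (Eventually.of_forall fun p => mul_nonneg (hA0 _) (hu.mem p).1), Measure.volume_eq_prod,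
      lintegral_prod _ (by exact (hA1.mul hu.measurable).ennreal_ofReal.aemeasurable),
      ← lintegral_indicator hA]
    refine lintegral_congr fun x => ?_
    by_cases hx : x ∈ A <;> simp [hx]
  rw [h1, setLIntegral_const, ← ENNReal.ofReal_toReal (measure_ne_top volume A),
    ← ENNReal.ofReal_mul hN]
  exact ENNReal.ofReal_le_ofReal (h A hA)

namespace KineticSolution

variable {f : ℝ → PhaseL1}

/-- The test function is fixed at the final time t and pulled back along characteristics. The
collision term at time s is then seen through χ streamed for the remaining time t - s, and this is
where dispersion enters. -/
theorem hasDerivWithinAt_streamed (hf : KineticSolution K Φ M T f) {χ : UnitAddCircle → ℝ}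
    (hχ : Measurable χ) {C : ℝ} (hC : ∀ x, |χ x| ≤ C) (t : ℝ) {s : ℝ} (hs : s ∈ Icc 0 T) :
    HasDerivWithinAt (fun s => ∫ p : Phase, χ (freeFlow t p).1 * sharp s (f s) p)
      (∫ p : Phase, χ (freeFlow (t - s) p).1 * collQ K Φ (clip M (f s)) p) (Icc 0 T) s := by
  have hχf : ∀ r, Measurable fun p : Phase => χ (freeFlow r p).1 := fun r =>
    hχ.comp (measurable_fst.comp (measurable_freeFlow r))
  obtain ⟨ℓ, hℓ⟩ := exists_weight_functional (hχf t) (fun p => hC _)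
  have h1 := ℓ.hasFDerivAt.comp_hasDerivWithinAt s (hf.deriv s hs)
  have h2 : ℓ (sharp s (collL K Φ (clip M (f s)))) =
      ∫ p : Phase, χ (freeFlow (t - s) p).1 * collQ K Φ (clip M (f s)) p := by
    rw [hℓ, ← integral_comp_freeFlow s
      (F := fun p : Phase => χ (freeFlow (t - s) p).1 * collQ K Φ (clip M (f s)) p)
      ((hχf (t - s)).aestronglyMeasurable.mul
        (hf.coll s hs).integrable_collQ.aestronglyMeasurable)]
    refine integral_congr_ae ?_
    filter_upwards [hf.coeFn_sharp_collL hs] with p hp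
    rw [hp, freeFlow_freeFlow, sub_add_cancel]
  rw [h2] at h1
  exact h1.congr (fun s _ => (hℓ _).symm) (hℓ _).symm

/-- Antiderivative of the growth rate of the spatial density. -/
noncomputable def densityGrowth (C₁ r N E τ : ℝ) : ℝ :=
  C₁ * ((16 * r ^ 2 * N + 4 * E / r) * (3 * τ ^ (1 / 3 : ℝ)) + 16 * E * τ)

theorem hasDerivAt_densityGrowth {C₁ r N E τ : ℝ} (hτ : 0 < τ) :
    HasDerivAt (densityGrowth C₁ r N E)
      (C₁ * ((16 * r ^ 2 * N + 4 * E / r) * τ ^ (-2 / 3 : ℝ) + 16 * E)) τ := by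
  have h1 := (((Real.hasDerivAt_rpow_const (x := τ) (p := 1 / 3) (Or.inl hτ.ne')).const_mul
    3).const_mul (16 * r ^ 2 * N + 4 * E / r)).add ((hasDerivAt_id τ).const_mul (16 * E))
  refine (h1.const_mul C₁).congr_deriv ?_
  rw [show (1 / 3 - 1 : ℝ) = -2 / 3 by norm_num]
  ring

theorem densityGrowth_nonneg {C₁ r N E τ : ℝ} (hC₁ : 0 ≤ C₁) (hr : 0 < r) (hN : 0 ≤ N) (hE : 0 ≤ E)
    (hτ : 0 ≤ τ) : 0 ≤ densityGrowth C₁ r N E τ := by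
  unfold densityGrowth
  have := Real.rpow_nonneg hτ (1 / 3)
  positivity

theorem densityGrowth_mono {C₁ r N E τ τ' : ℝ} (hC₁ : 0 ≤ C₁) (hr : 0 < r) (hN : 0 ≤ N) (hE : 0 ≤ E)
    (hτ : 0 ≤ τ) (h : τ ≤ τ') : densityGrowth C₁ r N E τ ≤ densityGrowth C₁ r N E τ' := by
  unfold densityGrowth
  have := Real.rpow_le_rpow hτ h (by norm_num : (0 : ℝ) ≤ 1 / 3)
  gcongr

theorem continuous_densityGrowth {C₁ r N E : ℝ} : Continuous (densityGrowth C₁ r N E) := by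
  unfold densityGrowth
  have : Continuous fun τ : ℝ => τ ^ (1 / 3 : ℝ) := Real.continuous_rpow_const (by norm_num)
  fun_prop

theorem streamed_collQ_le (hK : CollisionKernel K b c) (hb : 0 ≤ b) (hc : 0 ≤ c) (hM : 0 ≤ M)
    (hΦ : FillingFunction α M Φ) {u : Phase → ℝ} {N E : ℝ} (hu : BoundedDensity M N u)
    (hE : ∫ p, energyWeight p * u p ≤ E) {A : Set UnitAddCircle} (hA : MeasurableSet A) {τ r : ℝ}
    (hτ : 0 < τ) (hr : 0 < r) :
    ∫ p : Phase, A.indicator 1 (freeFlow τ p).1 * collQ K Φ u p ≤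
      4 * M ^ 3 * c * b * ((16 * r ^ 2 * N + 4 * E / r) * τ ^ (-2 / 3 : ℝ) + 16 * E) *
        (volume A).toReal := by
  have hE0 : 0 ≤ E := (integral_nonneg fun p =>
    mul_nonneg (energyWeight_nonneg p) (hu.mem p).1).trans hE
  have hN := hu.nonneg_bound
  have hA1 : Measurable fun p : Phase => A.indicator (1 : UnitAddCircle → ℝ) (freeFlow τ p).1 :=
    (measurable_one.indicator hA).comp (measurable_fst.comp (measurable_freeFlow τ))
  have hA0 : ∀ x, 0 ≤ A.indicator (1 : UnitAddCircle → ℝ) x := fun x =>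
    indicator_nonneg (fun _ _ => zero_le_one) x
  have hA2 : ∀ x, |A.indicator (1 : UnitAddCircle → ℝ) x| ≤ 1 := fun x => by
    by_cases hx : x ∈ A <;> simp [hx]
  have h1 := ofReal_integral_mul_collQ_le hK hΦ hu.toOccupation (hu.collInt hK hb hM hΦ) hA1
    (fun p => hA0 _) (fun p => hA2 _)
  -- This choice gives R² and 1/(Rτ) the same order τ^(-2/3), which is integrable at τ = 0. The
  -- factor r stays free in order to make the coefficient of N small.
  set R := r * τ ^ (-1 / 3 : ℝ) with hR
  have hRpos : 0 < R := mul_pos hr (Real.rpow_pos_of_pos hτ _)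
  have h2 := lintegral_mul_gainAt_le hK hb hc hM hΦ hu hE
    (χ := fun x => ENNReal.ofReal (A.indicator 1 x))
    (measurable_one.indicator hA).ennreal_ofReal hτ hRpos
  have h3 : ∫⁻ x, ENNReal.ofReal (A.indicator (1 : UnitAddCircle → ℝ) x) = volume A := by
    rw [← lintegral_indicator_one hA]
    refine lintegral_congr fun x => ?_
    by_cases hx : x ∈ A <;> simp [hx]
  rw [h3, ← ENNReal.ofReal_toReal (measure_ne_top volume A), ← ENNReal.ofReal_mul (by positivity)]
    at h2
  have h4 := (ENNReal.ofReal_le_ofReal_iff (by positivity)).1 (h1.trans h2)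
  refine h4.trans (le_of_eq ?_)
  have e1 : R ^ 2 = r ^ 2 * τ ^ (-2 / 3 : ℝ) := by
    rw [hR, mul_pow, ← Real.rpow_natCast (τ ^ _), ← Real.rpow_mul hτ.le]; norm_num
  have e2 : 4 / (R * τ) = 4 / r * τ ^ (-2 / 3 : ℝ) := by
    have : R * τ = r * τ ^ (2 / 3 : ℝ) := by
      rw [hR, mul_assoc, ← Real.rpow_add_one hτ.ne']; norm_num
    rw [this, show (-2 / 3 : ℝ) = -(2 / 3) by norm_num, Real.rpow_neg hτ.le]
    have := (Real.rpow_pos_of_pos hτ (2 / 3)).ne'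
    field_simp
  rw [e1, e2]
  ring

/-- One step of the bootstrap argument for the spatial density. -/
theorem density_step (hf : KineticSolution K Φ M T f) (hK : CollisionKernel K b c) (hb : 0 ≤ b)
    (hc : 0 ≤ c) (hM : 0 ≤ M) (hΦ : FillingFunction α M Φ) {s : Velocity → ℝ≥0∞} (hs : Measurable s)
    {C₀ E N r : ℝ} (hC₀ : 0 ≤ C₀) (hr : 0 < r) (hsC : ∫⁻ v, s v ≤ ENNReal.ofReal C₀)
    (hfs : ∀ᵐ p : Phase, ENNReal.ofReal (f 0 p) ≤ s p.2)
    (hE : ∀ t ∈ Icc 0 T, ∫ p, energyWeight p * clip M (f t) p ≤ E)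
    (hN : ∀ t ∈ Icc 0 T, BoundedDensity M N (clip M (f t))) :
    ∀ t ∈ Icc 0 T, DensityLE (clip M (f t)) (C₀ + densityGrowth (4 * M ^ 3 * c * b) r N E T) := by
  intro t ht
  have hE0 : 0 ≤ E := (integral_nonneg fun p =>
    mul_nonneg (energyWeight_nonneg p) ((hN t ht).mem p).1).trans (hE t ht)
  have hN0 := (hN t ht).nonneg_bound
  have hC₁ : 0 ≤ 4 * M ^ 3 * c * b := by positivity
  set C₁ := 4 * M ^ 3 * c * b with hC₁def
  have hΓ := densityGrowth_nonneg hC₁ hr hN0 hE0 (ht.1.trans ht.2)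
  refine densityLE_of_forall (hN t ht).toOccupation (hN t ht).integrable (add_nonneg hC₀ hΓ)
    fun A hA => ?_
  have hA1 : Measurable (A.indicator (1 : UnitAddCircle → ℝ)) := measurable_one.indicator hA
  have hA0 : ∀ x, 0 ≤ A.indicator (1 : UnitAddCircle → ℝ) x := fun x =>
    indicator_nonneg (fun _ _ => zero_le_one) x
  have hA2 : ∀ x, |A.indicator (1 : UnitAddCircle → ℝ) x| ≤ 1 := fun x => by
    by_cases hx : x ∈ A <;> simp [hx]
  set a := (volume A).toReal with ha
  have ha0 : 0 ≤ a := ENNReal.toReal_nonneg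
  set φ : ℝ → ℝ := fun s => ∫ p : Phase, A.indicator 1 (freeFlow t p).1 * sharp s (f s) p with hφ
  have hd : ∀ s ∈ Icc 0 T, HasDerivWithinAt φ
      (∫ p : Phase, A.indicator 1 (freeFlow (t - s) p).1 * collQ K Φ (clip M (f s)) p) (Icc 0 T) s :=
    fun s hs => hf.hasDerivWithinAt_streamed hA1 hA2 t hs
  have hsub : Icc 0 t ⊆ Icc 0 T := Icc_subset_Icc_right ht.2
  -- The growth rate blows up as s approaches t, so its continuous antiderivative in t - s is added
  -- and derivatives are used in the open interval only.
  have hanti : AntitoneOn (fun s => φ s + densityGrowth C₁ r N E (t - s) * a) (Icc 0 t) := by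
    have hder : ∀ s ∈ Ioo 0 t, HasDerivAt (fun s => φ s + densityGrowth C₁ r N E (t - s) * a)
        ((∫ p : Phase, A.indicator 1 (freeFlow (t - s) p).1 * collQ K Φ (clip M (f s)) p) +
          (C₁ * ((16 * r ^ 2 * N + 4 * E / r) * (t - s) ^ (-2 / 3 : ℝ) + 16 * E) * (-1)) * a) s := by
      intro s hs
      have h1 := (hd s (hsub ⟨hs.1.le, hs.2.le⟩)).hasDerivAt
        (Icc_mem_nhds hs.1 (hs.2.trans_le ht.2))
      have h2 := (hasDerivAt_densityGrowth (C₁ := C₁) (r := r) (N := N) (E := E)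
        (sub_pos.2 hs.2)).comp s ((hasDerivAt_id s).const_sub t)
      exact h1.add (h2.mul_const a)
    refine antitoneOn_of_deriv_nonpos (convex_Icc 0 t) ?_ ?_ ?_
    · refine ContinuousOn.add (fun s hs => ((hd s (hsub hs)).mono hsub).continuousWithinAt) ?_
      exact ((continuous_densityGrowth.comp (by fun_prop)).mul continuous_const).continuousOn
    · rw [interior_Icc]
      exact fun s hs => (hder s hs).differentiableAt.differentiableWithinAt
    · rw [interior_Icc]
      intro s hs
      rw [(hder s hs).deriv]
      have hs' := hsub ⟨hs.1.le, hs.2.le⟩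
      have := streamed_collQ_le hK hb hc hM hΦ (hN s hs') (hE s hs') hA (sub_pos.2 hs.2) hr
      linarith
  have h1 := hanti ⟨le_rfl, ht.1⟩ ⟨ht.1, le_rfl⟩ ht.1
  have hz : densityGrowth C₁ r N E 0 = 0 := by
    unfold densityGrowth
    rw [Real.zero_rpow (by norm_num)]; ring
  simp only [sub_self, sub_zero, hz, zero_mul, add_zero] at h1
  have h2 : φ t = ∫ p : Phase, A.indicator 1 p.1 * clip M (f t) p := by
    rw [← integral_comp_freeFlow t]
    · refine integral_congr_ae ?_
      filter_upwards [coeFn_sharp t (f t), ae_freeFlow t (hf.clip_ae ht)] with p a1 a2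
      rw [a1, a2]
    · exact ((hA1.comp measurable_fst).mul (hN t ht).measurable).aestronglyMeasurable
  -- The majorant of the initial datum does not depend on x, so streaming for the time t leaves the
  -- bound unchanged.
  have h3 : φ 0 ≤ C₀ * a := by
    have h0 := hf.range 0 ⟨le_rfl, ht.1.trans ht.2⟩
    have hAt : Measurable fun p : Phase => A.indicator (1 : UnitAddCircle → ℝ) (freeFlow t p).1 :=
      hA1.comp (measurable_fst.comp (measurable_freeFlow t))
    have hAt' : Measurable fun p : Phase =>
        A.indicator (1 : UnitAddCircle → ℝ≥0∞) (freeFlow t p).1 :=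
      (measurable_one.indicator hA).comp (measurable_fst.comp (measurable_freeFlow t))
    refine (ENNReal.ofReal_le_ofReal_iff (by positivity)).1 ?_
    simp only [hφ, sharp_zero]
    rw [ofReal_integral_eq_lintegral_ofReal
      (integrable_weight_mul hAt (fun p => hA2 _) (L1.integrable_coeFn (f 0)))
      (h0.mono fun p hp => mul_nonneg (hA0 _) hp.1)]
    calc _ ≤ ∫⁻ p : Phase, A.indicator 1 (freeFlow t p).1 * s p.2 := by
          refine lintegral_mono_ae ?_
          filter_upwards [hfs] with p hp
          rw [ENNReal.ofReal_mul (hA0 _)]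
          refine mul_le_mul' ?_ hp
          by_cases hx : (freeFlow t p).1 ∈ A <;> simp [hx]
      _ = ∫⁻ v : Velocity, ∫⁻ x : UnitAddCircle,
            A.indicator 1 (x + ((t * v 0 : ℝ) : UnitAddCircle)) * s v := by
          rw [Measure.volume_eq_prod, lintegral_prod_symm _
            (by exact (hAt'.mul (hs.comp measurable_snd)).aemeasurable)]
          rfl
      _ = ∫⁻ v : Velocity, volume A * s v := by
          refine lintegral_congr fun v => ?_
          have hm : Measurable fun x : UnitAddCircle =>
              A.indicator (1 : UnitAddCircle → ℝ≥0∞) (x + ((t * v 0 : ℝ) : UnitAddCircle)) :=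
            (measurable_one.indicator hA).comp (measurable_add_const _)
          rw [lintegral_mul_const _ hm, lintegral_add_right_eq_self
            (fun x => A.indicator (1 : UnitAddCircle → ℝ≥0∞) x), lintegral_indicator_one hA]
      _ ≤ volume A * ENNReal.ofReal C₀ := by
          rw [lintegral_const_mul _ hs]; gcongr
      _ = _ := by
          rw [mul_comm, ENNReal.ofReal_mul hC₀, ha, ENNReal.ofReal_toReal (measure_ne_top _ _)]
  rw [← h2, add_mul]
  have h4 := mul_le_mul_of_nonneg_right
    (densityGrowth_mono hC₁ hr hN0 hE0 ht.1 ht.2) ha0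
  linarith

end KineticSolution

/-- A bound for the spatial density depending on the data only. -/
theorem exists_density_bound {b c M C₀ E T : ℝ} (hb : 0 ≤ b) (hc : 0 ≤ c) (hM : 0 ≤ M)
    (hC₀ : 0 ≤ C₀) (hE : 0 ≤ E) (hT : 0 ≤ T) :
    ∃ N, 0 ≤ N ∧ ∀ (K : Velocity → Velocity → ℝ → ℝ) (Φ : ℝ → ℝ) (α : ℝ) (f : ℝ → PhaseL1)
      (s : Velocity → ℝ≥0∞), CollisionKernel K b c → FillingFunction α M Φ →
      KineticSolution K Φ M T f → Measurable s → ∫⁻ v, s v ≤ ENNReal.ofReal C₀ →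
      (∀ᵐ p : Phase, ENNReal.ofReal (f 0 p) ≤ s p.2) →
      (∀ t ∈ Icc 0 T, ∫ p, energyWeight p * clip M (f t) p ≤ E) →
      (∃ N', ∀ t ∈ Icc 0 T, BoundedDensity M N' (clip M (f t))) →
      ∀ t ∈ Icc 0 T, BoundedDensity M N (clip M (f t)) := by
  have hC₁ : 0 ≤ 4 * M ^ 3 * c * b := by positivity
  set C₁ := 4 * M ^ 3 * c * b with hC₁def
  set θ := T ^ (1 / 3 : ℝ) with hθ
  have hθ0 : 0 ≤ θ := Real.rpow_nonneg hT _
  -- Smallness of r replaces smallness of T: the coefficient of N becomes at most 1/2 on the whole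
  -- interval, while the remaining terms depend on the data only.
  obtain ⟨r, hr, hr2⟩ : ∃ r : ℝ, 0 < r ∧ C₁ * (16 * r ^ 2 * (3 * θ)) ≤ 1 / 2 := by
    set Y := C₁ * 48 * θ with hY
    have hY0 : 0 ≤ Y := by positivity
    refine ⟨1 / (2 * (Y + 1)), by positivity, ?_⟩
    have e : C₁ * (16 * (1 / (2 * (Y + 1))) ^ 2 * (3 * θ)) = Y / (4 * (Y + 1) ^ 2) := by
      rw [hY]; field_simp; ring
    rw [e, div_le_iff₀ (by positivity)]
    nlinarith
  set D := C₀ + C₁ * (4 * E / r * (3 * θ) + 16 * E * T) with hD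
  have hD0 : 0 ≤ D := by positivity
  refine ⟨2 * D + 1, by positivity, ?_⟩
  intro K Φ α f s hK hΦ hf hs hsC hfs hEn ⟨N', hN'⟩
  have hstep : ∀ N, (∀ t ∈ Icc 0 T, BoundedDensity M N (clip M (f t))) →
      ∀ t ∈ Icc 0 T, BoundedDensity M (D + N / 2) (clip M (f t)) := by
    intro N hN t ht
    have hN0 := (hN t ht).nonneg_bound
    refine ⟨(hN t ht).toOccupation, (hN t ht).energy, by positivity, ?_⟩
    refine (hf.density_step hK hb hc hM hΦ hs hC₀ hr hsC hfs hEn hN t ht).mono ?_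
    have h1 := mul_le_mul_of_nonneg_right hr2 hN0
    simp only [KineticSolution.densityGrowth, ← hθ, hD, ← hC₁def]
    linarith
  -- The map N ↦ D + N/2 has the fixed point 2D. The a priori bound N', which may depend on the
  -- truncation, is halved at each step and finally costs at most 1.
  have hiter : ∀ n : ℕ, ∀ t ∈ Icc 0 T, BoundedDensity M (2 * D + N' / 2 ^ n) (clip M (f t)) := by
    intro n
    induction n with
    | zero =>
      intro t ht
      have h := hN' t ht
      refine ⟨h.toOccupation, h.energy, by have := h.nonneg_bound; positivity,
        h.density.mono ?_⟩
      rw [pow_zero, div_one]; linarith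
    | succ n ih =>
      intro t ht
      have h := hstep _ ih t ht
      have e : D + (2 * D + N' / 2 ^ n) / 2 = 2 * D + N' / 2 ^ (n + 1) := by
        rw [pow_succ]; field_simp; ring
      rwa [e] at h
  obtain ⟨n, hn⟩ := pow_unbounded_of_one_lt N' (by norm_num : (1 : ℝ) < 2)
  intro t ht
  have h := hiter n t ht
  refine ⟨h.toOccupation, h.energy, by positivity, h.density.mono ?_⟩
  have : N' / 2 ^ n ≤ 1 := by rw [div_le_one (by positivity)]; exact hn.le
  linarith

end

section

variable {K : Velocity → Velocity → ℝ → ℝ} {b c α M k L T : ℝ} {Φ : ℝ → ℝ}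

/-! ### Lower bounds -/

theorem BoundedDensity.neg_mul_le_collQ (hK : CollisionKernel K b c) (hb : 0 ≤ b) (hM : 0 ≤ M)
    (hΦ : FillingFunction α M Φ) {u : Phase → ℝ} {N : ℝ} (hu : BoundedDensity M N u) :
    ∀ᵐ p : Phase, -(M ^ 2 * b * N * u p) ≤ collQ K Φ u p := by
  have hc := hu.collInt hK hb hM hΦ
  have hN : ∀ᵐ p : Phase, ∫⁻ v : Velocity, ENNReal.ofReal (u (p.1, v)) ≤ ENNReal.ofReal N :=
    Measure.quasiMeasurePreserving_fst.ae hu.density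
  filter_upwards [hc.1.prod_right_ae, hc.2.prod_right_ae, hN] with p h1 h2 h3
  have hu0 := (hu.mem p).1
  have hN0 := hu.nonneg_bound
  have h4 : ∫ q, lossFn K Φ u (p, q) ∂((volume : Measure Velocity).prod angleMeasure) ≤
      M ^ 2 * b * N * u p := by
    rw [integral_eq_lintegral_of_nonneg_ae
      (Eventually.of_forall fun q => lossFn_nonneg hK hΦ hu.toOccupation _) h2.aestronglyMeasurable]
    refine ENNReal.toReal_le_of_le_ofReal (by positivity) ?_
    refine (lintegral_lossFn_le hK hb hM hΦ hu.toOccupation p).trans ?_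
    calc _ ≤ ENNReal.ofReal (M ^ 2 * b * u p) * ENNReal.ofReal N := by gcongr
      _ = _ := by rw [← ENNReal.ofReal_mul (by positivity)]; congr 1; ring
  have h5 : -∫ q, lossFn K Φ u (p, q) ∂((volume : Measure Velocity).prod angleMeasure) ≤
      collQ K Φ u p := by
    rw [← integral_neg, collQ]
    refine integral_mono h2.neg (h1.sub h2) fun q => ?_
    have := gainFn_nonneg hK hΦ hu.toOccupation (p, q)
    simp only
    linarith
  linarith

theorem coeFn_smul_sub {X : Type*} [MeasurableSpace X] {μ : Measure X} (r : ℝ) (u w : Lp ℝ 1 μ) :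
    (r • u - w : Lp ℝ 1 μ) =ᵐ[μ] fun x => r * u x - w x := by
  filter_upwards [Lp.coeFn_sub (r • u) w, Lp.coeFn_smul r u] with x h1 h2
  rw [h1, Pi.sub_apply, h2, Pi.smul_apply, smul_eq_mul]

namespace KineticSolution

variable {f : ℝ → PhaseL1}

/-- Exponential lower bound along characteristics. -/
theorem exp_le (hf : KineticSolution K Φ M T f) (hK : CollisionKernel K b c) (hb : 0 ≤ b)
    (hM : 0 ≤ M) (hΦ : FillingFunction α M Φ) {N : ℝ}
    (hN : ∀ t ∈ Icc 0 T, BoundedDensity M N (clip M (f t))) :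
    ∀ t ∈ Icc 0 T, ∀ᵐ p : Phase,
      Real.exp (-(M ^ 2 * b * N * t)) * f 0 p ≤ f t (freeFlow t p) := by
  set C := M ^ 2 * b * N with hC
  have hd : ∀ t ∈ Icc 0 T, HasDerivWithinAt
      (fun t => Real.exp (-(C * t)) • f 0 - sharp t (f t))
      ((Real.exp (-(C * t)) * (-C)) • f 0 - sharp t (collL K Φ (clip M (f t)))) (Icc 0 T) t := by
    intro t ht
    have h1 : HasDerivAt (fun t : ℝ => Real.exp (-(C * t))) (Real.exp (-(C * t)) * (-C)) t := by
      have := ((hasDerivAt_id t).const_mul C).neg.exp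
      rw [mul_one] at this
      exact this
    exact (h1.hasDerivWithinAt.smul_const (f 0)).sub (hf.deriv t ht)
  have h0 : ∀ᵐ p : Phase, (Real.exp (-(C * 0)) • f 0 - sharp 0 (f 0) : PhaseL1) p ≤ 0 := by
    rw [mul_zero, neg_zero, Real.exp_zero, one_smul, sharp_zero, sub_self]
    filter_upwards [Lp.coeFn_zero ℝ 1 (volume : Measure Phase)] with p hp
    rw [hp]; exact le_rfl
  have key := ae_nonpos_of_deriv hd h0 fun t ht => by
    have ht' : t ∈ Icc 0 T := ⟨ht.1.le, ht.2.le⟩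
    filter_upwards [coeFn_smul_sub (Real.exp (-(C * t))) (f 0) (sharp t (f t)),
      coeFn_smul_sub (Real.exp (-(C * t)) * (-C)) (f 0) (sharp t (collL K Φ (clip M (f t)))),
      hf.coeFn_sharp_collL ht', ae_freeFlow t ((hN t ht').neg_mul_le_collQ hK hb hM hΦ),
      coeFn_sharp t (f t), ae_freeFlow t (hf.clip_ae ht')] with p a1 a2 a3 a4 a5 a6 h
    rw [a2, a3]
    rw [a1, a5] at h
    rw [a6] at a4
    have hC0 : 0 ≤ C := by
      have := (hN t ht').nonneg_bound
      positivity
    have := mul_le_mul_of_nonneg_left h hC0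
    nlinarith
  intro t ht
  filter_upwards [key t ht, coeFn_smul_sub (Real.exp (-(C * t))) (f 0) (sharp t (f t)),
    coeFn_sharp t (f t)] with p h1 h2 h3
  rw [h2, h3] at h1
  linarith

end KineticSolution

/-! ### The collision frequency -/

theorem volume_gt_half_le {M N : ℝ} (hM : 0 < M) {g : Velocity → ℝ} (hg : Measurable g)
    (hN : ∫⁻ v, ENNReal.ofReal (g v) ≤ ENNReal.ofReal N) :
    volume {v | M / 2 < g v} ≤ ENNReal.ofReal (2 * N / M) := by
  have h1 := mul_meas_ge_le_lintegral (μ := (volume : Measure Velocity)) hg.ennreal_ofReal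
    (ENNReal.ofReal (M / 2))
  have h2 : {v | M / 2 < g v} ⊆ {v | ENNReal.ofReal (M / 2) ≤ ENNReal.ofReal (g v)} :=
    fun v hv => ENNReal.ofReal_le_ofReal (le_of_lt hv)
  have h3 : ENNReal.ofReal (M / 2) * volume {v | M / 2 < g v} ≤ ENNReal.ofReal N :=
    (mul_le_mul_right (measure_mono h2) _).trans (h1.trans hN)
  calc volume {v | M / 2 < g v}
      = ENNReal.ofReal (2 / M) * (ENNReal.ofReal (M / 2) * volume {v | M / 2 < g v}) := by
        rw [← mul_assoc, ← ENNReal.ofReal_mul (by positivity)]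
        rw [show 2 / M * (M / 2) = 1 by field_simp, ENNReal.ofReal_one, one_mul]
    _ ≤ ENNReal.ofReal (2 / M) * ENNReal.ofReal N := by gcongr
    _ = _ := by rw [← ENNReal.ofReal_mul (by positivity)]; congr 1; ring

/-- The integrand of the collision frequency. -/
noncomputable def freqFn (K : Velocity → Velocity → ℝ → ℝ) (Φ : ℝ → ℝ) (u : Phase → ℝ)
    (z : CollSpace) : ℝ :=
  kernelOn K z * (u (ptStar z) * Φ (u (ptPost z)) * Φ (u (ptPostStar z)))

/-- Lower bound for the collision frequency where the density is bounded from below on a large set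
of velocities. -/
theorem le_lintegral_freqFn (hK : CollisionKernel K b c) (hb : 0 ≤ b) (hc : 0 ≤ c) (hM : 1 ≤ M)
    (hΦ : FillingFunction α M Φ) {u : Phase → ℝ} {N : ℝ} (hu : BoundedDensity M N u)
    {Z : Set Velocity} (hZ : MeasurableSet Z) {ρ γ ℓ δ : ℝ} (hδ : 0 ≤ δ)
    (huZ : ∀ᵐ p : Phase, p.2 ∈ Z → δ ≤ u p)
    (hKl : ∀ v w, ‖v‖ ≤ ρ → w ∈ Z → γ ≤ ‖v - w‖ →
      ENNReal.ofReal ℓ ≤ ∫⁻ φ, ENNReal.ofReal (K v w φ) ∂angleMeasure)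
    (hvol : ENNReal.ofReal (1 + 8 * c * b * N / M) +
      ENNReal.ofReal ℓ * volume (Metric.ball (0 : Velocity) γ) ≤ ENNReal.ofReal ℓ * volume Z) :
    ∀ᵐ p : Phase, ‖p.2‖ ≤ ρ → ENNReal.ofReal (δ / 4) ≤
      ∫⁻ q, ENNReal.ofReal (freqFn K Φ u (p, q)) ∂((volume : Measure Velocity).prod angleMeasure) := by
  have hN0 := hu.nonneg_bound
  have hMpos : 0 < M := by linarith
  have hdens : ∀ᵐ p : Phase, ∫⁻ v : Velocity, ENNReal.ofReal (u (p.1, v)) ≤ ENNReal.ofReal N :=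
    Measure.quasiMeasurePreserving_fst.ae hu.density
  have huZ' : ∀ᵐ p : Phase, ∀ᵐ w : Velocity, w ∈ Z → δ ≤ u (p.1, w) :=
    Measure.quasiMeasurePreserving_fst.ae
      (Measure.ae_ae_of_ae_prod (p := fun p : Phase => p.2 ∈ Z → δ ≤ u p) huZ)
  filter_upwards [hdens, huZ'] with p hp hpZ hpρ
  set ν := (volume : Measure Velocity).prod angleMeasure with hν
  have hux : Measurable fun w : Velocity => u (p.1, w) := hu.measurable.comp measurable_prodMk_left
  -- More than half filled states may block a collision. They occupy a volume at most 2N/M, and the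
  -- change of variables bounds the collisions leading into them, through v' or v'_*, by 4cbN/M
  -- each.
  set bad : Set Velocity := {w | M / 2 < u (p.1, w)} with hbad
  have hbadm : MeasurableSet bad := measurableSet_lt measurable_const hux
  have hbadvol := volume_gt_half_le hMpos hux hp
  set Kq : Velocity × ℝ → ℝ≥0∞ := fun q => ENNReal.ofReal (K p.2 q.1 q.2) with hKq
  have hKm : Measurable Kq := (hK.measurable_section p.2).ennreal_ofReal
  have hpost : Measurable fun q : Velocity × ℝ => postVel p.2 q.1 q.2 :=
    continuous_postVel.measurable.comp measurable_prodMk_left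
  have hpostS : Measurable fun q : Velocity × ℝ => postVelStar p.2 q.1 q.2 :=
    continuous_postVelStar.measurable.comp measurable_prodMk_left
  have hone : Measurable (bad.indicator (1 : Velocity → ℝ≥0∞)) := measurable_one.indicator hbadm
  have hb1 : ∫⁻ q, Kq q * bad.indicator 1 (postVel p.2 q.1 q.2) ∂ν ≤
      ENNReal.ofReal (4 * c * b * N / M) := by
    refine (hK.lintegral_post_le hb hc p.2 hone).trans ?_
    rw [lintegral_indicator_one hbadm]
    calc _ ≤ ENNReal.ofReal (2 * c * b) * ENNReal.ofReal (2 * N / M) := by gcongr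
      _ = _ := by rw [← ENNReal.ofReal_mul (by positivity)]; congr 1; ring
  have hb2 : ∫⁻ q, Kq q * bad.indicator 1 (postVelStar p.2 q.1 q.2) ∂ν ≤
      ENNReal.ofReal (4 * c * b * N / M) := by
    refine (hK.lintegral_postStar_le hb hc p.2 hone).trans ?_
    rw [lintegral_indicator_one hbadm]
    calc _ ≤ ENNReal.ofReal (2 * c * b) * ENNReal.ofReal (2 * N / M) := by gcongr
      _ = _ := by rw [← ENNReal.ofReal_mul (by positivity)]; congr 1; ring
  set good : Velocity × ℝ → ℝ≥0∞ := fun q =>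
    (Z ×ˢ (univ : Set ℝ)).indicator 1 q *
      (badᶜ.indicator 1 (postVel p.2 q.1 q.2) * badᶜ.indicator 1 (postVelStar p.2 q.1 q.2)) with hgood
  have hgoodm : Measurable good := (measurable_one.indicator (hZ.prod MeasurableSet.univ)).mul
    (((measurable_one.indicator hbadm.compl).comp hpost).mul
      ((measurable_one.indicator hbadm.compl).comp hpostS))
  have htot : ENNReal.ofReal ℓ * volume Z ≤ ENNReal.ofReal ℓ * volume (Metric.ball (0 : Velocity) γ) +
      ∫⁻ q, Kq q * (Z ×ˢ (univ : Set ℝ)).indicator 1 q ∂ν := by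
    have h1 : ∫⁻ q, Kq q * (Z ×ˢ (univ : Set ℝ)).indicator 1 q ∂ν =
        ∫⁻ w in Z, ∫⁻ φ, Kq (w, φ) ∂angleMeasure := by
      rw [hν, lintegral_prod _ (by exact (hKm.mul
        (measurable_one.indicator (hZ.prod MeasurableSet.univ))).aemeasurable),
        ← lintegral_indicator hZ]
      refine lintegral_congr fun w => ?_
      by_cases hw : w ∈ Z <;> simp [hw]
    have h2 : ∀ w ∈ Z, ENNReal.ofReal ℓ ≤
        (Metric.ball p.2 γ).indicator (fun _ => ENNReal.ofReal ℓ) w +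
          ∫⁻ φ, Kq (w, φ) ∂angleMeasure := by
      intro w hw
      by_cases hwb : w ∈ Metric.ball p.2 γ
      · rw [indicator_of_mem hwb]; exact le_self_add
      · refine le_add_left (hKl p.2 w hpρ hw ?_)
        rw [Metric.mem_ball, dist_comm, dist_eq_norm] at hwb
        exact not_lt.1 hwb
    have h3 : volume (Metric.ball p.2 γ) = volume (Metric.ball (0 : Velocity) γ) :=
      Measure.addHaar_ball_center _ _ _
    rw [h1, ← setLIntegral_const, ← h3]
    calc _ ≤ ∫⁻ w in Z, ((Metric.ball p.2 γ).indicator (fun _ => ENNReal.ofReal ℓ) w +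
          ∫⁻ φ, Kq (w, φ) ∂angleMeasure) := setLIntegral_mono' hZ h2
      _ = (∫⁻ w in Z, (Metric.ball p.2 γ).indicator (fun _ => ENNReal.ofReal ℓ) w) +
          ∫⁻ w in Z, ∫⁻ φ, Kq (w, φ) ∂angleMeasure :=
          lintegral_add_left (measurable_const.indicator measurableSet_ball) _
      _ ≤ _ := by
          gcongr
          refine (setLIntegral_le_lintegral _ _).trans ?_
          rw [lintegral_indicator_const measurableSet_ball]
  have hsplit : ∫⁻ q, Kq q * (Z ×ˢ (univ : Set ℝ)).indicator 1 q ∂ν ≤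
      ∫⁻ q, Kq q * good q ∂ν + (ENNReal.ofReal (4 * c * b * N / M) +
        ENNReal.ofReal (4 * c * b * N / M)) := by
    refine le_trans ?_ (add_le_add_right (add_le_add hb1 hb2) _)
    rw [← lintegral_add_left (by exact hKm.mul (hone.comp hpost)),
      ← lintegral_add_left (by exact hKm.mul hgoodm)]
    refine lintegral_mono fun q => ?_
    rw [← mul_add, ← mul_add]
    refine mul_le_mul_right ?_ _
    simp only [hgood]
    by_cases h1 : postVel p.2 q.1 q.2 ∈ bad
    · refine le_add_left (le_add_right ?_)
      rw [indicator_of_mem h1]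
      exact indicator_le_self' (fun _ _ => zero_le) q |>.trans le_rfl
    · by_cases h2 : postVelStar p.2 q.1 q.2 ∈ bad
      · refine le_add_left (le_add_left ?_)
        rw [indicator_of_mem h2]
        exact indicator_le_self' (fun _ _ => zero_le) q |>.trans le_rfl
      · refine le_add_right ?_
        rw [indicator_of_mem (mem_compl h1), indicator_of_mem (mem_compl h2)]
        simp
  -- The set Z is so large that, after removal of partners closer than γ and of both kinds of
  -- blocked collisions, the remaining collisions still have total weight at least 1. On them the
  -- filling factors are at least 1/2 each, whence δ/4.
  have hone_le : 1 ≤ ∫⁻ q, Kq q * good q ∂ν := by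
    have h1 := hvol.trans (htot.trans (add_le_add_right hsplit _))
    have e1 : ENNReal.ofReal (1 + 8 * c * b * N / M) = 1 + (ENNReal.ofReal (4 * c * b * N / M) +
        ENNReal.ofReal (4 * c * b * N / M)) := by
      rw [← ENNReal.ofReal_one, ← ENNReal.ofReal_add (by positivity) (by positivity),
        ← ENNReal.ofReal_add (by positivity) (by positivity)]
      congr 1; ring
    rw [e1, add_comm (ENNReal.ofReal ℓ * _)] at h1
    have h2 := (ENNReal.add_le_add_iff_right
      (ENNReal.mul_ne_top ENNReal.ofReal_ne_top measure_ball_lt_top.ne)).1 h1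
    exact (ENNReal.add_le_add_iff_right (by simp)).1 h2
  have hZae : ∀ᵐ q ∂ν, q.1 ∈ Z → δ ≤ u (p.1, q.1) :=
    (Measure.quasiMeasurePreserving_fst (μ := (volume : Measure Velocity))
      (ν := angleMeasure)).ae hpZ
  calc ENNReal.ofReal (δ / 4) ≤ ENNReal.ofReal (δ / 4) * ∫⁻ q, Kq q * good q ∂ν :=
        le_mul_of_one_le_right' hone_le
    _ = ∫⁻ q, ENNReal.ofReal (δ / 4) * (Kq q * good q) ∂ν :=
        (lintegral_const_mul _ (hKm.mul hgoodm)).symm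
    _ ≤ _ := by
        refine lintegral_mono_ae ?_
        filter_upwards [hZae] with q hq
        by_cases hg : q.1 ∈ Z ∧ postVel p.2 q.1 q.2 ∉ bad ∧ postVelStar p.2 q.1 q.2 ∉ bad
        · obtain ⟨g1, g2, g3⟩ := hg
          have e1 : good q = 1 := by
            simp only [hgood]
            rw [indicator_of_mem (mem_compl g2), indicator_of_mem (mem_compl g3),
              indicator_of_mem (by exact ⟨g1, mem_univ _⟩)]
            simp
          rw [e1, mul_one, hKq, ← ENNReal.ofReal_mul (by positivity)]
          refine ENNReal.ofReal_le_ofReal ?_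
          have f2 := hΦ.half_le hM (hu.mem (p.1, postVel p.2 q.1 q.2)).1 (not_lt.1 g2)
          have f3 := hΦ.half_le hM (hu.mem (p.1, postVelStar p.2 q.1 q.2)).1 (not_lt.1 g3)
          have f1 := hq g1
          simp only [freqFn, kernelOn, ptStar, ptPost, ptPostStar]
          rw [mul_comm]
          refine mul_le_mul_of_nonneg_left ?_ (hK.nonneg _ _ _)
          have f0 := (hu.mem (p.1, q.1)).1
          have f4 : 0 ≤ Φ (u (p.1, postVel p.2 q.1 q.2)) := by linarith
          calc δ / 4 = δ * (1 / 2) * (1 / 2) := by ring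
            _ ≤ _ := mul_le_mul (mul_le_mul f1 f2 (by norm_num) f0) f3 (by norm_num)
              (mul_nonneg f0 f4)
        · have e1 : good q = 0 := by
            simp only [hgood]
            by_cases g1 : q.1 ∈ Z
            · by_cases g2 : postVel p.2 q.1 q.2 ∈ bad
              · rw [indicator_of_notMem (s := badᶜ) (by simpa using g2), zero_mul, mul_zero]
              · by_cases g3 : postVelStar p.2 q.1 q.2 ∈ bad
                · rw [indicator_of_notMem (s := badᶜ) (a := postVelStar p.2 q.1 q.2)
                    (by simpa using g3), mul_zero, mul_zero]
                · exact absurd ⟨g1, g2, g3⟩ hg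
            · rw [indicator_of_notMem (s := Z ×ˢ (univ : Set ℝ)) (by simp [g1]), zero_mul]
          rw [e1, mul_zero, mul_zero]
          exact zero_le

end

section

variable {K : Velocity → Velocity → ℝ → ℝ} {b c α M k L T : ℝ} {Φ : ℝ → ℝ}

/-! ### Distance to full occupation -/

/-- The factor Φ(u) at v is kept in the gain instead of being bounded, so that the gain is small
near full occupation. The loss is u at v times the collision frequency. -/
theorem BoundedDensity.collQ_le (hK : CollisionKernel K b c) (hb : 0 ≤ b) (hc : 0 ≤ c) (hM : 0 ≤ M)
    (hΦ : FillingFunction α M Φ) {u : Phase → ℝ} {N : ℝ} (hu : BoundedDensity M N u) {c₁ : ℝ} :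
    ∀ᵐ p : Phase, ENNReal.ofReal c₁ ≤ ∫⁻ q, ENNReal.ofReal (freqFn K Φ u (p, q))
      ∂((volume : Measure Velocity).prod angleMeasure) →
      collQ K Φ u p ≤ 2 * c * b * M ^ 2 * N * Φ (u p) - c₁ * u p := by
  have hci := hu.collInt hK hb hM hΦ
  have hN : ∀ᵐ p : Phase, ∫⁻ v : Velocity, ENNReal.ofReal (u (p.1, v)) ≤ ENNReal.ofReal N :=
    Measure.quasiMeasurePreserving_fst.ae hu.density
  filter_upwards [hci.1.prod_right_ae, hci.2.prod_right_ae, hN] with p h1 h2 h3 hfreq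
  set ν := (volume : Measure Velocity).prod angleMeasure with hν
  have hu0 := (hu.mem p).1
  have hN0 := hu.nonneg_bound
  have hΦ0 := (hΦ.mem_Icc (hu.mem p)).1
  have hgain : ∫ q, gainFn K Φ u (p, q) ∂ν ≤ 2 * c * b * M ^ 2 * N * Φ (u p) := by
    rw [integral_eq_lintegral_of_nonneg_ae
      (Eventually.of_forall fun q => gainFn_nonneg hK hΦ hu.toOccupation _) h1.aestronglyMeasurable]
    refine ENNReal.toReal_le_of_le_ofReal (by positivity) ?_
    have hg : Measurable fun w : Velocity => ENNReal.ofReal (u (p.1, w)) :=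
      (hu.measurable.comp measurable_prodMk_left).ennreal_ofReal
    have h4 : ∀ q : Velocity × ℝ, ENNReal.ofReal (gainFn K Φ u (p, q)) ≤
        ENNReal.ofReal (M ^ 2 * Φ (u p)) *
          (ENNReal.ofReal (K p.2 q.1 q.2) * ENNReal.ofReal (u (p.1, postVel p.2 q.1 q.2))) := by
      intro q
      rw [← ENNReal.ofReal_mul (hK.nonneg _ _ _), ← ENNReal.ofReal_mul (by positivity)]
      refine ENNReal.ofReal_le_ofReal ?_
      have a1 := hu.mem (ptPost (p, q))
      have a2 := hu.mem (ptPostStar (p, q))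
      have a3 := hΦ.mem_Icc (hu.mem (ptStar (p, q)))
      have a4 : u (ptPostStar (p, q)) * Φ (u (ptStar (p, q))) ≤ M ^ 2 := by
        rw [sq]; exact mul_le_mul a2.2 a3.2 a3.1 hM
      have a5 : 0 ≤ kernelOn K (p, q) * u (ptPost (p, q)) * Φ (u p) :=
        mul_nonneg (mul_nonneg (hK.kernelOn_nonneg _) a1.1) hΦ0
      calc gainFn K Φ u (p, q) = kernelOn K (p, q) * u (ptPost (p, q)) * Φ (u p) *
            (u (ptPostStar (p, q)) * Φ (u (ptStar (p, q)))) := by rw [gainFn]; ring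
        _ ≤ kernelOn K (p, q) * u (ptPost (p, q)) * Φ (u p) * M ^ 2 :=
            mul_le_mul_of_nonneg_left a4 a5
        _ = _ := by simp only [kernelOn, ptPost]; ring
    calc _ ≤ ∫⁻ q : Velocity × ℝ, ENNReal.ofReal (M ^ 2 * Φ (u p)) *
          (ENNReal.ofReal (K p.2 q.1 q.2) * ENNReal.ofReal (u (p.1, postVel p.2 q.1 q.2))) ∂ν :=
          lintegral_mono h4
      _ ≤ ENNReal.ofReal (M ^ 2 * Φ (u p)) * (ENNReal.ofReal (2 * c * b) * ENNReal.ofReal N) := by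
          rw [lintegral_const_mul' _ _ ENNReal.ofReal_ne_top]
          gcongr
          exact (hK.lintegral_post_le hb hc p.2 hg).trans (by gcongr)
      _ = _ := by
          rw [← ENNReal.ofReal_mul (by positivity), ← ENNReal.ofReal_mul (by positivity)]
          congr 1; ring
  have hl0 : ∀ q, 0 ≤ lossFn K Φ u (p, q) := fun q => lossFn_nonneg hK hΦ hu.toOccupation _
  have hloss : c₁ * u p ≤ ∫ q, lossFn K Φ u (p, q) ∂ν := by
    refine (ENNReal.ofReal_le_ofReal_iff (integral_nonneg hl0)).1 ?_
    rw [ofReal_integral_eq_lintegral_ofReal h2 (Eventually.of_forall hl0), mul_comm,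
      ENNReal.ofReal_mul hu0]
    calc _ ≤ ENNReal.ofReal (u p) * ∫⁻ q, ENNReal.ofReal (freqFn K Φ u (p, q)) ∂ν := by gcongr
      _ = ∫⁻ q, ENNReal.ofReal (lossFn K Φ u (p, q)) ∂ν := by
          rw [← lintegral_const_mul' _ _ ENNReal.ofReal_ne_top]
          refine lintegral_congr fun q => ?_
          rw [← ENNReal.ofReal_mul hu0, freqFn, lossFn]
          congr 1; ring
  rw [collQ, integral_sub h1 h2]
  linarith

/-- Within distance z₀ of M the gain is at most c₁M/4 and the loss at least c₁M/2. The bound c₀ ≤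
z₀/T keeps the moving barrier in this region up to time T. The constant depends on Φ only through α
and M, hence not on the truncation. -/
theorem exists_barrier_slope {α M C₂ c₁ T : ℝ} (hα : 0 < α) (hM : 0 < M) (hC₂ : 0 ≤ C₂)
    (hc₁ : 0 < c₁) (hT : 0 < T) : ∃ c₀ : ℝ, 0 < c₀ ∧ ∀ Φ : ℝ → ℝ, FillingFunction α M Φ →
      ∀ y ∈ Icc 0 M, M - c₀ * T ≤ y → C₂ * Φ y - c₁ * y ≤ -c₀ := by
  set ζ := c₁ / (4 * (C₂ + 1)) with hζ
  have hζ0 : 0 < ζ := by positivity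
  set z₀ := min (M / 2) (ζ ^ (1 / α)) with hz₀
  have hz0 : 0 < z₀ := lt_min (by positivity) (Real.rpow_pos_of_pos hζ0 _)
  have hzα : z₀ ^ α ≤ ζ := by
    calc z₀ ^ α ≤ (ζ ^ (1 / α)) ^ α := Real.rpow_le_rpow hz0.le (min_le_right _ _) hα.le
      _ = ζ := by rw [← Real.rpow_mul hζ0.le, one_div_mul_cancel hα.ne', Real.rpow_one]
  refine ⟨min (c₁ * M / 4) (z₀ / T), lt_min (by positivity) (by positivity), ?_⟩
  intro Φ hΦ y hy hyM
  have h1 : min (c₁ * M / 4) (z₀ / T) * T ≤ z₀ := by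
    calc _ ≤ z₀ / T * T := by gcongr; exact min_le_right _ _
      _ = z₀ := by field_simp
  have h2 : M - y ≤ z₀ := by linarith
  have h3 : Φ y ≤ M * ζ := (hΦ.le_rpow y hy).trans (by
    refine mul_le_mul_of_nonneg_left (le_trans ?_ hzα) hM.le
    exact Real.rpow_le_rpow (by linarith [hy.2]) h2 hα.le)
  have h4 : C₂ * Φ y ≤ c₁ * M / 4 := by
    calc C₂ * Φ y ≤ C₂ * (M * ζ) := by gcongr
      _ = c₁ * M / 4 * (C₂ / (C₂ + 1)) := by rw [hζ]; field_simp
      _ ≤ c₁ * M / 4 * 1 := by gcongr; rw [div_le_one (by positivity)]; linarith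
      _ = _ := mul_one _
  have h5 : M / 2 ≤ y := by linarith [min_le_left (M / 2) (ζ ^ (1 / α))]
  have h6 : c₁ * (M / 2) ≤ c₁ * y := by gcongr
  have h7 := min_le_left (c₁ * M / 4) (z₀ / T)
  linarith

namespace KineticSolution

variable {f : ℝ → PhaseL1}

/-- Solutions stay below a barrier moving linearly away from full occupation. -/
theorem le_barrier (hf : KineticSolution K Φ M T f) {ρ c₀ : ℝ} (hc₀ : 0 ≤ c₀)
    (hQ : ∀ t ∈ Icc 0 T, ∀ᵐ p : Phase, ‖p.2‖ ≤ ρ → M - c₀ * T ≤ f t p →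
      collQ K Φ (clip M (f t)) p ≤ -c₀) :
    ∀ t ∈ Icc 0 T, ∀ᵐ p : Phase, ‖p.2‖ ≤ ρ → f t p ≤ M - c₀ * t := by
  set S : Set Phase := {p | ‖p.2‖ ≤ ρ} with hSdef
  have hSm : MeasurableSet S := measurableSet_norm_le ρ
  -- On a ball of velocities the measure is finite, so that the constant barrier belongs to L¹ and
  -- the positive part argument applies.
  set μ := (volume : Measure Phase).restrict S with hμ
  have hfin : volume S ≠ ∞ := by
    have : S = univ ×ˢ Metric.closedBall (0 : Velocity) ρ := by
      ext p; simp [hSdef]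
    rw [this, Measure.volume_eq_prod, Measure.prod_prod]
    exact ENNReal.mul_ne_top (by simp) measure_closedBall_lt_top.ne
  have : IsFiniteMeasure μ := ⟨by rw [hμ, Measure.restrict_apply_univ]; exact hfin.lt_top⟩
  let R := LpToLpRestrictCLM Phase ℝ ℝ (volume : Measure Phase) 1 S
  have hR : ∀ u : PhaseL1, R u =ᵐ[μ] u := fun u => LpToLpRestrictCLM_coeFn ℝ S u
  let e : Lp ℝ 1 μ := (memLp_const (1 : ℝ)).toLp (fun _ => (1 : ℝ))
  have he : e =ᵐ[μ] fun _ => 1 := MemLp.coeFn_toLp _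
  have hd : ∀ t ∈ Icc 0 T, HasDerivWithinAt (fun s => -((M - c₀ * s) • e - R (sharp s (f s))))
      (-((-c₀) • e - R (sharp t (collL K Φ (clip M (f t)))))) (Icc 0 T) t := by
    intro t ht
    have h1 := R.hasFDerivAt.comp_hasDerivWithinAt t (hf.deriv t ht)
    have h2 : HasDerivAt (fun s : ℝ => M - c₀ * s) (-c₀) t := by
      have := ((hasDerivAt_id t).const_mul c₀).const_sub M
      rw [mul_one] at this
      exact this
    exact ((h2.hasDerivWithinAt.smul_const e).sub h1).neg
  have hco : ∀ (r : ℝ) (u : PhaseL1), (-(r • e - R u) : Lp ℝ 1 μ) =ᵐ[μ] fun p => u p - r := by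
    intro r u
    filter_upwards [Lp.coeFn_neg (r • e - R u), coeFn_smul_sub r e (R u), hR u, he] with p a1 a2 a3 a4
    rw [a1, Pi.neg_apply, a2, a3, a4]; ring
  have hae : ∀ {P : Phase → Prop}, (∀ᵐ p : Phase, P p) → ∀ᵐ p ∂μ, P p := fun h =>
    ae_restrict_of_ae h
  intro t ht
  have hT : 0 ≤ T := ht.1.trans ht.2
  have key := ae_nonpos_of_deriv hd (by
    filter_upwards [hco (M - c₀ * 0) (sharp 0 (f 0)), hae (hf.range 0 ⟨le_rfl, hT⟩)] with p a1 a2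
    rw [a1, sharp_zero]; linarith [a2.2]) (fun s hs => by
    have hs' : s ∈ Icc 0 T := ⟨hs.1.le, hs.2.le⟩
    filter_upwards [hco (M - c₀ * s) (sharp s (f s)),
      hco (-c₀) (sharp s (collL K Φ (clip M (f s)))), hae (coeFn_sharp s (f s)),
      hae (hf.coeFn_sharp_collL hs'), hae (ae_freeFlow s (hQ s hs')), ae_restrict_mem hSm]
      with p a1 a2 a3 a4 a5 a6 h
    rw [a1, a3] at h
    rw [a2, a4]
    have h1 : c₀ * s ≤ c₀ * T := by gcongr; exact hs.2.le
    have := a5 a6 (by linarith)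
    linarith) t ht
  refine ae_of_ae_freeFlow t ?_
  have key' : ∀ᵐ p ∂μ, sharp t (f t) p - (M - c₀ * t) ≤ 0 := by
    filter_upwards [key, hco (M - c₀ * t) (sharp t (f t))] with p a1 a2
    rwa [← a2]
  filter_upwards [(ae_restrict_iff' hSm).1 key', coeFn_sharp t (f t)] with p a1 a2 hp
  have := a1 hp
  rw [a2] at this
  linarith

end KineticSolution

/-! ### Initial data -/

/-- The initial density is bounded from below on sets of velocities of arbitrarily large measure. -/
theorem exists_initial_lower_bound {f₀ : Phase → ℝ} (hf₀ : IsInitialDatum α f₀) (m : ℝ≥0∞)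
    (hm : m < ∞) : ∃ (δ S : ℝ) (Z : Set Velocity), 0 < δ ∧ 0 ≤ S ∧ MeasurableSet Z ∧
      (∀ w ∈ Z, ‖w‖ ≤ S) ∧ (∀ᵐ p : Phase, p.2 ∈ Z → δ ≤ f₀ p) ∧ m ≤ volume Z := by
  set D : ℕ → Set Velocity := fun n =>
    {v | ‖v‖ ≤ n ∧ 1 / ((n : ℝ) + 1) ≤ ⨅ x : UnitAddCircle, f₀ (x, v)} with hD
  have hmono : Monotone D := by
    intro i j hij v hv
    have hij' : (i : ℝ) ≤ j := by exact_mod_cast hij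
    refine ⟨hv.1.trans hij', le_trans ?_ hv.2⟩
    exact one_div_le_one_div_of_le (by positivity) (by linarith)
  have hU : volume (⋃ n, D n) = ∞ := by
    have h1 : volume (univ : Set Velocity) ≤ volume (⋃ n, D n) := by
      refine measure_mono_ae ?_
      filter_upwards [hf₀.inf_pos] with v hv _
      obtain ⟨n, hn⟩ := exists_nat_gt (max ‖v‖ (1 / ⨅ x : UnitAddCircle, f₀ (x, v)))
      refine mem_iUnion.2 ⟨n, ((le_max_left _ _).trans_lt hn).le, ?_⟩
      have h2 := (le_max_right ‖v‖ _).trans_lt hn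
      rw [div_lt_iff₀ hv] at h2
      rw [div_le_iff₀ (by positivity)]
      nlinarith
    rw [eq_top_iff]
    refine le_trans (le_of_eq ?_) h1
    exact (measure_univ_of_isAddLeftInvariant (volume : Measure Velocity)).symm
  have hsup : ⨆ n, volume (D n) = ∞ := by
    rw [← hU, (hmono.directed_le).measure_iUnion]
  obtain ⟨n, hn⟩ := lt_iSup_iff.1 (hsup ▸ hm)
  set δ : ℝ := 1 / ((n : ℝ) + 1) with hδ
  have hbad : MeasurableSet {p : Phase | f₀ p < δ} := measurableSet_lt hf₀.measurable measurable_const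
  -- An infimum over uncountably many x need not be measurable in v. The condition is therefore
  -- stated by null sections, which gives a measurable set containing the corresponding set defined
  -- by the infimum.
  set Z : Set Velocity :=
    {v | ‖v‖ ≤ n} ∩ {v | volume ((fun x : UnitAddCircle => (x, v)) ⁻¹' {p : Phase | f₀ p < δ}) = 0}
    with hZ
  have hZm : MeasurableSet Z := (measurableSet_le (by fun_prop) measurable_const).inter
    ((measurable_measure_prodMk_right hbad) (measurableSet_singleton 0))
  refine ⟨δ, n, Z, by positivity, Nat.cast_nonneg n, hZm, fun w hw => hw.1, ?_, ?_⟩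
  · have hbm : MeasurableSet ({p : Phase | f₀ p < δ} ∩ Prod.snd ⁻¹' Z) :=
      hbad.inter (measurable_snd hZm)
    have h0 : volume ({p : Phase | f₀ p < δ} ∩ Prod.snd ⁻¹' Z) = 0 := by
      rw [Measure.volume_eq_prod, Measure.prod_apply_symm hbm]
      refine (lintegral_congr fun v => ?_).trans lintegral_zero
      by_cases hv : v ∈ Z
      · exact measure_mono_null (fun x hx => hx.1) hv.2
      · convert measure_empty (μ := (volume : Measure UnitAddCircle))
        ext x; simp [hv]
    filter_upwards [measure_eq_zero_iff_ae_notMem.1 h0] with p hp hpZ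
    by_contra h
    exact hp ⟨not_le.1 h, hpZ⟩
  · refine hn.le.trans (measure_mono fun v hv => ⟨hv.1, ?_⟩)
    have : (fun x : UnitAddCircle => (x, v)) ⁻¹' {p : Phase | f₀ p < δ} = ∅ := by
      ext x
      simp only [mem_preimage, mem_ofPred_eq, mem_empty_iff_false, iff_false, not_lt]
      exact hv.2.trans (ciInf_le ⟨0, by rintro _ ⟨y, rfl⟩; exact (hf₀.pos _).le⟩ x)
    change volume ((fun x : UnitAddCircle => (x, v)) ⁻¹' {p : Phase | f₀ p < δ}) = 0
    rw [this, measure_empty]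

/-- The initial density is dominated by an integrable function of the velocity. -/
theorem exists_initial_majorant {f₀ : Phase → ℝ} (hf₀ : IsInitialDatum α f₀) :
    ∃ (C₀ : ℝ) (s : Velocity → ℝ≥0∞), 0 ≤ C₀ ∧ Measurable s ∧ ∫⁻ v, s v ≤ ENNReal.ofReal C₀ ∧
      ∀ᵐ p : Phase, ENNReal.ofReal (f₀ p) ≤ s p.2 := by
  set S : Velocity → ℝ := fun v => ⨆ x : UnitAddCircle, f₀ (x, v) with hS
  have hi := hf₀.sup_integrable
  have hle : ∀ p : Phase, f₀ p ≤ S p.2 := fun p =>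
    le_ciSup (f := fun x => f₀ (x, p.2)) ⟨1 / α, by rintro _ ⟨y, rfl⟩; exact hf₀.le _⟩ p.1
  have hS0 : ∀ v, 0 ≤ S v := fun v => (hf₀.pos (0, v)).le.trans (hle (0, v))
  refine ⟨∫ v, S v, fun v => ENNReal.ofReal (hi.1.mk S v), integral_nonneg hS0,
    hi.1.stronglyMeasurable_mk.measurable.ennreal_ofReal, ?_, ?_⟩
  · rw [ofReal_integral_eq_lintegral_ofReal hi (Eventually.of_forall hS0)]
    refine le_of_eq (lintegral_congr_ae ?_)
    filter_upwards [hi.1.ae_eq_mk] with v hv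
    rw [← hv]
  · have : ∀ᵐ p : Phase, S p.2 = hi.1.mk S p.2 :=
      Measure.quasiMeasurePreserving_snd.ae hi.1.ae_eq_mk
    filter_upwards [this] with p hp
    rw [← hp]
    exact ENNReal.ofReal_le_ofReal (hle p)

end

section

variable {K : Velocity → Velocity → ℝ → ℝ} {b c α M k L T : ℝ} {Φ : ℝ → ℝ}

/-! ### Uniform bounds for the truncated problems -/

/-- Solutions with bounded density and energy, which for velocities `|v| ≤ ρ` stay below the barrier
`M - c₀ t`. -/
structure ControlledSolution (K : Velocity → Velocity → ℝ → ℝ) (Φ : ℝ → ℝ) (M T N E c₀ ρ : ℝ)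
    (f : ℝ → PhaseL1) : Prop extends KineticSolution K Φ M T f where
  bounded : ∀ t ∈ Icc 0 T, BoundedDensity M N (clip M (f t))
  energy_le : ∀ t ∈ Icc 0 T, ∫ p, energyWeight p * clip M (f t) p ≤ E
  barrier : ∀ t ∈ Icc 0 T, ∀ᵐ p : Phase, ‖p.2‖ ≤ ρ → f t p ≤ M - c₀ * t

/-- Slow particles have density at most M times the volume of a ball, and fast ones are still
distributed as initially. The bound depends on k and serves only to start the iteration for the
uniform bound. -/
theorem KineticSolution.exists_boundedDensity {f : ℝ → PhaseL1} (hf : KineticSolution K Φ M T f)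
    (hK : CollisionKernel K b c) (hb : 0 ≤ b)
    (hM : 0 ≤ M) (hΦ : FillingFunction α M Φ) (hk : 0 ≤ k) (hS : KernelSupport K k)
    (h0 : Integrable (fun p => energyWeight p * f 0 p) volume) {C₀ : ℝ} {s : Velocity → ℝ≥0∞}
    (hC₀ : 0 ≤ C₀) (hs : Measurable s) (hsC : ∫⁻ v, s v ≤ ENNReal.ofReal C₀)
    (hfs : ∀ᵐ p : Phase, ENNReal.ofReal (f 0 p) ≤ s p.2) :
    ∀ t ∈ Icc 0 T, BoundedDensity M (ballBound k M + C₀) (clip M (f t)) := by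
  intro t ht
  have ho := occupation_clip hM (measurable_L1 (f t))
  refine ⟨ho, ?_, add_nonneg (ballBound_nonneg hM) hC₀, ?_⟩
  · refine (hf.energy_eq hK hb hM hΦ hk hS h0 ht).1.congr ?_
    filter_upwards [hf.clip_ae ht] with p hp
    rw [hp]
  · have h1 : ∀ᵐ p : Phase, ENNReal.ofReal (clip M (f t) p) ≤
        ENNReal.ofReal (cut k M (f t) p) + s p.2 := by
      refine ae_of_ae_freeFlow t ?_
      filter_upwards [hf.sharp_ae_eq_of_lt hk hS t ht, coeFn_sharp t (f t), hfs,
        ae_freeFlow t (hf.clip_ae ht)] with p a1 a2 a3 a4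
      rcases le_or_gt ‖p.2‖ k with hp | hp
      · rw [cut_of_le (p := freeFlow t p) hp]
        exact le_self_add
      · rw [a4, ← a2, a1 hp]
        exact le_add_left a3
    filter_upwards [Measure.ae_ae_of_ae_prod h1] with x hx
    calc _ ≤ ∫⁻ v : Velocity, (ENNReal.ofReal (cut k M (f t) (x, v)) + s v) := lintegral_mono_ae hx
      _ ≤ ENNReal.ofReal (ballBound k M) + ENNReal.ofReal C₀ := by
          rw [lintegral_add_right _ hs]
          exact add_le_add (density_cut hM (measurable_L1 _) x) hsC
      _ = _ := (ENNReal.ofReal_add (ballBound_nonneg hM) hC₀).symm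

theorem KineticSolution.integral_energy_clip {f : ℝ → PhaseL1} (hf : KineticSolution K Φ M T f) {t : ℝ}
    (ht : t ∈ Icc 0 T) :
    ∫ p, energyWeight p * clip M (f t) p = ∫ p, energyWeight p * f t p := by
  refine integral_congr_ae ?_
  filter_upwards [hf.clip_ae ht] with p hp
  rw [hp]

/-- The order of the choices matters: N from the data and T, then a set Z large in terms of N, then
the lower bound δ' on Z up to time T, then the barrier slope c₀. None of them depends on k. -/
theorem exists_uniform_bounds {B : ℝ → ℝ → ℝ} {B₀ γ γ' cB : ℝ} (hα : 0 < α) (hα1 : α ≤ 1)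
    (hB₀ : 0 < B₀) (hγ : 0 < γ) (hcB : 0 < cB) (hB : IsCutoffKernel B B₀ γ γ' cB) {c : ℝ}
    (hc : 0 ≤ c) (hK : CollisionKernel (kernelAt B) B₀ c) {f₀ : Phase → ℝ}
    (hf₀ : IsInitialDatum α f₀) (hT : 0 < T) :
    ∃ N c₀ k₀ : ℝ, 0 ≤ N ∧ 0 < c₀ ∧ 1 ≤ k₀ ∧ ∀ k, k₀ ≤ k → ∀ f : ℝ → PhaseL1,
      KineticSolution (truncKernel (kernelAt B) k) (cutFilling α k) (1 / α) T f →
      f 0 =ᵐ[volume] f₀ →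
      ControlledSolution (truncKernel (kernelAt B) k) (cutFilling α k) (1 / α) T N
        (∫ p, energyWeight p * f₀ p) c₀ (k / 2) f := by
  have hM := one_le_one_div hα hα1
  set M := 1 / α with hMdef
  have hM0 : 0 ≤ M := by linarith
  set E := ∫ p, energyWeight p * f₀ p with hE
  have hE0 : 0 ≤ E := integral_nonneg fun p => mul_nonneg (energyWeight_nonneg p) (hf₀.pos p).le
  obtain ⟨C₀, s, hC₀, hs, hsC, hfs⟩ := exists_initial_majorant hf₀
  obtain ⟨N, hN0, hN⟩ := exists_density_bound hB₀.le hc hM0 hC₀ hE0 hT.le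
  set ℓ := cB / (2 * π) with hℓ
  have hℓ0 : 0 < ℓ := by positivity
  have hℓE : ENNReal.ofReal ℓ ≠ 0 := (ENNReal.ofReal_pos.2 hℓ0).ne'
  set X := ENNReal.ofReal (1 + 8 * c * B₀ * N / M) +
    ENNReal.ofReal ℓ * volume (Metric.ball (0 : Velocity) γ) with hX
  have hXtop : X < ∞ := ENNReal.add_lt_top.2 ⟨ENNReal.ofReal_lt_top,
    ENNReal.mul_lt_top ENNReal.ofReal_lt_top measure_ball_lt_top⟩
  obtain ⟨δ, S, Z, hδ, hS0, hZ, hZS, hfZ, hvolZ⟩ := exists_initial_lower_bound hf₀ (X / ENNReal.ofReal ℓ)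
    (ENNReal.div_lt_top hXtop.ne hℓE)
  have hvol : X ≤ ENNReal.ofReal ℓ * volume Z := by
    calc X = ENNReal.ofReal ℓ * (X / ENNReal.ofReal ℓ) :=
          (ENNReal.mul_div_cancel hℓE ENNReal.ofReal_ne_top).symm
      _ ≤ _ := by gcongr
  set δ' := Real.exp (-(M ^ 2 * B₀ * N * T)) * δ with hδ'
  have hδ'0 : 0 < δ' := by positivity
  set C₂ := 2 * c * B₀ * M ^ 2 * N with hC₂
  obtain ⟨c₀, hc₀, hbar⟩ := exists_barrier_slope (C₂ := C₂) (c₁ := δ' / 4) hα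
    (by linarith : 0 < M) (by positivity) (by positivity) hT
  -- With k ≥ 2S a partner from Z and a particle with |v| ≤ k/2 have energy below k², so these
  -- collisions are not truncated. This is why the barrier is claimed on |v| ≤ k/2.
  refine ⟨N, c₀, max 1 (2 * S), hN0, hc₀, le_max_left _ _, ?_⟩
  intro k hk f hf hf0
  have hk1 : 1 ≤ k := (le_max_left _ _).trans hk
  have hkS : 2 * S ≤ k := (le_max_right _ _).trans hk
  have hKk : CollisionKernel (truncKernel (kernelAt B) k) B₀ c := hK.trunc hB₀.le k
  have hΦ : FillingFunction α M (cutFilling α k) := fillingFunction_cutFilling hα hα1 hk1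
  have hSupp := kernelSupport_truncKernel (kernelAt B) k
  have h0i : Integrable (fun p => energyWeight p * f 0 p) volume := by
    refine hf₀.mass_energy.congr ?_
    filter_upwards [hf0] with p hp
    rw [hp]; rfl
  have hfs0 : ∀ᵐ p : Phase, ENNReal.ofReal (f 0 p) ≤ s p.2 := by
    filter_upwards [hfs, hf0] with p h1 h2
    rwa [h2]
  have hE' : ∀ t ∈ Icc 0 T, ∫ p, energyWeight p * clip M (f t) p ≤ E := by
    intro t ht
    rw [hf.integral_energy_clip ht,
      (hf.energy_eq hKk hB₀.le hM0 hΦ (by linarith) hSupp h0i ht).2]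
    refine le_of_eq (integral_congr_ae ?_)
    filter_upwards [hf0] with p hp
    rw [hp]
  have hbd := hN _ _ α f s hKk hΦ hf hs hsC hfs0 hE'
    ⟨_, hf.exists_boundedDensity hKk hB₀.le hM0 hΦ (by linarith) hSupp h0i hC₀ hs hsC hfs0⟩
  refine ⟨hf, hbd, hE', hf.le_barrier hc₀.le fun t ht => ?_⟩
  have hlowZ : ∀ᵐ p : Phase, p.2 ∈ Z → δ' ≤ clip M (f t) p := by
    refine ae_of_ae_freeFlow t ?_
    filter_upwards [hf.exp_le hKk hB₀.le hM0 hΦ hbd t ht, hf0, hfZ, ae_freeFlow t (hf.clip_ae ht)]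
      with p a1 a2 a3 a4 hp
    rw [a4]
    refine le_trans ?_ a1
    rw [a2, hδ']
    have := a3 hp
    have e1 : M ^ 2 * B₀ * N * t ≤ M ^ 2 * B₀ * N * T :=
      mul_le_mul_of_nonneg_left ht.2 (by positivity)
    gcongr
  have hfreq := le_lintegral_freqFn hKk hB₀.le hc hM hΦ (hbd t ht) hZ (ρ := k / 2) (γ := γ) (ℓ := ℓ)
    hδ'0.le hlowZ (fun v w hv hw hvw => by
      have h1 := hZS w hw
      have h2 : ‖v‖ ^ 2 + ‖w‖ ^ 2 ≤ k ^ 2 := by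
        nlinarith [norm_nonneg v, norm_nonneg w]
      simp only [truncKernel_of_le h2]
      exact HaldaneBoltzmann.IsCutoffKernel.lintegral_angle_ge hγ hB hvw) hvol
  filter_upwards [hfreq, (hbd t ht).collQ_le hKk hB₀.le hc hM0 hΦ (c₁ := δ' / 4), hf.clip_ae ht]
    with p a1 a2 a3 hp hpb
  refine (a2 (a1 hp)).trans (hbar _ hΦ _ ((hbd t ht).mem p) ?_)
  rwa [a3]

end

section

variable {b c α M T N E c₀ ρ κ : ℝ}

/-! ### Comparison of solutions -/

theorem integral_abs_eq_posPart {X : Type*} [MeasurableSpace X] {μ : Measure X} {u : X → ℝ}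
    (hu : Integrable u μ) : ∫ x, |u x| ∂μ = 2 * (∫ x, max (u x) 0 ∂μ) - ∫ x, u x ∂μ := by
  rw [← integral_const_mul, ← integral_sub (hu.pos_part.const_mul 2) hu]
  refine integral_congr_ae (Eventually.of_forall fun x => ?_)
  simp only
  rcases le_total 0 (u x) with h | h
  · rw [abs_of_nonneg h, max_eq_left h]; ring
  · rw [abs_of_nonpos h, max_eq_right h]; ring

/-- Growth rate in the comparison estimate. -/
noncomputable def compRate (α M b c N E c₀ : ℝ) : ℝ :=
  2 * collConst M b c * N * (2 + M * c₀ ^ (α - 1)) + (collConst M b c * N * E + 8 * M ^ 2 * b * N * E)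

/-- Comparison of a controlled solution with an arbitrary solution of a perturbed equation. -/
theorem exists_comparison (hα : 0 < α) (hα1 : α ≤ 1) (hb : 0 ≤ b) (hc : 0 ≤ c) (hM : 1 ≤ M)
    (hN : 0 ≤ N) (hE : 0 ≤ E) (hc₀ : 0 < c₀) (T : ℝ) :
    ∃ C, 0 ≤ C ∧ ∀ (K K' : Velocity → Velocity → ℝ → ℝ) (Φ Φ' : ℝ → ℝ) (κ ρ : ℝ) (f g : ℝ → PhaseL1),
      0 ≤ κ → CollisionKernel K b c → CollisionKernel K' b c → FillingFunction α M Φ →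
      FillingFunction α M Φ' → (∀ y ∈ Icc 0 M, |Φ y - Φ' y| ≤ κ) →
      (∀ v w φ, |K v w φ - K' v w φ| ≤ b * (κ * (‖v‖ ^ 2 + ‖w‖ ^ 2))) →
      (∀ p : Phase, ρ < ‖p.2‖ → M ≤ κ * energyWeight p) →
      ControlledSolution K Φ M T N E c₀ ρ f → KineticSolution K' Φ' M T g →
      ∀ t ∈ Icc 0 T, ‖f t - g t‖ ≤ C * (‖f 0 - g 0‖ + κ) := by
  have hM0 : 0 ≤ M := by linarith
  have hCC := collConst_nonneg (M := M) hb hc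
  have hcp : 0 ≤ c₀ ^ (α - 1) := Real.rpow_nonneg hc₀.le _
  set C₁ := compRate α M b c N E c₀ with hC₁
  have hC₁0 : 0 ≤ C₁ := by rw [hC₁, compRate]; positivity
  -- The rate 1 + t^(α-1) comes from the Lipschitz constant at distance c₀t from full occupation.
  -- Its antiderivative is finite at zero because α > 0.
  set A : ℝ → ℝ := fun t => C₁ * (t + t ^ α / α) with hA
  set a : ℝ → ℝ := fun t => C₁ * (1 + t ^ (α - 1)) with ha
  have hAc : Continuous A := by
    have : Continuous fun t : ℝ => t ^ α := Real.continuous_rpow_const hα.le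
    fun_prop
  have hA' : ∀ t, 0 < t → HasDerivAt A (a t) t := by
    intro t ht
    have h1 := ((hasDerivAt_id t).add
      ((Real.hasDerivAt_rpow_const (x := t) (p := α) (Or.inl ht.ne')).div_const α)).const_mul C₁
    refine h1.congr_deriv ?_
    simp only [ha]
    field_simp
  have hA0 : A 0 = 0 := by simp only [hA]; rw [Real.zero_rpow hα.ne']; simp
  refine ⟨4 * Real.exp (A T), by positivity, ?_⟩
  intro K K' Φ Φ' κ ρ f g hκ hK hK' hΦ hΦ' hφ hKK hρ hf hg t ht
  have hT : 0 ≤ T := ht.1.trans ht.2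
  set δ := ‖f 0 - g 0‖ with hδ
  have hδ0 : 0 ≤ δ := norm_nonneg _
  set h : ℝ → PhaseL1 := fun s => sharp s (f s) - sharp s (g s) with hh
  have hh' : ∀ s, h s = sharp s (f s - g s) := fun s => (sharp_sub s _ _).symm
  set h' : ℝ → PhaseL1 := fun s => sharp s (collL K Φ (clip M (f s))) -
    sharp s (collL K' Φ' (clip M (g s))) with hh1
  have hd : ∀ s ∈ Icc 0 T, HasDerivWithinAt h (h' s) (Icc 0 T) s := fun s hs =>
    (hf.deriv s hs).sub (hg.deriv s hs)
  have hint : ∀ s ∈ Icc 0 T, ∫ p, h s p = ∫ p, f 0 p - g 0 p := by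
    intro s hs
    rw [hh', integral_sharp, integral_congr_ae (Lp.coeFn_sub (f s) (g s)),
      integral_sub (L1.integrable_coeFn _) (L1.integrable_coeFn _)]
    have e1 : ∫ p, (f s : Phase → ℝ) p - (g s : Phase → ℝ) p =
        (∫ p, f s p) - ∫ p, g s p := integral_sub (L1.integrable_coeFn _) (L1.integrable_coeFn _)
    simp only [Pi.sub_apply]
    rw [e1, hf.toKineticSolution.integral_eq hK s hs, hg.integral_eq hK' s hs]
  have hmass : |∫ p, f 0 p - g 0 p| ≤ δ := by
    rw [hδ, norm_sub_eq_integral (EventuallyEq.refl _ _) (EventuallyEq.refl _ _)]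
    exact abs_integral_le_integral_abs
  -- Both masses are conserved, so the integral of the difference keeps its initial value and |h| =
  -- 2h⁺ - h gives the norm from the positive part.
  have hnorm : ∀ s ∈ Icc 0 T, ‖f s - g s‖ ≤ 2 * (∫ p, max (h s p) 0) + δ := by
    intro s hs
    rw [← norm_sharp s, ← hh', L1.norm_eq_integral_norm]
    simp only [Real.norm_eq_abs]
    rw [integral_abs_eq_posPart (L1.integrable_coeFn (h s)), hint s hs]
    linarith [neg_le_of_abs_le hmass]
  have hβ : ∀ s ∈ Ioo 0 T, ∃ β : Phase → ℝ, Integrable β volume ∧ (∀ p, 0 ≤ β p) ∧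
      (∀ᵐ p : Phase, 0 ≤ h s p → h' s p ≤ β p) ∧
      ∫ p, β p ≤ a s * ((∫ p, max (h s p) 0) + (δ + κ)) := by
    intro s hs
    have hs' : s ∈ Icc 0 T := ⟨hs.1.le, hs.2.le⟩
    have hfb := hf.bounded s hs'
    have hgo := occupation_clip hM0 (measurable_L1 (g s))
    have hgi : Integrable (clip M (g s)) volume :=
      (L1.integrable_coeFn (g s)).congr (hg.clip_ae hs').symm
    have hspow : 0 ≤ s ^ (α - 1) := Real.rpow_nonneg hs.1.le _
    set Λ := 1 + M * (c₀ * s) ^ (α - 1) with hΛ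
    have hΛ0 : 0 ≤ Λ := by
      have : 0 ≤ (c₀ * s) ^ (α - 1) := Real.rpow_nonneg (mul_nonneg hc₀.le hs.1.le) _
      positivity
    have hΛφ : ∀ᵐ p : Phase, |Φ' (clip M (f s) p) - Φ' (clip M (g s) p)| ≤
        Λ * |clip M (f s) p - clip M (g s) p| + κ * energyWeight p := by
      filter_upwards [hf.barrier s hs', hf.clip_ae hs'] with p a1 a2
      -- Beyond |v| = ρ no barrier is available, but the difference of filling factors is at most M,
      -- and there M is at most κ times the energy weight.
      rcases le_or_gt ‖p.2‖ ρ with hp | hp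
      · have := hΦ'.lipschitz_away hα1 hM (mul_pos hc₀ hs.1) (hfb.mem p) (hgo.mem p)
          (by rw [a2]; exact a1 hp)
        have h0 : 0 ≤ κ * energyWeight p := mul_nonneg hκ (energyWeight_nonneg p)
        linarith
      · have h1 := hΦ'.mem_Icc (hfb.mem p)
        have h2 := hΦ'.mem_Icc (hgo.mem p)
        have h3 : |Φ' (clip M (f s) p) - Φ' (clip M (g s) p)| ≤ M := by
          rw [abs_le]; constructor <;> linarith [h1.1, h1.2, h2.1, h2.2]
        have h4 : 0 ≤ Λ * |clip M (f s) p - clip M (g s) p| := mul_nonneg hΛ0 (abs_nonneg _)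
        linarith [hρ p hp]
    have hfc := hfb.collInt hK hb hM0 hΦ
    have hfc' := hfb.collInt hK' hb hM0 hΦ'
    obtain ⟨β, hβi, hβ0, hβl, hβI⟩ := exists_collQ_sub_le hK' hb hc hM hΦ' hfb hgo hgi hfc'
      (hg.coll s hs') hΛ0 hκ hΛφ
    have hpert := integral_abs_collQ_perturb_le hK hK' hb hM hΦ hΦ' hfb hκ hφ hKK
    set π₁ : Phase → ℝ := fun p => |collQ K Φ (clip M (f s)) p - collQ K' Φ' (clip M (f s)) p| with hπ
    have hπi : Integrable π₁ volume := (hfc.integrable_collQ.sub hfc'.integrable_collQ).abs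
    refine ⟨fun p => (fun p => β p + π₁ p) (freeFlow s p),
      integrable_comp_freeFlow s (hβi.add hπi),
      fun p => add_nonneg (hβ0 _) (abs_nonneg _), ?_, ?_⟩
    · filter_upwards [Lp.coeFn_sub (sharp s (f s)) (sharp s (g s)), coeFn_sharp s (f s),
        coeFn_sharp s (g s), ae_freeFlow s (hf.clip_ae hs'), ae_freeFlow s (hg.clip_ae hs'),
        Lp.coeFn_sub (sharp s (collL K Φ (clip M (f s)))) (sharp s (collL K' Φ' (clip M (g s)))),
        hf.coeFn_sharp_collL hs', hg.coeFn_sharp_collL hs', ae_freeFlow s hβl]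
        with p a1 a2 a3 a4 a5 a6 a7 a8 a9 hp
      simp only [hh] at hp
      rw [a1, Pi.sub_apply, a2, a3, ← a4, ← a5, sub_nonneg] at hp
      simp only [hh1]
      rw [a6, Pi.sub_apply, a7, a8]
      have h1 := a9 hp
      have h2 : collQ K Φ (clip M (f s)) (freeFlow s p) - collQ K' Φ' (clip M (f s)) (freeFlow s p)
          ≤ π₁ (freeFlow s p) := le_abs_self _
      linarith
    · rw [integral_comp_freeFlow (F := fun p => β p + π₁ p) s
        (hβi.add hπi).aestronglyMeasurable, integral_add hβi hπi]
      have hEf := hf.energy_le s hs'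
      set φ := ∫ p, max (h s p) 0 with hφdef
      have hφ0 : 0 ≤ φ := integral_nonneg fun p => le_max_right _ _
      have hD : ∫ p, |clip M (f s) p - clip M (g s) p| ≤ 2 * φ + δ := by
        rw [← norm_sub_eq_integral (hf.clip_ae hs').symm (hg.clip_ae hs').symm]
        exact hnorm s hs'
      have e1 : Λ = 1 + M * c₀ ^ (α - 1) * s ^ (α - 1) := by
        rw [hΛ, Real.mul_rpow hc₀.le hs.1.le, mul_assoc]
      set q := s ^ (α - 1) with hq
      have b1 : (1 + Λ) ≤ (2 + M * c₀ ^ (α - 1)) * (1 + q) := by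
        rw [e1]
        have : 0 ≤ M * c₀ ^ (α - 1) := by positivity
        nlinarith
      have b2 : ∫ p, β p ≤ collConst M b c * N *
          ((2 + M * c₀ ^ (α - 1)) * (1 + q) * (2 * (φ + (δ + κ))) + κ * E) := by
        refine hβI.trans (mul_le_mul_of_nonneg_left (add_le_add ?_ ?_) (mul_nonneg hCC hN))
        · refine mul_le_mul b1 (hD.trans (by linarith)) (integral_nonneg fun p => abs_nonneg _)
            (by positivity)
        · exact mul_le_mul_of_nonneg_left hEf hκ
      have b3 : ∫ p, π₁ p ≤ 8 * M ^ 2 * b * N * (κ * E) :=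
        hpert.trans (mul_le_mul_of_nonneg_left (mul_le_mul_of_nonneg_left hEf hκ) (by positivity))
      set W := collConst M b c * N * E + 8 * M ^ 2 * b * N * E with hW
      have hW0 : 0 ≤ W := by positivity
      have b4 : W * κ ≤ W * ((1 + q) * (φ + (δ + κ))) := by
        refine mul_le_mul_of_nonneg_left ?_ hW0
        have h1 : 0 ≤ q * (φ + (δ + κ)) := by positivity
        nlinarith
      simp only [ha, hC₁, compRate]
      calc _ ≤ collConst M b c * N *
          ((2 + M * c₀ ^ (α - 1)) * (1 + q) * (2 * (φ + (δ + κ))) + κ * E) +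
            8 * M ^ 2 * b * N * (κ * E) := add_le_add b2 b3
        _ = 2 * collConst M b c * N * (2 + M * c₀ ^ (α - 1)) * ((1 + q) * (φ + (δ + κ))) + W * κ := by
            rw [hW]; ring
        _ ≤ 2 * collConst M b c * N * (2 + M * c₀ ^ (α - 1)) * ((1 + q) * (φ + (δ + κ))) +
            W * ((1 + q) * (φ + (δ + κ))) := by linarith
        _ = _ := by ring
  have hG := integral_posPart_le_exp (κ := δ + κ) (by positivity) hd hAc.continuousOn hA' hβ t ht
  rw [hA0, sub_zero] at hG
  have h0 : ∫ p, max (h 0 p) 0 ≤ δ := by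
    simp only [hδ]
    rw [hh', sharp_zero, L1.norm_eq_integral_norm]
    refine integral_mono (L1.integrable_coeFn _).pos_part (L1.integrable_coeFn _).norm fun p => ?_
    exact max_le (le_abs_self _) (abs_nonneg _)
  have hAT : A t ≤ A T := by
    simp only [hA]
    have := Real.rpow_le_rpow ht.1 ht.2 hα.le
    have := ht.2
    gcongr
  have hexp := Real.exp_le_exp.2 hAT
  have hφt : 0 ≤ ∫ p, max (h t p) 0 := integral_nonneg fun p => le_max_right _ _
  calc ‖f t - g t‖ ≤ 2 * (∫ p, max (h t p) 0) + δ := hnorm t ht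
    _ ≤ 2 * ((∫ p, max (h t p) 0) + (δ + κ)) := by linarith
    _ ≤ 2 * (((∫ p, max (h 0 p) 0) + (δ + κ)) * Real.exp (A t)) := by linarith
    _ ≤ 2 * ((2 * (δ + κ)) * Real.exp (A T)) := by
        gcongr
        linarith
    _ = _ := by ring

end

section

variable {b c α M T N E c₀ : ℝ}

/-! ### Passage to the limit -/

theorem ae_eventually_of_eventually_ae {X : Type*} [MeasurableSpace X] {μ : Measure X}
    {Q : ℕ → X → Prop} (h : ∀ᶠ n in atTop, ∀ᵐ x ∂μ, Q n x) : ∀ᵐ x ∂μ, ∀ᶠ n in atTop, Q n x := by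
  obtain ⟨n₀, hn₀⟩ := eventually_atTop.1 h
  have h1 : ∀ᵐ x ∂μ, ∀ n, n₀ ≤ n → Q n x := by
    rw [ae_all_iff]
    intro n
    by_cases hn : n₀ ≤ n
    · filter_upwards [hn₀ n hn] with x hx _
      exact hx
    · exact Eventually.of_forall fun x hx => absurd hx hn
  filter_upwards [h1] with x hx
  exact eventually_atTop.2 ⟨n₀, hx⟩

theorem exists_subseq_tendsto_ae {u : ℕ → PhaseL1} {l : PhaseL1} (h : Tendsto u atTop (𝓝 l)) :
    ∃ ns : ℕ → ℕ, StrictMono ns ∧ ∀ᵐ p : Phase, Tendsto (fun i => u (ns i) p) atTop (𝓝 (l p)) :=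
  (tendstoInMeasure_of_tendsto_Lp h).exists_seq_tendsto_ae

/-- Pointwise closed constraints pass to limits in `L¹`. -/
theorem ae_mem_of_tendsto {u : ℕ → PhaseL1} {l : PhaseL1} (h : Tendsto u atTop (𝓝 l))
    {S : Phase → Set ℝ} (hS : ∀ p, IsClosed (S p)) (hu : ∀ᵐ p : Phase, ∀ᶠ n in atTop, u n p ∈ S p) :
    ∀ᵐ p : Phase, l p ∈ S p := by
  obtain ⟨ns, hns, hlim⟩ := exists_subseq_tendsto_ae h
  filter_upwards [hu, hlim] with p h1 h2
  exact (hS p).mem_of_tendsto h2 (hns.tendsto_atTop.eventually h1)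

/-- Fatou's lemma along an almost everywhere convergent subsequence, on phase space for the energy
and on almost every fibre over x for the density. -/
theorem boundedDensity_of_tendsto {u : ℕ → PhaseL1} {l : PhaseL1} (h : Tendsto u atTop (𝓝 l))
    (hM : 0 ≤ M) (hu : ∀ᶠ n in atTop, BoundedDensity M N (clip M (u n)))
    (hE : ∀ᶠ n in atTop, ∫ p, energyWeight p * clip M (u n) p ≤ E) :
    BoundedDensity M N (clip M l) ∧ ∫ p, energyWeight p * clip M l p ≤ E := by
  obtain ⟨ns, hns, hlim⟩ := exists_subseq_tendsto_ae h
  have hcont : Continuous fun y : ℝ => max 0 (min y M) := by fun_prop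
  have hlim' : ∀ᵐ p : Phase, Tendsto (fun i => clip M (u (ns i)) p) atTop (𝓝 (clip M l p)) := by
    filter_upwards [hlim] with p hp
    exact (hcont.tendsto _).comp hp
  have ho := occupation_clip hM (measurable_L1 l)
  have hum := fun n => (occupation_clip hM (measurable_L1 (u n))).measurable
  obtain ⟨n₀, hn₀⟩ := (hu.and hE).exists
  have hN0 := hn₀.1.nonneg_bound
  have hE0 : 0 ≤ E := (integral_nonneg fun p =>
    mul_nonneg (energyWeight_nonneg p) (hn₀.1.mem p).1).trans hn₀.2
  have hlE : ∫⁻ p, ENNReal.ofReal (energyWeight p * clip M l p) ≤ ENNReal.ofReal E := by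
    have h1 : ∫⁻ p, ENNReal.ofReal (energyWeight p * clip M l p) =
        ∫⁻ p, liminf (fun i => ENNReal.ofReal (energyWeight p * clip M (u (ns i)) p)) atTop := by
      refine lintegral_congr_ae ?_
      filter_upwards [hlim'] with p hp
      exact ((ENNReal.continuous_ofReal.tendsto _).comp (hp.const_mul _)).liminf_eq.symm
    rw [h1]
    refine (lintegral_liminf_le fun i =>
      (measurable_energyWeight.mul (hum _)).ennreal_ofReal).trans ?_
    refine liminf_le_of_frequently_le' (Eventually.frequently ?_)
    filter_upwards [hns.tendsto_atTop.eventually (hu.and hE)] with i hi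
    change ∫⁻ p, ENNReal.ofReal (energyWeight p * clip M (u (ns i)) p) ≤ _
    rw [← ofReal_integral_eq_lintegral_ofReal hi.1.energy (Eventually.of_forall fun p =>
      mul_nonneg (energyWeight_nonneg p) (hi.1.mem p).1)]
    exact ENNReal.ofReal_le_ofReal hi.2
  have hE' : ∀ p, 0 ≤ energyWeight p * clip M l p := fun p =>
    mul_nonneg (energyWeight_nonneg p) (ho.mem p).1
  have hint : Integrable (fun p => energyWeight p * clip M l p) volume :=
    (lintegral_ofReal_ne_top_iff_integrable
      (measurable_energyWeight.mul ho.measurable).aestronglyMeasurable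
      (Eventually.of_forall hE')).1 (hlE.trans_lt ENNReal.ofReal_lt_top).ne
  refine ⟨⟨ho, hint, hN0, ?_⟩, ?_⟩
  · have hdens := ae_eventually_of_eventually_ae (hu.mono fun n hn => hn.density)
    filter_upwards [Measure.ae_ae_of_ae_prod hlim', hdens] with x h1 h2
    have h3 : ∫⁻ v : Velocity, ENNReal.ofReal (clip M l (x, v)) =
        ∫⁻ v : Velocity, liminf (fun i => ENNReal.ofReal (clip M (u (ns i)) (x, v))) atTop := by
      refine lintegral_congr_ae ?_
      filter_upwards [h1] with v hv
      exact ((ENNReal.continuous_ofReal.tendsto _).comp hv).liminf_eq.symm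
    rw [h3]
    refine (lintegral_liminf_le fun i =>
      ((hum _).comp measurable_prodMk_left).ennreal_ofReal).trans ?_
    exact liminf_le_of_frequently_le' (hns.tendsto_atTop.eventually h2).frequently
  · rw [← ofReal_integral_eq_lintegral_ofReal hint (Eventually.of_forall hE')] at hlE
    exact (ENNReal.ofReal_le_ofReal_iff hE0).1 hlE

/-- Uniform convergence of derivatives on a compact interval. -/
theorem hasDerivWithinAt_of_tendstoUniformlyOn {F : Type*} [NormedAddCommGroup F] [NormedSpace ℝ F]
    [CompleteSpace F] {h V : ℕ → ℝ → F} {h' V' : ℝ → F} {T : ℝ}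
    (hd : ∀ᶠ n in atTop, ∀ t ∈ Icc 0 T, HasDerivWithinAt (h n) (V n t) (Icc 0 T) t)
    (hc : ∀ᶠ n in atTop, ContinuousOn (V n) (Icc 0 T))
    (hh : ∀ t ∈ Icc 0 T, Tendsto (fun n => h n t) atTop (𝓝 (h' t)))
    (hV : TendstoUniformlyOn V V' atTop (Icc 0 T)) :
    ContinuousOn V' (Icc 0 T) ∧ ∀ t ∈ Icc 0 T, HasDerivWithinAt h' (V' t) (Icc 0 T) t := by
  have hVc : ContinuousOn V' (Icc 0 T) := hV.continuousOn hc.frequently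
  refine ⟨hVc, ?_⟩
  have hsub : ∀ t ∈ Icc 0 T, uIcc 0 t ⊆ Icc 0 T := fun t ht => by
    rw [uIcc_of_le ht.1]; exact Icc_subset_Icc_right ht.2
  have key : ∀ t ∈ Icc 0 T, h' t = h' 0 + ∫ s in (0 : ℝ)..t, V' s := by
    intro t ht
    have h0 : (0 : ℝ) ∈ Icc 0 T := ⟨le_rfl, ht.1.trans ht.2⟩
    have h1 : ∀ᶠ n in atTop, ∫ s in (0 : ℝ)..t, V n s = h n t - h n 0 := by
      filter_upwards [hd, hc] with n hdn hcn
      refine intervalIntegral.integral_eq_sub_of_hasDeriv_right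
        (fun s hs => ((hdn s (hsub t ht hs)).continuousWithinAt).mono (hsub t ht)) ?_
        (hcn.mono (hsub t ht)).intervalIntegrable
      intro s hs
      rw [min_eq_left ht.1, max_eq_right ht.1] at hs
      exact hasDerivWithinAt_Ioi_of_Icc (hdn s ⟨hs.1.le, hs.2.le.trans ht.2⟩)
        ⟨hs.1.le, hs.2.trans_le ht.2⟩
    have h2 : Tendsto (fun n => ∫ s in (0 : ℝ)..t, V n s) atTop (𝓝 (∫ s in (0 : ℝ)..t, V' s)) := by
      rw [Metric.tendsto_atTop']
      intro ε hε
      have h3 := Metric.tendstoUniformlyOn_iff.1 hV (ε / (t + 1)) (by have := ht.1; positivity)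
      obtain ⟨n₀, hn₀⟩ := eventually_atTop.1 (h3.and hc)
      refine ⟨n₀, fun n hn => ?_⟩
      obtain ⟨h4, h5⟩ := hn₀ n hn.le
      rw [dist_eq_norm, ← intervalIntegral.integral_sub (h5.mono (hsub t ht)).intervalIntegrable
        (hVc.mono (hsub t ht)).intervalIntegrable]
      have h6 : ‖∫ s in (0 : ℝ)..t, (V n s - V' s)‖ ≤ ε / (t + 1) * |t - 0| := by
        refine intervalIntegral.norm_integral_le_of_norm_le_const fun s hs => ?_
        have := h4 s (hsub t ht (uIoc_subset_uIcc hs))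
        rw [dist_eq_norm, norm_sub_rev] at this
        exact this.le
      rw [sub_zero, abs_of_nonneg ht.1] at h6
      refine h6.trans_lt ?_
      have := ht.1
      rw [div_mul_eq_mul_div, div_lt_iff₀ (by positivity)]
      nlinarith
    have h3 : Tendsto (fun n => h n t - h n 0) atTop (𝓝 (h' t - h' 0)) := (hh t ht).sub (hh 0 h0)
    have h4 := tendsto_nhds_unique h3 (h2.congr' h1)
    rw [← h4]; abel
  intro t ht
  have h0 : (0 : ℝ) ∈ Icc 0 T := ⟨le_rfl, ht.1.trans ht.2⟩
  have h1 := ODE.hasDerivWithinAt_picard_Icc (f := fun t (_ : F) => V' t) (α := fun _ => (0 : F))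
    (u := univ) h0 (hVc.comp continuousOn_fst fun q hq => hq.1) continuousOn_const
    (fun _ _ => mem_univ _) (h' 0) ht
  exact h1.congr (fun s hs => key s hs) (key t ht)

theorem abs_truncKernel_sub_le {K : Velocity → Velocity → ℝ → ℝ} (hK : CollisionKernel K b c)
    (hb : 0 ≤ b) {k κ : ℝ} (hκ0 : 0 ≤ κ) (hκ : 1 ≤ κ * k ^ 2) (v w : Velocity) (φ : ℝ) :
    |truncKernel K k v w φ - K v w φ| ≤ b * (κ * (‖v‖ ^ 2 + ‖w‖ ^ 2)) := by
  rcases le_or_gt (‖v‖ ^ 2 + ‖w‖ ^ 2) (k ^ 2) with h | h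
  · rw [truncKernel_of_le h, sub_self, abs_zero]; positivity
  · rw [truncKernel_of_lt h, zero_sub, abs_neg, abs_of_nonneg (hK.nonneg _ _ _)]
    refine (hK.le _ _ _).trans (le_mul_of_one_le_right hb (hκ.trans ?_))
    gcongr

theorem abs_truncKernel_sub_truncKernel_le {K : Velocity → Velocity → ℝ → ℝ}
    (hK : CollisionKernel K b c) (hb : 0 ≤ b) {k k' κ : ℝ} (hκ0 : 0 ≤ κ) (hκ : 1 ≤ κ * k ^ 2)
    (hk : 0 ≤ k) (hkk : k ≤ k') (v w : Velocity) (φ : ℝ) :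
    |truncKernel K k v w φ - truncKernel K k' v w φ| ≤ b * (κ * (‖v‖ ^ 2 + ‖w‖ ^ 2)) := by
  rcases le_or_gt (‖v‖ ^ 2 + ‖w‖ ^ 2) (k ^ 2) with h | h
  · rw [truncKernel_of_le h, truncKernel_of_le (h.trans (by gcongr)), sub_self, abs_zero]; positivity
  · have h1 := hK.trunc hb k'
    rw [truncKernel_of_lt h, zero_sub, abs_neg, abs_of_nonneg (h1.nonneg _ _ _)]
    refine (h1.le _ _ _).trans (le_mul_of_one_le_right hb (hκ.trans ?_))
    gcongr

/-- Limits of controlled solutions are controlled solutions of the limit equation. -/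
theorem controlledSolution_of_tendsto (hb : 0 ≤ b) (hc : 0 ≤ c) (hM : 1 ≤ M) (hT : 0 ≤ T)
    {K : Velocity → Velocity → ℝ → ℝ} {Φ : ℝ → ℝ} (hK : CollisionKernel K b c)
    (hΦ : FillingFunction α M Φ)
    (hmod : ∀ ε, 0 < ε → ∃ L, 0 ≤ L ∧ ∀ y ∈ Icc 0 M, ∀ z ∈ Icc 0 M, |Φ y - Φ z| ≤ L * |y - z| + ε)
    {Ks : ℕ → Velocity → Velocity → ℝ → ℝ} {Φs : ℕ → ℝ → ℝ} {ρs : ℕ → ℝ} {F : ℕ → ℝ → PhaseL1}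
    {f : ℝ → PhaseL1} (hKs : ∀ᶠ n in atTop, CollisionKernel (Ks n) b c)
    (hΦs : ∀ᶠ n in atTop, FillingFunction α M (Φs n))
    (hpert : ∀ κ, 0 < κ → ∀ᶠ n in atTop, (∀ y ∈ Icc 0 M, |Φs n y - Φ y| ≤ κ) ∧
      ∀ v w φ, |Ks n v w φ - K v w φ| ≤ b * (κ * (‖v‖ ^ 2 + ‖w‖ ^ 2)))
    (hρ : Tendsto ρs atTop atTop)
    (hF : ∀ᶠ n in atTop, ControlledSolution (Ks n) (Φs n) M T N E c₀ (ρs n) (F n))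
    (hconv : TendstoUniformlyOn F f atTop (Icc 0 T)) (ρ : ℝ) :
    ControlledSolution K Φ M T N E c₀ ρ f := by
  have hM0 : 0 ≤ M := by linarith
  have hpt : ∀ t ∈ Icc 0 T, Tendsto (fun n => F n t) atTop (𝓝 (f t)) := fun t ht =>
    hconv.tendsto_at ht
  have hbd : ∀ t ∈ Icc 0 T, BoundedDensity M N (clip M (f t)) ∧
      ∫ p, energyWeight p * clip M (f t) p ≤ E := fun t ht =>
    boundedDensity_of_tendsto (hpt t ht) hM0 (hF.mono fun n hn => hn.bounded t ht)
      (hF.mono fun n hn => hn.energy_le t ht)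
  have hrange : ∀ t ∈ Icc 0 T, ∀ᵐ p : Phase, 0 ≤ f t p ∧ f t p ≤ M := fun t ht =>
    ae_mem_of_tendsto (hpt t ht) (S := fun _ => Icc 0 M) (fun _ => isClosed_Icc)
      (ae_eventually_of_eventually_ae (hF.mono fun n hn => hn.range t ht))
  have hcoll : ∀ t ∈ Icc 0 T, CollInt K Φ (clip M (f t)) := fun t ht =>
    (hbd t ht).1.collInt hK hb hM0 hΦ
  obtain ⟨n₀, hn₀⟩ := hF.exists
  have h0T : (0 : ℝ) ∈ Icc 0 T := ⟨le_rfl, hT⟩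
  have hN0 : 0 ≤ N := (hbd 0 h0T).1.nonneg_bound
  have hE0 : 0 ≤ E := (integral_nonneg fun p =>
    mul_nonneg (energyWeight_nonneg p) ((hbd 0 h0T).1.mem p).1).trans (hbd 0 h0T).2
  have hunif : TendstoUniformlyOn (fun n t => sharp t (collL (Ks n) (Φs n) (clip M (F n t))))
      (fun t => sharp t (collL K Φ (clip M (f t)))) atTop (Icc 0 T) := by
    rw [Metric.tendstoUniformlyOn_iff]
    intro ε hε
    have hCC := collConst_nonneg (M := M) hb hc
    set W := 8 * M ^ 2 * b * N * E + collConst M b c * N * (1 + E) with hW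
    have hW0 : 0 ≤ W := by positivity
    set κ := ε / (2 * (W + 1)) with hκ
    have hκ0 : 0 < κ := by positivity
    -- The tolerance κ is fixed first; L may be huge, and L¹ closeness κ/(1 + L) is demanded only
    -- afterwards.
    obtain ⟨L, hL0, hL⟩ := hmod κ hκ0
    have hη : 0 < κ / (1 + L) := by positivity
    filter_upwards [hKs, hΦs, hpert κ hκ0, hF, Metric.tendstoUniformlyOn_iff.1 hconv _ hη]
      with n a1 a2 a3 a4 a5 t ht
    have hFb := a4.bounded t ht
    have hfb := (hbd t ht).1
    have hclose : ∫ p, |clip M (F n t) p - clip M (f t) p| ≤ κ / (1 + L) := by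
      rw [← norm_sub_eq_integral (a4.clip_ae ht).symm (clip_ae_eq (hrange t ht)).symm,
        norm_sub_rev, ← dist_eq_norm]
      exact (a5 t ht).le
    have e1 := integral_abs_collQ_perturb_le a1 hK hb hM a2 hΦ hFb hκ0.le a3.1 a3.2
    have e2 := integral_abs_collQ_le hK hb hc hM hΦ hFb.toOccupation hFb.integrable hFb.density hfb
      hL0 hκ0.le (Eventually.of_forall fun p => by
        refine (hL _ (hFb.mem p) _ (hfb.mem p)).trans (add_le_add_right ?_ _)
        exact le_mul_of_one_le_right hκ0.le (one_le_energyWeight p))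
    have i1 := hFb.collInt a1 hb hM0 a2
    have i2 := hFb.collInt hK hb hM0 hΦ
    have i3 := hcoll t ht
    rw [dist_eq_norm, ← sharp_sub, norm_sharp, norm_sub_rev,
      norm_sub_eq_integral (coeFn_collL i1) (coeFn_collL i3)]
    have e3 : ∫ p, |collQ (Ks n) (Φs n) (clip M (F n t)) p - collQ K Φ (clip M (f t)) p| ≤
        (∫ p, |collQ (Ks n) (Φs n) (clip M (F n t)) p - collQ K Φ (clip M (F n t)) p|) +
        ∫ p, |collQ K Φ (clip M (F n t)) p - collQ K Φ (clip M (f t)) p| := by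
      have i12 : Integrable (fun p => |collQ (Ks n) (Φs n) (clip M (F n t)) p -
          collQ K Φ (clip M (F n t)) p|) volume :=
        (i1.integrable_collQ.sub i2.integrable_collQ).abs
      have i23 : Integrable (fun p => |collQ K Φ (clip M (F n t)) p -
          collQ K Φ (clip M (f t)) p|) volume :=
        (i2.integrable_collQ.sub i3.integrable_collQ).abs
      rw [← integral_add i12 i23]
      refine integral_mono (i1.integrable_collQ.sub i3.integrable_collQ).abs (i12.add i23)
        fun p => ?_
      exact abs_sub_le _ _ _
    have e4 : 8 * M ^ 2 * b * N * (κ * ∫ p, energyWeight p * clip M (F n t) p) ≤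
        8 * M ^ 2 * b * N * (κ * E) := by
      gcongr
      exact a4.energy_le t ht
    have e5 : collConst M b c * N * ((1 + L) * (∫ p, |clip M (F n t) p - clip M (f t) p|) +
        κ * ∫ p, energyWeight p * clip M (f t) p) ≤ collConst M b c * N * (κ + κ * E) := by
      refine mul_le_mul_of_nonneg_left (add_le_add ?_ ?_) (mul_nonneg hCC hN0)
      · calc _ ≤ (1 + L) * (κ / (1 + L)) := by gcongr
          _ = κ := by field_simp
      · exact mul_le_mul_of_nonneg_left (hbd t ht).2 hκ0.le
    calc _ ≤ 8 * M ^ 2 * b * N * (κ * E) + collConst M b c * N * (κ + κ * E) := by linarith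
      _ = W * κ := by rw [hW]; ring
      _ = ε * (W / (2 * (W + 1))) := by rw [hκ]; field_simp
      _ < ε * 1 := by
          refine mul_lt_mul_of_pos_left ?_ hε
          rw [div_lt_one (by positivity)]; linarith
      _ = ε := mul_one ε
  have hder := hasDerivWithinAt_of_tendstoUniformlyOn (h := fun n t => sharp t (F n t))
    (h' := fun t => sharp t (f t)) (hF.mono fun n hn => hn.deriv) (hF.mono fun n hn => hn.cont)
    (fun t ht => ((sharpL t).continuous.tendsto _).comp (hpt t ht)) hunif
  refine ⟨⟨hrange, hcoll, hder.1, hder.2⟩, fun t ht => (hbd t ht).1, fun t ht => (hbd t ht).2,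
    fun t ht => ?_⟩
  -- Since the radii `ρs` tend to infinity, every velocity is eventually below the barrier, so the
  -- limit obeys it without restriction on |v|.
  have h1 := ae_mem_of_tendsto (hpt t ht) (S := fun _ => Iic (M - c₀ * t)) (fun _ => isClosed_Iic) (by
    filter_upwards [ae_eventually_of_eventually_ae (hF.mono fun n hn => hn.barrier t ht)] with p hp
    filter_upwards [hp, hρ.eventually_ge_atTop ‖p.2‖] with n a1 a2
    exact a1 a2)
  filter_upwards [h1] with p hp _
  exact hp

end

section

variable {b c α M T N E c₀ : ℝ}

/-! ### Global existence -/

/-- The truncations at level `k` approximate the equation with an error that tends to zero. -/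
theorem exists_truncation_level (hα : 0 < α) (hα1 : α ≤ 1) {K : Velocity → Velocity → ℝ → ℝ}
    (hK : CollisionKernel K b c) (hb : 0 ≤ b) {κ : ℝ} (hκ : 0 < κ) :
    ∃ k₀ : ℝ, ∀ k, k₀ ≤ k →
      (∀ y ∈ Icc 0 (1 / α), |cutFilling α k y - fillingFactor α y| ≤ κ) ∧
      (∀ v w φ, |truncKernel K k v w φ - K v w φ| ≤ b * (κ * (‖v‖ ^ 2 + ‖w‖ ^ 2))) ∧
      (∀ k', k ≤ k' → ∀ v w φ, |truncKernel K k v w φ - truncKernel K k' v w φ| ≤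
        b * (κ * (‖v‖ ^ 2 + ‖w‖ ^ 2))) ∧
      ∀ p : Phase, k / 2 < ‖p.2‖ → 1 / α ≤ κ * energyWeight p := by
  obtain ⟨k₁, hk₁⟩ := exists_cutFilling_close hα hα1 hκ
  refine ⟨max k₁ (max 1 (max (1 / κ) (4 * (1 / α) / κ))), fun k hk => ?_⟩
  have h1 : k₁ ≤ k := (le_max_left _ _).trans hk
  have h2 : 1 ≤ k := ((le_max_left _ _).trans (le_max_right _ _)).trans hk
  have h3 : 1 / κ ≤ k := (((le_max_left _ _).trans (le_max_right _ _)).trans (le_max_right _ _)).trans hk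
  have h4 : 4 * (1 / α) / κ ≤ k :=
    (((le_max_right _ _).trans (le_max_right _ _)).trans (le_max_right _ _)).trans hk
  rw [div_le_iff₀ hκ] at h3 h4
  have hkk : k ≤ k ^ 2 := by nlinarith
  have h5 : 1 ≤ κ * k ^ 2 := by nlinarith
  have h6 : 4 * (1 / α) ≤ κ * k ^ 2 := by nlinarith
  refine ⟨hk₁ k h1, abs_truncKernel_sub_le hK hb hκ.le h5, fun k' hk' =>
    abs_truncKernel_sub_truncKernel_le hK hb hκ.le h5 (by linarith) hk', fun p hp => ?_⟩
  have h7 : (k / 2) ^ 2 ≤ ‖p.2‖ ^ 2 := by gcongr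
  rw [energyWeight]
  nlinarith

/-- Global solutions, with uniform controls on bounded time intervals. -/
theorem exists_global_solution {B : ℝ → ℝ → ℝ} {B₀ γ γ' cB : ℝ} (hα : 0 < α) (hα1 : α ≤ 1)
    (hB₀ : 0 < B₀) (hγ : 0 < γ) (hcB : 0 < cB) (hB : IsCutoffKernel B B₀ γ γ' cB) {c : ℝ}
    (hc : 0 ≤ c) (hK : CollisionKernel (kernelAt B) B₀ c) {f₀ : Phase → ℝ}
    (hf₀ : IsInitialDatum α f₀) :
    ∃ f : ℝ → PhaseL1, f 0 =ᵐ[volume] f₀ ∧ ∀ T, 0 < T → ∃ N c₀, 0 ≤ N ∧ 0 < c₀ ∧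
      ∀ ρ, ControlledSolution (kernelAt B) (fillingFactor α) (1 / α) T N
        (∫ p, energyWeight p * f₀ p) c₀ ρ f := by
  have hM := one_le_one_div hα hα1
  have hint : Integrable f₀ volume := by
    refine hf₀.mass_energy.mono hf₀.measurable.aestronglyMeasurable
      (Eventually.of_forall fun p => ?_)
    rw [norm_mul]
    refine le_mul_of_one_le_left (norm_nonneg _) ?_
    exact (one_le_energyWeight p).trans (le_abs_self _)
  set u₀ : PhaseL1 := hint.toL1 f₀ with hu₀
  have hu₀f : u₀ =ᵐ[volume] f₀ := hint.coeFn_toL1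
  have hE : 0 ≤ ∫ p, energyWeight p * f₀ p := integral_nonneg fun p =>
    mul_nonneg (energyWeight_nonneg p) (hf₀.pos p).le
  -- The n-th truncated problem is solved on [0, n], so any given interval is eventually covered by
  -- a single sequence. The level n = 0 is excluded since the cut filling factor needs k ≥ 1.
  have hex : ∀ n : ℕ, ∃ F : ℝ → PhaseL1, 1 ≤ n → F 0 = u₀ ∧
      KineticSolution (truncKernel (kernelAt B) n) (cutFilling α n) (1 / α) n F := by
    intro n
    by_cases hn : 1 ≤ n
    · have hn' : (1 : ℝ) ≤ n := by exact_mod_cast hn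
      have hΦ := fillingFunction_cutFilling hα hα1 hn'
      obtain ⟨F, h1, h2⟩ := exists_truncated_solution (hK.trunc hB₀.le n) hB₀.le hc hM hΦ
        (by linarith : (0 : ℝ) ≤ n) (kernelSupport_truncKernel _ _) (by linarith : (0 : ℝ) ≤ n)
        (fun y hy z hz => hΦ.lipschitz_of_le hn' (fun y _ => cutFilling_le y) hy hz) (u₀ := u₀)
        (by filter_upwards [hu₀f] with p hp
            rw [hp]; exact ⟨(hf₀.pos p).le, hf₀.le p⟩) (by linarith : (0 : ℝ) ≤ n)
      exact ⟨F, fun _ => ⟨h1, h2⟩⟩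
    · exact ⟨fun _ => 0, fun h => absurd h hn⟩
  choose F hF using hex
  have hFT : ∀ T, ∀ᶠ n in atTop, F n 0 = u₀ ∧
      KineticSolution (truncKernel (kernelAt B) n) (cutFilling α n) (1 / α) T (F n) := by
    intro T
    filter_upwards [eventually_ge_atTop 1, tendsto_natCast_atTop_atTop.eventually_ge_atTop T]
      with n h1 h2
    exact ⟨(hF n h1).1, (hF n h1).2.mono h2⟩
  have hctrl : ∀ T, 0 < T → ∃ N c₀, 0 ≤ N ∧ 0 < c₀ ∧ ∀ᶠ n : ℕ in atTop,
      ControlledSolution (truncKernel (kernelAt B) n) (cutFilling α n) (1 / α) T N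
        (∫ p, energyWeight p * f₀ p) c₀ (n / 2) (F n) := by
    intro T hT
    obtain ⟨N, c₀, k₀, h1, h2, -, h3⟩ := exists_uniform_bounds hα hα1 hB₀ hγ hcB hB hc hK hf₀ hT
    refine ⟨N, c₀, h1, h2, ?_⟩
    filter_upwards [hFT T, tendsto_natCast_atTop_atTop.eventually_ge_atTop k₀] with n a1 a2
    exact h3 n a2 (F n) a1.2 (by rw [a1.1]; exact hu₀f)
  have hcauchy : ∀ T, 0 < T → UniformCauchySeqOn F atTop (Icc 0 T) := by
    intro T hT
    obtain ⟨N, c₀, hN, hc₀, hev⟩ := hctrl T hT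
    obtain ⟨C, hC, hcmp⟩ := exists_comparison hα hα1 hB₀.le hc hM hN hE hc₀ T
    rw [Metric.uniformCauchySeqOn_iff]
    intro ε hε
    have hκ : 0 < ε / (2 * (2 * C + 1)) := by positivity
    set κ := ε / (2 * (2 * C + 1)) with hκdef
    obtain ⟨k₀, hk₀⟩ := exists_truncation_level hα hα1 hK hB₀.le hκ
    obtain ⟨n₀, hn₀⟩ := eventually_atTop.1 ((hev.and (hFT T)).and
      ((eventually_ge_atTop 1).and (tendsto_natCast_atTop_atTop.eventually_ge_atTop k₀)))
    have key : ∀ n m : ℕ, n₀ ≤ n → n ≤ m → ∀ t ∈ Icc 0 T, ‖F n t - F m t‖ < ε := by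
      intro n m hn hm t ht
      obtain ⟨⟨a1, a2⟩, a3, a4⟩ := hn₀ n hn
      obtain ⟨⟨b1, b2⟩, b3, b4⟩ := hn₀ m (hn.trans hm)
      have hmr : (n : ℝ) ≤ m := by exact_mod_cast hm
      obtain ⟨l1, l2, l3, l4⟩ := hk₀ n a4
      obtain ⟨m1, -, -, -⟩ := hk₀ m b4
      -- The factor 2 arises because both cut filling factors are compared through F. Control is
      -- needed only for the approximation with the smaller index.
      have := hcmp _ _ _ _ (2 * κ) (n / 2) (F n) (F m) (by positivity) (hK.trunc hB₀.le n)
        (hK.trunc hB₀.le m) (fillingFunction_cutFilling hα hα1 (by exact_mod_cast a3))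
        (fillingFunction_cutFilling hα hα1 (by exact_mod_cast b3)) (fun y hy => by
          refine (abs_sub_le _ (fillingFactor α y) _).trans ?_
          rw [abs_sub_comm (fillingFactor α y)]
          linarith [l1 y hy, m1 y hy]) (fun v w φ => by
          refine (l3 m hmr v w φ).trans ?_
          gcongr
          linarith) (fun p hp => (l4 p hp).trans (by
          have := energyWeight_nonneg p
          nlinarith)) a1 b2.2 t ht
      rw [a2.1, b2.1, sub_self, norm_zero, zero_add] at this
      refine this.trans_lt ?_
      have h5 : C * (2 * κ) = ε * (2 * C / (2 * (2 * C + 1))) := by rw [hκdef]; ring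
      rw [h5]
      refine mul_lt_of_lt_one_right hε ?_
      rw [div_lt_one (by positivity)]; linarith
    refine ⟨n₀, fun m hm n hn t ht => ?_⟩
    rw [dist_eq_norm]
    rcases le_total m n with h | h
    · exact key m n hm h t ht
    · rw [norm_sub_rev]; exact key n m hn h t ht
  have hlim : ∀ t, ∃ l, 0 ≤ t → Tendsto (fun n => F n t) atTop (𝓝 l) := by
    intro t
    by_cases ht : 0 ≤ t
    -- The interval [0, t + 1] is used because the Cauchy property is stated for positive lengths
    -- and t may be zero.
    · obtain ⟨l, hl⟩ := cauchySeq_tendsto_of_complete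
        ((hcauchy (t + 1) (by linarith)).cauchySeq ⟨ht, by linarith⟩)
      exact ⟨l, fun _ => hl⟩
    · exact ⟨0, fun h => absurd h ht⟩
  choose f hf using hlim
  refine ⟨f, ?_, fun T hT => ?_⟩
  · have h1 : Tendsto (fun n => F n 0) atTop (𝓝 u₀) := tendsto_const_nhds.congr'
      ((hFT 0).mono fun n hn => hn.1.symm)
    rw [tendsto_nhds_unique (hf 0 le_rfl) h1]
    exact hu₀f
  · obtain ⟨N, c₀, hN, hc₀, hev⟩ := hctrl T hT
    refine ⟨N, c₀, hN, hc₀, fun ρ => ?_⟩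
    refine controlledSolution_of_tendsto (Ks := fun n => truncKernel (kernelAt B) n)
      (Φs := fun n => cutFilling α n) (ρs := fun n => (n : ℝ) / 2) (F := F) hB₀.le hc hM hT.le hK
      (fillingFunction_fillingFactor hα hα1)
      (fun ε hε => exists_fillingFactor_modulus hα hα1 hε)
      (Eventually.of_forall fun n => hK.trunc hB₀.le n) ?_ ?_ ?_ hev ?_ ρ
    · filter_upwards [eventually_ge_atTop 1] with n hn
      exact fillingFunction_cutFilling hα hα1 (by exact_mod_cast hn)
    · intro κ hκ
      obtain ⟨k₀, hk₀⟩ := exists_truncation_level hα hα1 hK hB₀.le hκ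
      filter_upwards [tendsto_natCast_atTop_atTop.eventually_ge_atTop k₀] with n hn
      exact ⟨(hk₀ n hn).1, (hk₀ n hn).2.1⟩
    · exact tendsto_natCast_atTop_atTop.atTop_div_const two_pos
    · exact (hcauchy T hT).tendstoUniformlyOn_of_tendsto fun t ht => hf t ht.1

end

section

variable {K : Velocity → Velocity → ℝ → ℝ} {b c α M T N E c₀ ρ : ℝ} {Φ : ℝ → ℝ}

/-! ### Conservation laws -/

/-- The energy moment of the collision term. -/
theorem BoundedDensity.integral_energyWeight_mul_abs_collQ_le (hK : CollisionKernel K b c)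
    (hb : 0 ≤ b) (hM : 0 ≤ M) (hΦ : FillingFunction α M Φ) {u : Phase → ℝ}
    (hu : BoundedDensity M N u) :
    Integrable (fun p => energyWeight p * |collQ K Φ u p|) volume ∧
      ∫ p, energyWeight p * |collQ K Φ u p| ≤
        3 * (M ^ 2 * (b * (N * ∫ p, energyWeight p * u p))) := by
  have hu0 : ∀ p, 0 ≤ u p := fun p => (hu.mem p).1
  obtain ⟨q1, -, q3, q4⟩ := IntLE.quad hK hb (measurable_energyWeight.mul hu.measurable)
    (fun p => mul_nonneg (energyWeight_nonneg p) (hu0 p)) hu.energy hu.measurable hu0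
    hu.nonneg_bound hu.density
  have hci := hu.collInt hK hb hM hΦ
  set Bd : CollSpace → ℝ := fun z =>
    M ^ 2 * (kernelOn K z * (energyWeight z.1 * u z.1 * u (ptStar z))) +
    (M ^ 2 * (kernelOn K z * (energyWeight (ptPost z) * u (ptPost z) * u (ptPostStar z))) +
     M ^ 2 * (kernelOn K z * (u (ptPost z) * (energyWeight (ptPostStar z) * u (ptPostStar z)))))
    with hBd
  have hB : IntLE Bd (3 * (M ^ 2 * (b * (N * ∫ p, energyWeight p * u p)))) := by
    refine ((q1.const_mul (sq_nonneg M)).add ((q3.const_mul (sq_nonneg M)).add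
      (q4.const_mul (sq_nonneg M)))).mono_right (le_of_eq ?_)
    simp only [Pi.mul_apply]
    ring
  have hpt : ∀ z : CollSpace,
      energyWeight z.1 * |gainFn K Φ u z - lossFn K Φ u z| ≤ Bd z := by
    intro z
    have hk := hK.kernelOn_nonneg z
    have hF : ∀ p q, 0 ≤ Φ (u p) * Φ (u q) ∧ Φ (u p) * Φ (u q) ≤ M ^ 2 := fun p q => by
      have h1 := hΦ.mem_Icc (hu.mem p)
      have h2 := hΦ.mem_Icc (hu.mem q)
      exact ⟨mul_nonneg h1.1 h2.1, by rw [sq]; exact mul_le_mul h1.2 h2.2 h2.1 hM⟩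
    have hg : gainFn K Φ u z ≤ M ^ 2 * (kernelOn K z * (u (ptPost z) * u (ptPostStar z))) := by
      calc gainFn K Φ u z = kernelOn K z * (u (ptPost z) * u (ptPostStar z)) *
            (Φ (u z.1) * Φ (u (ptStar z))) := by rw [gainFn]; ring
        _ ≤ kernelOn K z * (u (ptPost z) * u (ptPostStar z)) * M ^ 2 :=
            mul_le_mul_of_nonneg_left (hF _ _).2 (mul_nonneg hk (mul_nonneg (hu0 _) (hu0 _)))
        _ = _ := mul_comm _ _
    have hl : lossFn K Φ u z ≤ M ^ 2 * (kernelOn K z * (u z.1 * u (ptStar z))) := by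
      calc lossFn K Φ u z = kernelOn K z * (u z.1 * u (ptStar z)) *
            (Φ (u (ptPost z)) * Φ (u (ptPostStar z))) := by rw [lossFn]; ring
        _ ≤ kernelOn K z * (u z.1 * u (ptStar z)) * M ^ 2 :=
            mul_le_mul_of_nonneg_left (hF _ _).2 (mul_nonneg hk (mul_nonneg (hu0 _) (hu0 _)))
        _ = _ := mul_comm _ _
    have hg0 := gainFn_nonneg hK hΦ hu.toOccupation z
    have hl0 := lossFn_nonneg hK hΦ hu.toOccupation z
    have habs : |gainFn K Φ u z - lossFn K Φ u z| ≤ gainFn K Φ u z + lossFn K Φ u z :=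
      abs_le.2 ⟨by linarith, by linarith⟩
    have he := energyWeight_post z
    -- In the gain the densities sit at v' and v'_*, so the weight at v is transferred to these
    -- particles.
    have he1 : energyWeight z.1 ≤ energyWeight (ptPost z) + energyWeight (ptPostStar z) := by
      have := energyWeight_nonneg (ptStar z); linarith
    calc energyWeight z.1 * |gainFn K Φ u z - lossFn K Φ u z|
        ≤ energyWeight z.1 * gainFn K Φ u z + energyWeight z.1 * lossFn K Φ u z := by
          rw [← mul_add]; exact mul_le_mul_of_nonneg_left habs (energyWeight_nonneg _)
      _ ≤ (energyWeight (ptPost z) + energyWeight (ptPostStar z)) *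
            (M ^ 2 * (kernelOn K z * (u (ptPost z) * u (ptPostStar z)))) +
          energyWeight z.1 * (M ^ 2 * (kernelOn K z * (u z.1 * u (ptStar z)))) :=
          add_le_add (mul_le_mul he1 hg hg0 (add_nonneg (energyWeight_nonneg _)
            (energyWeight_nonneg _))) (mul_le_mul_of_nonneg_left hl (energyWeight_nonneg _))
      _ = Bd z := by rw [hBd]; ring
  have hle : ∀ᵐ p : Phase, energyWeight p * |collQ K Φ u p| ≤ ∫ q : Velocity × ℝ, Bd (p, q)
      ∂((volume : Measure Velocity).prod angleMeasure) := by
    filter_upwards [hB.1.prod_right_ae, hci.sub.prod_right_ae] with p h1 h2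
    calc energyWeight p * |collQ K Φ u p| ≤ energyWeight p * ∫ q : Velocity × ℝ,
          |gainFn K Φ u (p, q) - lossFn K Φ u (p, q)|
            ∂((volume : Measure Velocity).prod angleMeasure) :=
          mul_le_mul_of_nonneg_left abs_integral_le_integral_abs (energyWeight_nonneg p)
      _ = ∫ q : Velocity × ℝ, energyWeight p * |gainFn K Φ u (p, q) - lossFn K Φ u (p, q)|
            ∂((volume : Measure Velocity).prod angleMeasure) := (integral_const_mul _ _).symm
      _ ≤ _ := integral_mono (h2.abs.const_mul _) h1 fun q => hpt (p, q)
  have h0 : ∀ p, 0 ≤ energyWeight p * |collQ K Φ u p| := fun p =>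
    mul_nonneg (energyWeight_nonneg p) (abs_nonneg _)
  have hi : Integrable (fun p => energyWeight p * |collQ K Φ u p|) volume := by
    refine hB.1.integral_prod_left.mono (measurable_energyWeight.aestronglyMeasurable.mul
      hci.integrable_collQ.abs.aestronglyMeasurable) ?_
    filter_upwards [hle] with p hp
    rw [Real.norm_of_nonneg (h0 p)]
    exact hp.trans (le_abs_self _)
  refine ⟨hi, (integral_mono_ae hi hB.1.integral_prod_left hle).trans ?_⟩
  have := hB.2
  rwa [collMeasure, integral_prod _ hB.1] at this

theorem KineticSolution.continuousOn_weight_collQ {f : ℝ → PhaseL1} (hf : KineticSolution K Φ M T f)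
    {ω : Velocity → ℝ} (hω : Measurable ω) {C : ℝ} (hC : ∀ v, |ω v| ≤ C) :
    ContinuousOn (fun t => ∫ p : Phase, ω p.2 * collQ K Φ (clip M (f t)) p) (Icc 0 T) := by
  obtain ⟨ℓ, hℓ⟩ := exists_weight_functional (ω := fun p : Phase => ω p.2)
    (hω.comp measurable_snd) (fun p => hC p.2)
  refine (ℓ.continuous.comp_continuousOn hf.cont).congr fun t ht => ?_
  rw [Function.comp_apply, hℓ, integral_weight_sharp hω]
  refine integral_congr_ae ?_
  filter_upwards [coeFn_collL (hf.coll t ht)] with p hp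
  rw [hp]

theorem ControlledSolution.integrable_energy {f : ℝ → PhaseL1}
    (hf : ControlledSolution K Φ M T N E c₀ ρ f) {t : ℝ} (ht : t ∈ Icc 0 T) :
    Integrable (fun p => energyWeight p * f t p) volume := by
  refine (hf.bounded t ht).energy.congr ?_
  filter_upwards [hf.clip_ae ht] with p hp
  rw [hp]

/-- Collision invariants of at most quadratic growth are conserved. -/
theorem ControlledSolution.integral_invariant_eq {f : ℝ → PhaseL1}
    (hf : ControlledSolution K Φ M T N E c₀ ρ f) (hK : CollisionKernel K b c) (hb : 0 ≤ b)
    (hM : 0 ≤ M) (hΦ : FillingFunction α M Φ) {φ : Velocity → ℝ} (hφ : Measurable φ)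
    (hinv : ∀ v w θ, φ (postVel v w θ) + φ (postVelStar v w θ) = φ v + φ w) {C : ℝ} (hC : 0 ≤ C)
    (hle : ∀ v, |φ v| ≤ C * (1 + ‖v‖ ^ 2)) {t : ℝ} (ht : t ∈ Icc 0 T) :
    ∫ p : Phase, φ p.2 * f t p = ∫ p : Phase, φ p.2 * f 0 p := by
  have h0T : (0 : ℝ) ∈ Icc 0 T := ⟨le_rfl, ht.1.trans ht.2⟩
  have hN := (hf.bounded t ht).nonneg_bound
  -- Truncated weights act on L¹ but are not collision invariants. Their collision moments tend to
  -- zero at each time and are bounded uniformly in n and time by the energy moment, so dominated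
  -- convergence removes the truncation in the integrated balance law.
  set ω : ℕ → Velocity → ℝ := fun n v => if ‖v‖ ≤ n then φ v else 0 with hω
  have hωm : ∀ n, Measurable (ω n) := fun n =>
    Measurable.ite (measurableSet_le (by fun_prop) measurable_const) hφ measurable_const
  have hωφ : ∀ n v, |ω n v| ≤ C * (1 + ‖v‖ ^ 2) := by
    intro n v
    simp only [hω]
    split_ifs
    · exact hle v
    · rw [abs_zero]; positivity
  have hωC : ∀ (n : ℕ) v, |ω n v| ≤ C * (1 + (n : ℝ) ^ 2) := by
    intro n v
    simp only [hω]
    split_ifs with hv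
    · refine (hle v).trans ?_
      gcongr
    · rw [abs_zero]; positivity
  have hωlim : ∀ v, Tendsto (fun n => ω n v) atTop (𝓝 (φ v)) := by
    intro v
    refine tendsto_const_nhds.congr' ?_
    filter_upwards [tendsto_natCast_atTop_atTop.eventually_ge_atTop ‖v‖] with n hn
    simp only [hω]
    rw [if_pos hn]
  have hlim : ∀ {u : Phase → ℝ}, AEStronglyMeasurable u volume →
      Integrable (fun p => energyWeight p * |u p|) volume →
      Tendsto (fun n => ∫ p : Phase, ω n p.2 * u p) atTop (𝓝 (∫ p : Phase, φ p.2 * u p)) := by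
    intro u hum hu
    refine tendsto_integral_of_dominated_convergence
      (fun p => C * (energyWeight p * |u p|))
      (fun n => ((hωm n).comp measurable_snd).aestronglyMeasurable.mul hum)
      (hu.const_mul C) (fun n => Eventually.of_forall fun p => ?_)
      (Eventually.of_forall fun p => (hωlim p.2).mul_const _)
    rw [norm_mul, Real.norm_eq_abs, Real.norm_eq_abs, ← mul_assoc]
    exact mul_le_mul_of_nonneg_right (hωφ n p.2) (abs_nonneg _)
  have hsol : ∀ s ∈ Icc 0 T, Tendsto (fun n => ∫ p : Phase, ω n p.2 * f s p) atTop
      (𝓝 (∫ p : Phase, φ p.2 * f s p)) := by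
    intro s hs
    refine hlim (Lp.aestronglyMeasurable (f s)) ((hf.integrable_energy hs).congr ?_)
    filter_upwards [hf.range s hs] with p hp
    rw [abs_of_nonneg hp.1]
  have hcoll : ∀ s ∈ Icc 0 T,
      Tendsto (fun n => ∫ p : Phase, ω n p.2 * collQ K Φ (clip M (f s)) p) atTop (𝓝 0) := by
    intro s hs
    have hbs := hf.bounded s hs
    rw [← (hbs.integral_mul_collQ hK hb hM hΦ hφ hinv hC hle).2]
    exact hlim (hf.coll s hs).integrable_collQ.aestronglyMeasurable
      (hbs.integral_energyWeight_mul_abs_collQ_le hK hb hM hΦ).1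
  set D := C * (3 * (M ^ 2 * (b * (N * E)))) with hD
  have hbound : ∀ n, ∀ s ∈ Icc 0 T,
      |∫ p : Phase, ω n p.2 * collQ K Φ (clip M (f s)) p| ≤ D := by
    intro n s hs
    obtain ⟨h1, h2⟩ := (hf.bounded s hs).integral_energyWeight_mul_abs_collQ_le hK hb hM hΦ
    calc _ ≤ ∫ p : Phase, |ω n p.2 * collQ K Φ (clip M (f s)) p| := abs_integral_le_integral_abs
      _ ≤ ∫ p : Phase, C * (energyWeight p * |collQ K Φ (clip M (f s)) p|) := by
          refine integral_mono ?_ (h1.const_mul C) fun p => ?_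
          · exact (integrable_weight_mul ((hωm n).comp measurable_snd) (fun p => hωC n p.2)
              (hf.coll s hs).integrable_collQ).abs
          · change |ω n p.2 * _| ≤ _
            rw [abs_mul, ← mul_assoc]
            exact mul_le_mul_of_nonneg_right (hωφ n p.2) (abs_nonneg _)
      _ ≤ D := by
          rw [integral_const_mul, hD]
          refine mul_le_mul_of_nonneg_left (h2.trans ?_) hC
          have := hf.energy_le s hs
          gcongr
  have hsub : uIcc 0 t ⊆ Icc 0 T := by
    rw [uIcc_of_le ht.1]; exact Icc_subset_Icc_right ht.2
  have hftc : ∀ n, ∫ s in (0 : ℝ)..t, (∫ p : Phase, ω n p.2 * collQ K Φ (clip M (f s)) p) =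
      (∫ p : Phase, ω n p.2 * f t p) - ∫ p : Phase, ω n p.2 * f 0 p := by
    intro n
    have hd := fun s (hs : s ∈ Icc 0 T) => hf.hasDerivWithinAt_weight (hωm n) (hωC n) hs
    refine intervalIntegral.integral_eq_sub_of_hasDeriv_right
      (fun s hs => ((hd s (hsub hs)).continuousWithinAt).mono hsub) ?_
      ((hf.continuousOn_weight_collQ (hωm n) (hωC n)).mono hsub).intervalIntegrable
    intro s hs
    rw [min_eq_left ht.1, max_eq_right ht.1] at hs
    exact hasDerivWithinAt_Ioi_of_Icc (hd s ⟨hs.1.le, hs.2.le.trans ht.2⟩)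
      ⟨hs.1.le, hs.2.trans_le ht.2⟩
  have hzero : Tendsto (fun n => ∫ s in (0 : ℝ)..t,
      (∫ p : Phase, ω n p.2 * collQ K Φ (clip M (f s)) p)) atTop (𝓝 0) := by
    have := intervalIntegral.tendsto_integral_filter_of_dominated_convergence
      (μ := volume) (a := 0) (b := t) (f := fun _ => (0 : ℝ)) (l := (atTop : Filter ℕ))
      (F := fun n s => ∫ p : Phase, ω n p.2 * collQ K Φ (clip M (f s)) p) (fun _ => D)
      (Eventually.of_forall fun n => ((hf.continuousOn_weight_collQ (hωm n) (hωC n)).mono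
        (uIoc_subset_uIcc.trans hsub)).aestronglyMeasurable measurableSet_uIoc)
      (Eventually.of_forall fun n => Eventually.of_forall fun s hs =>
        hbound n s (hsub (uIoc_subset_uIcc hs)))
      intervalIntegrable_const
      (Eventually.of_forall fun s hs => hcoll s (hsub (uIoc_subset_uIcc hs)))
    simpa using this
  simp_rw [hftc] at hzero
  exact sub_eq_zero.1 (tendsto_nhds_unique ((hsol t ht).sub (hsol 0 h0T)) hzero)

end

section

variable {K : Velocity → Velocity → ℝ → ℝ} {α M T : ℝ} {Φ : ℝ → ℝ} {B : ℝ → ℝ → ℝ}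

/-! ### Strong solutions -/

/-- Strong solutions are L¹ classes while the integrands are formed from functions. Independence of
the representative also allows passage between f and its clipped version. -/
theorem coll_ae_congr (K : Velocity → Velocity → ℝ → ℝ) (Φ : ℝ → ℝ) {u w : Phase → ℝ}
    (h : u =ᵐ[volume] w) :
    gainFn K Φ u =ᵐ[collMeasure] gainFn K Φ w ∧ lossFn K Φ u =ᵐ[collMeasure] lossFn K Φ w := by
  have h1 := quasiMeasurePreserving_fst.ae h
  have h2 := quasiMeasurePreserving_ptStar.ae h
  have h3 := quasiMeasurePreserving_ptPost.ae h
  have h4 := quasiMeasurePreserving_ptPostStar.ae h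
  constructor <;>
  · filter_upwards [h1, h2, h3, h4] with z a1 a2 a3 a4
    simp only [gainFn, lossFn, a1, a2, a3, a4]

theorem CollInt.congr_ae {u w : Phase → ℝ} (hu : CollInt K Φ u) (h : u =ᵐ[volume] w) :
    CollInt K Φ w :=
  ⟨hu.1.congr (coll_ae_congr K Φ h).1, hu.2.congr (coll_ae_congr K Φ h).2⟩

theorem collQ_ae_congr {u w : Phase → ℝ} (h : u =ᵐ[volume] w) :
    collQ K Φ u =ᵐ[volume] collQ K Φ w := by
  obtain ⟨h1, h2⟩ := coll_ae_congr K Φ h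
  filter_upwards [Measure.ae_ae_of_ae_prod h1, Measure.ae_ae_of_ae_prod h2] with p a1 a2
  refine integral_congr_ae ?_
  filter_upwards [a1, a2] with q b1 b2
  rw [b1, b2]

theorem collInt_iff_collisionIntegrable {u : Phase → ℝ} :
    CollInt (kernelAt B) (fillingFactor α) u ↔ CollisionIntegrable α B u := Iff.rfl

theorem collQ_eq_collisionOp (u : Phase → ℝ) :
    collQ (kernelAt B) (fillingFactor α) u = collisionOp α B u := rfl

theorem kineticSolution_of_isStrongSolution {f₀ : Phase → ℝ} {f : ℝ → PhaseL1}
    (hf : IsStrongSolution α B (Icc 0 T) f₀ f) :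
    KineticSolution (kernelAt B) (fillingFactor α) (1 / α) T f := by
  obtain ⟨q, hq, hqc, hqd⟩ := hf.equation
  have hcl : ∀ t ∈ Icc 0 T, clip (1 / α) (f t) =ᵐ[volume] f t := fun t ht =>
    clip_ae_eq (hf.range t ht)
  have hci : ∀ t ∈ Icc 0 T, CollInt (kernelAt B) (fillingFactor α) (clip (1 / α) (f t)) :=
    fun t ht => (collInt_iff_collisionIntegrable.2 (hf.collision t ht)).congr_ae (hcl t ht).symm
  have hqL : ∀ t ∈ Icc 0 T, collL (kernelAt B) (fillingFactor α) (clip (1 / α) (f t)) = q t := by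
    intro t ht
    refine Lp.ext ((coeFn_collL (hci t ht)).trans ((collQ_ae_congr (hcl t ht)).trans ?_))
    rw [collQ_eq_collisionOp]
    exact (hq t ht).symm
  refine ⟨hf.range, hci, hqc.congr fun t ht => by rw [hqL t ht], fun t ht => ?_⟩
  rw [hqL t ht]
  exact hqd t ht

theorem isStrongSolution_of_kineticSolution {f₀ : Phase → ℝ} {f : ℝ → PhaseL1}
    (h0 : f 0 =ᵐ[volume] f₀)
    (hf : ∀ T, 0 < T → KineticSolution (kernelAt B) (fillingFactor α) (1 / α) T f) :
    IsStrongSolution α B (Ici 0) f₀ f := by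
  -- The extra unit of time makes [0, t + 1] a neighbourhood of t in [0, ∞), so that derivatives
  -- there are derivatives along the half line.
  have hmem : ∀ t : ℝ, 0 ≤ t → t ∈ Icc 0 (t + 1) := fun t ht => ⟨ht, by linarith⟩
  have hsol : ∀ t : ℝ, 0 ≤ t → KineticSolution (kernelAt B) (fillingFactor α) (1 / α) (t + 1) f :=
    fun t ht => hf (t + 1) (by linarith)
  have hnhds : ∀ t : ℝ, 0 ≤ t → Icc 0 (t + 1) ∈ 𝓝[Ici 0] t := fun t _ => by
    rw [← Ici_inter_Iic]
    exact inter_mem_nhdsWithin _ (Iic_mem_nhds (by linarith))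
  have hcl : ∀ t : ℝ, 0 ≤ t → clip (1 / α) (f t) =ᵐ[volume] f t := fun t ht =>
    (hsol t ht).clip_ae (hmem t ht)
  refine ⟨fun t ht => ?_, h0, fun t ht => (hsol t ht).range t (hmem t ht), fun t ht => ?_,
    fun t => collL (kernelAt B) (fillingFactor α) (clip (1 / α) (f t)), fun t ht => ?_,
    fun t ht => ?_, fun t ht => ?_⟩
  · exact ((hsol t ht).continuousOn t (hmem t ht)).mono_of_mem_nhdsWithin (hnhds t ht)
  · exact collInt_iff_collisionIntegrable.1
      (((hsol t ht).coll t (hmem t ht)).congr_ae (hcl t ht))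
  · rw [← collQ_eq_collisionOp]
    exact (coeFn_collL ((hsol t ht).coll t (hmem t ht))).trans (collQ_ae_congr (hcl t ht))
  · exact ((hsol t ht).cont t (hmem t ht)).mono_of_mem_nhdsWithin (hnhds t ht)
  · exact ((hsol t ht).deriv t (hmem t ht)).mono_of_mem_nhdsWithin (hnhds t ht)

/-- Stability of controlled solutions among all solutions. -/
theorem exists_stability_constant {b c N E c₀ : ℝ} (hα : 0 < α) (hα1 : α ≤ 1) (hb : 0 ≤ b)
    (hc : 0 ≤ c) (hM : 1 ≤ M) (hN : 0 ≤ N) (hE : 0 ≤ E) (hc₀ : 0 < c₀) (hK : CollisionKernel K b c)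
    (hΦ : FillingFunction α M Φ) {f : ℝ → PhaseL1}
    (hf : ∀ ρ, ControlledSolution K Φ M T N E c₀ ρ f) :
    ∃ C, 0 ≤ C ∧ ∀ g : ℝ → PhaseL1, KineticSolution K Φ M T g →
      ∀ t ∈ Icc 0 T, ‖f t - g t‖ ≤ C * ‖f 0 - g 0‖ := by
  obtain ⟨C, hC, h⟩ := exists_comparison hα hα1 hb hc hM hN hE hc₀ T
  refine ⟨C, hC, fun g hg t ht => ?_⟩
  have key : ∀ κ : ℝ, 0 < κ → ‖f t - g t‖ ≤ C * (‖f 0 - g 0‖ + κ) := by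
    intro κ hκ
    -- The two equations coincide, so κ only pays for velocities outside the ball with the barrier.
    -- Since f has barriers on all balls, κ is arbitrary and tends to zero.
    refine h K K Φ Φ κ (M / κ + 1) f g hκ.le hK hK hΦ hΦ (fun y _ => ?_) (fun v w φ => ?_)
      (fun p hp => ?_) (hf _) hg t ht
    · rw [sub_self, abs_zero]; exact hκ.le
    · rw [sub_self, abs_zero]; positivity
    · have h1 : 1 ≤ ‖p.2‖ := by have : 0 ≤ M / κ := by positivity
                                linarith
      have h2 : M / κ ≤ energyWeight p := by
        rw [energyWeight]; nlinarith
      rwa [div_le_iff₀ hκ, mul_comm] at h2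
  have hlim : Tendsto (fun κ : ℝ => C * (‖f 0 - g 0‖ + κ)) (𝓝[>] 0) (𝓝 (C * (‖f 0 - g 0‖ + 0))) :=
    ((tendsto_const_nhds.add tendsto_id).const_mul C).mono_left nhdsWithin_le_nhds
  rw [add_zero] at hlim
  exact ge_of_tendsto hlim (eventually_nhdsWithin_of_forall fun κ hκ => key κ hκ)

end

section

variable {K : Velocity → Velocity → ℝ → ℝ} {b c α M T N E c₀ ρ : ℝ} {Φ : ℝ → ℝ}

/-! ### Positivity, momentum, energy and the distance to full occupation -/

theorem KineticSolution.ae_pos {f : ℝ → PhaseL1} (hf : KineticSolution K Φ M T f)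
    (hK : CollisionKernel K b c) (hb : 0 ≤ b) (hM : 0 ≤ M) (hΦ : FillingFunction α M Φ)
    (hN : ∀ t ∈ Icc 0 T, BoundedDensity M N (clip M (f t))) (h0 : ∀ᵐ p : Phase, 0 < f 0 p) {t : ℝ}
    (ht : t ∈ Icc 0 T) : ∀ᵐ p : Phase, 0 < f t p := by
  refine ae_of_ae_freeFlow t ?_
  filter_upwards [hf.exp_le hK hb hM hΦ hN t ht, h0] with p h1 h2
  exact (mul_pos (Real.exp_pos _) h2).trans_le h1

theorem norm_le_one_add_sq {V : Type*} [NormedAddCommGroup V] (v : V) : ‖v‖ ≤ 1 + ‖v‖ ^ 2 := by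
  nlinarith [sq_nonneg (‖v‖ - 1), norm_nonneg v]

theorem integrable_smul_velocity (u : PhaseL1)
    (hu : Integrable (fun p => energyWeight p * u p) volume) :
    Integrable (fun p : Phase => u p • p.2) volume := by
  refine hu.mono ((Lp.aestronglyMeasurable u).smul
    (by fun_prop : Measurable fun p : Phase => p.2).aestronglyMeasurable)
    (Eventually.of_forall fun p => ?_)
  rw [norm_smul, norm_mul, mul_comm, Real.norm_of_nonneg (energyWeight_nonneg p)]
  exact mul_le_mul_of_nonneg_right (norm_le_one_add_sq p.2) (norm_nonneg _)

/-- Conservation of momentum. -/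
theorem ControlledSolution.integral_momentum_eq {f : ℝ → PhaseL1}
    (hf : ControlledSolution K Φ M T N E c₀ ρ f) (hK : CollisionKernel K b c) (hb : 0 ≤ b)
    (hM : 0 ≤ M) (hΦ : FillingFunction α M Φ) {t : ℝ} (ht : t ∈ Icc 0 T) :
    ∫ p : Phase, f t p • p.2 = ∫ p : Phase, f 0 p • p.2 := by
  have h0T : (0 : ℝ) ∈ Icc 0 T := ⟨le_rfl, ht.1.trans ht.2⟩
  ext i
  have hproj : ∀ s ∈ Icc 0 T,
      (∫ p : Phase, f s p • p.2) i = ∫ p : Phase, p.2 i * f s p := by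
    intro s hs
    have h1 := (EuclideanSpace.proj i : Velocity →L[ℝ] ℝ).integral_comp_comm
      (integrable_smul_velocity (f s) (hf.integrable_energy hs))
    rw [PiLp.proj_apply] at h1
    rw [← h1]
    refine integral_congr_ae (Eventually.of_forall fun p => ?_)
    simp [mul_comm]
  rw [hproj t ht, hproj 0 h0T]
  refine hf.integral_invariant_eq hK hb hM hΦ (φ := fun v => v i) (by fun_prop) (fun v w θ => ?_)
    zero_le_one (fun v => ?_) ht
  · have := congrArg (fun u : Velocity => u i) (post_add v w θ)
    simpa using this
  · rw [one_mul]
    exact (PiLp.norm_apply_le v i).trans (norm_le_one_add_sq v)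

/-- Conservation of energy. -/
theorem ControlledSolution.integral_energy_eq {f : ℝ → PhaseL1}
    (hf : ControlledSolution K Φ M T N E c₀ ρ f) (hK : CollisionKernel K b c) (hb : 0 ≤ b)
    (hM : 0 ≤ M) (hΦ : FillingFunction α M Φ) {t : ℝ} (ht : t ∈ Icc 0 T) :
    ∫ p : Phase, ‖p.2‖ ^ 2 * f t p = ∫ p : Phase, ‖p.2‖ ^ 2 * f 0 p :=
  hf.integral_invariant_eq hK hb hM hΦ (φ := fun v => ‖v‖ ^ 2) (by fun_prop) post_energy
    zero_le_one (fun v => by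
      rw [one_mul, abs_of_nonneg (sq_nonneg _)]; linarith) ht

/-- Barriers on all velocity balls keep the density away from its maximal value. -/
theorem ae_le_sub_of_controlled {f : ℝ → PhaseL1}
    (hf : ∀ ρ, ControlledSolution K Φ M T N E c₀ ρ f) {t : ℝ} (ht : t ∈ Icc 0 T) :
    ∀ᵐ p : Phase, f t p ≤ M - c₀ * t := by
  have h1 : ∀ᵐ p : Phase, ∀ n : ℕ, ‖p.2‖ ≤ n → f t p ≤ M - c₀ * t :=
    ae_all_iff.2 fun n => (hf n).barrier t ht
  filter_upwards [h1] with p hp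
  obtain ⟨n, hn⟩ := exists_nat_ge ‖p.2‖
  exact hp n hn

end

end HaldaneBoltzmann

/-! ### Assembly of the main theorem -/

theorem theorem2p1 (α : ℝ) (hα : 0 < α) (hα1 : α ≤ 1)
    (B : ℝ → ℝ → ℝ) (B₀ γ γ' cB : ℝ) (hB₀ : 0 < B₀) (hγ : 0 < γ) (hγ' : 0 < γ') (hcB : 0 < cB)
    (hB : IsCutoffKernel B B₀ γ γ' cB)
    (f₀ : Phase → ℝ) (hf₀ : IsInitialDatum α f₀) :
    ∃ f : ℝ → PhaseL1,
      -- global strong solution with values strictly between `0` and `1/α`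
      IsStrongSolution α B (Ici 0) f₀ f ∧
      (∀ t : ℝ, 0 < t → ∀ᵐ p : Phase, 0 < f t p ∧ f t p < 1 / α) ∧
      -- uniform distance to `1/α` after the initial layer
      (∃ tₘ : ℝ, 0 < tₘ ∧ ∀ T : ℝ, tₘ < T → ∃ η : ℝ, 0 < η ∧
        ∀ t ∈ Icc tₘ T, ∀ᵐ p : Phase, f t p ≤ 1 / α - η) ∧
      -- uniqueness on each `[0,T]`
      (∀ T : ℝ, 0 < T → ∀ g : ℝ → PhaseL1, IsStrongSolution α B (Icc 0 T) f₀ g →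
        ∀ t ∈ Icc 0 T, g t = f t) ∧
      -- stability in `L¹` on each `[0,T]`
      (∀ T : ℝ, 0 < T → ∃ C : ℝ, ∀ (g₀ : Phase → ℝ) (g : ℝ → PhaseL1), IsInitialDatum α g₀ →
        IsStrongSolution α B (Icc 0 T) g₀ g →
        ∀ t ∈ Icc 0 T, ‖f t - g t‖ ≤ C * ∫ p : Phase, |f₀ p - g₀ p|) ∧
      -- conservation of mass, first moments and energy
      (∀ t : ℝ, 0 ≤ t →
        Integrable (fun p : Phase => (1 + ‖p.2‖ ^ 2) * f t p) volume ∧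
        ∫ p : Phase, f t p = ∫ p : Phase, f₀ p ∧
        ∫ p : Phase, f t p • p.2 = ∫ p : Phase, f₀ p • p.2 ∧
        ∫ p : Phase, ‖p.2‖ ^ 2 * f t p = ∫ p : Phase, ‖p.2‖ ^ 2 * f₀ p) := by
  obtain ⟨c, hc, hK⟩ := HaldaneBoltzmann.IsCutoffKernel.collisionKernel hγ hγ' hB
  have hM := HaldaneBoltzmann.one_le_one_div hα hα1
  have hM0 : 0 ≤ 1 / α := zero_le_one.trans hM
  have hΦ := HaldaneBoltzmann.fillingFunction_fillingFactor hα hα1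
  obtain ⟨f, hf0, hf⟩ := HaldaneBoltzmann.exists_global_solution hα hα1 hB₀ hγ hcB hB hc.le hK hf₀
  have hE : 0 ≤ ∫ p, HaldaneBoltzmann.energyWeight p * f₀ p := integral_nonneg fun p =>
    mul_nonneg (HaldaneBoltzmann.energyWeight_nonneg p) (hf₀.pos p).le
  have hinit : ∀ ψ : Phase → ℝ, ∫ p, ψ p * f 0 p = ∫ p, ψ p * f₀ p := fun ψ =>
    integral_congr_ae (by filter_upwards [hf0] with p hp; rw [hp])
  have hstab : ∀ T : ℝ, 0 < T → ∃ C, 0 ≤ C ∧ ∀ (g₀ : Phase → ℝ) (g : ℝ → PhaseL1),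
      IsStrongSolution α B (Icc 0 T) g₀ g →
      ∀ t ∈ Icc 0 T, ‖f t - g t‖ ≤ C * ∫ p : Phase, |f₀ p - g₀ p| := by
    intro T hT
    obtain ⟨N, c₀, hN, hc₀, hctrl⟩ := hf T hT
    obtain ⟨C, hC, h⟩ := HaldaneBoltzmann.exists_stability_constant hα hα1 hB₀.le hc.le hM hN hE
      hc₀ hK hΦ hctrl
    refine ⟨C, hC, fun g₀ g hg t ht => ?_⟩
    rw [← HaldaneBoltzmann.norm_sub_eq_integral hf0 hg.initial]
    exact h g (HaldaneBoltzmann.kineticSolution_of_isStrongSolution hg) t ht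
  refine ⟨f, HaldaneBoltzmann.isStrongSolution_of_kineticSolution hf0 fun T hT => ?_,
    fun t ht => ?_, ⟨1, one_pos, fun T hT => ?_⟩, fun T hT g hg t ht => ?_, fun T hT => ?_,
    fun t ht => ?_⟩
  · obtain ⟨N, c₀, -, -, hctrl⟩ := hf T hT
    exact (hctrl 0).toKineticSolution
  · obtain ⟨N, c₀, hN, hc₀, hctrl⟩ := hf t ht
    have htt : t ∈ Icc 0 t := ⟨ht.le, le_rfl⟩
    have hpos := (hctrl 0).toKineticSolution.ae_pos hK hB₀.le hM0 hΦ (hctrl 0).bounded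
      (by filter_upwards [hf0] with p hp; rw [hp]; exact hf₀.pos p) htt
    filter_upwards [hpos, HaldaneBoltzmann.ae_le_sub_of_controlled hctrl htt] with p h1 h2
    exact ⟨h1, h2.trans_lt (sub_lt_self _ (mul_pos hc₀ ht))⟩
  -- The time 1 is arbitrary; any positive time would do. From then on the barrier is at depth at
  -- least c₀, where c₀ depends on T.
  · obtain ⟨N, c₀, hN, hc₀, hctrl⟩ := hf T (one_pos.trans hT)
    refine ⟨c₀, hc₀, fun t ht => ?_⟩
    filter_upwards [HaldaneBoltzmann.ae_le_sub_of_controlled hctrl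
      ⟨zero_le_one.trans ht.1, ht.2⟩] with p hp
    exact hp.trans (sub_le_sub_left (le_mul_of_one_le_right hc₀.le ht.1) _)
  -- Uniqueness is stability with equal initial values.
  · obtain ⟨C, -, h⟩ := hstab T hT
    have h1 := h f₀ g hg t ht
    simp only [sub_self, abs_zero, integral_zero, mul_zero] at h1
    exact (sub_eq_zero.1 (norm_le_zero_iff.1 h1)).symm
  · obtain ⟨C, -, h⟩ := hstab T hT
    exact ⟨C, fun g₀ g _ hg => h g₀ g hg⟩
  -- The interval is enlarged so as to have positive length also for t = 0.
  · obtain ⟨N, c₀, hN, hc₀, hctrl⟩ := hf (t + 1) (by linarith)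
    have htt : t ∈ Icc 0 (t + 1) := ⟨ht, by linarith⟩
    refine ⟨(hctrl 0).integrable_energy htt, ?_, ?_, ?_⟩
    · rw [(hctrl 0).toKineticSolution.integral_eq hK t htt]
      exact integral_congr_ae hf0
    · rw [(hctrl 0).integral_momentum_eq hK hB₀.le hM0 hΦ htt]
      exact integral_congr_ae (by filter_upwards [hf0] with p hp; rw [hp])
    · rw [(hctrl 0).integral_energy_eq hK hB₀.le hM0 hΦ htt]
      exact hinit _
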